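/- **Setting.** Let $T>0$, $d_I\in\mathbb R$, let $\mathbb T^3$ be the three-dimensional torus of period $L>0$, and identify fields on $\mathbb T^3$ with periodic fields on $\mathbb R^3$. Let $b:(0,T)\times\mathbb T^3\to\mathbb R^3$ be a distributional solution of the inviscid EMHD equations $$\partial_t b+d_I\nabla\times[J\times b]=0,\qquad J=\nabla\times b,\qquad \operatorname{div} b=0,$$ with $b$, $J$, $J\times b$ locally integrable. *Notation.* $\varphi$ denotes any nonnegative radial $C_c^\infty(\mathbb R^3)$ function with $\int\varphi=1$, and $\varphi^\varepsilon(\ell)=\varepsilon^{-3}\varphi(\ell/\varepsilon)$. For $\ell\ne0$ put $n=\ell/|\ell|$, $v_L=(n\cdot v)n$, $v_T=v-v_L$; $\delta F=\delta F(\ell)=F(x+\ell,t)-F(x,t)$ and $\delta F_X=(\delta F)_X$ for $X=L,T$. A superscript $\varepsilon$ denotes $\int\varphi^\varepsilon(\ell)(\cdot)\,d\ell$, the bracket being evaluated at $(x+\ell,t)$ with direction $n=\ell/|\ell|$; e.g. $b_X^\varepsilon(x,t)=\int\varphi^\varepsilon(\ell)\,(b(x+\ell,t))_X\,d\ell$ and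 $[J(b_X\cdot b_X)]^\varepsilon=\int\varphi^\varepsilon(\ell)J(x+\ell,t)|b(x+\ell,t)_X|^2d\ell$. Also $[\operatorname{div}(b\otimes b_X)]^\varepsilon_i=\sum_k\partial_k(b_kb_{X,i})^\varepsilon$ and $[\operatorname{div}(b\otimes b)]_i=\sum_k\partial_k(b_kb_i)$. A product $(\operatorname{div}A)\times c$ of a distribution with a function is the limit in the sense of distributions, as $\delta\to0$, of $(\operatorname{div}A)*\rho_\delta\times c$, where $\rho_\delta$ is any mollifier in $x$ of the above kind; the existence of these limits is part of the claim. The defect terms are $$\begin{aligned}D_{EL}^\varepsilon={}&\tfrac{3d_I}{4}\int_{\mathbb R^3}\Big\{\nabla\varphi^\varepsilon\cdot\delta b\,(\delta J_L\cdot\delta b_L)+\tfrac{2}{|\ell|}\varphi^\varepsilon\, n\cdot\big[\delta b(\delta J_T\cdot\delta b_T)-\delta b(\delta J\cdot\delta b)+\delta J|\delta b|^2\big]\Big\}d\ell\\&-\tfrac{3d_I}{8}\int_{\mathbb R^3}\Big\{\nabla\varphi^\varepsilon\cdot\delta J\,|\delta b_L|^2+\tfrac2{|\ell|}\varphi^\varepsilon\,n\cdot\delta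 J\,|\delta b_T|^2\Big\}d\ell,\\ D_{ET}^\varepsilon={}&-\tfrac{3d_I}{16}\int_{\mathbb R^3}\Big\{\nabla\varphi^\varepsilon\cdot\delta J\,|\delta b_T|^2-\tfrac2{|\ell|}\varphi^\varepsilon\,n\cdot\delta J\,|\delta b_T|^2\Big\}d\ell\\&+\tfrac{3d_I}{8}\int_{\mathbb R^3}\Big\{\nabla\varphi^\varepsilon\cdot\delta b(\delta J_T\cdot\delta b_T)-\tfrac2{|\ell|}\varphi^\varepsilon\,n\cdot\delta b(\delta J_T\cdot\delta b_T)\Big\}d\ell\\&+\tfrac{3d_I}{8}\int_{\mathbb R^3}\tfrac2{|\ell|}\varphi^\varepsilon\,n\cdot\big[\delta b(\delta b\cdot\delta J)-\delta J|\delta b|^2\big]d\ell.\end{aligned}$$ With $\sigma$ the surface measure of the unit sphere $\partial B$, increments taken at $\ell=\lambda n$, $n\in\partial B$, and $\lambda>0$, put $$\overline S_{EX}(\lambda)=\frac{d_I}{\lambda}\int_{\partial B}n\cdot\big[\delta b(\delta J_X\cdot\delta b_X)-\tfrac12\delta J|\delta b_X|^2\big]\frac{d\sigma}{4\pi},\qquad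 \overline S_E(\lambda)=\frac{d_I}{\lambda}\int_{\partial B}n\cdot\big[\delta J|\delta b|^2-\delta b(\delta J\cdot\delta b)\big]\frac{d\sigma}{4\pi},$$ $$S_{EL}(\lambda)=\overline S_{EL}(\lambda)-\tfrac25\overline S_E(\lambda),\qquad S_{ET}(\lambda)=\overline S_{ET}(\lambda)+\tfrac25\overline S_E(\lambda).$$ **Theorem.** (i) Suppose that $b\in L^p(s,t;L^q(\mathbb T^3))$ and $J\in L^m(s,t;L^n(\mathbb T^3))$ for all $0<s<t<T$, for some $p,q\in[3,\infty]$, $m,n\in[1,\infty]$ with $\frac2p+\frac1m\le1$, $\frac2q+\frac1n\le1$. Then for every $\varphi$, every $\varepsilon>0$ and $(X,c_X)\in\{(L,\frac23),(T,\frac43)\}$ the local Kármán–Howarth equation $$\begin{aligned}&\partial_t(b_X^\varepsilon\cdot b)+\tfrac{d_I}{2}\operatorname{div}\big\{[\operatorname{div}(b\otimes b_X)]^\varepsilon\times b\big\}+\tfrac{d_I}{2}\operatorname{div}\big\{[\operatorname{div}(b\otimes b)]\times b_X^\varepsilon\big\}\\&+\tfrac{d_I}{2}\operatorname{div}\big[b(b\cdot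 J_X^\varepsilon)+b(b_X^\varepsilon\cdot J)-J(b\cdot b_X^\varepsilon)\big]-\tfrac{d_I}{4}\operatorname{div}\big\{[J(b_X\cdot b_X)]^\varepsilon-J(b_X\cdot b_X)^\varepsilon\big\}\\&+\tfrac{d_I}{2}\operatorname{div}\big\{[b(J_X\cdot b_X)]^\varepsilon-b(J_X\cdot b_X)^\varepsilon\big\}=-c_X\,D_{EX}^\varepsilon\end{aligned}$$ holds in the sense of distributions on $(0,T)\times\mathbb T^3$. (ii) Suppose in addition that $b\in L^p(0,T;L^q(\mathbb T^3))$ and $J\in L^m(0,T;L^n(\mathbb T^3))$ with $1<m,n<\infty$, $3\le p,q<\infty$, $\frac2p+\frac1m=1$, $\frac2q+\frac1n=1$. Then there is a distribution $D_E$ on $(0,T)\times\mathbb T^3$ such that, for every $\varphi$, $D_{EL}^\varepsilon\to D_E$ and $D_{ET}^\varepsilon\to D_E$ in the sense of distributions as $\varepsilon\to0$, and the local energy equation $$\partial_t\big(\tfrac12|b|^2\big)+\tfrac{d_I}{2}\operatorname{div}\big([\operatorname{div}(b\otimes b)]\times b\big)-\tfrac{d_I}{4}\operatorname{div}(J|b|^2)+\tfrac{d_I}{2}\operatorname{div}[b(J\cdot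 b)]=-D_E$$ holds in the sense of distributions. Moreover, provided $\overline S_E(\lambda)$ has a limit in the sense of distributions as $\lambda\to0^+$, the limits $S_{EX}=\lim_{\lambda\to0^+}S_{EX}(\lambda)$, $X=L,T$, exist in the sense of distributions and $$S_{EL}=-\tfrac45D_E,\qquad S_{ET}=-\tfrac8{15}D_E .$$ -/

import Mathlib

open MeasureTheory Set Filter Topology TopologicalSpace
open scoped ENNReal Distributions LineDeriv RealInnerProductSpace

noncomputable section

namespace EMHD

/-- Three-dimensional Euclidean space. -/
abbrev E3 := EuclideanSpace ℝ (Fin 3)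

/-- Space-time, with points `(t, x)`. Fields on the torus of period `L` are fields on `ℝ × E3`
that are `L`-periodic in each space variable. -/
abbrev ST := ℝ × E3

/-- The `i`-th standard basis vector. -/
def e (i : Fin 3) : E3 := EuclideanSpace.single i 1

/-- Cross product on `E3`. -/
def cross (u v : E3) : E3 :=
  WithLp.toLp 2 (crossProduct (WithLp.ofLp u) (WithLp.ofLp v))

/-! ### Periodic fields and mixed Lebesgue spaces -/

/-- `L`-periodicity in each space variable. -/
def SpacePeriodic (L : ℝ) (f : ST → E3) : Prop :=
  ∀ (t : ℝ) (x : E3) (i : Fin 3), f (t, x + L • e i) = f (t, x)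

/-- Fundamental cell of the torus of period `L`. -/
def cell (L : ℝ) : Set E3 := {x | ∀ i, x i ∈ Ico 0 L}

/-- `f ∈ L^p(s, t; L^q(𝕋³))`, with `𝕋³` the torus of period `L`. -/
def MemLpLq (L s t : ℝ) (p q : ℝ≥0∞) (f : ST → E3) : Prop :=
  AEStronglyMeasurable f (volume.restrict (Ioo s t ×ˢ (univ : Set E3))) ∧
  eLpNorm (fun τ : ℝ => eLpNorm (fun x : E3 => f (τ, x)) q (volume.restrict (cell L))) p
    (volume.restrict (Ioo s t)) < ∞

/-! ### Distributions on the space-time domain -/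

/-- The domain `(0, T) × ℝ³`; for fields that are periodic in space, testing with functions
compactly supported in it is the same as testing on `(0, T) × 𝕋³`. -/
def dom (T : ℝ) : Opens ST := ⟨Ioo 0 T ×ˢ univ, isOpen_Ioo.prod isOpen_univ⟩

/-- The distribution `ψ ↦ ∫ ψ f` of a locally integrable function `f`. -/
def toDist (T : ℝ) (f : ST → ℝ) : 𝓓'(dom T, ℝ) :=
  (TestFunction.integralAgainstBilinCLM (ContinuousLinearMap.mul ℝ ℝ) volume f :
    𝓓(dom T, ℝ) →L[ℝ] ℝ)

theorem toDist_apply {T : ℝ} {f : ST → ℝ} (hf : LocallyIntegrableOn f (dom T)) (ψ : 𝓓(dom T, ℝ)) :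
    toDist T f ψ = ∫ z, ψ z * f z :=
  TestFunction.integralAgainstBilinCLM_eq_integral hf

/-- Time derivative of a distribution. -/
def dt {T : ℝ} (u : 𝓓'(dom T, ℝ)) : 𝓓'(dom T, ℝ) := ∂_{((1, 0) : ST)} u

/-- Space derivative of a distribution. -/
def dx {T : ℝ} (i : Fin 3) (u : 𝓓'(dom T, ℝ)) : 𝓓'(dom T, ℝ) := ∂_{((0, e i) : ST)} u

/-- Space divergence of a vector of distributions. -/
def div {T : ℝ} (u : Fin 3 → 𝓓'(dom T, ℝ)) : 𝓓'(dom T, ℝ) := ∑ i, dx i (u i)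

/-- Curl (in space) of a vector of distributions. -/
def curl {T : ℝ} (u : Fin 3 → 𝓓'(dom T, ℝ)) : Fin 3 → 𝓓'(dom T, ℝ) :=
  ![dx 1 (u 2) - dx 2 (u 1), dx 2 (u 0) - dx 0 (u 2), dx 0 (u 1) - dx 1 (u 0)]

/-- The vector of distributions of a locally integrable vector field. -/
def toDistV (T : ℝ) (F : ST → E3) : Fin 3 → 𝓓'(dom T, ℝ) := fun i => toDist T (fun z => F z i)

/-- `f δ → D` in the sense of distributions as `δ → 0+`, for locally integrable functions `f δ`. -/
def ConvergesTo (T : ℝ) (f : ℝ → ST → ℝ) (D : 𝓓'(dom T, ℝ)) : Prop :=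
  (∀ δ > 0, LocallyIntegrableOn (f δ) (dom T)) ∧
  ∀ ψ : 𝓓(dom T, ℝ), Tendsto (fun δ => toDist T (f δ) ψ) (𝓝[>] 0) (𝓝 (D ψ))

/-! ### The inviscid EMHD equations -/

/-- `b` is a distributional solution on `(0, T)` of `∂ₜ b + d ∇ × (J × b) = 0` with `div b = 0`
and `J = ∇ × b`. -/
structure IsSolution (T d : ℝ) (b J : ST → E3) : Prop where
  locallyIntegrable_b : LocallyIntegrableOn b (dom T)
  locallyIntegrable_J : LocallyIntegrableOn J (dom T)
  locallyIntegrable_cross : LocallyIntegrableOn (fun z => cross (J z) (b z)) (dom T)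
  div_b : div (toDistV T b) = 0
  curl_b : toDistV T J = curl (toDistV T b)
  equation : ∀ i, dt (toDistV T b i) + d • curl (toDistV T fun z => cross (J z) (b z)) i = 0

/-! ### Mollification, longitudinal and transverse parts -/

/-- Nonnegative radial functions in `C_c^∞(ℝ³)` with unit integral. -/
structure IsMollifier (φ : E3 → ℝ) : Prop where
  smooth : ContDiff ℝ (⊤ : ℕ∞) φ
  compact : HasCompactSupport φ
  nonneg : ∀ x, 0 ≤ φ x
  integral : ∫ x, φ x = 1
  radial : ∀ x y, ‖x‖ = ‖y‖ → φ x = φ y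

/-- `φ^ε(ℓ) = ε⁻³ φ(ℓ / ε)`. -/
def scaled (φ : E3 → ℝ) (ε : ℝ) (l : E3) : ℝ := (ε ^ 3)⁻¹ * φ (ε⁻¹ • l)

/-- The unit vector `n = ℓ / |ℓ|`. -/
def dir (l : E3) : E3 := ‖l‖⁻¹ • l

/-- Longitudinal part `(n ⊗ n) v`. -/
def longi (n v : E3) : E3 := ⟪n, v⟫ • n

/-- Transverse part `(1 - n ⊗ n) v`. -/
def trans (n v : E3) : E3 := v - longi n v

/-- Space translate `(t, x) ↦ (t, x + ℓ)`. -/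
def shift (z : ST) (l : E3) : ST := (z.1, z.2 + l)

/-- Increment `δF(ℓ) = F(t, x + ℓ) - F(t, x)`. -/
def incr (F : ST → E3) (z : ST) (l : E3) : E3 := F (shift z l) - F z

/-- `∫ φ^ε(ℓ) G(n; t, x + ℓ) dℓ` with `n = ℓ / |ℓ|`: the mollification of a function that may
depend on the direction of the displacement. -/
def moll {V : Type*} [NormedAddCommGroup V] [NormedSpace ℝ V]
    (φ : E3 → ℝ) (ε : ℝ) (G : E3 → ST → V) (z : ST) : V :=
  ∫ l : E3, scaled φ ε l • G (dir l) (shift z l)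

/-- `F_X^ε`, for `X = L` (`P = longi`) or `X = T` (`P = trans`). -/
def mollX (φ : E3 → ℝ) (ε : ℝ) (P : E3 → E3 → E3) (F : ST → E3) : ST → E3 :=
  moll φ ε fun n z => P n (F z)

/-! ### The distribution `(div A) × c` -/

/-- `(div A) ^ δ` for a tensor field `A` (with `A z k` the vector `(A_{k1}, A_{k2}, A_{k3})`),
where `(div A)_i = ∑ k, ∂_k A_{ki}`: the divergence of the space mollification of `A`. -/
def divMoll (ρ : E3 → ℝ) (δ : ℝ) (A : ST → Fin 3 → E3) (z : ST) : E3 :=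
  ∑ k, lineDeriv ℝ (fun x : E3 => moll ρ δ (fun _ w => A w k) (z.1, x)) z.2 (e k)

/-- `P` is the product `(div A) × c` of the distribution `div A` and the function `c`, in the sense
of regularization: `(div A) ^ δ × c → P` in the sense of distributions, for every mollifier.
This is the usual product when `div A` is a function in a Lebesgue class dual to that of `c`. -/
def IsDivCross (T : ℝ) (A : ST → Fin 3 → E3) (c : ST → E3) (P : Fin 3 → 𝓓'(dom T, ℝ)) : Prop :=
  ∀ ρ, IsMollifier ρ → ∀ i,
    ConvergesTo T (fun δ z => cross (divMoll ρ δ A z) (c z) i) (P i)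

/-- `b ⊗ b`. -/
def tensor (b : ST → E3) (z : ST) (k : Fin 3) : E3 := b z k • b z

/-- `(b ⊗ b_X)^ε`, with entries `(b_k b_{X i})^ε`. -/
def tensorX (φ : E3 → ℝ) (ε : ℝ) (P : E3 → E3 → E3) (b : ST → E3) (z : ST) (k : Fin 3) : E3 :=
  moll φ ε (fun n w => b w k • P n (b w)) z

/-! ### Kármán–Howarth equations -/

/-- The part of the energy flux (apart from the two terms with `div (b ⊗ b_X)^ε` and
`div (b ⊗ b)`) in the local Kármán–Howarth equations. -/
def flux (d : ℝ) (b J : ST → E3) (φ : E3 → ℝ) (ε : ℝ) (P : E3 → E3 → E3) (z : ST) : E3 :=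
  (d / 2) • (⟪b z, mollX φ ε P J z⟫ • b z)
  + (d / 2) • (⟪mollX φ ε P b z, J z⟫ • b z)
  - (d / 2) • (⟪b z, mollX φ ε P b z⟫ • J z)
  - (d / 4) • moll φ ε (fun n w => ⟪P n (b w), P n (b w)⟫ • J w) z
  + (d / 4) • (moll φ ε (fun n w => ⟪P n (b w), P n (b w)⟫) z • J z)
  + (d / 2) • moll φ ε (fun n w => ⟪P n (J w), P n (b w)⟫ • b w) z
  - (d / 2) • (moll φ ε (fun n w => ⟪P n (J w), P n (b w)⟫) z • b z)

/-- The local equation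
`∂ₜ(b_X^ε · b) + d/2 div([div (b ⊗ b_X)]^ε × b) + d/2 div([div (b ⊗ b)] × b_X^ε) + div flux = -c D`
in the sense of distributions. -/
def KarmanHowarth (T d : ℝ) (b J : ST → E3) (φ : E3 → ℝ) (ε : ℝ) (P : E3 → E3 → E3)
    (c : ℝ) (D : ST → ℝ) : Prop :=
  LocallyIntegrableOn (fun z => ⟪mollX φ ε P b z, b z⟫) (dom T) ∧
  LocallyIntegrableOn (flux d b J φ ε P) (dom T) ∧
  LocallyIntegrableOn D (dom T) ∧
  ∃ U V : Fin 3 → 𝓓'(dom T, ℝ),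
    IsDivCross T (tensorX φ ε P b) b U ∧
    IsDivCross T (tensor b) (mollX φ ε P b) V ∧
    dt (toDist T fun z => ⟪mollX φ ε P b z, b z⟫)
      + (d / 2) • div U + (d / 2) • div V + div (toDistV T (flux d b J φ ε P))
      = -(c • toDist T D)

/-- The longitudinal defect term `D_EL^ε`. -/
def DEL (d : ℝ) (b J : ST → E3) (φ : E3 → ℝ) (ε : ℝ) (z : ST) : ℝ :=
  (3 * d / 4) * (∫ l : E3,
    (⟪gradient (scaled φ ε) l, incr b z l⟫
        * ⟪longi (dir l) (incr J z l), longi (dir l) (incr b z l)⟫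
      + 2 / ‖l‖ * scaled φ ε l * ⟪dir l,
          ⟪trans (dir l) (incr J z l), trans (dir l) (incr b z l)⟫ • incr b z l
          - ⟪incr J z l, incr b z l⟫ • incr b z l
          + ⟪incr b z l, incr b z l⟫ • incr J z l⟫))
  - (3 * d / 8) * (∫ l : E3,
    (⟪gradient (scaled φ ε) l, incr J z l⟫ * ‖longi (dir l) (incr b z l)‖ ^ 2
      + 2 / ‖l‖ * scaled φ ε l * (⟪dir l, incr J z l⟫ * ‖trans (dir l) (incr b z l)‖ ^ 2)))

/-- The transverse defect term `D_ET^ε`. -/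
def DET (d : ℝ) (b J : ST → E3) (φ : E3 → ℝ) (ε : ℝ) (z : ST) : ℝ :=
  -(3 * d / 16) * (∫ l : E3,
    (⟪gradient (scaled φ ε) l, incr J z l⟫ * ‖trans (dir l) (incr b z l)‖ ^ 2
      - 2 / ‖l‖ * scaled φ ε l * (⟪dir l, incr J z l⟫ * ‖trans (dir l) (incr b z l)‖ ^ 2)))
  + (3 * d / 8) * (∫ l : E3,
    (⟪gradient (scaled φ ε) l, incr b z l⟫
        * ⟪trans (dir l) (incr J z l), trans (dir l) (incr b z l)⟫
      - 2 / ‖l‖ * scaled φ ε l * (⟪dir l, incr b z l⟫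
        * ⟪trans (dir l) (incr J z l), trans (dir l) (incr b z l)⟫)))
  + (3 * d / 8) * (∫ l : E3,
    2 / ‖l‖ * scaled φ ε l * ⟪dir l,
      ⟪incr b z l, incr J z l⟫ • incr b z l - ⟪incr b z l, incr b z l⟫ • incr J z l⟫)

/-- The local energy equation
`∂ₜ(|b|²/2) + d/2 div([div (b ⊗ b)] × b) - d/4 div(J |b|²) + d/2 div(b (J · b)) = -D`. -/
def LocalEnergy (T d : ℝ) (b J : ST → E3) (D : 𝓓'(dom T, ℝ)) : Prop :=
  LocallyIntegrableOn (fun z => ‖b z‖ ^ 2 / 2) (dom T) ∧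
  LocallyIntegrableOn (fun z => ‖b z‖ ^ 2 • J z) (dom T) ∧
  LocallyIntegrableOn (fun z => ⟪J z, b z⟫ • b z) (dom T) ∧
  ∃ U : Fin 3 → 𝓓'(dom T, ℝ),
    IsDivCross T (tensor b) b U ∧
    dt (toDist T fun z => ‖b z‖ ^ 2 / 2) + (d / 2) • div U
      - (d / 4) • div (toDistV T fun z => ‖b z‖ ^ 2 • J z)
      + (d / 2) • div (toDistV T fun z => ⟪J z, b z⟫ • b z) = -D

/-! ### Structure functions -/

/-- `(1/λ) ∫_{∂B} n · G(λ n) dσ(n) / 4π`, with `σ` the surface measure of the unit sphere. -/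
def sphereAvg (lam : ℝ) (G : E3 → E3) : ℝ :=
  lam⁻¹ * ((4 * Real.pi)⁻¹ *
    ∫ n : Metric.sphere (0 : E3) 1, ⟪(n : E3), G (lam • (n : E3))⟫ ∂(volume : Measure E3).toSphere)

/-- `d/λ ∫_{∂B} n · [δb (δJ_X · δb_X) - δJ |δb_X|² / 2] dσ / 4π`. -/
def SbarX (d : ℝ) (b J : ST → E3) (P : E3 → E3 → E3) (lam : ℝ) (z : ST) : ℝ :=
  d * sphereAvg lam fun l =>
    ⟪P (dir l) (incr J z l), P (dir l) (incr b z l)⟫ • incr b z l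
      - (‖P (dir l) (incr b z l)‖ ^ 2 / 2) • incr J z l

/-- `d/λ ∫_{∂B} n · [δJ |δb|² - δb (δJ · δb)] dσ / 4π`. -/
def SbarE (d : ℝ) (b J : ST → E3) (lam : ℝ) (z : ST) : ℝ :=
  d * sphereAvg lam fun l =>
    ‖incr b z l‖ ^ 2 • incr J z l - ⟪incr J z l, incr b z l⟫ • incr b z l

/-- The longitudinal structure function `S_EL(λ)`. -/
def SEL (d : ℝ) (b J : ST → E3) (lam : ℝ) (z : ST) : ℝ :=
  SbarX d b J longi lam z - 2 / 5 * SbarE d b J lam z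

/-- The transverse structure function `S_ET(λ)`. -/
def SET (d : ℝ) (b J : ST → E3) (lam : ℝ) (z : ST) : ℝ :=
  SbarX d b J trans lam z + 2 / 5 * SbarE d b J lam z

end EMHD

end

open MeasureTheory Set Filter Topology TopologicalSpace
open scoped ENNReal Distributions LineDeriv RealInnerProductSpace

noncomputable section

namespace EMHD


notation "V3" => Fin 3 → ℝ

notation "C¹" => ContDiff ℝ 1

notation "𝔹" => Metric.closedBall (0 : E3)

notation "𝕊" => Metric.sphere (0 : E3) 1
/-! ### Trilinear continuity of translations -/

instance isAddHaarMeasure_volume_ST : (volume : Measure ST).IsAddHaarMeasure :=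
  inferInstanceAs (((volume : Measure ℝ).prod (volume : Measure E3)).IsAddHaarMeasure)

theorem lintegral_enorm_mul3_le {α E F G : Type*} [MeasurableSpace α] {μ : Measure α}
    [NormedAddCommGroup E] [NormedAddCommGroup F] [NormedAddCommGroup G]
    {p q r s : ℝ≥0∞} [ENNReal.HolderTriple p q s] [ENNReal.HolderTriple s r 1] {f : α → E} {g : α → F} {h : α → G}
    (hf : AEStronglyMeasurable f μ) (hg : AEStronglyMeasurable g μ)
    (hh : AEStronglyMeasurable h μ) :
    ∫⁻ x, ‖f x‖ₑ * ‖g x‖ₑ * ‖h x‖ₑ ∂μ ≤ eLpNorm f p μ * eLpNorm g q μ * eLpNorm h r μ := by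
  have h1 : eLpNorm (fun x => (‖f x‖ * ‖g x‖) * ‖h x‖) 1 μ
      ≤ eLpNorm (fun x => ‖f x‖ * ‖g x‖) s μ * eLpNorm (fun x => ‖h x‖) r μ :=
    eLpNorm_smul_le_mul_eLpNorm (φ := fun x => ‖f x‖ * ‖g x‖) hh.norm (hf.norm.mul hg.norm)
  have h2 : eLpNorm (fun x => ‖f x‖ * ‖g x‖) s μ
      ≤ eLpNorm (fun x => ‖f x‖) p μ * eLpNorm (fun x => ‖g x‖) q μ :=
    eLpNorm_smul_le_mul_eLpNorm (φ := fun x => ‖f x‖) hg.norm hf.norm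
  rw [eLpNorm_norm] at h1
  rw [eLpNorm_norm, eLpNorm_norm] at h2
  calc ∫⁻ x, ‖f x‖ₑ * ‖g x‖ₑ * ‖h x‖ₑ ∂μ
      = eLpNorm (fun x => (‖f x‖ * ‖g x‖) * ‖h x‖) 1 μ := by
        rw [eLpNorm_one_eq_lintegral_enorm]
        simp [enorm_mul]
    _ ≤ _ := h1.trans (by gcongr)

instance holderTriple_three : ENNReal.HolderTriple 3 3 (3 / 2) where
  inv_add_inv_eq_inv := by
    rw [ENNReal.inv_div (by simp) (by simp), ← two_mul, ENNReal.div_eq_inv_mul, mul_comm]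

instance holderTriple_three' : ENNReal.HolderTriple (3 / 2) 3 1 where
  inv_add_inv_eq_inv := by
    rw [ENNReal.inv_div (by simp) (by simp), inv_one, ENNReal.div_eq_inv_mul]
    nth_rewrite 2 [← mul_one (3⁻¹ : ℝ≥0∞)]
    rw [← mul_add]
    norm_num
    exact ENNReal.inv_mul_cancel (by simp) (by simp)

theorem tendsto_eLpNorm_translate {f : ST → E3} (hf : MemLp f 3 volume) :
    Tendsto (fun y : ST => eLpNorm (fun z => f (z + y) - f z) 3 volume) (𝓝 0) (𝓝 0) := by
  let g : ST → C(ST, ST) := fun y => ⟨fun z => z + y, by fun_prop⟩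
  have hg : Continuous g := by
    apply ContinuousMap.continuous_of_continuous_uncurry
    simp only [Function.uncurry_def]
    show Continuous fun p : ST × ST => p.2 + p.1
    fun_prop
  have hmp : ∀ y, MeasurePreserving (g y) (volume : Measure ST) volume := fun y =>
    measurePreserving_add_right volume y
  have : Fact ((1 : ℝ≥0∞) ≤ 3) := ⟨by norm_num⟩
  have hc := (Continuous.compMeasurePreservingLp (p := 3)
    (continuous_const (y := hf.toLp f)) hg hmp (by simp)).tendsto 0
  have h0 := tendsto_iff_edist_tendsto_0.1 hc
  refine h0.congr fun y => ?_
  rw [Lp.toLp_compMeasurePreserving, Lp.toLp_compMeasurePreserving, Lp.edist_toLp_toLp]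
  congr 1
  ext z
  simp [g, Function.comp]

/-- `f, g` lie in `L^3` and `h` is approximated by `L^3` functions in the seminorm
`sup ∫ |f(z + y₁)| |g(z + y₂)| |h(z)| dz`. -/
structure Tame (f g h : ST → E3) : Prop where
  hf : MemLp f 3 volume
  hg : MemLp g 3 volume
  hh : LocallyIntegrable h volume
  approx : ∀ ε : ℝ≥0∞, 0 < ε → ∃ k : ST → E3, MemLp k 3 volume ∧
    ∀ y₁ y₂ : ST, ∫⁻ z, ‖f (z + y₁)‖ₑ * ‖g (z + y₂)‖ₑ * ‖h z - k z‖ₑ ≤ ε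

theorem eLpNorm_translate {f : ST → E3} (p : ℝ≥0∞) (hf : AEStronglyMeasurable f volume) (s : ST) :
    eLpNorm (fun z => f (z + s)) p volume = eLpNorm f p volume :=
  eLpNorm_comp_measurePreserving (g := f) hf (measurePreserving_add_right volume s)

theorem aesm_translate {f : ST → E3} (hf : AEStronglyMeasurable f volume) (s : ST) :
    AEStronglyMeasurable (fun z => f (z + s)) volume :=
  hf.comp_measurePreserving (measurePreserving_add_right volume s)

theorem Tame.of_memLp {f g h : ST → E3} (hf : MemLp f 3 volume) (hg : MemLp g 3 volume)
    (hh : MemLp h 3 volume) : Tame f g h where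
  hf := hf
  hg := hg
  hh := hh.locallyIntegrable (by norm_num)
  approx := fun ε hε => ⟨h, hh, fun y₁ y₂ => by simp⟩

/-- The product of components of translates of three fields. -/
def mono (f g h : ST → E3) (s : ST × ST × ST) (i j k : Fin 3) (z : ST) : ℝ :=
  f (z + s.1) i * (g (z + s.2.1) j * h (z + s.2.2) k)

theorem enorm_apply_le (v : E3) (i : Fin 3) : ‖v i‖ₑ ≤ ‖v‖ₑ := by
  rw [← ofReal_norm, ← ofReal_norm]
  exact ENNReal.ofReal_le_ofReal (PiLp.norm_apply_le v i)

theorem aesm_apply {α : Type*} [MeasurableSpace α] {μ : Measure α} {f : α → E3}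
    (hf : AEStronglyMeasurable f μ) (i : Fin 3) : AEStronglyMeasurable (fun z => f z i) μ :=
  (EuclideanSpace.proj (𝕜 := ℝ) i).continuous.comp_aestronglyMeasurable hf

theorem aesm_mono {f g h : ST → E3} (hf : AEStronglyMeasurable f volume)
    (hg : AEStronglyMeasurable g volume) (hh : AEStronglyMeasurable h volume)
    (s : ST × ST × ST) (i j k : Fin 3) : AEStronglyMeasurable (mono f g h s i j k) volume :=
  (aesm_apply (aesm_translate hf _) i).mul ((aesm_apply (aesm_translate hg _) j).mul
    (aesm_apply (aesm_translate hh _) k))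

theorem lintegral_enorm_add_le {α : Type*} [MeasurableSpace α] {μ : Measure α} {F G : α → ℝ}
    (hF : AEStronglyMeasurable F μ) :
    ∫⁻ x, ‖F x + G x‖ₑ ∂μ ≤ (∫⁻ x, ‖F x‖ₑ ∂μ) + ∫⁻ x, ‖G x‖ₑ ∂μ := by
  rw [← lintegral_add_left' hF.enorm]
  exact lintegral_mono fun x => enorm_add_le _ _

theorem lintegral_mono_le {f g h : ST → E3} (hf : MemLp f 3 volume) (hg : MemLp g 3 volume)
    (hh : MemLp h 3 volume) (s : ST × ST × ST) (i j k : Fin 3) :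
    ∫⁻ z, ‖mono f g h s i j k z‖ₑ ≤ eLpNorm f 3 volume * eLpNorm g 3 volume * eLpNorm h 3 volume := by
  rw [← eLpNorm_translate _ hf.1 s.1, ← eLpNorm_translate _ hg.1 s.2.1,
    ← eLpNorm_translate _ hh.1 s.2.2]
  refine (lintegral_mono fun z => ?_).trans (lintegral_enorm_mul3_le (p := 3) (q := 3) (r := 3)
    (s := 3 / 2) (aesm_translate hf.1 _) (aesm_translate hg.1 _) (aesm_translate hh.1 _))
  rw [mono, enorm_mul, enorm_mul, ← mul_assoc]
  gcongr <;> exact enorm_apply_le _ _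

theorem Tame.aesm {f g h : ST → E3} (H : Tame f g h) : AEStronglyMeasurable f volume ∧
    AEStronglyMeasurable g volume ∧ AEStronglyMeasurable h volume :=
  ⟨H.hf.1, H.hg.1, H.hh.aestronglyMeasurable⟩

theorem Tame.exists_approx {f g h : ST → E3} (H : Tame f g h) {ε : ℝ≥0∞} (hε : 0 < ε) :
    ∃ k k' : ST → E3, MemLp k 3 volume ∧ ∀ s i j l,
      AEStronglyMeasurable (mono f g k' s i j l) volume ∧
      (∀ z, mono f g h s i j l z = mono f g k' s i j l z + mono f g k s i j l z) ∧
      ∫⁻ z, ‖mono f g k' s i j l z‖ₑ ≤ ε := by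
  obtain ⟨k, hk, hle⟩ := H.approx ε hε
  refine ⟨k, h - k, hk, fun s i j l => ⟨aesm_mono H.hf.1 H.hg.1 (H.aesm.2.2.sub hk.1) s i j l,
    fun z => by simp only [mono, Pi.sub_apply, PiLp.sub_apply]; ring, ?_⟩⟩
  refine le_trans ?_ (hle (s.1 - s.2.2) (s.2.1 - s.2.2))
  rw [← lintegral_add_right_eq_self _ (-s.2.2)]
  refine lintegral_mono fun z => ?_
  have h1 : ∀ a, z + -s.2.2 + a = z + (a - s.2.2) := fun a => by abel
  rw [mono, enorm_mul, enorm_mul, ← mul_assoc, neg_add_cancel_right, h1, h1]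
  gcongr <;> exact enorm_apply_le _ _

theorem Tame.bound_mono {f g h : ST → E3} (H : Tame f g h) : ∃ C : ℝ≥0∞, C < ∞ ∧
    ∀ (s : ST × ST × ST) (i j k : Fin 3), ∫⁻ z, ‖mono f g h s i j k z‖ₑ ≤ C := by
  obtain ⟨k, k', hk, hle⟩ := H.exists_approx one_pos
  refine ⟨1 + eLpNorm f 3 volume * eLpNorm g 3 volume * eLpNorm k 3 volume,
    ENNReal.add_lt_top.2 ⟨by simp, ENNReal.mul_lt_top (ENNReal.mul_lt_top H.hf.2 H.hg.2) hk.2⟩,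
    fun s i j l => ?_⟩
  simp_rw [(hle s i j l).2.1]
  exact (lintegral_enorm_add_le (hle s i j l).1).trans
    (add_le_add (hle s i j l).2.2 (lintegral_mono_le H.hf H.hg hk s i j l))

theorem Tame.equicont {f g h : ST → E3} (H : Tame f g h) {ε : ℝ≥0∞} (hε : 0 < ε) :
    ∀ᶠ y in 𝓝 (0 : ST × ST × ST), ∀ (s : ST × ST × ST) (i j l : Fin 3),
      ∫⁻ z, ‖mono f g h (s + y) i j l z - mono f g h s i j l z‖ₑ ≤ ε := by
  have hε3 : 0 < ε / 3 := ENNReal.div_pos hε.ne' (by simp)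
  obtain ⟨k, k', hk, hle⟩ := H.exists_approx hε3
  have hF := H.hf.2.ne
  have hG := H.hg.2.ne
  have hK := hk.2.ne
  set Δ : (ST → E3) → ST → ST → E3 := fun u y z => u (z + y) - u z with hΔ
  have hm : ∀ {u : ST → E3}, MemLp u 3 volume → ∀ y, MemLp (Δ u y) 3 volume := fun hu y =>
    (hu.comp_measurePreserving (measurePreserving_add_right volume y)).sub hu
  have ht : Tendsto (fun y : ST × ST × ST =>
      eLpNorm (Δ f y.1) 3 volume * eLpNorm g 3 volume * eLpNorm k 3 volume
      + (eLpNorm f 3 volume * eLpNorm (Δ g y.2.1) 3 volume * eLpNorm k 3 volume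
      + eLpNorm f 3 volume * eLpNorm g 3 volume * eLpNorm (Δ k y.2.2) 3 volume)) (𝓝 0)
      (𝓝 (0 * eLpNorm g 3 volume * eLpNorm k 3 volume + (eLpNorm f 3 volume * 0
        * eLpNorm k 3 volume + eLpNorm f 3 volume * eLpNorm g 3 volume * 0))) :=
    (ENNReal.Tendsto.mul_const (ENNReal.Tendsto.mul_const ((tendsto_eLpNorm_translate H.hf).comp
      (continuous_fst.tendsto 0)) (Or.inr hG)) (Or.inr hK)).add
    ((ENNReal.Tendsto.mul_const (ENNReal.Tendsto.const_mul ((tendsto_eLpNorm_translate H.hg).comp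
      ((continuous_fst.comp continuous_snd).tendsto 0)) (Or.inr hF)) (Or.inr hK)).add
    (ENNReal.Tendsto.const_mul ((tendsto_eLpNorm_translate hk).comp
      ((continuous_snd.comp continuous_snd).tendsto 0)) (Or.inr (ENNReal.mul_ne_top hF hG))))
  simp only [zero_mul, mul_zero, add_zero] at ht
  filter_upwards [(ENNReal.tendsto_nhds_zero.1 ht) _ hε3] with y hy s i j l
  have e1 : ∀ z, mono f g h (s + y) i j l z - mono f g h s i j l z
      = mono f g k' (s + y) i j l z + (-mono f g k' s i j l z
      + (mono (Δ f y.1) g k (s.1, (s + y).2) i j l z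
      + (mono f (Δ g y.2.1) k (s.1, s.2.1, (s + y).2.2) i j l z
      + mono f g (Δ k y.2.2) s i j l z))) := by
    intro z
    rw [(hle _ i j l).2.1, (hle _ i j l).2.1]
    simp only [mono, hΔ, Prod.fst_add, Prod.snd_add, PiLp.sub_apply, ← add_assoc]
    ring
  simp_rw [e1]
  refine (lintegral_enorm_add_le (hle _ i j l).1).trans ((add_le_add (hle _ i j l).2.2
    ((lintegral_enorm_add_le (hle _ i j l).1.neg).trans (add_le_add ?_
    (((lintegral_enorm_add_le (aesm_mono (hm H.hf _).1 H.hg.1 hk.1 _ _ _ _)).trans (add_le_add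
    (lintegral_mono_le (hm H.hf _) H.hg hk _ _ _ _) ((lintegral_enorm_add_le
    (aesm_mono H.hf.1 (hm H.hg _).1 hk.1 _ _ _ _)).trans (add_le_add
    (lintegral_mono_le H.hf (hm H.hg _) hk _ _ _ _)
    (lintegral_mono_le H.hf H.hg (hm hk _) _ _ _ _))))).trans hy)))).trans
    (by rw [← add_assoc, ENNReal.add_thirds]))
  simpa only [Pi.neg_apply, enorm_neg] using (hle s i j l).2.2

/-! ### Trilinear forms in the values of fields at shifted points -/

/-- Real functions of three tuples of vectors. -/
abbrev Form (V : Type) (N : ℕ) : Type := (Fin N → V) → (Fin N → V) → (Fin N → V) → ℝ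

/-- Positions and components in three tuples of vectors. -/
abbrev Ix (N : ℕ) : Type := (Fin N × Fin 3) × (Fin N × Fin 3) × (Fin N × Fin 3)

/-- Trilinearity of a function of three tuples of vectors. -/
structure IsTri {N : ℕ} (m : Form E3 N) : Prop where
  lin₁ : ∀ V W, IsLinearMap ℝ fun U => m U V W
  lin₂ : ∀ U W, IsLinearMap ℝ fun V => m U V W
  lin₃ : ∀ U V, IsLinearMap ℝ fun W => m U V W

/-- The tuple with `e x.2` in position `x.1` and zeros elsewhere. -/
def slot {N : ℕ} (x : Fin N × Fin 3) : Fin N → E3 := Pi.single x.1 (e x.2)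

/-- The coefficients of a form. -/
def co {N : ℕ} (m : Form E3 N) (x : Ix N) : ℝ := m (slot x.1) (slot x.2.1) (slot x.2.2)

theorem isLinearMap_expand {N : ℕ} {l : (Fin N → E3) → ℝ} (h : IsLinearMap ℝ l)
    (U : Fin N → E3) : l U = ∑ x : Fin N × Fin 3, U x.1 x.2 * l (slot x) := by
  have hU : U = ∑ x : Fin N × Fin 3, U x.1 x.2 • slot x := by
    ext b j
    rw [Fintype.sum_prod_type, Finset.sum_apply, Finset.sum_eq_single b]
    · fin_cases j <;> simp [slot, e, Fin.sum_univ_three]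
    · intro a _ hab
      rw [Finset.sum_apply]
      exact Finset.sum_eq_zero fun i _ => by simp [slot, Pi.single_eq_of_ne hab.symm]
    · simp
  have := congrArg (h.mk' l) hU
  simpa only [map_sum, map_smul, IsLinearMap.mk'_apply, smul_eq_mul] using this

/-- The value of a form at the values of `f, g, h` at the points `z + s a y`. -/
def ev {Y : Type*} {N : ℕ} (m : Y → ST → Form E3 N) (s : Fin N → Y → ST) (f g h : ST → E3) (y : Y)
    (z : ST) : ℝ :=
  m y z (fun a => f (z + s a y)) (fun a => g (z + s a y)) (fun a => h (z + s a y))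

/-- The displacements of the positions of an index. -/
def tr {Y : Type*} {N : ℕ} (s : Fin N → Y → ST) (x : Ix N) (y : Y) : ST × ST × ST :=
  (s x.1.1 y, s x.2.1.1 y, s x.2.2.1 y)

/-- The product of components of three fields at displaced points. -/
def mo {Y : Type*} {N : ℕ} (f g h : ST → E3) (s : Fin N → Y → ST) (x : Ix N) (y : Y) : ST → ℝ :=
  mono f g h (tr s x y) x.1.2 x.2.1.2 x.2.2.2

theorem ev_expand {Y : Type*} {N : ℕ} {m : Y → ST → Form E3 N} (hm : ∀ y z, IsTri (m y z))
    (s : Fin N → Y → ST) (f g h : ST → E3) (y : Y) (z : ST) :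
    ev m s f g h y z = ∑ x, co (m y z) x * mo f g h s x y z := by
  rw [ev, isLinearMap_expand ((hm y z).lin₁ _ _) fun a => f _]
  refine Eq.trans (Finset.sum_congr rfl fun x₁ _ => ?_) (Fintype.sum_prod_type _).symm
  rw [isLinearMap_expand ((hm y z).lin₂ (slot x₁) _) fun a => g _, Finset.mul_sum]
  refine Eq.trans (Finset.sum_congr rfl fun x₂ _ => ?_) (Fintype.sum_prod_type _).symm
  rw [isLinearMap_expand ((hm y z).lin₃ (slot x₁) (slot x₂)) fun a => h _, Finset.mul_sum,
    Finset.mul_sum]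
  refine Finset.sum_congr rfl fun x₃ _ => ?_
  simp only [co, mo, mono, tr]
  ring

/-- A measurable family of trilinear forms with coefficients dominated by an integrable function
of the parameter. -/
structure Fam {Y : Type*} [MeasurableSpace Y] (ν : Measure Y) {N : ℕ} (κ : Y → ℝ)
    (s : Fin N → Y → ST) (m : Y → ST → Form E3 N) : Prop where
  tri : ∀ y z, IsTri (m y z)
  meas : ∀ U V W, AEStronglyMeasurable (fun p : Y × ST => m p.1 p.2 U V W) (ν.prod volume)
  bd : ∀ y z x, |co (m y z) x| ≤ κ y
  int : Integrable κ ν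
  shift : ∀ a, Measurable (s a)

section

variable {Y : Type*} [MeasurableSpace Y] {ν : Measure Y} [SFinite ν]

theorem aesm_shift {E : Type*} [TopologicalSpace E] {f : ST → E}
    (hf : AEStronglyMeasurable f volume) {s : Y → ST} (hs : Measurable s) :
    AEStronglyMeasurable (fun p : Y × ST => f (p.2 + s p.1)) (ν.prod volume) := by
  have hm : Measurable fun p : Y × ST => p.2 + s p.1 :=
    measurable_snd.add (hs.comp measurable_fst)
  refine hf.comp_quasiMeasurePreserving ⟨hm, Measure.AbsolutelyContinuous.mk fun A hA hA0 => ?_⟩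
  rw [Measure.map_apply hm hA, Measure.measure_prod_null (hm hA)]
  refine Eventually.of_forall fun y => ?_
  change volume ((fun z => z + s y) ⁻¹' A) = 0
  simpa using (measurePreserving_add_right (volume : Measure ST) (s y)).measure_preimage
    hA.nullMeasurableSet |>.trans hA0

theorem aesm_mono_shift {f g h : ST → E3} (hf : AEStronglyMeasurable f volume)
    (hg : AEStronglyMeasurable g volume) (hh : AEStronglyMeasurable h volume)
    {s : Y → ST × ST × ST} (hs : Measurable s) (i j k : Fin 3) :
    AEStronglyMeasurable (fun p : Y × ST => mono f g h (s p.1) i j k p.2) (ν.prod volume) :=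
  (aesm_apply (aesm_shift hf hs.fst) i).mul ((aesm_apply (aesm_shift hg hs.snd.fst) j).mul
    (aesm_apply (aesm_shift hh hs.snd.snd) k))

variable {N : ℕ} {κ : Y → ℝ} {s : Fin N → Y → ST} {m : Y → ST → Form E3 N} {f g h : ST → E3}

theorem Fam.aesm_mo (hm : Fam ν κ s m) (hf : AEStronglyMeasurable f volume)
    (hg : AEStronglyMeasurable g volume) (hh : AEStronglyMeasurable h volume) (x : Ix N) :
    AEStronglyMeasurable (fun p : Y × ST => mo f g h s x p.1 p.2) (ν.prod volume) :=
  aesm_mono_shift hf hg hh ((hm.shift _).prodMk ((hm.shift _).prodMk (hm.shift _))) _ _ _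

theorem Fam.sum_bound (hm : Fam ν κ s m) {F : Ix N → Y → ST → ℝ}
    (hF : ∀ x, AEStronglyMeasurable (fun p : Y × ST => F x p.1 p.2) (ν.prod volume)) :
    AEStronglyMeasurable (fun p : Y × ST => ∑ x, co (m p.1 p.2) x * F x p.1 p.2) (ν.prod volume) ∧
    ∫⁻ p : Y × ST, ‖∑ x, co (m p.1 p.2) x * F x p.1 p.2‖ₑ ∂(ν.prod volume)
      ≤ ∑ x, ∫⁻ y, ‖κ y‖ₑ * (∫⁻ z, ‖F x y z‖ₑ) ∂ν := by
  have hκ : ∀ x, AEMeasurable (fun p : Y × ST => ‖κ p.1 * F x p.1 p.2‖ₑ) (ν.prod volume) :=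
    fun x => ((show AEStronglyMeasurable (fun p : Y × ST => κ p.1) (ν.prod volume) from
      hm.int.1.comp_fst).mul (hF x)).enorm
  refine ⟨Finset.aestronglyMeasurable_fun_sum _ fun x _ => (hm.meas _ _ _).mul (hF x), ?_⟩
  calc _ ≤ ∫⁻ p : Y × ST, ∑ x, ‖κ p.1 * F x p.1 p.2‖ₑ ∂(ν.prod volume) := by
        refine lintegral_mono fun p => (enorm_sum_le _ _).trans (Finset.sum_le_sum fun x _ => ?_)
        rw [enorm_mul, enorm_mul]
        gcongr
        exact enorm_le_iff_norm_le.2 ((hm.bd _ _ x).trans (le_abs_self _))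
    _ = _ := by
        rw [lintegral_finsetSum' _ fun x _ => hκ x]
        refine Finset.sum_congr rfl fun x _ => ?_
        rw [lintegral_prod _ (hκ x)]
        simp_rw [enorm_mul, lintegral_const_mul' _ _ enorm_ne_top]

theorem Fam.sum_lt_top (hm : Fam ν κ s m) {F : Ix N → Y → ST → ℝ} {C : ℝ≥0∞} (hC : C < ∞)
    (hF : ∀ x y, ∫⁻ z, ‖F x y z‖ₑ ≤ C) : ∑ x, ∫⁻ y, ‖κ y‖ₑ * (∫⁻ z, ‖F x y z‖ₑ) ∂ν < ∞ := by
  refine ENNReal.sum_lt_top.2 fun x _ => (lintegral_mono fun y => ?_).trans_lt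
    (b := ∫⁻ y, ‖κ y‖ₑ * C ∂ν) ?_
  · gcongr
    exact hF x y
  · rw [lintegral_mul_const' _ _ hC.ne]
    exact ENNReal.mul_lt_top hm.int.2 hC

theorem Fam.integrable (hm : Fam ν κ s m) (H : Tame f g h) :
    Integrable (fun p : Y × ST => ev m s f g h p.1 p.2) (ν.prod volume) := by
  obtain ⟨C, hCt, hC⟩ := H.bound_mono
  simp_rw [ev_expand hm.tri]
  have h1 := hm.sum_bound fun x => hm.aesm_mo H.aesm.1 H.aesm.2.1 H.aesm.2.2 x
  exact ⟨h1.1, h1.2.trans_lt (hm.sum_lt_top hCt fun x y => hC _ _ _ _)⟩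

/-- Convergence of families of triples of fields, uniformly in all translations. -/
def TameConv {ι : Type*} (l : Filter ι) (fn gn hn : ι → ST → E3) (f g h : ST → E3) : Prop :=
  ∀ ε : ℝ≥0∞, 0 < ε → ∀ᶠ n in l, ∀ (s : ST × ST × ST) (i j k : Fin 3),
    ∫⁻ z, ‖mono (fn n) (gn n) (hn n) s i j k z - mono f g h s i j k z‖ₑ ≤ ε

/-- Integrals of forms depend continuously on the fields and on the displacements. -/
theorem Fam.tendsto {ι : Type*} {l : Filter ι} [l.IsCountablyGenerated] {s' : ι → Fin N → Y → ST}
    (hm : Fam ν κ s m) (hm' : ∀ n, Fam ν κ (s' n) m)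
    (hs : ∀ a y, Tendsto (fun n => s' n a y) l (𝓝 (s a y)))
    (H : Tame f g h) {fn gn hn : ι → ST → E3}
    (hconv : TameConv l fn gn hn f g h) (hfn : ∀ n, AEStronglyMeasurable (fn n) volume)
    (hgn : ∀ n, AEStronglyMeasurable (gn n) volume)
    (hhn : ∀ n, AEStronglyMeasurable (hn n) volume) :
    Tendsto (fun n => ∫ p, ev m (s' n) (fn n) (gn n) (hn n) p.1 p.2 ∂(ν.prod volume)) l
      (𝓝 (∫ p, ev m s f g h p.1 p.2 ∂(ν.prod volume))) := by
  obtain ⟨C, hCt, hC⟩ := H.bound_mono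
  set F : ι → Ix N → Y → ST → ℝ := fun n x y z =>
    mo (fn n) (gn n) (hn n) (s' n) x y z - mo f g h s x y z with hF
  have hFm : ∀ n x, AEStronglyMeasurable (fun p : Y × ST => F n x p.1 p.2) (ν.prod volume) :=
    fun n x => ((hm' n).aesm_mo (hfn n) (hgn n) (hhn n) x).sub
      (hm.aesm_mo H.aesm.1 H.aesm.2.1 H.aesm.2.2 x)
  have hS : ∀ n x y, ∫⁻ z, ‖F n x y z‖ₑ ≤
      (∫⁻ z, ‖mo (fn n) (gn n) (hn n) (s' n) x y z - mo f g h (s' n) x y z‖ₑ)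
      + ∫⁻ z, ‖mo f g h (s' n) x y z - mo f g h s x y z‖ₑ := fun n x y => by
    refine le_trans (le_of_eq ?_) (lintegral_enorm_add_le ((aesm_mono (hfn n) (hgn n) (hhn n)
      _ _ _ _).sub (aesm_mono H.aesm.1 H.aesm.2.1 H.aesm.2.2 _ _ _ _)))
    exact lintegral_congr fun z => by simp [hF, mo]
  have hbd : ∀ᶠ n in l, ∀ x y, ∫⁻ z, ‖F n x y z‖ₑ ≤ 1 + (C + C) := by
    filter_upwards [hconv 1 one_pos] with n hn x y
    refine (hS n x y).trans (add_le_add (hn _ _ _ _) ?_)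
    simp_rw [sub_eq_add_neg]
    refine (lintegral_enorm_add_le (aesm_mono H.aesm.1 H.aesm.2.1 H.aesm.2.2 _ _ _ _)).trans ?_
    simp_rw [enorm_neg]
    exact add_le_add (hC _ _ _ _) (hC _ _ _ _)
  have hlim : ∀ x y, Tendsto (fun n => ∫⁻ z, ‖F n x y z‖ₑ) l (𝓝 0) := by
    refine fun x y => ENNReal.tendsto_nhds_zero.2 fun ε hε => ?_
    have ht : Tendsto (fun n => tr (s' n) x y - tr s x y) l (𝓝 0) := by
      have h0 : ∀ a, Tendsto (fun n => s' n a y - s a y) l (𝓝 0) := fun a => by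
        simpa using (hs a y).sub_const (s a y)
      exact (h0 _).prodMk_nhds ((h0 _).prodMk_nhds (h0 _))
    filter_upwards [hconv _ (ENNReal.half_pos hε.ne'),
      ht.eventually (H.equicont (ENNReal.half_pos hε.ne'))] with n h1 h2
    refine (hS n x y).trans ((add_le_add (h1 _ _ _ _) ?_).trans (ENNReal.add_halves ε).le)
    have h3 := h2 (tr s x y) x.1.2 x.2.1.2 x.2.2.2
    rwa [add_sub_cancel] at h3
  have e1 : ∀ n (p : Y × ST), ev m (s' n) (fn n) (gn n) (hn n) p.1 p.2 - ev m s f g h p.1 p.2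
      = ∑ x, co (m p.1 p.2) x * F n x p.1 p.2 := fun n p => by
    rw [ev_expand hm.tri, ev_expand hm.tri, ← Finset.sum_sub_distrib]
    simp_rw [hF, mul_sub]
  have h2 : 1 + (C + C) < ∞ := by finiteness
  refine tendsto_integral_of_L1 _ (hm.integrable H).1 ?_ ?_
  · filter_upwards [hbd] with n hn
    have h1 := hm.sum_bound (hFm n)
    refine (((hm.integrable H).add (g := fun p : Y × ST => ∑ x, co (m p.1 p.2) x * F n x p.1 p.2)
      ⟨h1.1, h1.2.trans_lt (hm.sum_lt_top h2 hn)⟩)).congr (.of_forall fun p => ?_)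
    simp [← e1]
  · simp_rw [e1]
    refine tendsto_of_tendsto_of_tendsto_of_le_of_le tendsto_const_nhds ?_ (fun _ => zero_le)
      fun n => (hm.sum_bound (hFm n)).2
    rw [← Finset.sum_const_zero (s := (Finset.univ : Finset (Ix N))) (M := ℝ≥0∞)]
    refine tendsto_finsetSum _ fun x _ => ?_
    rw [← lintegral_zero (μ := ν)]
    refine tendsto_of_seq_tendsto fun u hu => ?_
    obtain ⟨k, hk⟩ := eventually_atTop.1 (hu.eventually hbd)
    refine (tendsto_add_atTop_iff_nat k).1 (tendsto_lintegral_of_dominated_convergence'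
      (fun y => ‖κ y‖ₑ * (1 + (C + C)))
      (fun n => hm.int.1.enorm.mul (hFm _ x).enorm.lintegral_prod_right')
      (fun n => Eventually.of_forall fun y => ?_) ?_ (.of_forall fun y => ?_))
    · exact mul_le_mul_right (hk _ (Nat.le_add_left k n) x y) _
    · rw [lintegral_mul_const' _ _ h2.ne]
      exact (ENNReal.mul_lt_top hm.int.2 h2).ne
    · simpa using ENNReal.Tendsto.const_mul (((hlim x y).comp hu).comp (tendsto_add_atTop_nat k))
        (Or.inr (enorm_ne_top (x := κ y)))

end
/-! ### Space-time mollification -/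

/-- Mollification in space-time. -/
def mollify (φ : ContDiffBump (0 : ST)) (f : ST → E3) : ST → E3 :=
  convolution (φ.normed volume) f (ContinuousLinearMap.lsmul ℝ ℝ) volume

theorem contDiff_mollify (φ : ContDiffBump (0 : ST)) {f : ST → E3}
    (hf : LocallyIntegrable f volume) : ContDiff ℝ (⊤ : ℕ∞) (mollify φ f) :=
  φ.hasCompactSupport_normed.contDiff_convolution_left _ φ.contDiff_normed hf

theorem integrable_mollify (φ : ContDiffBump (0 : ST)) {f : ST → E3}
    (hf : LocallyIntegrable f volume) (z : ST) :
    Integrable (fun t => φ.normed volume t • f (z - t)) volume :=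
  φ.hasCompactSupport_normed.convolutionExists_left (ContinuousLinearMap.lsmul ℝ ℝ)
    φ.continuous_normed hf z

theorem mollify_apply (φ : ContDiffBump (0 : ST)) {f : ST → E3}
    (hf : LocallyIntegrable f volume) (z : ST) (i : Fin 3) :
    mollify φ f z i = ∫ t, φ.normed volume t * f (z - t) i := by
  have h := (EuclideanSpace.proj (𝕜 := ℝ) i).integral_comp_comm (integrable_mollify φ hf z)
  rw [mollify, convolution_def]
  simpa using h.symm

theorem integrable_mollify_apply (φ : ContDiffBump (0 : ST)) {f : ST → E3}
    (hf : LocallyIntegrable f volume) (z : ST) (i : Fin 3) :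
    Integrable (fun t => φ.normed volume t * f (z - t) i) volume := by
  simpa using (EuclideanSpace.proj (𝕜 := ℝ) i).integrable_comp (integrable_mollify φ hf z)

theorem mollify_apply' (φ : ContDiffBump (0 : ST)) {f : ST → E3}
    (hf : LocallyIntegrable f volume) (z : ST) (i : Fin 3) :
    mollify φ f z i = ∫ y, φ.normed volume (z - y) * f y i := by
  rw [mollify_apply φ hf, ← integral_sub_left_eq_self _ volume z]
  simp

theorem fderiv_mollify_apply (φ : ContDiffBump (0 : ST)) {f : ST → E3}
    (hf : LocallyIntegrable f volume) (z v : ST) (i : Fin 3) :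
    fderiv ℝ (mollify φ f) z v i
      = -∫ y, fderiv ℝ (fun y => φ.normed volume (z - y)) y v * f y i := by
  have h1 := φ.hasCompactSupport_normed (μ := volume) |>.hasFDerivAt_convolution_left
    (ContinuousLinearMap.lsmul ℝ ℝ : ℝ →L[ℝ] E3 →L[ℝ] E3) (μ := volume)
    (φ.contDiff_normed (n := 1)) hf z
  have h2 : ConvolutionExistsAt (fderiv ℝ (φ.normed volume)) f z
      ((ContinuousLinearMap.lsmul ℝ ℝ : ℝ →L[ℝ] E3 →L[ℝ] E3).precompL ST) volume :=
    ((φ.hasCompactSupport_normed (μ := volume)).fderiv ℝ).convolutionExists_left _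
      ((φ.contDiff_normed (n := 1)).continuous_fderiv one_ne_zero) hf z
  have h3 : fderiv ℝ (mollify φ f) z v i
      = ∫ t, (fderiv ℝ (φ.normed volume) t v) * f (z - t) i := by
    rw [mollify, h1.fderiv, convolution_def]
    have h4 := (((EuclideanSpace.proj (𝕜 := ℝ) i).comp
      (ContinuousLinearMap.apply ℝ E3 v)).integral_comp_comm h2).symm
    simpa using h4
  rw [h3, ← integral_sub_left_eq_self _ volume z, ← integral_neg]
  congr 1; ext y
  have h5 : HasFDerivAt (fun y => φ.normed volume (z - y))
      ((fderiv ℝ (φ.normed volume) (z - y)).comp (-ContinuousLinearMap.id ℝ ST)) y := by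
    have h6 : HasFDerivAt (φ.normed volume) (fderiv ℝ (φ.normed volume) (z - y)) (z - y) :=
      ((φ.contDiff_normed (n := 1)).differentiable one_ne_zero _).hasFDerivAt
    exact h6.comp y ((hasFDerivAt_id y).const_sub z)
  rw [h5.fderiv]
  simp

/-- Smooth functions with compact support in `Ω`. -/
structure IsTest (Ω : Set ST) (η : ST → ℝ) : Prop where
  smooth : ContDiff ℝ (⊤ : ℕ∞) η
  compact : HasCompactSupport η
  subset : tsupport η ⊆ Ω

theorem isTest_normed (φ : ContDiffBump (0 : ST)) {Ω : Set ST} {z : ST}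
    (hz : Metric.closedBall z φ.rOut ⊆ Ω) : IsTest Ω (fun y => φ.normed volume (z - y)) := by
  have h1 : tsupport (fun y => φ.normed volume (z - y)) ⊆ Metric.closedBall z φ.rOut := by
    refine closure_minimal (fun y hy => ?_) Metric.isClosed_closedBall
    have : z - y ∈ Function.support (φ.normed volume) := hy
    rw [φ.support_normed_eq] at this
    rw [Metric.mem_closedBall, dist_comm, dist_eq_norm]
    exact (mem_ball_zero_iff.1 this).le
  exact ⟨φ.contDiff_normed.comp (contDiff_const.sub contDiff_id),
    HasCompactSupport.of_support_subset_isCompact (isCompact_closedBall z φ.rOut)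
      (subset_tsupport _ |>.trans h1), h1.trans hz⟩

/-- The equations `div f = 0`, `curl f = h`, `∂ₜ f + d curl E = 0` in the sense of distributions
on `Ω`. -/
structure WeakEq (Ω : Set ST) (d : ℝ) (f h E : ST → E3) : Prop where
  div : ∀ η, IsTest Ω η → ∑ i, ∫ z, fderiv ℝ η z (0, e i) * f z i = 0
  curl : ∀ η, IsTest Ω η → ∀ i : Fin 3, ∫ z, η z * h z i =
    -(∫ z, fderiv ℝ η z (0, e (i + 1)) * f z (i + 2))
    + ∫ z, fderiv ℝ η z (0, e (i + 2)) * f z (i + 1)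
  time : ∀ η, IsTest Ω η → ∀ i : Fin 3, ∫ z, fderiv ℝ η z (1, 0) * f z i =
    -d * (∫ z, fderiv ℝ η z (0, e (i + 1)) * E z (i + 2))
    + d * ∫ z, fderiv ℝ η z (0, e (i + 2)) * E z (i + 1)

/-- The space derivative `∂ₖ fᵢ`. -/
def D (f : ST → E3) (k i : Fin 3) (z : ST) : ℝ := fderiv ℝ f z (0, e k) i

theorem WeakEq.mollify {Ω : Set ST} {d : ℝ} {f h E : ST → E3} (H : WeakEq Ω d f h E)
    (hf : LocallyIntegrable f volume) (hh : LocallyIntegrable h volume)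
    (hE : LocallyIntegrable E volume) (φ : ContDiffBump (0 : ST)) {z : ST}
    (hz : Metric.closedBall z φ.rOut ⊆ Ω) :
    (∑ i, D (mollify φ f) i i z = 0) ∧
    (∀ i : Fin 3, mollify φ h z i
      = D (EMHD.mollify φ f) (i + 1) (i + 2) z - D (EMHD.mollify φ f) (i + 2) (i + 1) z) ∧
    (∀ i : Fin 3, fderiv ℝ (EMHD.mollify φ f) z (1, 0) i
      = -d * (D (EMHD.mollify φ E) (i + 1) (i + 2) z - D (EMHD.mollify φ E) (i + 2) (i + 1) z)) := by
  have ht := isTest_normed φ hz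
  refine ⟨?_, fun i => ?_, fun i => ?_⟩
  · simp_rw [D, fderiv_mollify_apply φ hf, Finset.sum_neg_distrib, H.div _ ht, neg_zero]
  · simp_rw [D, fderiv_mollify_apply φ hf, mollify_apply' φ hh, H.curl _ ht]
    ring
  · simp_rw [D, fderiv_mollify_apply φ hf, fderiv_mollify_apply φ hE, H.time _ ht]
    ring

theorem mono_mollify (φ : ContDiffBump (0 : ST)) {f g h : ST → E3}
    (hf : LocallyIntegrable f volume) (hg : LocallyIntegrable g volume)
    (hh : LocallyIntegrable h volume) (s : ST × ST × ST) (i j k : Fin 3) (z : ST) :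
    Integrable (fun t : ST × ST × ST => (φ.normed volume t.1 *
        (φ.normed volume t.2.1 * φ.normed volume t.2.2)) * mono f g h (s - t) i j k z) volume ∧
    mono (mollify φ f) (mollify φ g) (mollify φ h) s i j k z
      = ∫ t : ST × ST × ST, (φ.normed volume t.1 *
        (φ.normed volume t.2.1 * φ.normed volume t.2.2)) * mono f g h (s - t) i j k z := by
  have e1 : ∀ t : ST × ST × ST, (φ.normed volume t.1 *
        (φ.normed volume t.2.1 * φ.normed volume t.2.2)) * mono f g h (s - t) i j k z
      = (φ.normed volume t.1 * f (z + s.1 - t.1) i) *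
        ((φ.normed volume t.2.1 * g (z + s.2.1 - t.2.1) j) *
        (φ.normed volume t.2.2 * h (z + s.2.2 - t.2.2) k)) := by
    intro t
    simp only [mono, Prod.fst_sub, Prod.snd_sub, add_sub_assoc]
    ring
  simp_rw [e1]
  constructor
  · exact (integrable_mollify_apply φ hf _ i).mul_prod
      ((integrable_mollify_apply φ hg _ j).mul_prod (integrable_mollify_apply φ hh _ k))
  · rw [mono, mollify_apply φ hf, mollify_apply φ hg, mollify_apply φ hh, ← integral_prod_mul,
      ← integral_prod_mul]
    rfl

theorem Tame.locallyIntegrable {f g h : ST → E3} (H : Tame f g h) :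
    LocallyIntegrable f volume ∧ LocallyIntegrable g volume ∧ LocallyIntegrable h volume :=
  ⟨H.hf.locallyIntegrable (by norm_num), H.hg.locallyIntegrable (by norm_num), H.hh⟩

theorem Tame.tameConv_mollify {f g h : ST → E3} (H : Tame f g h) {ι : Type*} {l : Filter ι}
    {φ : ι → ContDiffBump (0 : ST)} (hφ : Tendsto (fun n => (φ n).rOut) l (𝓝 0)) :
    TameConv l (fun n => mollify (φ n) f) (fun n => mollify (φ n) g) (fun n => mollify (φ n) h)
      f g h := by
  intro ε hε
  obtain ⟨δ, hδ, hδb⟩ := Metric.eventually_nhds_iff.1 (H.equicont hε)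
  filter_upwards [hφ.eventually (gt_mem_nhds hδ)] with n hn s i j k
  set ρ := (φ n).normed volume with hρ
  obtain ⟨lf, lg, lh⟩ := H.locallyIntegrable
  obtain ⟨af, ag, ah⟩ := H.aesm
  set w : ST × ST × ST → ℝ := fun t => ρ t.1 * (ρ t.2.1 * ρ t.2.2) with hw
  have hρi : Integrable ρ volume := (φ n).integrable_normed
  have hwi : Integrable w volume := hρi.mul_prod (hρi.mul_prod hρi)
  have hw1 : ∫ t, w t = 1 := by
    have : ∫ t, w t = (∫ t, ρ t) * ((∫ t, ρ t) * ∫ t, ρ t) := by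
      rw [← integral_prod_mul, ← integral_prod_mul]; rfl
    rw [this, hρ, (φ n).integral_normed]; norm_num
  have hw0 : ∀ t, 0 ≤ w t := fun t =>
    mul_nonneg ((φ n).nonneg_normed _) (mul_nonneg ((φ n).nonneg_normed _) ((φ n).nonneg_normed _))
  have hwl : ∫⁻ t, ‖w t‖ₑ = 1 := by
    have h1 : ∀ t, ‖w t‖ₑ = ENNReal.ofReal (w t) := fun t => Real.enorm_of_nonneg (hw0 t)
    simp_rw [h1]
    rw [← ofReal_integral_eq_lintegral_ofReal hwi (Eventually.of_forall hw0), hw1,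
      ENNReal.ofReal_one]
  have hpt : ∀ z, mono (mollify (φ n) f) (mollify (φ n) g) (mollify (φ n) h) s i j k z
      - mono f g h s i j k z = ∫ t, w t * (mono f g h (s - t) i j k z - mono f g h s i j k z) := by
    intro z
    obtain ⟨h1, h2⟩ := mono_mollify (φ n) lf lg lh s i j k z
    rw [h2]
    simp_rw [mul_sub]
    rw [integral_sub h1 (hwi.mul_const _), integral_mul_const, hw1, one_mul]
  have hae : AEMeasurable (fun p : (ST × ST × ST) × ST =>
      ‖w p.1 * (mono f g h (s - p.1) i j k p.2 - mono f g h s i j k p.2)‖ₑ)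
      (volume.prod volume) := by
    refine AEStronglyMeasurable.enorm ?_
    refine AEStronglyMeasurable.mul (hwi.1.comp_fst) (AEStronglyMeasurable.sub ?_ ?_)
    · exact aesm_mono_shift (s := fun t => s - t) af ag ah (measurable_const.sub measurable_id) i j k
    · exact (aesm_mono af ag ah s i j k).comp_snd
  calc _ ≤ ∫⁻ z, ∫⁻ t, ‖w t * (mono f g h (s - t) i j k z - mono f g h s i j k z)‖ₑ := by
        refine lintegral_mono fun z => ?_
        rw [hpt z]
        exact enorm_integral_le_lintegral_enorm _
    _ = ∫⁻ t, ∫⁻ z, ‖w t * (mono f g h (s - t) i j k z - mono f g h s i j k z)‖ₑ :=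
        (lintegral_lintegral_swap hae).symm
    _ ≤ ∫⁻ t, ‖w t‖ₑ * ε := by
        refine lintegral_mono fun t => ?_
        simp_rw [enorm_mul]
        rw [lintegral_const_mul' _ _ (by simp)]
        by_cases ht : w t = 0
        · simp [ht]
        have hmem : ∀ y, ρ y ≠ 0 → ‖y‖ < δ := fun y hy => by
          have : y ∈ Function.support ρ := hy
          rw [hρ, (φ n).support_normed_eq] at this
          exact (mem_ball_zero_iff.1 this).trans hn
        have h1 := left_ne_zero_of_mul ht
        have h2 := right_ne_zero_of_mul ht
        have hd : dist (-t) 0 < δ := by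
          rw [dist_zero_right, norm_neg, Prod.norm_def, Prod.norm_def]
          exact max_lt (hmem _ h1) (max_lt (hmem _ (left_ne_zero_of_mul h2))
            (hmem _ (right_ne_zero_of_mul h2)))
        gcongr
        simpa only [sub_eq_add_neg] using hδb hd s i j k
    _ = ε := by
        rw [lintegral_mul_const'' _ hwi.1.enorm, hwl, one_mul]

/-! ### Identities for smooth fields -/

section

variable {Y : Type*} [NormedAddCommGroup Y] [NormedSpace ℝ Y] [FiniteDimensional ℝ Y]
  [MeasurableSpace Y] [BorelSpace Y] {ν : Measure Y} [ν.IsAddHaarMeasure]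

theorem integral_fderiv_eq_zero {X : Type*} [NormedAddCommGroup X] [NormedSpace ℝ X]
    [FiniteDimensional ℝ X] [MeasurableSpace X] [BorelSpace X] {μ : Measure X}
    [μ.IsAddHaarMeasure] {G : X → ℝ} (hG : C¹ G) (hc : HasCompactSupport G) (v : X) :
    Integrable (fun x => fderiv ℝ G x v) μ ∧ ∫ x, fderiv ℝ G x v ∂μ = 0 := by
  have h1 : Integrable (fun x => fderiv ℝ G x v) μ := by
    have hcont : Continuous fun x => fderiv ℝ G x v :=
      (hG.continuous_fderiv one_ne_zero).clm_apply continuous_const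
    exact hcont.integrable_of_hasCompactSupport (hc.fderiv_apply ℝ v)
  refine ⟨h1, ?_⟩
  have h := integral_mul_fderiv_eq_neg_fderiv_mul_of_integrable (𝕜 := ℝ) (μ := μ)
    (f := fun _ => (1 : ℝ)) (g := G) (v := v) (by simp) (by simpa using h1)
    (by simpa using hG.continuous.integrable_of_hasCompactSupport hc)
    (fun _ _ => differentiableAt_const _) (fun x _ => hG.differentiable one_ne_zero x)
  simpa using h

theorem hasDerivAt_line {X : Type*} [NormedAddCommGroup X] [NormedSpace ℝ X] {f : X → ℝ}
    (hf : C¹ f) (x v : X) :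
    HasDerivAt (fun t : ℝ => f (x + t • v)) (fderiv ℝ f x v) 0 := by
  have h := (hf.differentiable one_ne_zero (x + (0 : ℝ) • v)).hasFDerivAt
  have h2 : HasDerivAt (fun t : ℝ => x + t • v) v 0 := by
    simpa using ((hasDerivAt_id (0 : ℝ)).smul_const v).const_add x
  have h3 := h.comp_hasDerivAt (0 : ℝ) h2
  simp only [zero_smul, add_zero] at h3
  exact h3

/-- Vanishing of an absolutely convergent integral over the parameters and space-time. -/
def Zero {Y : Type*} [MeasurableSpace Y] (ν : Measure Y) (I : Y → ST → ℝ) : Prop :=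
  Integrable (fun p : Y × ST => I p.1 p.2) (ν.prod volume) ∧
    ∫ p : Y × ST, I p.1 p.2 ∂(ν.prod volume) = 0

namespace Zero

variable {Y : Type*} [MeasurableSpace Y] {ν : Measure Y} {I I' : Y → ST → ℝ}

theorem add (h : Zero ν I) (h' : Zero ν I') : Zero ν fun y z => I y z + I' y z :=
  ⟨h.1.add h'.1, by rw [integral_add h.1 h'.1, h.2, h'.2, add_zero]⟩

theorem const_mul (h : Zero ν I) (c : ℝ) : Zero ν fun y z => c * I y z :=
  ⟨h.1.const_mul c, by rw [integral_const_mul, h.2, mul_zero]⟩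

theorem congr (h : Zero ν I) (he : ∀ y z, I' y z = I y z) : Zero ν I' := by
  rwa [show I' = I from funext fun y => funext (he y)]

end Zero

/-- A function that is a sum of three divergences of compactly supported fields has vanishing
integral. -/
theorem zero_of_divergence {C : Set Y} {S : Set ST} (hC : IsCompact C) (hS : IsCompact S)
    {I : Y → ST → ℝ} (G₁ G₂ G₃ : Fin 3 → Y → ST → ℝ) {a₁ a₂ a₃ : Fin 3 → Y}
    {b₁ b₂ b₃ : Fin 3 → ST}
    (hG : ∀ k, C¹ (fun p : Y × ST => G₁ k p.1 p.2) ∧ C¹ (fun p : Y × ST => G₂ k p.1 p.2) ∧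
      C¹ fun p : Y × ST => G₃ k p.1 p.2)
    (h0 : ∀ y z, y ∉ C ∨ z ∉ S → I y z = 0 ∧ ∀ k, G₁ k y z = 0 ∧ G₂ k y z = 0 ∧ G₃ k y z = 0)
    (hI : ∀ y z, y ∈ C → z ∈ S → ∃ c₁ c₂ c₃ : V3,
      (∀ k, HasDerivAt (fun t : ℝ => G₁ k (y + t • a₁ k) (z + t • b₁ k)) (c₁ k) 0) ∧
      (∀ k, HasDerivAt (fun t : ℝ => G₂ k (y + t • a₂ k) (z + t • b₂ k)) (c₂ k) 0) ∧
      (∀ k, HasDerivAt (fun t : ℝ => G₃ k (y + t • a₃ k) (z + t • b₃ k)) (c₃ k) 0) ∧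
      I y z = c₁ 0 + c₁ 1 + c₁ 2 + (c₂ 0 + c₂ 1 + c₂ 2) + (c₃ 0 + c₃ 1 + c₃ 2)) :
    Zero ν I := by
  have key : ∀ {G : Fin 3 → Y → ST → ℝ} (_ : ∀ k, C¹ fun p : Y × ST => G k p.1 p.2)
      (_ : ∀ k y z, y ∉ C ∨ z ∉ S → G k y z = 0) (a : Fin 3 → Y) (b : Fin 3 → ST),
      Zero ν (fun y z => ∑ k, fderiv ℝ (fun p : Y × ST => G k p.1 p.2) (y, z) (a k, b k)) ∧
      ∀ y z, y ∉ C ∨ z ∉ S → ∀ k, fderiv ℝ (fun p : Y × ST => G k p.1 p.2) (y, z) = 0 := by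
    intro G hG hG0 a b
    have hs : ∀ k, ∀ p : Y × ST, p ∉ C ×ˢ S → G k p.1 p.2 = 0 := fun k p hp =>
      hG0 k _ _ (not_and_or.1 hp)
    have h1 := fun k => integral_fderiv_eq_zero (μ := ν.prod (volume : Measure ST)) (hG k)
      (HasCompactSupport.intro (hC.prod hS) (hs k)) (a k, b k)
    refine ⟨⟨integrable_finsetSum _ fun k _ => (h1 k).1, ?_⟩, fun y z h k =>
      fderiv_of_notMem_tsupport ℝ fun hm => ?_⟩
    · rw [integral_finsetSum _ fun k _ => (h1 k).1, Finset.sum_eq_zero fun k _ => (h1 k).2]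
    · exact not_and_or.2 h (closure_minimal (Function.support_subset_iff'.2 (hs k))
        (hC.prod hS).isClosed hm)
  have k1 := key (fun k => (hG k).1) (fun k y z h => ((h0 y z h).2 k).1) a₁ b₁
  have k2 := key (fun k => (hG k).2.1) (fun k y z h => ((h0 y z h).2 k).2.1) a₂ b₂
  have k3 := key (fun k => (hG k).2.2) (fun k y z h => ((h0 y z h).2 k).2.2) a₃ b₃
  refine ((k1.1.add k2.1).add k3.1).congr fun y z => ?_
  by_cases hp : y ∉ C ∨ z ∉ S
  · simp [(h0 y z hp).1, k1.2 y z hp, k2.2 y z hp, k3.2 y z hp]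
  · obtain ⟨hy, hz⟩ := not_or.1 hp
    obtain ⟨c₁, c₂, c₃, h1, h2, h3, h4⟩ := hI y z (not_not.1 hy) (not_not.1 hz)
    simp only [h4, Fin.sum_univ_three, fun k => (h1 k).unique (hasDerivAt_line (hG k).1 (y, z)
      (a₁ k, b₁ k)), fun k => (h2 k).unique (hasDerivAt_line (hG k).2.1 (y, z) (a₂ k, b₂ k)),
      fun k => (h3 k).unique (hasDerivAt_line (hG k).2.2 (y, z) (a₃ k, b₃ k))]

end

/-- Isotropic kernels `A(ℓ) + G(ℓ) ℓ ⊗ ℓ` with radial smooth `A`, `G` supported in a ball, with a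
potential `κ` of the divergence of the kernel. -/
structure Ker where
  A : E3 → ℝ
  G : E3 → ℝ
  κ : E3 → ℝ
  A₁ : E3 → ℝ
  G₁ : E3 → ℝ
  r : ℝ
  smA : C¹ A
  smG : C¹ G
  smκ : C¹ κ
  dA : ∀ l k, fderiv ℝ A l (e k) = A₁ l * l k
  dG : ∀ l k, fderiv ℝ G l (e k) = G₁ l * l k
  dκ : ∀ l k, fderiv ℝ κ l (e k)
    = (A₁ l + G₁ l * (l 0 ^ 2 + l 1 ^ 2 + l 2 ^ 2) + 4 * G l) * l k
  supp : ∀ l, l ∉ 𝔹 r →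
    A l = 0 ∧ G l = 0 ∧ κ l = 0 ∧ A₁ l = 0 ∧ G₁ l = 0

/-- Kronecker symbol. -/
def kd (i j : Fin 3) : ℝ := if i = j then 1 else 0

/-- The vector `t x`. -/
def mv (t : Fin 3 → V3) (x : V3) (i : Fin 3) : ℝ := t i 0 * x 0 + t i 1 * x 1 + t i 2 * x 2

/-- The trilinear form `qₖᵢⱼ xₖ yᵢ wⱼ`. -/
def tq (q : Fin 3 → Fin 3 → V3) (x y w : V3) : ℝ := ∑ k, ∑ i, ∑ j, q k i j * x k * y i * w j

/-- The vector `qₖⱼₙ xₖ yₙ`. -/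
def vq (q : Fin 3 → Fin 3 → V3) (x y : V3) (j : Fin 3) : ℝ := ∑ k, ∑ n, q k j n * x k * y n

/-- The form `εᵢₘₙ qₘᵢⱼ xⱼ yₙ`. -/
def cq (q : Fin 3 → Fin 3 → V3) (x y : V3) : ℝ :=
  ∑ m : Fin 3, ∑ j, (q m (m + 2) j * y (m + 1) - q m (m + 1) j * y (m + 2)) * x j

/-- The scalar product of triples. -/
def dot3 (x y : V3) : ℝ := x 0 * y 0 + x 1 * y 1 + x 2 * y 2

/-- The components of the vector product. -/
def cr (x y : V3) (i : Fin 3) : ℝ := x (i + 1) * y (i + 2) - x (i + 2) * y (i + 1)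

/-- Half of the square of the length. -/
def hs (x : V3) : ℝ := (x 0 * x 0 + x 1 * x 1 + x 2 * x 2) / 2

/-- The space gradient of a test function. -/
def gr (ψ : ST → ℝ) (z : ST) (k : Fin 3) : ℝ := fderiv ℝ ψ z (0, e k)

/-- The displacement of space-time by a space vector. -/
def sh (l : E3) : ST := (0, l)

/-- The space derivative `∂ₖ uᵢ` of a component. -/
def dc (u : ST → V3) (k i : Fin 3) (z : ST) : ℝ := fderiv ℝ (fun z => u z i) z (0, e k)

/-- The time derivative `∂ₜ uᵢ` of a component. -/
def tc (u : ST → V3) (i : Fin 3) (z : ST) : ℝ := fderiv ℝ (fun z => u z i) z (1, 0)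

namespace Ker

variable (K : Ker)

/-- The entries of the kernel. -/
def tm (l : E3) (i j : Fin 3) : ℝ := K.A l * kd i j + K.G l * (l i * l j)

/-- The derivatives of the kernel. -/
def qm (l : E3) (k i j : Fin 3) : ℝ :=
  K.A₁ l * l k * kd i j + K.G₁ l * l k * (l i * l j) + K.G l * (kd k i * l j + l i * kd k j)

theorem contDiff_coord (i : Fin 3) : C¹ fun l : E3 => l i :=
  (EuclideanSpace.proj (𝕜 := ℝ) i).contDiff

@[fun_prop]
theorem contDiff_tm : C¹ K.tm :=
  contDiff_pi.2 fun i => contDiff_pi.2 fun j => (K.smA.mul contDiff_const).add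
    (K.smG.mul ((contDiff_coord i).mul (contDiff_coord j)))

@[fun_prop]
theorem contDiff_κ : C¹ K.κ := K.smκ

theorem fderiv_tm (l : E3) (k i j : Fin 3) :
    fderiv ℝ (fun l => K.tm l i j) l (e k) = K.qm l k i j := by
  have hc : ∀ i, HasDerivAt (fun t : ℝ => (l + t • e k) i) (kd k i) 0 := fun i => by
    simpa [e, kd, eq_comm, Pi.single_apply] using
      ((hasDerivAt_id (0 : ℝ)).mul_const (e k i)).const_add (l i)
  have h := ((hasDerivAt_line K.smA l (e k)).mul_const (kd i j)).fun_add
    ((hasDerivAt_line K.smG l (e k)).fun_mul ((hc i).fun_mul (hc j)))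
  refine (hasDerivAt_line (f := fun l => K.tm l i j) (by fun_prop) l (e k)).unique
    (h.congr_deriv ?_)
  simp only [K.dA, K.dG, qm, zero_smul, add_zero]
  ring

theorem tm_eq_zero {l : E3} (hl : l ∉ 𝔹 K.r) : K.tm l = 0 := by
  funext i j
  simp [tm, (K.supp l hl).1, (K.supp l hl).2.1]

theorem qm_eq_zero {l : E3} (hl : l ∉ 𝔹 K.r) : K.qm l = 0 := by
  obtain ⟨-, h1, -, h2, h3⟩ := K.supp l hl
  funext k i j
  simp [qm, h1, h2, h3]

theorem κ_eq_zero {l : E3} (hl : l ∉ 𝔹 K.r) : K.κ l = 0 := (K.supp l hl).2.2.1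

end Ker

section

variable {X : Type*} [NormedAddCommGroup X] [NormedSpace ℝ X]

@[fun_prop]
theorem contDiff_sh {n : WithTop ℕ∞} : ContDiff ℝ n sh := contDiff_const.prodMk contDiff_id

@[fun_prop]
theorem contDiff_mv {t : X → Fin 3 → V3} {x : X → V3} (ht : C¹ t) (hx : C¹ x) :
    C¹ fun p => mv (t p) (x p) := by
  unfold mv
  fun_prop

@[fun_prop]
theorem contDiff_dot3 {x y : X → V3} (hx : C¹ x) (hy : C¹ y) : C¹ fun p => dot3 (x p) (y p) := by
  unfold dot3
  fun_prop

@[fun_prop]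
theorem contDiff_cr {x y : X → V3} (hx : C¹ x) (hy : C¹ y) : C¹ fun p => cr (x p) (y p) := by
  unfold cr
  fun_prop

@[fun_prop]
theorem contDiff_hs {x : X → V3} (hx : C¹ x) : C¹ fun p => hs (x p) := by
  unfold hs
  fun_prop

end

section

variable {x y : ℝ → V3} {x' y' : V3}

theorem hasDerivAt_dot3 (hx : ∀ j, HasDerivAt (fun t => x t j) (x' j) 0)
    (hy : ∀ j, HasDerivAt (fun t => y t j) (y' j) 0) :
    HasDerivAt (fun t => dot3 (x t) (y t)) (dot3 x' (y 0) + dot3 (x 0) y') 0 :=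
  ((((hx 0).fun_mul (hy 0)).fun_add ((hx 1).fun_mul (hy 1))).fun_add
    ((hx 2).fun_mul (hy 2))).congr_deriv (by simp only [dot3]; ring)

theorem hasDerivAt_mv {t : ℝ → Fin 3 → V3} {t' : Fin 3 → V3}
    (ht : ∀ i j, HasDerivAt (fun s => t s i j) (t' i j) 0)
    (hx : ∀ j, HasDerivAt (fun t => x t j) (x' j) 0) (i : Fin 3) :
    HasDerivAt (fun s => mv (t s) (x s) i) (mv t' (x 0) i + mv (t 0) x' i) 0 :=
  hasDerivAt_dot3 (ht i) hx

theorem hasDerivAt_cr (hx : ∀ j, HasDerivAt (fun t => x t j) (x' j) 0)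
    (hy : ∀ j, HasDerivAt (fun t => y t j) (y' j) 0) (k : Fin 3) :
    HasDerivAt (fun t => cr (x t) (y t) k) (cr x' (y 0) k + cr (x 0) y' k) 0 :=
  (((hx (k + 1)).fun_mul (hy (k + 2))).fun_sub ((hx (k + 2)).fun_mul (hy (k + 1)))).congr_deriv
    (by simp only [cr]; ring)

theorem hasDerivAt_hs (hx : ∀ j, HasDerivAt (fun t => x t j) (x' j) 0) :
    HasDerivAt (fun s => hs (x s)) (dot3 (x 0) x') 0 :=
  ((hasDerivAt_dot3 hx hx).div_const 2).congr_deriv (by simp only [dot3]; ring)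

end

theorem sh_zero : sh 0 = 0 := rfl

theorem sh_e (k : Fin 3) : sh (e k) = (0, e k) := rfl

theorem add_sh_neg (k : Fin 3) : ((0, e k) : ST) + sh (-e k) = 0 := by simp [sh]

section

variable {u : ST → V3} {ψ : ST → ℝ} {Ω : Set ST}

theorem hasDerivAt_u (hu : C¹ u) (z ζ : ST) (i : Fin 3) :
    HasDerivAt (fun t : ℝ => u (z + t • ζ) i) (fderiv ℝ (fun z => u z i) z ζ) 0 :=
  hasDerivAt_line (f := fun z => u z i) (by fun_prop) z ζ

theorem hasDerivAt_us (hu : C¹ u) (z ζ : ST) (l v : E3) (i : Fin 3) :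
    HasDerivAt (fun t : ℝ => u (z + t • ζ + sh (l + t • v)) i)
      (fderiv ℝ (fun z => u z i) (z + sh l) (ζ + sh v)) 0 := by
  have h : ∀ t : ℝ, z + t • ζ + sh (l + t • v) = z + sh l + t • (ζ + sh v) := fun t => by
    simp [sh, Prod.ext_iff, add_assoc, add_left_comm]
  simpa only [h] using hasDerivAt_u hu (z + sh l) (ζ + sh v) i

theorem Ker.hasDerivAt_tm (K : Ker) (l v : E3) (i j : Fin 3) :
    HasDerivAt (fun t : ℝ => K.tm (l + t • v) i j) (fderiv ℝ (fun l => K.tm l i j) l v) 0 :=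
  hasDerivAt_line (f := fun l => K.tm l i j) (by fun_prop) l v

theorem gr_eq_zero {z : ST} (hz : z ∉ tsupport ψ) : gr ψ z = 0 := by
  funext k
  simp [gr, fderiv_of_notMem_tsupport ℝ hz]

theorem IsTest.contDiff_two (hψ : IsTest Ω ψ) : ContDiff ℝ 2 ψ :=
  mod_cast contDiff_infty.1 hψ.smooth 2

theorem IsTest.contDiff_one (hψ : IsTest Ω ψ) : C¹ ψ :=
  hψ.contDiff_two.of_le one_le_two

theorem contDiff_gr (hψ : IsTest Ω ψ) : C¹ (gr ψ) :=
  contDiff_pi.2 fun _ => (hψ.contDiff_two.fderiv_right le_rfl).clm_apply contDiff_const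

theorem dc_gr_comm (hψ : IsTest Ω ψ) (i k : Fin 3) (z : ST) :
    dc (gr ψ) k i z = dc (gr ψ) i k z := by
  have h2 := hψ.contDiff_two
  have h : C¹ (fderiv ℝ ψ) := h2.fderiv_right le_rfl
  have h3 : ∀ v w : ST, fderiv ℝ (fun z => fderiv ℝ ψ z v) z w = fderiv ℝ (fderiv ℝ ψ) z w v := by
    intro v w
    rw [fderiv_clm_apply (h.differentiable one_ne_zero z) (differentiableAt_const v)]
    simp
  simp only [dc, gr, h3]
  exact (h2.contDiffAt.isSymmSndFDerivAt (by simp)) _ _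

end

/-- Smooth fields with `div u = 0`, `curl u = v`, `div v = 0` on `Ω`, in components. -/
structure SmoothFields (Ω : Set ST) (u v : ST → V3) : Prop where
  smu : C¹ u
  smv : C¹ v
  divu : ∀ z ∈ Ω, dc u 0 0 z + dc u 1 1 z + dc u 2 2 z = 0
  curl : ∀ z ∈ Ω, ∀ i : Fin 3, v z i = dc u (i + 1) (i + 2) z - dc u (i + 2) (i + 1) z
  divv : ∀ z ∈ Ω, dc v 0 0 z + dc v 1 1 z + dc v 2 2 z = 0

theorem SmoothFields.eqs {Ω : Set ST} {u v : ST → V3} (H : SmoothFields Ω u v) {z : ST}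
    (hz : z ∈ Ω) : (∀ i : Fin 3, v z i = dc u (i + 1) (i + 2) z - dc u (i + 2) (i + 1) z) ∧
    dc u 2 2 z = -dc u 0 0 z - dc u 1 1 z ∧ dc v 2 2 z = -dc v 0 0 z - dc v 1 1 z :=
  ⟨H.curl z hz, by linarith [H.divu z hz], by linarith [H.divv z hz]⟩

/-- Transport of a quadratic expression at the translated point. -/
theorem smooth_transport_shift (K : Ker) {Ω : Set ST} {ψ : ST → ℝ} (hψ : IsTest Ω ψ)
    {x : E3 × ST → V3} {y w : ST → V3} (hx : C¹ x) (hy : C¹ y) (hw : C¹ w)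
    (hdiv : ∀ z ∈ tsupport ψ, ∀ l ∈ 𝔹 K.r, ∃ c : V3, c 0 + c 1 + c 2 = 0 ∧
      ∀ k, HasDerivAt (fun t : ℝ => x (l + t • -e k, z + t • (0, e k)) k) (c k) 0) :
    Zero volume fun l z =>
      dot3 (gr ψ z) (x (l, z)) * dot3 (y (z + sh l)) (mv (K.tm l) (w (z + sh l)))
      - ψ z * tq (K.qm l) (x (l, z)) (y (z + sh l)) (w (z + sh l)) := by
  have hψ1 := hψ.contDiff_one
  refine zero_of_divergence (isCompact_closedBall (0 : E3) K.r) hψ.compact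
    (fun k l z => ψ z * x (l, z) k * dot3 (y (z + sh l)) (mv (K.tm l) (w (z + sh l))))
    (fun _ _ _ => 0) (fun _ _ _ => 0)
    (a₁ := fun k => -e k) (b₁ := fun k => (0, e k)) (a₂ := 0) (b₂ := 0) (a₃ := 0) (b₃ := 0)
    (fun k => ⟨by fun_prop, by fun_prop, by fun_prop⟩) ?_ fun l z hl hz => ?_
  · rintro l z (hl | hz)
    · simp [K.tm_eq_zero hl, K.qm_eq_zero hl, mv, tq, dot3]
    · simp [image_eq_zero_of_notMem_tsupport hz, gr_eq_zero hz, dot3]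
  · obtain ⟨c, hc, hd⟩ := hdiv z hz l hl
    refine ⟨_, 0, 0, fun k => ((hasDerivAt_line hψ1 z (0, e k)).fun_mul (hd k)).fun_mul
      (hasDerivAt_dot3 (hasDerivAt_us hy z _ l _) (hasDerivAt_mv (K.hasDerivAt_tm l _)
      (hasDerivAt_us hw z _ l _))), fun _ => hasDerivAt_const _ _, fun _ => hasDerivAt_const _ _, ?_⟩
    have : c 2 = -c 0 - c 1 := by linarith
    simp only [zero_smul, add_zero, Fin.sum_univ_three, mv, tq, dot3, gr, this, K.fderiv_tm,
      map_neg, map_zero, add_sh_neg, Pi.zero_apply]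
    ring

theorem smooth_transport_self (K : Ker) {Ω : Set ST} {ψ : ST → ℝ} (hψ : IsTest Ω ψ)
    {x : E3 × ST → V3} {y w : ST → V3} (hx : C¹ x) (hy : C¹ y) (hw : C¹ w)
    (hdiv : ∀ z ∈ tsupport ψ, ∀ l ∈ 𝔹 K.r, ∃ c : V3, c 0 + c 1 + c 2 = 0 ∧
      ∀ k, HasDerivAt (fun t : ℝ => x (l + t • e k, z + t • (0 : ST)) k) (c k) 0) :
    Zero volume fun l z => ψ z * tq (K.qm l) (x (l, z)) (y z) (w z) := by
  have hψ1 := hψ.contDiff_one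
  refine zero_of_divergence (isCompact_closedBall (0 : E3) K.r) hψ.compact
    (fun k l z => ψ z * x (l, z) k * dot3 (y z) (mv (K.tm l) (w z)))
    (fun _ _ _ => 0) (fun _ _ _ => 0)
    (a₁ := e) (b₁ := fun _ => 0) (a₂ := 0) (b₂ := 0) (a₃ := 0) (b₃ := 0)
    (fun k => ⟨by fun_prop, by fun_prop, by fun_prop⟩) ?_ fun l z hl hz => ?_
  · rintro l z (hl | hz)
    · simp [K.tm_eq_zero hl, K.qm_eq_zero hl, mv, tq, dot3]
    · simp [image_eq_zero_of_notMem_tsupport hz]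
  · obtain ⟨c, hc, hd⟩ := hdiv z hz l hl
    refine ⟨_, 0, 0, fun k => ((hasDerivAt_line hψ1 z 0).fun_mul (hd k)).fun_mul
      (hasDerivAt_dot3 (hasDerivAt_u hy z _) (hasDerivAt_mv (K.hasDerivAt_tm l _)
      (hasDerivAt_u hw z _))), fun _ => hasDerivAt_const _ _, fun _ => hasDerivAt_const _ _, ?_⟩
    have : c 2 = -c 0 - c 1 := by linarith
    simp only [zero_smul, smul_zero, add_zero, Fin.sum_univ_three, mv, tq, dot3, this, K.fderiv_tm,
      map_zero, Pi.zero_apply]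
    ring

/-- The identity that removes the product of the mollified Lorentz force with the field. -/
theorem smooth_force (K : Ker) {Ω : Set ST} {ψ : ST → ℝ} (hψ : IsTest Ω ψ)
    (hΩ : ∀ z ∈ tsupport ψ, ∀ l ∈ 𝔹 K.r, z + sh l ∈ Ω) {u v : ST → V3} (H : SmoothFields Ω u v) :
    Zero volume fun l z =>
      -dot3 (gr ψ z) (cr (mv (K.tm l) (cr (v (z + sh l)) (u (z + sh l)))) (u z))
      + dot3 (gr ψ z) (v z) * K.κ l * hs (u (z + sh l))
      - ψ z * (-tq (K.qm l) (u (z + sh l)) (u z) (v (z + sh l))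
        + tq (K.qm l) (v (z + sh l)) (u z) (u (z + sh l))
        + tq (K.qm l) (u (z + sh l)) (u (z + sh l)) (v z)) := by
  have hψ1 := hψ.contDiff_one
  have hu := H.smu
  have hv := H.smv
  refine zero_of_divergence (isCompact_closedBall (0 : E3) K.r) hψ.compact
    (fun k l z => -ψ z * cr (mv (K.tm l) (cr (v (z + sh l)) (u (z + sh l)))) (u z) k)
    (fun k l z => ψ z * v z k * K.κ l * hs (u (z + sh l)))
    (fun k l z => -ψ z * (u (z + sh l) k * dot3 (v z) (mv (K.tm l) (u (z + sh l)))
      - hs (u (z + sh l)) * mv (K.tm l) (v z) k))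
    (a₁ := fun k => -e k) (b₁ := fun k => (0, e k)) (a₂ := fun k => -e k) (b₂ := fun k => (0, e k))
    (a₃ := e) (b₃ := fun _ => 0)
    (fun k => ⟨by fun_prop, by fun_prop, by fun_prop⟩) ?_ fun l z hl hz => ?_
  · rintro l z (hl | hz)
    · simp [K.tm_eq_zero hl, K.qm_eq_zero hl, mv, tq, dot3, cr, K.κ_eq_zero hl]
    · simp [image_eq_zero_of_notMem_tsupport hz, gr_eq_zero hz, dot3]
  · refine ⟨_, _, _, fun k => (hasDerivAt_line hψ1 z (0, e k)).fun_neg.fun_mul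
        (hasDerivAt_cr (hasDerivAt_mv (K.hasDerivAt_tm l _) (hasDerivAt_cr
          (hasDerivAt_us hv z _ l _) (hasDerivAt_us hu z _ l _))) (hasDerivAt_u hu z _) k),
      fun k => (((hasDerivAt_line hψ1 z (0, e k)).fun_mul (hasDerivAt_u hv z _ k)).fun_mul
        (hasDerivAt_line K.smκ l _)).fun_mul (hasDerivAt_hs (hasDerivAt_us hu z _ l _)),
      fun k => (hasDerivAt_line hψ1 z 0).fun_neg.fun_mul
        (((hasDerivAt_us hu z _ l _ k).fun_mul (hasDerivAt_dot3 (hasDerivAt_u hv z _)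
          (hasDerivAt_mv (K.hasDerivAt_tm l _) (hasDerivAt_us hu z _ l _)))).fun_sub
        ((hasDerivAt_hs (hasDerivAt_us hu z _ l _)).fun_mul
          (hasDerivAt_mv (K.hasDerivAt_tm l _) (hasDerivAt_u hv z _) k))), ?_⟩
    have h0 := H.eqs (hψ.subset hz)
    have h1 := H.eqs (hΩ z hz l hl)
    simp only [dc] at h0 h1
    simp only [zero_smul, smul_zero, add_zero, zero_add, Fin.sum_univ_three, mv, tq, dot3, gr, cr,
      hs, K.fderiv_tm, K.dκ, map_neg, map_zero, sh_e, add_sh_neg, Fin.isValue, Fin.reduceAdd, h0, h1]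
    simp [Ker.qm, Ker.tm, kd]
    ring

/-- The identity that removes the product of the field with the mollified current. -/
theorem smooth_current (K : Ker) {Ω : Set ST} {ψ : ST → ℝ} (hψ : IsTest Ω ψ)
    (hΩ : ∀ z ∈ tsupport ψ, ∀ l ∈ 𝔹 K.r, z + sh l ∈ Ω) {u v : ST → V3} (H : SmoothFields Ω u v) :
    Zero volume fun l z =>
      -(dot3 (gr ψ z) (u z) * dot3 (u z) (mv (K.tm l) (v (z + sh l))))
      + dot3 (gr ψ z) (mv (K.tm l) (v (z + sh l))) * hs (u z)
      - ψ z * (-tq (K.qm l) (u z) (u z) (v (z + sh l)) + tq (K.qm l) (u z) (v z) (u (z + sh l))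
        - tq (K.qm l) (v z) (u z) (u (z + sh l))) := by
  have hψ1 := hψ.contDiff_one
  have hu := H.smu
  have hv := H.smv
  refine zero_of_divergence (isCompact_closedBall (0 : E3) K.r) hψ.compact
    (fun k l z => -ψ z * (u z k * dot3 (u z) (mv (K.tm l) (v (z + sh l)))
      - hs (u z) * mv (K.tm l) (v (z + sh l)) k))
    (fun k l z => ψ z * hs (u z) * K.κ l * v (z + sh l) k)
    (fun k l z => ψ z * cr (u (z + sh l)) (mv (K.tm l) (cr (v z) (u z))) k)
    (a₁ := fun k => -e k) (b₁ := fun k => (0, e k)) (a₂ := e) (b₂ := fun _ => 0)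
    (a₃ := e) (b₃ := fun _ => 0)
    (fun k => ⟨by fun_prop, by fun_prop, by fun_prop⟩) ?_ fun l z hl hz => ?_
  · rintro l z (hl | hz)
    · simp [K.tm_eq_zero hl, K.qm_eq_zero hl, mv, tq, dot3, cr, K.κ_eq_zero hl]
    · simp [image_eq_zero_of_notMem_tsupport hz, gr_eq_zero hz, dot3]
  · refine ⟨_, _, _, fun k => (hasDerivAt_line hψ1 z (0, e k)).fun_neg.fun_mul
        (((hasDerivAt_u hu z _ k).fun_mul (hasDerivAt_dot3 (hasDerivAt_u hu z _)
          (hasDerivAt_mv (K.hasDerivAt_tm l _) (hasDerivAt_us hv z _ l _)))).fun_sub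
        ((hasDerivAt_hs (hasDerivAt_u hu z _)).fun_mul
          (hasDerivAt_mv (K.hasDerivAt_tm l _) (hasDerivAt_us hv z _ l _) k))),
      fun k => (((hasDerivAt_line hψ1 z 0).fun_mul (hasDerivAt_hs (hasDerivAt_u hu z _))).fun_mul
        (hasDerivAt_line K.smκ l _)).fun_mul (hasDerivAt_us hv z _ l _ k),
      fun k => (hasDerivAt_line hψ1 z 0).fun_mul (hasDerivAt_cr (hasDerivAt_us hu z _ l _)
        (hasDerivAt_mv (K.hasDerivAt_tm l _)
          (hasDerivAt_cr (hasDerivAt_u hv z _) (hasDerivAt_u hu z _))) k), ?_⟩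
    have h0 := H.eqs (hψ.subset hz)
    have h1 := H.eqs (hΩ z hz l hl)
    simp only [dc] at h0 h1
    simp only [zero_smul, smul_zero, add_zero, zero_add, Fin.sum_univ_three, mv, tq, dot3, gr, cr,
      hs, K.fderiv_tm, K.dκ, map_neg, map_zero, sh_e, add_sh_neg, Fin.isValue, Fin.reduceAdd, h0, h1]
    simp [Ker.qm, Ker.tm, kd]
    ring

/-- The mollified divergence of `u ⊗ u` in terms of the mollified Lorentz force. -/
theorem smooth_divergence (K : Ker) {Ω : Set ST} {ψ : ST → ℝ} (hψ : IsTest Ω ψ)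
    (hΩ : ∀ z ∈ tsupport ψ, ∀ l ∈ 𝔹 K.r, z + sh l ∈ Ω) {u v : ST → V3} (H : SmoothFields Ω u v) :
    Zero volume fun l z =>
      -dot3 (gr ψ z) (cr (vq (K.qm l) (u (z + sh l)) (u (z + sh l))) (u z))
      - dot3 (gr ψ z) (cr (mv (K.tm l) (cr (v (z + sh l)) (u (z + sh l)))) (u z))
      + dot3 (gr ψ z) (v z) * K.κ l * hs (u (z + sh l)) := by
  have hg := contDiff_gr hψ
  have hu := H.smu
  refine zero_of_divergence (isCompact_closedBall (0 : E3) K.r) hψ.compact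
    (fun k l z => -u (z + sh l) k * dot3 (cr (u z) (gr ψ z)) (mv (K.tm l) (u (z + sh l))))
    (fun k l z => hs (u (z + sh l)) * mv (K.tm l) (cr (u z) (gr ψ z)) k)
    (fun k l z => K.κ l * hs (u (z + sh l)) * cr (u z) (gr ψ z) k)
    (a₁ := e) (b₁ := fun _ => 0) (a₂ := e) (b₂ := fun _ => 0)
    (a₃ := fun k => -e k) (b₃ := fun k => (0, e k))
    (fun k => ⟨by fun_prop, by fun_prop, by fun_prop⟩) ?_ fun l z hl hz => ?_
  · rintro l z (hl | hz)
    · simp [K.tm_eq_zero hl, K.qm_eq_zero hl, mv, vq, dot3, cr, K.κ_eq_zero hl]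
    · simp [gr_eq_zero hz, dot3, cr, mv]
  · refine ⟨_, _, _, fun k => (hasDerivAt_us hu z _ l _ k).fun_neg.fun_mul
        (hasDerivAt_dot3 (hasDerivAt_cr (hasDerivAt_u hu z 0) (hasDerivAt_u hg z _))
          (hasDerivAt_mv (K.hasDerivAt_tm l _) (hasDerivAt_us hu z _ l _))),
      fun k => (hasDerivAt_hs (hasDerivAt_us hu z _ l _)).fun_mul (hasDerivAt_mv
        (K.hasDerivAt_tm l _) (hasDerivAt_cr (hasDerivAt_u hu z 0) (hasDerivAt_u hg z _)) k),
      fun k => ((hasDerivAt_line K.smκ l _).fun_mul (hasDerivAt_hs (hasDerivAt_us hu z _ l _))).fun_mul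
        (hasDerivAt_cr (hasDerivAt_u hu z _) (hasDerivAt_u hg z _) k), ?_⟩
    have h0 := H.eqs (hψ.subset hz)
    have h1 := H.eqs (hΩ z hz l hl)
    have hc := fun i k => dc_gr_comm hψ i k z
    simp only [dc] at h0 h1 hc
    simp only [zero_smul, smul_zero, add_zero, zero_add, Fin.sum_univ_three, mv, vq, dot3, cr, hs,
      K.fderiv_tm, K.dκ, map_neg, map_zero, sh_e, add_sh_neg, Fin.isValue, Fin.reduceAdd, h0, h1,
      hc 1 0, hc 2 0, hc 2 1]
    simp [Ker.qm, Ker.tm, kd]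
    ring

/-- The evolution of the mollified energy. -/
theorem smooth_time (K : Ker) {Ω : Set ST} {ψ : ST → ℝ} (hψ : IsTest Ω ψ)
    (hΩ : ∀ z ∈ tsupport ψ, ∀ l ∈ 𝔹 K.r, z + sh l ∈ Ω)
    {u w : ST → V3} (hu : C¹ u) (hw : C¹ w) {d : ℝ}
    (H : ∀ z ∈ Ω, ∀ i : Fin 3, tc u i z
      = -d * (dc w (i + 1) (i + 2) z - dc w (i + 2) (i + 1) z)) :
    Zero volume fun l z => fderiv ℝ ψ z (1, 0) * dot3 (u z) (mv (K.tm l) (u (z + sh l)))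
      + d * (dot3 (gr ψ z) (cr (w z) (mv (K.tm l) (u (z + sh l))))
        - ψ z * cq (K.qm l) (u (z + sh l)) (w z) + ψ z * cq (K.qm l) (u z) (w (z + sh l))) := by
  have hψ1 := hψ.contDiff_one
  refine zero_of_divergence (isCompact_closedBall (0 : E3) K.r) hψ.compact
    (fun k l z => 1 / 3 * ψ z * dot3 (u z) (mv (K.tm l) (u (z + sh l))))
    (fun k l z => d * ψ z * cr (w z) (mv (K.tm l) (u (z + sh l))) k)
    (fun k l z => d * ψ z * cr (w (z + sh l)) (mv (K.tm l) (u z)) k)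
    (a₁ := fun _ => 0) (b₁ := fun _ => (1, 0)) (a₂ := fun k => -e k) (b₂ := fun k => (0, e k))
    (a₃ := e) (b₃ := fun _ => 0)
    (fun k => ⟨by fun_prop, by fun_prop, by fun_prop⟩) ?_ fun l z hl hz => ?_
  · rintro l z (hl | hz)
    · simp [K.tm_eq_zero hl, K.qm_eq_zero hl, mv, cq, dot3, cr]
    · simp [image_eq_zero_of_notMem_tsupport hz, fderiv_of_notMem_tsupport ℝ hz, dot3,
        gr_eq_zero hz]
  · refine ⟨_, _, _, fun k => ((hasDerivAt_line hψ1 z _).const_mul (1 / 3)).fun_mul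
        (hasDerivAt_dot3 (hasDerivAt_u hu z _)
          (hasDerivAt_mv (K.hasDerivAt_tm l _) (hasDerivAt_us hu z _ l _))),
      fun k => ((hasDerivAt_line hψ1 z (0, e k)).const_mul d).fun_mul (hasDerivAt_cr
        (hasDerivAt_u hw z _) (hasDerivAt_mv (K.hasDerivAt_tm l _) (hasDerivAt_us hu z _ l _)) k),
      fun k => ((hasDerivAt_line hψ1 z 0).const_mul d).fun_mul (hasDerivAt_cr
        (hasDerivAt_us hw z _ l _) (hasDerivAt_mv (K.hasDerivAt_tm l _) (hasDerivAt_u hu z _)) k), ?_⟩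
    have h0 := H z (hψ.subset hz)
    have h1 := H _ (hΩ z hz l hl)
    simp only [dc, tc] at h0 h1
    simp only [zero_smul, smul_zero, add_zero, zero_add, Fin.sum_univ_three, mv, cq, dot3, gr, cr,
      K.fderiv_tm, map_neg, map_zero, sh_e, sh_zero, add_sh_neg, Fin.isValue, Fin.reduceAdd, h0, h1]
    simp [Ker.qm, Ker.tm, kd]
    ring

/-- The gradient of a function of the space variable. -/
def gs (ρ : E3 → ℝ) (y : E3) (k : Fin 3) : ℝ := fderiv ℝ ρ y (e k)

theorem gs_eq_zero {ρ : E3 → ℝ} {y : E3} (hy : y ∉ tsupport ρ) : gs ρ y = 0 := by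
  funext k
  simp [gs, fderiv_of_notMem_tsupport ℝ hy]

section

variable {ρ : E3 → ℝ} {Ω : Set ST} {ψ : ST → ℝ} {u v : ST → V3}

/-- The mollified divergence of `u ⊗ u` times a field `c`. -/
theorem smooth_product (hρ : C¹ ρ) (hρc : HasCompactSupport ρ) (hψ : IsTest Ω ψ)
    (hΩ : ∀ z ∈ tsupport ψ, ∀ l ∈ tsupport ρ, z + sh l ∈ Ω) (H : SmoothFields Ω u v) (a : V3) :
    Zero volume fun y z =>
      dot3 (gs ρ y) (u (z + sh y)) * ψ z * dot3 a (cr (u (z + sh y)) (u z))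
      + ρ y * (ψ z * dot3 a (cr (cr (v (z + sh y)) (u (z + sh y))) (u z))
        - hs (u (z + sh y)) * dot3 a (cr (gr ψ z) (u z))
        - ψ z * hs (u (z + sh y)) * dot3 a (v z)) := by
  have hψ1 := hψ.contDiff_one
  have hu := H.smu
  have ha : ∀ j, HasDerivAt (fun _ : ℝ => a j) ((0 : V3) j) 0 := fun _ => hasDerivAt_const _ _
  refine zero_of_divergence (C := tsupport ρ) hρc hψ.compact
    (fun k y z => ρ y * ψ z * u (z + sh y) k * dot3 a (cr (u (z + sh y)) (u z)))
    (fun k y z => -ρ y * ψ z * hs (u (z + sh y)) * cr (u z) a k) (fun _ _ _ => 0)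
    (a₁ := e) (b₁ := fun _ => 0) (a₂ := fun _ => 0) (b₂ := fun k => (0, e k)) (a₃ := 0) (b₃ := 0)
    (fun k => ⟨by fun_prop, by fun_prop, by fun_prop⟩) ?_ fun y z hy hz => ?_
  · rintro l z (hl | hz)
    · simp [image_eq_zero_of_notMem_tsupport hl, gs_eq_zero hl, dot3]
    · simp [image_eq_zero_of_notMem_tsupport hz, gr_eq_zero hz, dot3, cr]
  · refine ⟨_, _, 0, fun k => (((hasDerivAt_line hρ y (e k)).fun_mul
        (hasDerivAt_line hψ1 z 0)).fun_mul (hasDerivAt_us hu z _ y _ k)).fun_mul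
        (hasDerivAt_dot3 ha (hasDerivAt_cr (hasDerivAt_us hu z _ y _) (hasDerivAt_u hu z _))),
      fun k => (((hasDerivAt_line hρ y 0).fun_neg.fun_mul (hasDerivAt_line hψ1 z (0, e k))).fun_mul
        (hasDerivAt_hs (hasDerivAt_us hu z _ y _))).fun_mul
        (hasDerivAt_cr (hasDerivAt_u hu z _) ha k),
      fun k => hasDerivAt_const _ _, ?_⟩
    have h0 := H.eqs (hψ.subset hz)
    have h1 := H.eqs (hΩ z hz y hy)
    simp only [dc] at h0 h1
    simp only [zero_smul, smul_zero, add_zero, zero_add, dot3, gs, gr, cr, hs, map_zero, sh_zero,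
      sh_e, Pi.zero_apply, Fin.isValue, Fin.reduceAdd, h0, h1]
    ring

instance isAddHaarMeasure_volume_E3_prod : (volume : Measure (E3 × E3)).IsAddHaarMeasure :=
  inferInstanceAs ((volume : Measure E3).prod (volume : Measure E3)).IsAddHaarMeasure

/-- The mollified divergence of `u ⊗ u` times a mollified field. -/
theorem smooth_product_kernel (K : Ker) (hρ : C¹ ρ) (hρc : HasCompactSupport ρ) (hψ : IsTest Ω ψ)
    (hΩ : ∀ z ∈ tsupport ψ, ∀ l ∈ tsupport ρ, z + sh l ∈ Ω)
    (hΩ' : ∀ z ∈ tsupport ψ, ∀ l ∈ 𝔹 K.r, z + sh l ∈ Ω) (H : SmoothFields Ω u v) (a : V3) :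
    Zero volume fun (y : E3 × E3) z =>
      dot3 (gs ρ y.1) (u (z + sh y.1)) * ψ z
        * dot3 a (cr (u (z + sh y.1)) (mv (K.tm y.2) (u (z + sh y.2))))
      + ρ y.1 * (ψ z * dot3 a (cr (cr (v (z + sh y.1)) (u (z + sh y.1)))
          (mv (K.tm y.2) (u (z + sh y.2))))
        - hs (u (z + sh y.1)) * dot3 a (cr (gr ψ z) (mv (K.tm y.2) (u (z + sh y.2))))
        - ψ z * hs (u (z + sh y.1)) * dot3 a (mv (K.tm y.2) (v (z + sh y.2)))) := by
  have hψ1 := hψ.contDiff_one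
  have hu := H.smu
  have ha : ∀ j, HasDerivAt (fun _ : ℝ => a j) ((0 : V3) j) 0 := fun _ => hasDerivAt_const _ _
  refine zero_of_divergence (C := tsupport ρ ×ˢ 𝔹 K.r)
    (IsCompact.prod hρc (isCompact_closedBall _ _)) hψ.compact
    (fun k y z => ρ y.1 * ψ z * u (z + sh y.1) k
      * dot3 a (cr (u (z + sh y.1)) (mv (K.tm y.2) (u (z + sh y.2)))))
    (fun k y z => -ρ y.1 * ψ z * hs (u (z + sh y.1)) * cr (mv (K.tm y.2) (u (z + sh y.2))) a k)
    (fun k y z => -ρ y.1 * ψ z * hs (u (z + sh y.1)) * cr (u (z + sh y.2)) (mv (K.tm y.2) a) k)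
    (a₁ := fun k => (e k, 0)) (b₁ := fun _ => 0)
    (a₂ := fun k => (0, -e k)) (b₂ := fun k => (0, e k))
    (a₃ := fun k => (0, e k)) (b₃ := fun _ => 0)
    (fun k => ⟨by fun_prop, by fun_prop, by fun_prop⟩) ?_ fun ⟨y, l⟩ z ⟨hy, hl⟩ hz => ?_
  · rintro ⟨y, l⟩ z (hy | hz)
    · rcases not_and_or.1 hy with hy | hl
      · simp [image_eq_zero_of_notMem_tsupport hy, gs_eq_zero hy, dot3]
      · simp [K.tm_eq_zero hl, dot3, cr, mv]
    · simp [image_eq_zero_of_notMem_tsupport hz, gr_eq_zero hz, dot3, cr, mv]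
  · refine ⟨_, _, _, fun k => (((hasDerivAt_line hρ y (e k)).fun_mul
        (hasDerivAt_line hψ1 z 0)).fun_mul (hasDerivAt_us hu z _ y _ k)).fun_mul
        (hasDerivAt_dot3 ha (hasDerivAt_cr (hasDerivAt_us hu z _ y _)
          (hasDerivAt_mv (K.hasDerivAt_tm l _) (hasDerivAt_us hu z _ l _)))),
      fun k => (((hasDerivAt_line hρ y 0).fun_neg.fun_mul (hasDerivAt_line hψ1 z (0, e k))).fun_mul
        (hasDerivAt_hs (hasDerivAt_us hu z _ y _))).fun_mul (hasDerivAt_cr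
          (hasDerivAt_mv (K.hasDerivAt_tm l _) (hasDerivAt_us hu z _ l _)) ha k),
      fun k => (((hasDerivAt_line hρ y 0).fun_neg.fun_mul (hasDerivAt_line hψ1 z 0)).fun_mul
        (hasDerivAt_hs (hasDerivAt_us hu z _ y _))).fun_mul (hasDerivAt_cr
          (hasDerivAt_us hu z _ l _) (hasDerivAt_mv (K.hasDerivAt_tm l _) ha) k), ?_⟩
    have h0 := H.eqs (hΩ' z hz l hl)
    have h1 := H.eqs (hΩ z hz y hy)
    simp only [dc] at h0 h1
    simp only [zero_smul, smul_zero, add_zero, zero_add, dot3, gs, gr, cr, hs, mv, map_zero, map_neg,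
      sh_zero, sh_e, add_sh_neg, K.fderiv_tm, Pi.zero_apply, Fin.isValue, Fin.reduceAdd, h0, h1]
    simp [Ker.qm, Ker.tm, kd]
    ring

end

/-! ### The balance of energy for smooth fields -/

/-- The density of the defect. -/
def defectTri (q : Fin 3 → Fin 3 → V3) (u x w : Fin 2 → V3) : ℝ :=
  1 / 2 * tq q (u 1 - u 0) (w 1 - w 0) (x 1 - x 0)
    - 1 / 4 * tq q (w 1 - w 0) (u 1 - u 0) (x 1 - x 0)

/-- The flux paired with `g`. -/
def fluxTri (t : Fin 3 → V3) (g : V3) (u x w : Fin 2 → V3) : ℝ :=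
  1 / 2 * (dot3 (u 0) (mv t (w 1)) * dot3 g (x 0))
    + 1 / 2 * (dot3 (mv t (u 1)) (w 0) * dot3 g (x 0))
    - 1 / 2 * (dot3 (u 0) (mv t (x 1)) * dot3 g (w 0))
    - 1 / 4 * (dot3 (u 1) (mv t (x 1)) * dot3 g (w 1))
    + 1 / 4 * (dot3 (u 1) (mv t (x 1)) * dot3 g (w 0))
    + 1 / 2 * (dot3 (w 1) (mv t (u 1)) * dot3 g (x 1))
    - 1 / 2 * (dot3 (w 1) (mv t (u 1)) * dot3 g (x 0))

/-- The product of the divergence of `u ⊗ u` with the mollified field, paired with `g`. -/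
def rightTri (t : Fin 3 → V3) (g : V3) (u x w : Fin 2 → V3) : ℝ :=
  1 / 2 * dot3 g (cr (cr (w 0) (u 0)) (mv t (x 1)))
    - 1 / 4 * (dot3 (u 0) (x 0) * dot3 g (mv t (w 1)))

/-- The product of the mollified divergence of `u ⊗ u` with the field, paired with `g`. -/
def leftTri (q : Fin 3 → Fin 3 → V3) (g : V3) (u x w : Fin 2 → V3) : ℝ :=
  -(1 / 2) * dot3 g (cr (vq q (u 1) (x 1)) (w 0))

/-- The same as `leftTri`, after removal of the derivatives of the kernel. -/
def forceTri (t : Fin 3 → V3) (k : ℝ) (g : V3) (u x w : Fin 2 → V3) : ℝ :=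
  1 / 2 * dot3 g (cr (mv t (cr (w 1) (u 1))) (x 0))
    - 1 / 4 * (dot3 g (w 0) * k * dot3 (u 1) (x 1))

/-- The contribution of the time derivative. -/
def evolTri (t : Fin 3 → V3) (q : Fin 3 → Fin 3 → V3) (g : V3) (p : ℝ)
    (u x w : Fin 2 → V3) : ℝ :=
  dot3 g (cr (cr (w 0) (u 0)) (mv t (x 1))) - p * cq q (x 1) (cr (w 0) (u 0))
    + p * cq q (x 0) (cr (w 1) (u 1))

/-- The values of a field at `z` and at the translated point. -/
def two (u : ST → V3) (l : E3) (z : ST) : Fin 2 → V3 := ![u z, u (z + sh l)]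

theorem smooth_balance (K : Ker) {Ω : Set ST} {ψ : ST → ℝ} (hψ : IsTest Ω ψ)
    (hΩ : ∀ z ∈ tsupport ψ, ∀ l ∈ 𝔹 K.r, z + sh l ∈ Ω)
    {u v : ST → V3} (H : SmoothFields Ω u v) :
    Zero volume fun l z =>
      forceTri (K.tm l) (K.κ l) (gr ψ z) (two u l z) (two u l z) (two v l z)
      + rightTri (K.tm l) (gr ψ z) (two u l z) (two u l z) (two v l z)
      + fluxTri (K.tm l) (gr ψ z) (two u l z) (two u l z) (two v l z)
      - ψ z * defectTri (K.qm l) (two u l z) (two u l z) (two v l z)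
      - evolTri (K.tm l) (K.qm l) (gr ψ z) (ψ z) (two u l z) (two u l z) (two v l z) := by
  have hu := H.smu
  have hv := H.smv
  have A : ∀ {x y w : ST → V3}, C¹ x → C¹ y → C¹ w →
      (∀ z ∈ Ω, dc x 0 0 z + dc x 1 1 z + dc x 2 2 z = 0) →
      Zero volume (fun l z =>
        dot3 (gr ψ z) (x (z + sh l)) * dot3 (y (z + sh l)) (mv (K.tm l) (w (z + sh l)))
        - ψ z * tq (K.qm l) (x (z + sh l)) (y (z + sh l)) (w (z + sh l))) ∧
      Zero volume (fun l z =>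
        dot3 (gr ψ z) (x z) * dot3 (y (z + sh l)) (mv (K.tm l) (w (z + sh l)))
        - ψ z * tq (K.qm l) (x z) (y (z + sh l)) (w (z + sh l))) ∧
      Zero volume (fun l z => ψ z * tq (K.qm l) (x (z + sh l)) (y z) (w z)) ∧
      Zero volume fun l z => ψ z * tq (K.qm l) (x z) (y z) (w z) := by
    intro x y w hx hy hw h
    refine ⟨smooth_transport_shift K hψ (x := fun p => x (p.2 + sh p.1)) (by fun_prop) hy hw
        fun z _ l _ => ⟨0, by simp, fun k => ?_⟩,
      smooth_transport_shift K hψ (x := fun p => x p.2) (by fun_prop) hy hw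
        fun z hz l _ => ⟨_, h z (hψ.subset hz), fun k => hasDerivAt_u hx z _ k⟩,
      smooth_transport_self K hψ (x := fun p => x (p.2 + sh p.1)) (by fun_prop) hy hw
        fun z hz l hl => ⟨fun k => dc x k k (z + sh l), h _ (hΩ z hz l hl), fun k => ?_⟩,
      smooth_transport_self K hψ (x := fun p => x p.2) (by fun_prop) hy hw
        fun z _ l _ => ⟨0, by simp, fun k => ?_⟩⟩
    · simpa [add_sh_neg] using hasDerivAt_us hx z (0, e k) l (-e k) k
    · simpa [dc, sh_e] using hasDerivAt_us hx z 0 l (e k) k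
    · simpa using hasDerivAt_u hx z 0 k
  obtain ⟨s2, s4, s5, s7⟩ := A hu hv hu H.divu
  obtain ⟨s1, s3, s6, s8⟩ := A hv hu hu H.divv
  refine ((((s1.const_mul (-(1 / 4))).add (s2.const_mul (1 / 2))).add
    ((s3.const_mul (1 / 4)).add (s4.const_mul (-(1 / 2))))).add
    ((((s5.const_mul (-(1 / 2))).add (s6.const_mul (1 / 4))).add
    ((s7.const_mul (1 / 2)).add (s8.const_mul (-(1 / 4))))).add
    (((smooth_force K hψ hΩ H).const_mul (-(1 / 2))).add
    ((smooth_current K hψ hΩ H).const_mul (-(1 / 2)))))).congr fun l z => ?_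
  simp only [two, Matrix.cons_val_zero, Matrix.cons_val_one]
  generalize u z = u0
  generalize u (z + sh l) = u1
  generalize v z = v0
  generalize v (z + sh l) = v1
  generalize gr ψ z = g
  have ht : ∀ i j, K.tm l j i = K.tm l i j := fun i j => by
    simp only [Ker.tm, kd, eq_comm (a := j)]; ring
  have hq : ∀ k i j, K.qm l k j i = K.qm l k i j := fun k i j => by
    simp only [Ker.qm, kd, eq_comm (a := j)]; ring
  simp only [forceTri, rightTri, fluxTri, defectTri, evolTri, tq, cq, mv, dot3, cr, hs,
    Fin.sum_univ_three, Matrix.cons_val_zero, Matrix.cons_val_one, Fin.isValue, Fin.reduceAdd,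
    zero_add, Pi.sub_apply, ht 0 1, ht 0 2, ht 1 2, hq _ 0 1, hq _ 0 2, hq _ 1 2]
  ring

/-! ### Transfer of the identities to the limit -/

/-- A continuous family of trilinear forms with compact support. -/
structure CFam {Y : Type*} [TopologicalSpace Y] {N : ℕ} (C : Set Y) (S : Set ST)
    (s : Fin N → Y → ST)
    (m : Y → ST → Form E3 N) : Prop where
  tri : ∀ y z, IsTri (m y z)
  cont : ∀ U V W, Continuous fun p : Y × ST => m p.1 p.2 U V W
  supp : ∀ y z, y ∉ C ∨ z ∉ S → ∀ U V W, m y z U V W = 0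
  shift : ∀ a, Continuous (s a)

section

variable {Y : Type*} [NormedAddCommGroup Y] [NormedSpace ℝ Y] [FiniteDimensional ℝ Y]
  [MeasurableSpace Y] [BorelSpace Y] {ν : Measure Y} [ν.IsAddHaarMeasure] {N : ℕ} {C : Set Y}
  {S : Set ST} {s : Fin N → Y → ST}
  {m : Y → ST → Form E3 N}

theorem CFam.exists_fam (hm : CFam C S s m) (hC : IsCompact C) (hS : IsCompact S) :
    ∃ κ, Fam ν κ s m := by
  have h1 : ∀ U V W, ∃ B, ∀ p : Y × ST, ‖m p.1 p.2 U V W‖ ≤ B := by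
    intro U V W
    have hcs : HasCompactSupport fun p : Y × ST => m p.1 p.2 U V W :=
      HasCompactSupport.intro (hC.prod hS) fun p hp => hm.supp _ _ (by
        by_contra! h
        exact hp ⟨h.1, h.2⟩) _ _ _
    exact hcs.exists_bound_of_continuous (hm.cont U V W)
  choose B hB using h1
  set G : Ix N → ℝ := fun x => |B (slot x.1) (slot x.2.1) (slot x.2.2)| with hG
  set M : ℝ := ∑ x, G x with hM
  refine ⟨C.indicator fun _ => M, hm.tri, fun U V W => (hm.cont U V W).aestronglyMeasurable,
    fun y z x => ?_, ?_, fun a => (hm.shift a).measurable⟩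
  · by_cases hy : y ∈ C
    · rw [indicator_of_mem hy]
      refine (hB _ _ _ (y, z)).trans ((le_abs_self _).trans ?_)
      exact Finset.single_le_sum (f := G) (fun x _ => abs_nonneg _)
        (Finset.mem_univ x)
    · rw [indicator_of_notMem hy, co, hm.supp y z (Or.inl hy), abs_zero]
  · exact (integrable_indicator_iff hC.measurableSet).2
      (integrableOn_const hC.measure_lt_top.ne)

theorem CFam.integrable_of_continuous (hm : CFam C S s m) (hC : IsCompact C) (hS : IsCompact S)
    {f g h : ST → E3} (hf : Continuous f) (hg : Continuous g) (hh : Continuous h) :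
    Integrable (fun p : Y × ST => ev m s f g h p.1 p.2) (ν.prod volume) := by
  have hs := hm.shift
  have hc := hm.cont
  refine Continuous.integrable_of_hasCompactSupport ?_ ?_
  · simp_rw [ev_expand hm.tri, co, mo, mono, tr]
    fun_prop
  · exact HasCompactSupport.intro (hC.prod hS) fun p hp => hm.supp _ _ (by
        by_contra! h
        exact hp ⟨h.1, h.2⟩) _ _ _

/-- Passage to the limit in the mollification parameter. -/
theorem zero_of_mollify {m' : Y → ST → Form E3 N}
    (hm : CFam C S s m) (hm' : CFam C S s m') (hC : IsCompact C) (hS : IsCompact S)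
    {f g h f' g' h' : ST → E3} (H : Tame f g h) (H' : Tame f' g' h')
    {φ : ℕ → ContDiffBump (0 : ST)} (hφ : Tendsto (fun n => (φ n).rOut) atTop (𝓝 0))
    (hz : ∀ n, Zero ν fun y z => ev m s (mollify (φ n) f) (mollify (φ n) g) (mollify (φ n) h) y z
      + ev m' s (mollify (φ n) f') (mollify (φ n) g') (mollify (φ n) h') y z) :
    Zero ν fun y z => ev m s f g h y z + ev m' s f' g' h' y z := by
  obtain ⟨κ, hκ⟩ := hm.exists_fam (ν := ν) hC hS
  obtain ⟨κ', hκ'⟩ := hm'.exists_fam (ν := ν) hC hS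
  have hcm : ∀ {u : ST → E3} (hu : LocallyIntegrable u volume) n, Continuous (mollify (φ n) u) :=
    fun hu n => (contDiff_mollify (φ n) hu).continuous
  have haem : ∀ {u : ST → E3} (hu : LocallyIntegrable u volume) n,
      AEStronglyMeasurable (mollify (φ n) u) volume := fun hu n => (hcm hu n).aestronglyMeasurable
  obtain ⟨lf, lg, lh⟩ := H.locallyIntegrable
  obtain ⟨lf', lg', lh'⟩ := H'.locallyIntegrable
  have t1 := hκ.tendsto (fun _ => hκ) (fun _ _ => tendsto_const_nhds) H (H.tameConv_mollify hφ) (haem lf) (haem lg) (haem lh)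
  have t2 := hκ'.tendsto (fun _ => hκ') (fun _ _ => tendsto_const_nhds) H' (H'.tameConv_mollify hφ) (haem lf') (haem lg') (haem lh')
  refine ⟨(hκ.integrable H).add (hκ'.integrable H'), ?_⟩
  rw [integral_add (hκ.integrable H) (hκ'.integrable H')]
  refine tendsto_nhds_unique (t1.add t2) ?_
  have : ∀ n, (∫ p : Y × ST, ev m s (mollify (φ n) f) (mollify (φ n) g) (mollify (φ n) h) p.1 p.2
        ∂(ν.prod volume))
      + ∫ p : Y × ST, ev m' s (mollify (φ n) f') (mollify (φ n) g') (mollify (φ n) h') p.1 p.2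
        ∂(ν.prod volume) = 0 := by
    intro n
    rw [← integral_add (hm.integrable_of_continuous hC hS (hcm lf n) (hcm lg n) (hcm lh n))
      (hm'.integrable_of_continuous hC hS (hcm lf' n) (hcm lg' n) (hcm lh' n))]
    exact (hz n).2
  simp_rw [this]
  exact tendsto_const_nhds

end

/-- The components of a vector field. -/
def cp (F : ST → E3) (z : ST) : V3 := (F z).ofLp

theorem dc_cp {F : ST → E3} (hF : Differentiable ℝ F) (k i : Fin 3) (z : ST) :
    dc (cp F) k i z = D F k i z := by
  have h := ((EuclideanSpace.proj (𝕜 := ℝ) i).hasFDerivAt.comp z (hF z).hasFDerivAt).fderiv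
  have h2 : (fun z => cp F z i) = (EuclideanSpace.proj (𝕜 := ℝ) i) ∘ F := rfl
  rw [dc, h2, h]
  rfl

theorem tc_cp {F : ST → E3} (hF : Differentiable ℝ F) (i : Fin 3) (z : ST) :
    tc (cp F) i z = fderiv ℝ F z (1, 0) i := by
  have h := ((EuclideanSpace.proj (𝕜 := ℝ) i).hasFDerivAt.comp z (hF z).hasFDerivAt).fderiv
  have h2 : (fun z => cp F z i) = (EuclideanSpace.proj (𝕜 := ℝ) i) ∘ F := rfl
  rw [tc, h2, h]
  rfl

theorem contDiff_cp {F : ST → E3} (hF : C¹ F) : C¹ (cp F) :=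
  contDiff_pi.2 fun i => (EuclideanSpace.proj (𝕜 := ℝ) i).contDiff.comp hF

theorem IsTest.derivative {Ω : Set ST} {η : ST → ℝ} (hη : IsTest Ω η) (v : ST) :
    IsTest Ω fun z => fderiv ℝ η z v := by
  refine ⟨?_, hη.compact.fderiv_apply ℝ v,
    (tsupport_fderiv_apply_subset ℝ v).trans hη.subset⟩
  exact (hη.smooth.fderiv_right (m := (⊤ : ℕ∞)) (by simp)).clm_apply contDiff_const

theorem IsTest.fderiv_comm {Ω : Set ST} {η : ST → ℝ} (hη : IsTest Ω η) (v w : ST) (z : ST) :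
    fderiv ℝ (fun z => fderiv ℝ η z v) z w = fderiv ℝ (fun z => fderiv ℝ η z w) z v := by
  have h2 := hη.contDiff_two
  have h : C¹ (fderiv ℝ η) := h2.fderiv_right (by norm_num)
  have h3 : ∀ v w : ST, fderiv ℝ (fun z => fderiv ℝ η z v) z w = fderiv ℝ (fderiv ℝ η) z w v := by
    intro v w
    rw [fderiv_clm_apply (h.differentiable one_ne_zero z) (differentiableAt_const v)]
    simp
  rw [h3, h3]
  exact (h2.contDiffAt.isSymmSndFDerivAt (by simp)) _ _

/-- A curl is solenoidal. -/
theorem WeakEq.div_curl {Ω : Set ST} {d : ℝ} {f h E : ST → E3} (H : WeakEq Ω d f h E) (η : ST → ℝ)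
    (hη : IsTest Ω η) : ∑ i, ∫ z, fderiv ℝ η z (0, e i) * h z i = 0 := by
  have hc := fun i => H.curl _ (hη.derivative (0, e i)) i
  simp only [Fin.sum_univ_three, hc, Fin.isValue, Fin.reduceAdd, zero_add]
  simp only [hη.fderiv_comm (0, e 1) (0, e 0), hη.fderiv_comm (0, e 2) (0, e 0),
    hη.fderiv_comm (0, e 2) (0, e 1)]
  ring

theorem contDiff_one_mollify (φ : ContDiffBump (0 : ST)) {f : ST → E3}
    (hf : LocallyIntegrable f volume) : C¹ (mollify φ f) :=
  (contDiff_mollify φ hf).of_le (by exact_mod_cast le_top)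

theorem smoothFields_mollify {Ω : Set ST} {d : ℝ} {f h E : ST → E3} (H : WeakEq Ω d f h E)
    (hf : LocallyIntegrable f volume) (hh : LocallyIntegrable h volume)
    (hE : LocallyIntegrable E volume) (φ : ContDiffBump (0 : ST)) {Ω' : Set ST}
    (hz : ∀ z ∈ Ω', Metric.closedBall z φ.rOut ⊆ Ω) :
    SmoothFields Ω' (cp (mollify φ f)) (cp (mollify φ h)) ∧
    ∀ z ∈ Ω', ∀ i : Fin 3, tc (cp (mollify φ f)) i z
      = -d * (dc (cp (mollify φ E)) (i + 1) (i + 2) z - dc (cp (mollify φ E)) (i + 2) (i + 1) z) := by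
  have sm := fun {u : ST → E3} (hu : LocallyIntegrable u volume) => contDiff_one_mollify φ hu
  have df : ∀ {u : ST → E3}, LocallyIntegrable u volume → Differentiable ℝ (mollify φ u) :=
    fun hu => (sm hu).differentiable one_ne_zero
  refine ⟨⟨contDiff_cp (sm hf), contDiff_cp (sm hh), fun z hzΩ => ?_, fun z hzΩ i => ?_,
    fun z hzΩ => ?_⟩, fun z hzΩ i => ?_⟩
  · have := (H.mollify hf hh hE φ (hz z hzΩ)).1
    simpa [dc_cp (df hf), Fin.sum_univ_three] using this
  · rw [dc_cp (df hf), dc_cp (df hf)]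
    exact (H.mollify hf hh hE φ (hz z hzΩ)).2.1 i
  · have ht := isTest_normed φ (hz z hzΩ)
    have := H.div_curl _ ht
    simp only [dc_cp (df hh), D, fderiv_mollify_apply φ hh]
    simp only [Fin.sum_univ_three] at this
    linarith
  · rw [tc_cp (df hf), dc_cp (df hE), dc_cp (df hE)]
    exact (H.mollify hf hh hE φ (hz z hzΩ)).2.2 i

/-- Bumps that shrink to the origin, with the mollified equations near a compact set. -/
theorem exists_smoothFields {Ω : Set ST} (hΩ : IsOpen Ω) {d : ℝ} {f h E : ST → E3}
    (H : WeakEq Ω d f h E)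
    (hf : LocallyIntegrable f volume) (hh : LocallyIntegrable h volume)
    (hE : LocallyIntegrable E volume) {S : Set ST} (hS : IsCompact S) (hSΩ : S ⊆ Ω) :
    ∃ (Ω' : Set ST) (φ : ℕ → ContDiffBump (0 : ST)), S ⊆ Ω' ∧
      Tendsto (fun n => (φ n).rOut) atTop (𝓝 0) ∧
      (∀ n, ∀ z ∈ Ω', Metric.closedBall z (φ n).rOut ⊆ Ω) ∧
      ∀ n, SmoothFields Ω' (cp (mollify (φ n) f)) (cp (mollify (φ n) h)) ∧
        ∀ z ∈ Ω', ∀ i : Fin 3, tc (cp (mollify (φ n) f)) i z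
          = -d * (dc (cp (mollify (φ n) E)) (i + 1) (i + 2) z
            - dc (cp (mollify (φ n) E)) (i + 2) (i + 1) z) := by
  obtain ⟨δ, hδ, hδΩ⟩ := hS.exists_cthickening_subset_open hΩ hSΩ
  have hpos : ∀ n : ℕ, 0 < δ / ((n : ℝ) + 1) := fun n => by positivity
  refine ⟨{z | Metric.closedBall z δ ⊆ Ω}, fun n => ⟨δ / ((n : ℝ) + 1) / 2, δ / ((n : ℝ) + 1),
    by linarith [hpos n], by linarith [hpos n]⟩, fun z hz => ?_, ?_, fun n z hz => ?_, fun n => ?_⟩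
  · exact (Metric.closedBall_subset_cthickening hz δ).trans hδΩ
  · simpa [div_eq_mul_inv] using (tendsto_one_div_add_atTop_nhds_zero_nat (𝕜 := ℝ)).const_mul δ
  · refine (Metric.closedBall_subset_closedBall ?_).trans hz
    exact div_le_self hδ.le (by linarith [n.cast_nonneg (α := ℝ)])
  · refine smoothFields_mollify H hf hh hE _ fun z hz => ?_
    refine (Metric.closedBall_subset_closedBall ?_).trans hz
    exact div_le_self hδ.le (by linarith [n.cast_nonneg (α := ℝ)])

/-! ### The balance of energy for weak solutions and regular kernels -/

/-- The components of a tuple of vectors. -/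
def fx {N : ℕ} (U : Fin N → E3) (a : Fin N) : V3 := (U a).ofLp

/-- The displacements `0` and `l`. -/
def pt : Fin 2 → E3 → ST := ![fun _ => 0, sh]

theorem fx_pt (f : ST → E3) (l : E3) (z : ST) : fx (fun a => f (z + pt a l)) = two (cp f) l z := by
  funext a
  fin_cases a <;> simp [fx, pt, two, cp]

theorem continuous_pt (a : Fin 2) : Continuous (pt a) := by
  fin_cases a
  · exact continuous_const
  · exact (contDiff_sh (n := 0)).continuous

/-- Trilinearity of a form in components. -/
theorem isTri_of {N : ℕ} {F : Form V3 N}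
    (h₁ : ∀ u u' x w, F (u + u') x w = F u x w + F u' x w)
    (h₁' : ∀ (c : ℝ) u x w, F (c • u) x w = c * F u x w)
    (h₂ : ∀ u x x' w, F u (x + x') w = F u x w + F u x' w)
    (h₂' : ∀ (c : ℝ) u x w, F u (c • x) w = c * F u x w)
    (h₃ : ∀ u x w w', F u x (w + w') = F u x w + F u x w')
    (h₃' : ∀ (c : ℝ) u x w, F u x (c • w) = c * F u x w) :
    IsTri fun U V W => F (fx U) (fx V) (fx W) where
  lin₁ V W := ⟨fun U U' => h₁ (fx U) (fx U') _ _, fun c U => h₁' c (fx U) _ _⟩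
  lin₂ U W := ⟨fun V V' => h₂ _ (fx V) (fx V') _, fun c V => h₂' c _ (fx V) _⟩
  lin₃ U V := ⟨fun W W' => h₃ _ _ (fx W) (fx W'), fun c W => h₃' c _ _ (fx W)⟩

section

variable (t : Fin 3 → V3) (q : Fin 3 → Fin 3 → V3) (k : ℝ) (g : V3)

theorem isTri_force : IsTri fun U V W => forceTri t k g (fx U) (fx V) (fx W) := by
  refine isTri_of ?_ ?_ ?_ ?_ ?_ ?_ <;> intros <;> simp [forceTri, mv, dot3, cr] <;> ring

theorem isTri_right : IsTri fun U V W => rightTri t g (fx U) (fx V) (fx W) := by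
  refine isTri_of ?_ ?_ ?_ ?_ ?_ ?_ <;> intros <;> simp [rightTri, mv, dot3, cr] <;> ring

theorem isTri_flux : IsTri fun U V W => fluxTri t g (fx U) (fx V) (fx W) := by
  refine isTri_of ?_ ?_ ?_ ?_ ?_ ?_ <;> intros <;> simp [fluxTri, mv, dot3] <;> ring

theorem isTri_defect : IsTri fun U V W => defectTri q (fx U) (fx V) (fx W) := by
  refine isTri_of ?_ ?_ ?_ ?_ ?_ ?_ <;> intros <;>
  · simp only [defectTri, tq, Fin.sum_univ_three, Pi.add_apply, Pi.sub_apply, Pi.smul_apply,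
      smul_eq_mul]
    ring

theorem isTri_left : IsTri fun U V W => leftTri q g (fx U) (fx V) (fx W) := by
  refine isTri_of ?_ ?_ ?_ ?_ ?_ ?_ <;> intros <;>
  · simp only [leftTri, vq, dot3, cr, Fin.sum_univ_three, Pi.add_apply, Pi.smul_apply,
      smul_eq_mul]
    ring

theorem isTri_evol (p : ℝ) : IsTri fun U V W => evolTri t q g p (fx U) (fx V) (fx W) := by
  refine isTri_of ?_ ?_ ?_ ?_ ?_ ?_ <;> intros <;>
  · simp only [evolTri, cq, mv, dot3, cr, Fin.sum_univ_three, Pi.add_apply, Pi.smul_apply,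
      smul_eq_mul, Fin.isValue, Fin.reduceAdd, zero_add]
    ring

/-- The density of the mollified energy. -/
def enTri (u x w : Fin 2 → V3) : ℝ := dot3 (u 0) (mv t (w 1)) * x 0 0

theorem isTri_en : IsTri fun U V W => enTri t (fx U) (fx V) (fx W) := by
  refine isTri_of ?_ ?_ ?_ ?_ ?_ ?_ <;> intros <;> simp [enTri, mv, dot3] <;> ring

/-- The contribution of the time derivative, in terms of the Lorentz force. -/
def indTri (p : ℝ) (u x w : Fin 2 → V3) : ℝ :=
  (dot3 g (cr (w 0) (mv t (u 1))) - p * cq q (u 1) (w 0) + p * cq q (u 0) (w 1)) * x 0 0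

theorem isTri_ind (p : ℝ) : IsTri fun U V W => indTri t q g p (fx U) (fx V) (fx W) := by
  refine isTri_of ?_ ?_ ?_ ?_ ?_ ?_ <;> intros <;>
  · simp only [indTri, cq, mv, dot3, cr, Fin.sum_univ_three, Pi.add_apply, Pi.smul_apply,
      smul_eq_mul, Fin.isValue, Fin.reduceAdd, zero_add]
    ring

end

theorem IsTri.add {N : ℕ} {m m' : Form E3 N}
    (h : IsTri m) (h' : IsTri m') : IsTri fun U V W => m U V W + m' U V W where
  lin₁ V W := ⟨fun U U' => by simp only [(h.lin₁ V W).map_add, (h'.lin₁ V W).map_add]; ring,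
    fun c U => by simp only [(h.lin₁ V W).map_smul, (h'.lin₁ V W).map_smul, smul_add]⟩
  lin₂ U W := ⟨fun V V' => by simp only [(h.lin₂ U W).map_add, (h'.lin₂ U W).map_add]; ring,
    fun c V => by simp only [(h.lin₂ U W).map_smul, (h'.lin₂ U W).map_smul, smul_add]⟩
  lin₃ U V := ⟨fun W W' => by simp only [(h.lin₃ U V).map_add, (h'.lin₃ U V).map_add]; ring,
    fun c W => by simp only [(h.lin₃ U V).map_smul, (h'.lin₃ U V).map_smul, smul_add]⟩

theorem IsTri.const_mul {N : ℕ} {m : Form E3 N}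
    (h : IsTri m) (c : ℝ) : IsTri fun U V W => c * m U V W where
  lin₁ V W := ⟨fun U U' => by simp only [(h.lin₁ V W).map_add]; ring,
    fun c U => by simp only [(h.lin₁ V W).map_smul, smul_eq_mul]; ring⟩
  lin₂ U W := ⟨fun V V' => by simp only [(h.lin₂ U W).map_add]; ring,
    fun c V => by simp only [(h.lin₂ U W).map_smul, smul_eq_mul]; ring⟩
  lin₃ U V := ⟨fun W W' => by simp only [(h.lin₃ U V).map_add]; ring,
    fun c W => by simp only [(h.lin₃ U V).map_smul, smul_eq_mul]; ring⟩

theorem IsTri.zero {N : ℕ} : IsTri fun _ _ _ : Fin N → E3 => (0 : ℝ) where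
  lin₁ _ _ := ⟨fun _ _ => by simp, fun _ _ => by simp⟩
  lin₂ _ _ := ⟨fun _ _ => by simp, fun _ _ => by simp⟩
  lin₃ _ _ := ⟨fun _ _ => by simp, fun _ _ => by simp⟩

theorem CFam.zero {Y : Type*} [TopologicalSpace Y] {N : ℕ} {C : Set Y} {S : Set ST}
    {s : Fin N → Y → ST} (hs : ∀ a, Continuous (s a)) :
    CFam C S s fun _ _ _ _ _ => (0 : ℝ) :=
  ⟨fun _ _ => IsTri.zero, fun _ _ _ => continuous_const, fun _ _ _ _ _ _ => rfl, hs⟩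

@[fun_prop]
theorem Ker.continuous_tm (K : Ker) : Continuous K.tm := K.contDiff_tm.continuous

@[fun_prop]
theorem Ker.continuous_κ (K : Ker) : Continuous K.κ := K.smκ.continuous

@[fun_prop]
theorem Ker.continuous_qm (K : Ker) : Continuous K.qm :=
  continuous_pi fun k => continuous_pi fun i => continuous_pi fun j => by
    simp_rw [← K.fderiv_tm]
    exact (ContDiff.continuous_fderiv (by fun_prop) one_ne_zero).clm_apply continuous_const

section

variable {X : Type*} [TopologicalSpace X] {t : X → Fin 3 → V3} {q : X → Fin 3 → Fin 3 → V3}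
  {x y w : X → V3}

@[fun_prop]
theorem continuous_dot3 (hx : Continuous x) (hy : Continuous y) :
    Continuous fun p => dot3 (x p) (y p) := by
  unfold dot3
  fun_prop

@[fun_prop]
theorem continuous_mv (ht : Continuous t) (hx : Continuous x) :
    Continuous fun p => mv (t p) (x p) :=
  continuous_pi fun i => continuous_dot3 (x := fun p => t p i) (by fun_prop) hx

@[fun_prop]
theorem continuous_cr (hx : Continuous x) (hy : Continuous y) :
    Continuous fun p => cr (x p) (y p) := by
  unfold cr
  fun_prop

@[fun_prop]
theorem continuous_tq (hq : Continuous q) (hx : Continuous x) (hy : Continuous y)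
    (hw : Continuous w) : Continuous fun p => tq (q p) (x p) (y p) (w p) := by
  unfold tq
  fun_prop

@[fun_prop]
theorem continuous_vq (hq : Continuous q) (hx : Continuous x) (hy : Continuous y) :
    Continuous fun p => vq (q p) (x p) (y p) := by
  unfold vq
  fun_prop

@[fun_prop]
theorem continuous_cq (hq : Continuous q) (hx : Continuous x) (hy : Continuous y) :
    Continuous fun p => cq (q p) (x p) (y p) := by
  unfold cq
  fun_prop

end

/-- Global fields that solve the equations on the open set `Ω`, with the integrability that gives
sense to the balance of energy. -/
structure Cut (Ω : Set ST) (d : ℝ) (f h : ST → E3) : Prop where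
  isOpen : IsOpen Ω
  tame : Tame f f h
  unit : MemLp (Ω.indicator fun _ => e 0) 3 (volume : Measure ST)
  force : Tame f (Ω.indicator fun _ => e 0) fun z => cross (h z) (f z)
  weak : WeakEq Ω d f h fun z => cross (h z) (f z)

theorem cp_cross (f h : ST → E3) (z : ST) :
    cp (fun z => cross (h z) (f z)) z = cr (cp h z) (cp f z) := by
  funext i
  fin_cases i <;> simp [cp, cross, cr, crossProduct]

theorem mollify_indicator {Ω : Set ST} (φ : ContDiffBump (0 : ST))
    (hg : LocallyIntegrable (Ω.indicator fun _ => e 0) (volume : Measure ST)) {z : ST}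
    (hz : Metric.closedBall z φ.rOut ⊆ Ω) : mollify φ (Ω.indicator fun _ => e 0) z 0 = 1 := by
  rw [mollify_apply φ hg]
  have (t : ST) : φ.normed volume t * (Ω.indicator (fun _ => e 0) (z - t)) 0
      = φ.normed volume t := by
    by_cases ht : φ.normed volume t = 0
    · simp [ht]
    · have h1 : t ∈ Function.support (φ.normed volume) := ht
      rw [φ.support_normed_eq] at h1
      rw [indicator_of_mem (hz ?_)]
      · simp [e]
      · rw [Metric.mem_closedBall, dist_eq_norm]
        simpa using (mem_ball_zero_iff.1 h1).le
  simp_rw [this]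
  exact φ.integral_normed

section

variable {Ω : Set ST} {d : ℝ} {f h : ST → E3} {ψ : ST → ℝ}

theorem isCompact_translates (hψ : IsTest Ω ψ) (r : ℝ) : IsCompact
    ((fun p : E3 × ST => p.2 + sh p.1) '' (𝔹 r ×ˢ tsupport ψ)) :=
  ((isCompact_closedBall _ _).prod hψ.compact).image
    (continuous_snd.add ((contDiff_sh (n := 0)).continuous.comp continuous_fst))

theorem Cut.exists_smooth (H : Cut Ω d f h) (hψ : IsTest Ω ψ) {r : ℝ}
    (hΩ : ∀ z ∈ tsupport ψ, ∀ l ∈ 𝔹 r, z + sh l ∈ Ω) :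
    ∃ (Ω' : Set ST) (φ : ℕ → ContDiffBump (0 : ST)), IsTest Ω' ψ ∧
      (∀ z ∈ tsupport ψ, ∀ l ∈ 𝔹 r, z + sh l ∈ Ω') ∧
      Tendsto (fun n => (φ n).rOut) atTop (𝓝 0) ∧
      (∀ n, ∀ z ∈ Ω', Metric.closedBall z (φ n).rOut ⊆ Ω) ∧
      ∀ n, SmoothFields Ω' (cp (mollify (φ n) f)) (cp (mollify (φ n) h)) ∧
        ∀ z ∈ Ω', ∀ i : Fin 3, tc (cp (mollify (φ n) f)) i z
          = -d * (dc (cp (mollify (φ n) fun z => cross (h z) (f z))) (i + 1) (i + 2) z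
            - dc (cp (mollify (φ n) fun z => cross (h z) (f z))) (i + 2) (i + 1) z) := by
  obtain ⟨Ω', φ, h1, h2, h3, h4⟩ := exists_smoothFields H.isOpen H.weak H.tame.locallyIntegrable.1
    H.tame.locallyIntegrable.2.2 H.force.locallyIntegrable.2.2
    (hψ.compact.union (isCompact_translates hψ r)) (union_subset hψ.subset (by
      rintro _ ⟨⟨l, z⟩, ⟨hl, hz⟩, rfl⟩
      exact hΩ z hz l hl))
  refine ⟨Ω', φ, ⟨hψ.smooth, hψ.compact, subset_union_left.trans h1⟩, fun z hz l hl => h1 ?_,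
    h2, h3, h4⟩
  exact Or.inr ⟨(l, z), ⟨hl, hz⟩, rfl⟩

theorem continuous_gr (hψ : IsTest Ω ψ) : Continuous (gr ψ) := (contDiff_gr hψ).continuous

end

section

variable {Ω : Set ST} {d : ℝ} {f h : ST → E3} {ψ : ST → ℝ}

theorem cfam_balance (K : Ker) (hψ : IsTest Ω ψ) :
    CFam (𝔹 K.r) (tsupport ψ) pt fun l z U V W =>
      forceTri (K.tm l) (K.κ l) (gr ψ z) (fx U) (fx V) (fx W)
      + rightTri (K.tm l) (gr ψ z) (fx U) (fx V) (fx W)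
      + fluxTri (K.tm l) (gr ψ z) (fx U) (fx V) (fx W)
      + (-ψ z) * defectTri (K.qm l) (fx U) (fx V) (fx W)
      + (-1) * evolTri (K.tm l) (K.qm l) (gr ψ z) (ψ z) (fx U) (fx V) (fx W) where
  tri l z := (((((isTri_force _ _ _).add (isTri_right _ _)).add (isTri_flux _ _)).add
    ((isTri_defect _).const_mul _)).add ((isTri_evol _ _ _ _).const_mul _))
  cont U V W := by
    have h4 := continuous_gr hψ
    have h5 := hψ.smooth.continuous
    unfold forceTri rightTri fluxTri defectTri evolTri
    fun_prop
  supp l z hlz U V W := by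
    rcases hlz with hl | hz
    · simp [K.tm_eq_zero hl, K.qm_eq_zero hl, K.κ_eq_zero hl, forceTri, rightTri, fluxTri,
        defectTri, evolTri, mv, tq, cq, dot3, cr]
    · simp [gr_eq_zero hz, image_eq_zero_of_notMem_tsupport hz, forceTri, rightTri, fluxTri,
        evolTri, dot3]
  shift := continuous_pt

theorem limit_balance (K : Ker) (H : Cut Ω d f h) (hψ : IsTest Ω ψ)
    (hΩ : ∀ z ∈ tsupport ψ, ∀ l ∈ 𝔹 K.r, z + sh l ∈ Ω) :
    Zero volume fun l z =>
      forceTri (K.tm l) (K.κ l) (gr ψ z) (two (cp f) l z) (two (cp f) l z) (two (cp h) l z)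
      + rightTri (K.tm l) (gr ψ z) (two (cp f) l z) (two (cp f) l z) (two (cp h) l z)
      + fluxTri (K.tm l) (gr ψ z) (two (cp f) l z) (two (cp f) l z) (two (cp h) l z)
      + (-ψ z) * defectTri (K.qm l) (two (cp f) l z) (two (cp f) l z) (two (cp h) l z)
      + (-1) * evolTri (K.tm l) (K.qm l) (gr ψ z) (ψ z) (two (cp f) l z) (two (cp f) l z)
        (two (cp h) l z) := by
  obtain ⟨Ω', φ, hψ', hΩ', hφ, -, hs⟩ := H.exists_smooth hψ hΩ
  have key := zero_of_mollify (ν := volume) (cfam_balance K hψ) (CFam.zero continuous_pt)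
    (isCompact_closedBall _ _) hψ.compact H.tame H.tame hφ fun n => by
      refine (smooth_balance K hψ' hΩ' (hs n).1).congr fun l z => ?_
      simp only [ev, fx_pt]
      ring
  refine key.congr fun l z => ?_
  simp only [ev, fx_pt, add_zero]

theorem cfam_left (K : Ker) (hψ : IsTest Ω ψ) :
    CFam (𝔹 K.r) (tsupport ψ) pt fun l z U V W =>
      leftTri (K.qm l) (gr ψ z) (fx U) (fx V) (fx W) where
  tri l z := isTri_left _ _
  cont U V W := by
    have h4 := continuous_gr hψ
    unfold leftTri
    fun_prop
  supp l z hlz U V W := by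
    rcases hlz with hl | hz
    · simp [K.qm_eq_zero hl, leftTri, vq, dot3, cr]
    · simp [gr_eq_zero hz, leftTri, dot3]
  shift := continuous_pt

theorem cfam_force (K : Ker) (hψ : IsTest Ω ψ) :
    CFam (𝔹 K.r) (tsupport ψ) pt fun l z U V W =>
      (-1) * forceTri (K.tm l) (K.κ l) (gr ψ z) (fx U) (fx V) (fx W) where
  tri l z := (isTri_force _ _ _).const_mul _
  cont U V W := by
    have h4 := continuous_gr hψ
    unfold forceTri
    fun_prop
  supp l z hlz U V W := by
    rcases hlz with hl | hz
    · simp [K.tm_eq_zero hl, K.κ_eq_zero hl, forceTri, mv, dot3, cr]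
    · simp [gr_eq_zero hz, forceTri, dot3]
  shift := continuous_pt

theorem limit_left (K : Ker) (H : Cut Ω d f h) (hψ : IsTest Ω ψ)
    (hΩ : ∀ z ∈ tsupport ψ, ∀ l ∈ 𝔹 K.r, z + sh l ∈ Ω) :
    Zero volume fun l z =>
      leftTri (K.qm l) (gr ψ z) (two (cp f) l z) (two (cp f) l z) (two (cp f) l z)
      + (-1) * forceTri (K.tm l) (K.κ l) (gr ψ z) (two (cp f) l z) (two (cp f) l z)
        (two (cp h) l z) := by
  obtain ⟨Ω', φ, hψ', hΩ', hφ, -, hs⟩ := H.exists_smooth hψ hΩ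
  have key := zero_of_mollify (ν := volume) (cfam_left K hψ) (cfam_force K hψ)
    (isCompact_closedBall _ _) hψ.compact (Tame.of_memLp H.tame.hf H.tame.hf H.tame.hf) H.tame hφ
    fun n => by
      refine ((smooth_divergence K hψ' hΩ' (hs n).1).const_mul (1 / 2)).congr fun l z => ?_
      simp only [ev, fx_pt, two]
      simp only [leftTri, forceTri, EMHD.hs, dot3, Matrix.cons_val_zero, Matrix.cons_val_one]
      ring
  refine key.congr fun l z => ?_
  simp only [ev, fx_pt]

theorem cfam_en (K : Ker) (hψ : IsTest Ω ψ) :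
    CFam (𝔹 K.r) (tsupport ψ) pt fun l z U V W =>
      fderiv ℝ ψ z (1, 0) * enTri (K.tm l) (fx U) (fx V) (fx W) where
  tri l z := (isTri_en _).const_mul _
  cont U V W := by
    have h4 := hψ.contDiff_one.continuous_fderiv one_ne_zero
    unfold enTri
    fun_prop
  supp l z hlz U V W := by
    rcases hlz with hl | hz
    · simp [K.tm_eq_zero hl, enTri, mv, dot3]
    · simp [fderiv_of_notMem_tsupport ℝ hz]
  shift := continuous_pt

theorem indTri_eq (t : Fin 3 → V3) (q : Fin 3 → Fin 3 → V3) (g : V3) (p : ℝ)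
    (u x W w : Fin 2 → V3) (hx : x 0 0 = 1) (h0 : W 0 = cr (w 0) (u 0))
    (h1 : W 1 = cr (w 1) (u 1)) : indTri t q g p u x W = evolTri t q g p u u w := by
  simp only [indTri, evolTri, hx, h0, h1, mul_one]

theorem cfam_ind (K : Ker) (hψ : IsTest Ω ψ) (d : ℝ) :
    CFam (𝔹 K.r) (tsupport ψ) pt fun l z U V W =>
      d * indTri (K.tm l) (K.qm l) (gr ψ z) (ψ z) (fx U) (fx V) (fx W) where
  tri l z := (isTri_ind _ _ _ _).const_mul _
  cont U V W := by
    have h4 := continuous_gr hψ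
    have h5 := hψ.smooth.continuous
    unfold indTri
    fun_prop
  supp l z hlz U V W := by
    rcases hlz with hl | hz
    · simp [K.tm_eq_zero hl, K.qm_eq_zero hl, indTri, mv, cq, dot3, cr]
    · simp [gr_eq_zero hz, image_eq_zero_of_notMem_tsupport hz, indTri, dot3]
  shift := continuous_pt

theorem limit_time (K : Ker) (H : Cut Ω d f h) (hψ : IsTest Ω ψ)
    (hΩ : ∀ z ∈ tsupport ψ, ∀ l ∈ 𝔹 K.r, z + sh l ∈ Ω) :
    Zero volume fun l z =>
      fderiv ℝ ψ z (1, 0) * dot3 (cp f z) (mv (K.tm l) (cp f (z + sh l)))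
      + d * evolTri (K.tm l) (K.qm l) (gr ψ z) (ψ z) (two (cp f) l z) (two (cp f) l z)
        (two (cp h) l z) := by
  obtain ⟨Ω', φ, hψ', hΩ', hφ, hsub, hs⟩ := H.exists_smooth hψ hΩ
  have key := zero_of_mollify (ν := volume) (cfam_en K hψ) (cfam_ind K hψ d)
    (isCompact_closedBall _ _) hψ.compact (Tame.of_memLp H.tame.hf H.unit H.tame.hf) H.force hφ
    fun n => by
      refine (smooth_time K hψ' hΩ' (hs n).1.smu
        (contDiff_cp (contDiff_one_mollify _ H.force.locallyIntegrable.2.2))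
        (hs n).2).congr fun l z => ?_
      simp only [ev, fx_pt]
      by_cases hz : z ∈ tsupport ψ
      · have h1 : two (cp (mollify (φ n) (Ω.indicator fun _ => e 0))) l z 0 0 = 1 :=
          mollify_indicator (φ n) H.force.locallyIntegrable.2.1 (hsub n z (hψ'.subset hz))
        simp only [enTri, indTri, h1]
        simp only [two, Matrix.cons_val_zero, Matrix.cons_val_one, cp_cross]
        ring
      · simp [gr_eq_zero hz, image_eq_zero_of_notMem_tsupport hz, indTri, dot3,
          fderiv_of_notMem_tsupport ℝ hz]
  refine key.congr fun l z => ?_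
  simp only [ev, fx_pt]
  by_cases hz : z ∈ tsupport ψ
  · have h1 : two (cp (Ω.indicator fun _ => e 0)) l z 0 0 = 1 := by
      simp [two, cp, indicator_of_mem (hψ.subset hz), e]
    rw [show fx (fun a => cross (h (z + pt a l)) (f (z + pt a l)))
        = two (cp fun z => cross (h z) (f z)) l z from fx_pt (fun z => cross (h z) (f z)) l z,
      indTri_eq _ _ _ _ _ _ _ (two (cp h) l z) h1 (cp_cross f h z) (cp_cross f h _), enTri, h1,
      mul_one]
    rfl
  · simp [gr_eq_zero hz, image_eq_zero_of_notMem_tsupport hz, indTri, evolTri, dot3,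
      fderiv_of_notMem_tsupport ℝ hz]

/-- The balance of energy for regular kernels, without derivatives of the kernel in the flux. -/
theorem limit_energy (K : Ker) (H : Cut Ω d f h) (hψ : IsTest Ω ψ)
    (hΩ : ∀ z ∈ tsupport ψ, ∀ l ∈ 𝔹 K.r, z + sh l ∈ Ω) :
    Zero volume fun l z =>
      fderiv ℝ ψ z (1, 0) * dot3 (cp f z) (mv (K.tm l) (cp f (z + sh l)))
      + d * (forceTri (K.tm l) (K.κ l) (gr ψ z) (two (cp f) l z) (two (cp f) l z) (two (cp h) l z)
      + rightTri (K.tm l) (gr ψ z) (two (cp f) l z) (two (cp f) l z) (two (cp h) l z)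
      + fluxTri (K.tm l) (gr ψ z) (two (cp f) l z) (two (cp f) l z) (two (cp h) l z)
      - ψ z * defectTri (K.qm l) (two (cp f) l z) (two (cp f) l z) (two (cp h) l z)) :=
  ((limit_time K H hψ hΩ).add ((limit_balance K H hψ hΩ).const_mul d)).congr fun l z => by ring

/-- The balance of energy for regular kernels. -/
theorem limit_karmanHowarth (K : Ker) (H : Cut Ω d f h) (hψ : IsTest Ω ψ)
    (hΩ : ∀ z ∈ tsupport ψ, ∀ l ∈ 𝔹 K.r, z + sh l ∈ Ω) :
    Zero volume fun l z =>
      fderiv ℝ ψ z (1, 0) * dot3 (cp f z) (mv (K.tm l) (cp f (z + sh l)))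
      + d * (leftTri (K.qm l) (gr ψ z) (two (cp f) l z) (two (cp f) l z) (two (cp f) l z)
      + rightTri (K.tm l) (gr ψ z) (two (cp f) l z) (two (cp f) l z) (two (cp h) l z)
      + fluxTri (K.tm l) (gr ψ z) (two (cp f) l z) (two (cp f) l z) (two (cp h) l z)
      - ψ z * defectTri (K.qm l) (two (cp f) l z) (two (cp f) l z) (two (cp h) l z)) :=
  ((limit_energy K H hψ hΩ).add ((limit_left K H hψ hΩ).const_mul d)).congr fun l z => by ring

end

/-! ### The product of the divergence with a field -/

section

variable (t : Fin 3 → V3) (r p : ℝ) (G g a : V3)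

/-- The part of the product identity that contains only the field. -/
def prodTri (u x w : Fin 3 → V3) : ℝ :=
  dot3 G (u 1) * p * dot3 a (cr (x 1) (mv t (w 2)))
    - r * (1 / 2 * dot3 (u 1) (x 1)) * dot3 a (cr g (mv t (w 2)))

/-- The part of the product identity that contains the current. -/
def curlTri (u x w : Fin 3 → V3) : ℝ :=
  r * p * (dot3 a (cr (cr (w 1) (u 1)) (mv t (x 2)))
    - 1 / 2 * dot3 (u 1) (x 1) * dot3 a (mv t (w 2)))

theorem isTri_prod : IsTri fun U V W => prodTri t r p G g a (fx U) (fx V) (fx W) := by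
  refine isTri_of ?_ ?_ ?_ ?_ ?_ ?_ <;> intros <;> simp [prodTri, mv, dot3, cr] <;> ring

theorem isTri_curl : IsTri fun U V W => curlTri t r p a (fx U) (fx V) (fx W) := by
  refine isTri_of ?_ ?_ ?_ ?_ ?_ ?_ <;> intros <;> simp [curlTri, mv, dot3, cr] <;> ring

end

/-- The displacements `0`, `y` and `l`. -/
def pt3 : Fin 3 → E3 × E3 → ST := ![fun _ => 0, fun y => sh y.1, fun y => sh y.2]

/-- The displacements `0`, `y` and `0`. -/
def pt30 : Fin 3 → E3 → ST := ![fun _ => 0, sh, fun _ => 0]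

/-- The values of a field at three points. -/
def three (u : ST → V3) (y l : E3) (z : ST) : Fin 3 → V3 :=
  ![u z, u (z + sh y), u (z + sh l)]

theorem fx_pt3 (f : ST → E3) (y : E3 × E3) (z : ST) :
    fx (fun a => f (z + pt3 a y)) = three (cp f) y.1 y.2 z := by
  funext a
  fin_cases a <;> simp [fx, pt3, three, cp]

theorem fx_pt30 (f : ST → E3) (y : E3) (z : ST) :
    fx (fun a => f (z + pt30 a y)) = three (cp f) y 0 z := by
  funext a
  fin_cases a <;> simp [fx, pt30, three, cp, sh_zero]

@[fun_prop]
theorem continuous_sh : Continuous sh := (contDiff_sh (n := 0)).continuous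

theorem continuous_pt3 (a : Fin 3) : Continuous (pt3 a) := by
  fin_cases a <;> simp only [pt3] <;> dsimp <;> fun_prop

theorem continuous_pt30 (a : Fin 3) : Continuous (pt30 a) := by
  fin_cases a <;> simp only [pt30] <;> dsimp <;> fun_prop

theorem continuous_gs {ρ : E3 → ℝ} (hρ : C¹ ρ) : Continuous (gs ρ) :=
  continuous_pi fun _ => (hρ.continuous_fderiv one_ne_zero).clm_apply continuous_const

section

variable {Ω : Set ST} {d : ℝ} {f h : ST → E3} {ψ : ST → ℝ} {ρ : E3 → ℝ}

theorem cfam_prod (K : Ker) (hρ : C¹ ρ) (hψ : IsTest Ω ψ) (a : V3) :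
    CFam (tsupport ρ ×ˢ 𝔹 K.r) (tsupport ψ) pt3 fun y z U V W =>
      prodTri (K.tm y.2) (ρ y.1) (ψ z) (gs ρ y.1) (gr ψ z) a (fx U) (fx V) (fx W) where
  tri l z := isTri_prod _ _ _ _ _ _
  cont U V W := by
    have h2 := continuous_gs hρ
    have h3 := continuous_gr hψ
    have h4 := hψ.smooth.continuous
    have h5 := hρ.continuous
    unfold prodTri
    fun_prop
  supp y z hyz U V W := by
    rcases hyz with hy | hz
    · rcases not_and_or.1 hy with hy | hl
      · simp [image_eq_zero_of_notMem_tsupport hy, gs_eq_zero hy, prodTri, dot3]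
      · simp [K.tm_eq_zero hl, prodTri, mv, dot3, cr]
    · simp [gr_eq_zero hz, image_eq_zero_of_notMem_tsupport hz, prodTri, dot3, cr]
  shift := continuous_pt3

theorem cfam_curl (K : Ker) (hρ : C¹ ρ) (hψ : IsTest Ω ψ) (a : V3) :
    CFam (tsupport ρ ×ˢ 𝔹 K.r) (tsupport ψ) pt3 fun y z U V W =>
      curlTri (K.tm y.2) (ρ y.1) (ψ z) a (fx U) (fx V) (fx W) where
  tri l z := isTri_curl _ _ _ _
  cont U V W := by
    have h4 := hψ.smooth.continuous
    have h5 := hρ.continuous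
    unfold curlTri
    fun_prop
  supp y z hyz U V W := by
    rcases hyz with hy | hz
    · rcases not_and_or.1 hy with hy | hl
      · simp [image_eq_zero_of_notMem_tsupport hy, curlTri]
      · simp [K.tm_eq_zero hl, curlTri, mv, dot3, cr]
    · simp [image_eq_zero_of_notMem_tsupport hz, curlTri]
  shift := continuous_pt3

theorem cfam_prod_self (hρ : C¹ ρ) (hψ : IsTest Ω ψ) (a : V3) :
    CFam (tsupport ρ) (tsupport ψ) pt30 fun y z U V W =>
      prodTri kd (ρ y) (ψ z) (gs ρ y) (gr ψ z) a (fx U) (fx V) (fx W) where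
  tri l z := isTri_prod _ _ _ _ _ _
  cont U V W := by
    have h2 := continuous_gs hρ
    have h3 := continuous_gr hψ
    have h4 := hψ.smooth.continuous
    have h5 := hρ.continuous
    unfold prodTri
    fun_prop
  supp y z hyz U V W := by
    rcases hyz with hy | hz
    · simp [image_eq_zero_of_notMem_tsupport hy, gs_eq_zero hy, prodTri, dot3]
    · simp [gr_eq_zero hz, image_eq_zero_of_notMem_tsupport hz, prodTri, dot3, cr]
  shift := continuous_pt30

theorem cfam_curl_self (hρ : C¹ ρ) (hψ : IsTest Ω ψ) (a : V3) :
    CFam (tsupport ρ) (tsupport ψ) pt30 fun y z U V W =>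
      curlTri kd (ρ y) (ψ z) a (fx U) (fx V) (fx W) where
  tri l z := isTri_curl _ _ _ _
  cont U V W := by
    have h4 := hψ.smooth.continuous
    have h5 := hρ.continuous
    unfold curlTri
    fun_prop
  supp y z hyz U V W := by
    rcases hyz with hy | hz
    · simp [image_eq_zero_of_notMem_tsupport hy, curlTri]
    · simp [image_eq_zero_of_notMem_tsupport hz, curlTri]
  shift := continuous_pt30

/-- The product of the mollified divergence with a mollified field, for weak solutions. -/
theorem limit_product (K : Ker) (hρ : C¹ ρ) (hρc : HasCompactSupport ρ)
    (H : Cut Ω d f h) (hψ : IsTest Ω ψ) {r : ℝ} (hρr : tsupport ρ ⊆ Metric.closedBall 0 r)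
    (hKr : K.r ≤ r) (hΩ : ∀ z ∈ tsupport ψ, ∀ l ∈ 𝔹 r, z + sh l ∈ Ω)
    (a : V3) :
    Zero volume fun (y : E3 × E3) z =>
      prodTri (K.tm y.2) (ρ y.1) (ψ z) (gs ρ y.1) (gr ψ z) a (three (cp f) y.1 y.2 z)
        (three (cp f) y.1 y.2 z) (three (cp f) y.1 y.2 z)
      + curlTri (K.tm y.2) (ρ y.1) (ψ z) a (three (cp f) y.1 y.2 z)
        (three (cp f) y.1 y.2 z) (three (cp h) y.1 y.2 z) := by
  obtain ⟨Ω', φ, hψ', hΩ', hφ, -, hs⟩ := H.exists_smooth hψ hΩ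
  have key := zero_of_mollify (ν := volume) (cfam_prod K hρ hψ a) (cfam_curl K hρ hψ a)
    (IsCompact.prod hρc (isCompact_closedBall _ _)) hψ.compact
    (Tame.of_memLp H.tame.hf H.tame.hf H.tame.hf) H.tame hφ
    fun n => by
      refine (smooth_product_kernel K hρ hρc hψ' (fun z hz l hl => hΩ' z hz l (hρr hl))
        (fun z hz l hl => hΩ' z hz l (Metric.closedBall_subset_closedBall hKr hl))
        (hs n).1 a).congr fun l z => ?_
      simp only [ev, fx_pt3, three]
      simp only [prodTri, curlTri, EMHD.hs, dot3, Matrix.cons_val]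
      ring
  refine key.congr fun l z => ?_
  simp only [ev, fx_pt3]

/-- The product of the mollified divergence with the field, for weak solutions. -/
theorem limit_product_self (hρ : C¹ ρ) (hρc : HasCompactSupport ρ)
    (H : Cut Ω d f h) (hψ : IsTest Ω ψ) {r : ℝ} (hρr : tsupport ρ ⊆ Metric.closedBall 0 r)
    (hΩ : ∀ z ∈ tsupport ψ, ∀ l ∈ 𝔹 r, z + sh l ∈ Ω)
    (a : V3) :
    Zero volume fun y z =>
      prodTri kd (ρ y) (ψ z) (gs ρ y) (gr ψ z) a (three (cp f) y 0 z)
        (three (cp f) y 0 z) (three (cp f) y 0 z)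
      + curlTri kd (ρ y) (ψ z) a (three (cp f) y 0 z)
        (three (cp f) y 0 z) (three (cp h) y 0 z) := by
  obtain ⟨Ω', φ, hψ', hΩ', hφ, -, hs⟩ := H.exists_smooth hψ hΩ
  have key := zero_of_mollify (ν := volume) (cfam_prod_self hρ hψ a) (cfam_curl_self hρ hψ a)
    hρc hψ.compact (Tame.of_memLp H.tame.hf H.tame.hf H.tame.hf) H.tame hφ
    fun n => by
      refine (smooth_product hρ hρc hψ' (fun z hz l hl => hΩ' z hz l (hρr hl))
        (hs n).1 a).congr fun l z => ?_
      simp only [ev, fx_pt30, three, sh_zero, add_zero]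
      simp only [prodTri, curlTri, EMHD.hs, dot3, cr, mv, kd, Matrix.cons_val,
        Fin.isValue, Fin.reduceAdd, zero_add]
      simp
      ring
  refine key.congr fun l z => ?_
  simp only [ev, fx_pt30]

end

/-! ### Radial kernels -/

theorem hasFDerivAt_norm_E3 {l : E3} (hl : l ≠ 0) :
    HasFDerivAt (fun l : E3 => ‖l‖) (‖l‖⁻¹ • innerSL ℝ l) l := by
  have h1 := (hasStrictFDerivAt_norm_sq l).hasFDerivAt.sqrt (by positivity)
  have h2 : (fun l : E3 => √(‖l‖ ^ 2)) = fun l => ‖l‖ := by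
    funext l
    exact Real.sqrt_sq (norm_nonneg l)
  rw [h2] at h1
  refine h1.congr_fderiv ?_
  have : ‖l‖ ≠ 0 := norm_ne_zero_iff.2 hl
  ext v
  simp only [Real.sqrt_sq (norm_nonneg l), smul_apply, nsmul_eq_mul,
    smul_eq_mul, innerSL_apply_apply, Nat.cast_ofNat]
  field_simp

theorem inner_e (l : E3) (k : Fin 3) : ⟪l, e k⟫ = l k := by
  simp [e, EuclideanSpace.inner_single_right]

/-- Radial functions with a profile that is constant near the origin. -/
theorem radial_smooth {H : ℝ → ℝ} (hH : C¹ H) {a c : ℝ} (ha : 0 < a)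
    (hc : ∀ s < a, H s = c) : C¹ (fun l : E3 => H ‖l‖) ∧
    ∀ (l : E3) k, fderiv ℝ (fun l : E3 => H ‖l‖) l (e k) = deriv H ‖l‖ / ‖l‖ * l k := by
  have hloc : ∀ l : E3, ‖l‖ < a → (fun l : E3 => H ‖l‖) =ᶠ[𝓝 l] fun _ => c := by
    intro l hl
    filter_upwards [continuous_norm.continuousAt.eventually (gt_mem_nhds hl)] with x hx
    exact hc _ hx
  have hlt : ∀ l : E3, l ≠ 0 ∨ ‖l‖ < a := fun l => by
    by_cases h : l = 0
    · right; simpa [h] using ha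
    · exact Or.inl h
  constructor
  · rw [contDiff_iff_contDiffAt]
    intro l
    rcases hlt l with hl | hl
    · exact hH.contDiffAt.comp l (contDiffAt_norm ℝ hl)
    · exact contDiffAt_const.congr_of_eventuallyEq (hloc l hl)
  · intro l k
    rcases hlt l with hl | hl
    · have h1 := ((hH.differentiable one_ne_zero ‖l‖).hasDerivAt.comp_hasFDerivAt l
        (hasFDerivAt_norm_E3 hl)).fderiv
      have h2 : (fun l : E3 => H ‖l‖) = H ∘ fun l => ‖l‖ := rfl
      rw [h2, h1]
      simp only [smul_apply, innerSL_apply_apply, inner_e, smul_eq_mul]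
      ring
    · rw [(hloc l hl).fderiv_eq]
      have h3 : H =ᶠ[𝓝 ‖l‖] fun _ => c := by
        filter_upwards [gt_mem_nhds hl] with s hs using hc s hs
      rw [h3.deriv_eq]
      simp

/-- The projection-like matrix `α + β n ⊗ n`. -/
def pm (α β : ℝ) (n : E3) (i j : Fin 3) : ℝ := α * kd i j + β * (n i * n j)

/-- The kernel with profile `F`. -/
def tF (α β : ℝ) (F : ℝ → ℝ) (l : E3) (i j : Fin 3) : ℝ := F ‖l‖ * pm α β (dir l) i j

/-- The derivatives of the kernel with profile `F`. -/
def qF (α β : ℝ) (F F' : ℝ → ℝ) (l : E3) (k i j : Fin 3) : ℝ :=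
  F' ‖l‖ * (dir l k * pm α β (dir l) i j)
    + F ‖l‖ / ‖l‖ * (β * (kd k i * dir l j + dir l i * kd k j
      - 2 * (dir l i * dir l j) * dir l k))

/-- The potential of the divergence of the kernel with profile `F` supported in `(0, b)`. -/
def κF (α β b : ℝ) (F : ℝ → ℝ) (r : ℝ) : ℝ := (α + β) * F r + 2 * β * ∫ s in b..r, F s / s

theorem contDiff_div_pow {F : ℝ → ℝ} (hF : C¹ F) {a : ℝ} (ha : 0 < a)
    (h0 : ∀ s < a, F s = 0) (n : ℕ) : C¹ fun s => F s / s ^ n := by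
  rw [contDiff_iff_contDiffAt]
  intro s
  by_cases hs : s < a
  · refine contDiffAt_const (c := (0 : ℝ)).congr_of_eventuallyEq ?_
    filter_upwards [gt_mem_nhds hs] with x hx
    rw [h0 x hx, zero_div]
  · exact hF.contDiffAt.div (by fun_prop) (pow_ne_zero _ (ha.trans_le (not_lt.1 hs)).ne')

theorem hasDerivAt_κF {α β b : ℝ} {F : ℝ → ℝ} (hF : C¹ F) {a : ℝ} (ha : 0 < a)
    (h0 : ∀ s < a, F s = 0) (r : ℝ) :
    HasDerivAt (κF α β b F) ((α + β) * deriv F r + 2 * β * (F r / r)) r := by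
  have hc : Continuous fun s => F s / s := by
    simpa using (contDiff_div_pow hF ha h0 1).continuous
  exact ((hF.differentiable one_ne_zero r).hasDerivAt.const_mul _).add
    ((intervalIntegral.integral_hasDerivAt_right (hc.intervalIntegrable _ _)
      (hc.stronglyMeasurableAtFilter _ _) hc.continuousAt).const_mul _)

theorem contDiff_κF {α β b : ℝ} {F : ℝ → ℝ} (hF : C¹ F) {a : ℝ} (ha : 0 < a)
    (h0 : ∀ s < a, F s = 0) : C¹ (κF α β b F) := by
  refine contDiff_one_iff_deriv.2 ⟨fun r => (hasDerivAt_κF hF ha h0 r).differentiableAt, ?_⟩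
  have hc : Continuous fun s => F s / s := by
    simpa using (contDiff_div_pow hF ha h0 1).continuous
  have h1 : deriv (κF α β b F) = fun r => (α + β) * deriv F r + 2 * β * (F r / r) :=
    funext fun r => (hasDerivAt_κF hF ha h0 r).deriv
  rw [h1]
  have := hF.continuous_deriv_one
  fun_prop

theorem κF_eq {α β b a : ℝ} {F : ℝ → ℝ} (hF : C¹ F) (ha : 0 < a)
    (h0 : ∀ s < a, F s = 0) {s : ℝ} (hs : s < a) :
    κF α β b F s = 2 * β * ∫ s in b..a, F s / s := by
  have hc : Continuous fun s => F s / s := by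
    simpa using (contDiff_div_pow hF ha h0 1).continuous
  rw [κF, h0 s hs, ← intervalIntegral.integral_add_adjacent_intervals
    (hc.intervalIntegrable b a) (hc.intervalIntegrable a s)]
  have : ∫ x in a..s, F x / x = 0 := by
    rw [intervalIntegral.integral_symm, intervalIntegral.integral_of_le hs.le,
      integral_Ioc_eq_integral_Ioo, setIntegral_eq_zero_of_forall_eq_zero, neg_zero]
    intro x hx
    rw [h0 x hx.2, zero_div]
  rw [this]
  ring

theorem κF_eq_zero {α β b : ℝ} {F : ℝ → ℝ} (h1 : ∀ s, b < s → F s = 0) {s : ℝ} (hs : b < s) :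
    κF α β b F s = 0 := by
  rw [κF, h1 s hs, intervalIntegral.integral_of_le hs.le,
    setIntegral_eq_zero_of_forall_eq_zero]
  · simp
  · intro x hx
    rw [h1 x hx.1, zero_div]

theorem deriv_eq_zero_of_lt {F : ℝ → ℝ} {a : ℝ} (h0 : ∀ s < a, F s = 0) {s : ℝ} (hs : s < a) :
    deriv F s = 0 := by
  have : F =ᶠ[𝓝 s] fun _ => 0 := by
    filter_upwards [gt_mem_nhds hs] with x hx using h0 x hx
  rw [this.deriv_eq]
  simp

theorem deriv_eq_zero_of_gt {F : ℝ → ℝ} {b : ℝ} (h1 : ∀ s, b < s → F s = 0) {s : ℝ} (hs : b < s) :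
    deriv F s = 0 := by
  have : F =ᶠ[𝓝 s] fun _ => 0 := by
    filter_upwards [lt_mem_nhds hs] with x hx using h1 x hx
  rw [this.deriv_eq]
  simp

theorem norm_sq_E3 (l : E3) : l 0 ^ 2 + l 1 ^ 2 + l 2 ^ 2 = ‖l‖ ^ 2 := by
  rw [EuclideanSpace.norm_sq_eq]
  simp [Fin.sum_univ_three]

theorem deriv_div_sq {F : ℝ → ℝ} (hF : C¹ F) {a : ℝ} (ha : 0 < a)
    (h0 : ∀ s < a, F s = 0) (s : ℝ) :
    deriv (fun s => F s / s ^ 2) s = deriv F s / s ^ 2 - 2 * F s / s ^ 3 := by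
  by_cases hs : s < a
  · rw [deriv_eq_zero_of_lt (a := a) (fun x hx => by rw [h0 x hx, zero_div]) hs,
      deriv_eq_zero_of_lt h0 hs, h0 s hs]
    simp
  · have hs0 : s ≠ 0 := (ha.trans_le (not_lt.1 hs)).ne'
    have := ((hF.differentiable one_ne_zero s).hasDerivAt.div (hasDerivAt_pow 2 s)
      (pow_ne_zero _ hs0)).deriv
    have h2 : deriv (F / fun x => x ^ 2) s = deriv (fun s => F s / s ^ 2) s := rfl
    rw [← h2, this]
    field_simp
    norm_num
    ring

/-- The regular kernel with a profile supported in an annulus. -/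
def Ker.ofProfile (α β : ℝ) {F : ℝ → ℝ} {a : ℝ} (b : ℝ) (hF : C¹ F) (ha : 0 < a)
    (h0 : ∀ s < a, F s = 0) (h1 : ∀ s, b < s → F s = 0) : Ker where
  A l := α * F ‖l‖
  G l := β * (F ‖l‖ / ‖l‖ ^ 2)
  κ l := κF α β b F ‖l‖
  A₁ l := α * (deriv F ‖l‖ / ‖l‖)
  G₁ l := β * ((deriv F ‖l‖ / ‖l‖ ^ 2 - 2 * F ‖l‖ / ‖l‖ ^ 3) / ‖l‖)
  r := b
  smA := contDiff_const.mul (radial_smooth hF ha h0).1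
  smG := contDiff_const.mul (radial_smooth (contDiff_div_pow hF ha h0 2) ha (c := 0)
    fun s hs => by rw [h0 s hs, zero_div]).1
  smκ := (radial_smooth (contDiff_κF hF ha h0) ha fun s hs => κF_eq hF ha h0 hs).1
  dA l k := by
    obtain ⟨h2, h3⟩ := radial_smooth hF ha h0
    rw [fderiv_const_mul (h2.differentiable one_ne_zero l)]
    simp only [smul_apply, h3, smul_eq_mul]
    ring
  dG l k := by
    obtain ⟨h2, h3⟩ := radial_smooth (contDiff_div_pow hF ha h0 2) ha (c := 0)
      fun s hs => by rw [h0 s hs, zero_div]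
    rw [fderiv_const_mul (h2.differentiable one_ne_zero l)]
    simp only [smul_apply, h3, smul_eq_mul, deriv_div_sq hF ha h0]
    ring
  dκ l k := by
    rw [(radial_smooth (contDiff_κF hF ha h0) ha fun s hs => κF_eq hF ha h0 hs).2,
      (hasDerivAt_κF hF ha h0 _).deriv, norm_sq_E3]
    by_cases hl : l = 0
    · simp [hl]
    · have : ‖l‖ ≠ 0 := norm_ne_zero_iff.2 hl
      field_simp
      ring
  supp l hl := by
    have hb : b < ‖l‖ := by simpa using hl
    rw [h1 _ hb, deriv_eq_zero_of_gt h1 hb, κF_eq_zero h1 hb]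
    simp

section

variable {α β : ℝ} {F : ℝ → ℝ} {a b : ℝ} (hF : C¹ F) (ha : 0 < a)
  (h0 : ∀ s < a, F s = 0) (h1 : ∀ s, b < s → F s = 0)

theorem Ker.ofProfile_tm (l : E3) : (Ker.ofProfile α β b hF ha h0 h1).tm l = tF α β F l := by
  funext i j
  by_cases hl : l = 0
  · simp [Ker.tm, Ker.ofProfile, tF, hl, h0 0 ha]
  · have : ‖l‖ ≠ 0 := norm_ne_zero_iff.2 hl
    simp only [Ker.tm, Ker.ofProfile, tF, pm, dir, PiLp.smul_apply, smul_eq_mul]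
    field_simp

theorem Ker.ofProfile_qm (l : E3) :
    (Ker.ofProfile α β b hF ha h0 h1).qm l = qF α β F (deriv F) l := by
  funext k i j
  by_cases hl : l = 0
  · simp [Ker.qm, Ker.ofProfile, qF, hl, dir]
  · have : ‖l‖ ≠ 0 := norm_ne_zero_iff.2 hl
    simp only [Ker.qm, Ker.ofProfile, qF, pm, dir, PiLp.smul_apply, smul_eq_mul]
    field_simp
    ring

end

/-! ### Removal of the cut-off at the origin -/

/-- A smooth function that vanishes below `1` and equals `1` above `2`. -/
def cut (s : ℝ) : ℝ := Real.smoothTransition (s - 1)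

theorem contDiff_cut : C¹ cut :=
  Real.smoothTransition.contDiff.comp (contDiff_id.sub contDiff_const)

theorem cut_of_le {s : ℝ} (hs : s ≤ 1) : cut s = 0 :=
  Real.smoothTransition.zero_of_nonpos (by linarith)

theorem cut_of_ge {s : ℝ} (hs : 2 ≤ s) : cut s = 1 :=
  Real.smoothTransition.one_of_one_le (by linarith)

theorem abs_cut_le (s : ℝ) : |cut s| ≤ 1 := by
  rw [cut, abs_of_nonneg (Real.smoothTransition.nonneg _)]
  exact Real.smoothTransition.le_one _

theorem deriv_cut_of_gt {s : ℝ} (hs : 2 < s) : deriv cut s = 0 := by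
  have : cut =ᶠ[𝓝 s] fun _ => 1 := by
    filter_upwards [lt_mem_nhds hs] with x hx using cut_of_ge hx.le
  rw [this.deriv_eq]
  simp

theorem exists_deriv_cut_le : ∃ C, 0 ≤ C ∧ ∀ η s : ℝ, 0 < η → 0 < s →
    |deriv cut (s / η) / η| ≤ C / s := by
  have hc : HasCompactSupport (deriv cut) := by
    refine HasCompactSupport.intro (isCompact_Icc (a := (1 : ℝ)) (b := 2)) fun s hs => ?_
    rcases not_and_or.1 hs with h | h
    · exact deriv_eq_zero_of_lt (fun x hx => cut_of_le hx.le) (not_le.1 h)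
    · exact deriv_cut_of_gt (not_le.1 h)
  obtain ⟨C, hC⟩ := hc.exists_bound_of_continuous contDiff_cut.continuous_deriv_one
  have hC0 : 0 ≤ C := (norm_nonneg _).trans (hC 0)
  refine ⟨2 * C, by positivity, fun η s hη hs => ?_⟩
  rw [abs_div, abs_of_pos hη]
  by_cases h : 2 < s / η
  · rw [deriv_cut_of_gt h]
    simp only [abs_zero, zero_div]
    positivity
  · rw [div_le_div_iff₀ hη hs]
    have h2 : s ≤ 2 * η := by
      rw [not_lt, div_le_iff₀ hη] at h
      exact h
    calc |deriv cut (s / η)| * s ≤ C * (2 * η) := by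
          gcongr
          exact hC _
      _ = 2 * C * η := by ring

/-- The identities for kernels that vanish near the origin imply those for singular kernels. -/
theorem zero_of_cut {Y : Type*} [MeasurableSpace Y] {ν : Measure Y} [SFinite ν] {I I' : Y → ST → ℝ}
    {N : Y → ℝ} (hN0 : ∀ᵐ y ∂ν, 0 < N y)
    (hI : Integrable (fun p : Y × ST => I p.1 p.2) (ν.prod volume))
    (hI' : Integrable (fun p : Y × ST => (N p.1)⁻¹ * I' p.1 p.2) (ν.prod volume))
    (h : ∀ η > 0, Zero ν fun y z => cut (N y / η) * I y z
      + deriv cut (N y / η) / η * I' y z) : Zero ν I := by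
  refine ⟨hI, ?_⟩
  obtain ⟨C, hC0, hC⟩ := exists_deriv_cut_le
  have hNp : ∀ᵐ p : Y × ST ∂(ν.prod volume), 0 < N p.1 :=
    Measure.quasiMeasurePreserving_fst.ae hN0
  have key : Tendsto (fun n : ℕ => ∫ p : Y × ST, (cut (N p.1 / (1 / ((n : ℝ) + 1))) * I p.1 p.2
      + deriv cut (N p.1 / (1 / ((n : ℝ) + 1))) / (1 / ((n : ℝ) + 1)) * I' p.1 p.2)
      ∂(ν.prod volume)) atTop (𝓝 (∫ p : Y × ST, I p.1 p.2 ∂(ν.prod volume))) := by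
    refine tendsto_integral_of_dominated_convergence
      (fun p => ‖I p.1 p.2‖ + C * ‖(N p.1)⁻¹ * I' p.1 p.2‖) (fun n => (h _ (by positivity)).1.1)
      (hI.norm.add (hI'.norm.const_mul C)) (fun n => ?_) ?_
    · filter_upwards [hNp] with p hp
      refine (norm_add_le _ _).trans (add_le_add ?_ ?_)
      · rw [norm_mul]
        exact mul_le_of_le_one_left (norm_nonneg _) (abs_cut_le _)
      · rw [norm_mul, norm_mul, ← mul_assoc]
        gcongr
        rw [norm_inv, Real.norm_eq_abs, Real.norm_eq_abs, abs_of_pos hp, ← div_eq_mul_inv]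
        exact hC _ _ (by positivity) hp
    · filter_upwards [hNp] with p hp
      refine tendsto_const_nhds.congr' ?_
      obtain ⟨n₀, hn₀⟩ := exists_nat_gt (3 / N p.1)
      filter_upwards [eventually_ge_atTop n₀] with n hn
      have h2 : 2 < N p.1 / (1 / ((n : ℝ) + 1)) := by
        rw [div_lt_iff₀ hp] at hn₀
        have : (n₀ : ℝ) ≤ n := by exact_mod_cast hn
        rw [div_div_eq_mul_div, div_one]
        nlinarith
      rw [cut_of_ge h2.le, deriv_cut_of_gt h2]
      simp
  refine tendsto_nhds_unique key ?_
  have : ∀ n : ℕ, ∫ p : Y × ST, (cut (N p.1 / (1 / ((n : ℝ) + 1))) * I p.1 p.2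
      + deriv cut (N p.1 / (1 / ((n : ℝ) + 1))) / (1 / ((n : ℝ) + 1)) * I' p.1 p.2)
      ∂(ν.prod volume) = 0 := fun n => (h _ (by positivity)).2
  simp_rw [this]
  exact tendsto_const_nhds

/-! ### Forms with integrable kernels -/

/-- The values of a field at translated points, in components. -/
def vals {N : ℕ} {Y : Type*} (b : ST → E3) (s : Fin N → Y → E3) (y : Y) (z : ST) :
    Fin N → V3 := fun a => cp b (z + sh (s a y))

/-- A form in the values of three fields that depends linearly on a parameter. -/
structure LTri {P : Type*} [NormedAddCommGroup P] [NormedSpace ℝ P] {N : ℕ}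
    (m : P → Form V3 N) : Prop where
  lin : ∀ u x w, IsLinearMap ℝ fun t => m t u x w
  tri : ∀ t, IsTri fun U V W => m t (fx U) (fx V) (fx W)

section

variable {P : Type*} [NormedAddCommGroup P] [NormedSpace ℝ P] [FiniteDimensional ℝ P] {N : ℕ}
  {m : P → Form V3 N}

theorem LTri.exists_bound (hm : LTri m) : ∃ C, 0 ≤ C ∧ ∀ t (x : Ix N),
    |m t (fx (slot x.1)) (fx (slot x.2.1)) (fx (slot x.2.2))| ≤ C * ‖t‖ := by
  set L : Ix N → P →L[ℝ] ℝ := fun x => LinearMap.toContinuousLinearMap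
    (IsLinearMap.mk' _ (hm.lin (fx (slot x.1)) (fx (slot x.2.1)) (fx (slot x.2.2))))
  refine ⟨∑ x, ‖L x‖, by positivity, fun t x => ((L x).le_opNorm t).trans
    (mul_le_mul_of_nonneg_right ?_ (norm_nonneg _))⟩
  exact Finset.single_le_sum (f := fun x => ‖L x‖) (fun x _ => norm_nonneg _) (Finset.mem_univ x)

theorem LTri.fam (hm : LTri m) {Y : Type*} [MeasurableSpace Y] {ν : Measure Y} [SFinite ν]
    {T : Y → P} (hT : Integrable T ν) {ψ : ST → ℝ} (hψ : Continuous ψ) (hψc : HasCompactSupport ψ) :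
    ∃ κ, ∀ s : Fin N → Y → ST, (∀ a, Measurable (s a)) →
      Fam ν κ s fun y z U V W => ψ z * m (T y) (fx U) (fx V) (fx W) := by
  obtain ⟨C, hC0, hC⟩ := hm.exists_bound
  obtain ⟨B, hB⟩ := hψc.exists_bound_of_continuous hψ
  refine ⟨fun y => B * (C * ‖T y‖), fun s hs => ⟨fun y z => (hm.tri _).const_mul _,
    fun U V W => ?_, fun y z x => ?_, (hT.norm.const_mul C).const_mul B, hs⟩⟩
  · have h1 : Continuous fun t => m t (fx U) (fx V) (fx W) :=
      (LinearMap.toContinuousLinearMap (IsLinearMap.mk' _ (hm.lin (fx U) (fx V) (fx W)))).continuous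
    exact (hψ.measurable.comp measurable_snd).aestronglyMeasurable.mul
      ((h1.comp_aestronglyMeasurable hT.1).comp_quasiMeasurePreserving
        Measure.quasiMeasurePreserving_fst)
  · rw [co, abs_mul]
    have := (norm_nonneg _).trans (hB 0)
    exact mul_le_mul (hB z) (hC _ _) (abs_nonneg _) this

theorem LTri.zero_param (hm : LTri m) (u x w : Fin N → V3) : m 0 u x w = 0 :=
  (hm.lin u x w).map_zero

end

/-- Test functions in `Ω`, with continuity only. -/
structure IsCTest (Ω : Set ST) (ψ : ST → ℝ) : Prop where
  cont : Continuous ψ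
  compact : HasCompactSupport ψ
  subset : tsupport ψ ⊆ Ω

/-- Fields that coincide locally with fields to which the estimates for trilinear forms apply. -/
def LocTame (Ω : Set ST) (b₁ b₂ b₃ : ST → E3) : Prop :=
  ∀ S ⊆ Ω, IsCompact S → ∀ r : ℝ, ∃ f g h : ST → E3, Tame f g h ∧ ∀ z ∈ S, ∀ l : E3, ‖l‖ ≤ r →
    f (z + sh l) = b₁ (z + sh l) ∧ g (z + sh l) = b₂ (z + sh l) ∧ h (z + sh l) = b₃ (z + sh l)

section

variable {P : Type*} [NormedAddCommGroup P] [NormedSpace ℝ P] [FiniteDimensional ℝ P] {N : ℕ}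
  {m : P → Form V3 N}
  {Ω : Set ST} {b₁ b₂ b₃ : ST → E3}
  {Y : Type} [MeasurableSpace Y] {ν : Measure Y} [SFinite ν] {T : Y → P}

theorem vals_eq {f b : ST → E3} {s : Fin N → Y → E3} {y : Y} {z : ST}
    (h : ∀ a, f (z + sh (s a y)) = b (z + sh (s a y))) : vals f s y z = vals b s y z := by
  funext a
  simp only [vals, cp, h a]

theorem fx_vals (f : ST → E3) (s : Fin N → Y → E3) (y : Y) (z : ST) :
    (fx fun a => f (z + sh (s a y))) = vals f s y z := rfl

theorem form_congr {f g h : ST → E3} {S : Set ST} {r : ℝ}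
    (hf : ∀ z ∈ S, ∀ l : E3, ‖l‖ ≤ r → f (z + sh l) = b₁ (z + sh l) ∧ g (z + sh l) = b₂ (z + sh l)
      ∧ h (z + sh l) = b₃ (z + sh l)) {s : Fin N → Y → E3} (hm : LTri m)
    {ψ : ST → ℝ} (hψ : tsupport ψ ⊆ S) {y : Y} (hr : T y ≠ 0 → ∀ a, ‖s a y‖ ≤ r) (z : ST) :
    ψ z * m (T y) (vals b₁ s y z) (vals b₂ s y z) (vals b₃ s y z)
      = ψ z * m (T y) (vals f s y z) (vals g s y z) (vals h s y z) := by
  by_cases hz : ψ z = 0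
  · simp [hz]
  by_cases hy : T y = 0
  · simp [hy, hm.zero_param]
  · have hz' := hψ (subset_tsupport _ hz)
    rw [vals_eq fun a => (hf z hz' _ (hr hy a)).1.symm,
      vals_eq fun a => (hf z hz' _ (hr hy a)).2.1.symm,
      vals_eq fun a => (hf z hz' _ (hr hy a)).2.2.symm]

theorem LocTame.integrable (H : LocTame Ω b₁ b₂ b₃) (hm : LTri m) (hT : Integrable T ν)
    {s : Fin N → Y → E3} (hs : ∀ a, Measurable (s a)) {r : ℝ} (hr : ∀ y, T y ≠ 0 → ∀ a, ‖s a y‖ ≤ r)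
    {ψ : ST → ℝ} (hψ : IsCTest Ω ψ) :
    Integrable (fun p : Y × ST => ψ p.2 * m (T p.1) (vals b₁ s p.1 p.2) (vals b₂ s p.1 p.2)
      (vals b₃ s p.1 p.2)) (ν.prod volume) := by
  obtain ⟨f, g, h, ht, hf⟩ := H _ hψ.subset hψ.compact r
  obtain ⟨κ, hκ⟩ := hm.fam hT hψ.cont hψ.compact
  have := (hκ (fun a y => sh (s a y)) fun a => continuous_sh.measurable.comp (hs a)).integrable ht
  refine this.congr (.of_forall fun p => ?_)
  exact (form_congr hf hm subset_rfl (hr p.1) p.2).symm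

/-- Continuous dependence of integrals on the displacements. -/
theorem LocTame.continuousAt (H : LocTame Ω b₁ b₂ b₃) (hm : LTri m) (hT : Integrable T ν)
    {Θ : Type*} [TopologicalSpace Θ] [FirstCountableTopology Θ] {θ₀ : Θ}
    {s : Fin N → Θ → Y → E3} (hs : ∀ a θ, Measurable (s a θ)) (hsc : ∀ a y, Continuous fun θ => s a θ y)
    {r : ℝ} (hr : ∀ᶠ θ in 𝓝 θ₀, ∀ y, T y ≠ 0 → ∀ a, ‖s a θ y‖ ≤ r)
    {ψ : ST → ℝ} (hψ : IsCTest Ω ψ) :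
    ContinuousAt (fun θ => ∫ p : Y × ST, ψ p.2 * m (T p.1) (vals b₁ (fun a => s a θ) p.1 p.2)
      (vals b₂ (fun a => s a θ) p.1 p.2) (vals b₃ (fun a => s a θ) p.1 p.2) ∂(ν.prod volume))
      θ₀ := by
  obtain ⟨f, g, h, ht, hf⟩ := H _ hψ.subset hψ.compact r
  obtain ⟨κ, hκ⟩ := hm.fam hT hψ.cont hψ.compact
  have hF := fun θ => hκ (fun a y => sh (s a θ y)) fun a => continuous_sh.measurable.comp (hs a θ)
  have key : ContinuousAt _ θ₀ := (hF θ₀).tendsto (l := 𝓝 θ₀) hF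
    (fun a y => ((continuous_sh.comp (hsc a y)).tendsto _)) ht
    (fun ε _ => Eventually.of_forall fun _ _ _ _ _ => by simp)
    (fun _ => ht.aesm.1) (fun _ => ht.aesm.2.1) (fun _ => ht.aesm.2.2)
  refine key.congr ?_
  filter_upwards [hr] with θ hθ
  refine integral_congr_ae (.of_forall fun p => ?_)
  exact (form_congr hf hm subset_rfl (hθ p.1) p.2).symm

end

/-! ### Representation of distributions by forms -/

section

variable {T₀ : ℝ} {Y : Type*} [MeasurableSpace Y] {ν : Measure Y} [SFinite ν] {M : Y → ST → ℝ}
  {X : ST → ℝ}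

theorem TestFunction.isCTest {Ω : Opens ST} (ψ : 𝓓(Ω, ℝ)) : IsCTest Ω ψ :=
  ⟨ψ.contDiff.continuous, ψ.hasCompactSupport, ψ.tsupport_subset⟩

/-- `M` is a density of `X` with integrability on compact sets. -/
structure Rep (Ω : Set ST) (ν : Measure Y) (X : ST → ℝ) (M : Y → ST → ℝ) : Prop where
  eq : ∀ᵐ z ∂(volume.restrict Ω), X z = ∫ y, M y z ∂ν
  int : ∀ ψ, IsCTest Ω ψ → Integrable (fun p : Y × ST => ψ p.2 * M p.1 p.2) (ν.prod volume)

theorem exists_isCTest {Ω : Set ST} (hΩ : IsOpen Ω) {K : Set ST} (hK : IsCompact K) (hKΩ : K ⊆ Ω) :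
    ∃ ψ, IsCTest Ω ψ ∧ ∀ z ∈ K, ψ z = 1 := by
  obtain ⟨U, hU, hKU, hUc, hUΩ⟩ : ∃ U, IsOpen U ∧ K ⊆ U ∧ IsCompact (closure U) ∧ closure U ⊆ Ω := by
    obtain ⟨L, hL, hKL, hLΩ⟩ := exists_compact_between hK hΩ hKΩ
    exact ⟨interior L, isOpen_interior, hKL, hL.of_isClosed_subset isClosed_closure
      (closure_minimal interior_subset hL.isClosed),
      (closure_minimal interior_subset hL.isClosed).trans hLΩ⟩
  obtain ⟨g, hg1, hg0, -⟩ := exists_continuous_one_zero_of_isCompact hK hU.isClosed_compl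
    (disjoint_compl_right_iff_subset.2 hKU)
  have hsub : tsupport g ⊆ closure U := closure_mono fun z hz => by
    by_contra h
    exact hz (hg0 h)
  exact ⟨g, ⟨g.continuous, hUc.of_isClosed_subset (isClosed_tsupport _) hsub, hsub.trans hUΩ⟩,
    fun z hz => hg1 hz⟩

theorem exists_seq_isCTest {Ω : Set ST} (hΩ : IsOpen Ω) :
    ∃ ψ : ℕ → ST → ℝ, (∀ n, IsCTest Ω (ψ n)) ∧ ∀ z ∈ Ω, ∃ n, ψ n z = 1 := by
  have : SigmaCompactSpace Ω := by
    have := hΩ.locallyCompactSpace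
    infer_instance
  have h1 : ∀ n, ∃ ψ, IsCTest Ω ψ ∧ ∀ z ∈ Subtype.val '' (compactCovering Ω n), ψ z = 1 := fun n =>
    exists_isCTest hΩ ((isCompact_compactCovering Ω n).image continuous_subtype_val)
      (by rintro _ ⟨x, -, rfl⟩; exact x.2)
  choose ψ hψ hψ1 using h1
  refine ⟨ψ, hψ, fun z hz => ?_⟩
  obtain ⟨n, hn⟩ := mem_iUnion.1 (by rw [iUnion_compactCovering]; trivial :
    (⟨z, hz⟩ : Ω) ∈ ⋃ n, compactCovering Ω n)
  exact ⟨n, hψ1 n z ⟨⟨z, hz⟩, hn, rfl⟩⟩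

/-- The integrability of the sections of a density. -/
theorem ae_integrable_of_test {Ω : Set ST} (hΩ : IsOpen Ω)
    (h : ∀ ψ, IsCTest Ω ψ → Integrable (fun p : Y × ST => ψ p.2 * M p.1 p.2) (ν.prod volume)) :
    ∀ᵐ z ∂(volume.restrict Ω), Integrable (fun y => M y z) ν := by
  obtain ⟨ψ, hψ, hψ1⟩ := exists_seq_isCTest hΩ
  have h1 : ∀ᵐ z : ST, ∀ n, Integrable (fun y => ψ n z * M y z) ν :=
    ae_all_iff.2 fun n => (h _ (hψ n)).prod_left_ae
  filter_upwards [ae_restrict_of_ae h1, ae_restrict_mem hΩ.measurableSet] with z hz hzΩ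
  obtain ⟨n, hn⟩ := hψ1 z hzΩ
  simpa [hn] using hz n

theorem Rep.ae_eq_test {Ω : Set ST} (hΩ : IsOpen Ω) (H : Rep Ω ν X M) {ψ : ST → ℝ}
    (hψ : IsCTest Ω ψ) : (fun z => ψ z * X z) =ᵐ[volume] fun z => ∫ y, ψ z * M y z ∂ν := by
  filter_upwards [(ae_restrict_iff' hΩ.measurableSet).1 H.eq] with z hz
  by_cases h : z ∈ Ω
  · rw [hz h, integral_const_mul]
  · have : ψ z = 0 := image_eq_zero_of_notMem_tsupport fun h' => h (hψ.subset h')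
    simp [this]

theorem Rep.integrable {Ω : Set ST} (hΩ : IsOpen Ω) (H : Rep Ω ν X M) {ψ : ST → ℝ}
    (hψ : IsCTest Ω ψ) : Integrable fun z => ψ z * X z :=
  (H.int ψ hψ).integral_prod_right.congr (H.ae_eq_test hΩ hψ).symm

theorem Rep.integral {Ω : Set ST} (hΩ : IsOpen Ω) (H : Rep Ω ν X M) {ψ : ST → ℝ}
    (hψ : IsCTest Ω ψ) : ∫ z, ψ z * X z = ∫ p : Y × ST, ψ p.2 * M p.1 p.2 ∂(ν.prod volume) := by
  rw [integral_congr_ae (H.ae_eq_test hΩ hψ), integral_prod_symm _ (H.int ψ hψ)]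

theorem locallyIntegrableOn_of_test {Ω : Set ST} (hΩ : IsOpen Ω)
    (h : ∀ ψ, IsCTest Ω ψ → Integrable fun z => ψ z * X z) : LocallyIntegrableOn X Ω := by
  rw [locallyIntegrableOn_iff hΩ.isLocallyClosed]
  intro K hKΩ hK
  obtain ⟨ψ, hψ, hψ1⟩ := exists_isCTest hΩ hK hKΩ
  refine (h ψ hψ).integrableOn.congr_fun (fun z hz => ?_) hK.measurableSet
  simp [hψ1 z hz]

theorem Rep.locallyIntegrableOn {Ω : Set ST} (hΩ : IsOpen Ω) (H : Rep Ω ν X M) :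
    LocallyIntegrableOn X Ω :=
  locallyIntegrableOn_of_test hΩ fun _ hψ => H.integrable hΩ hψ

theorem Rep.toDist_apply (H : Rep (dom T₀) ν X M) (ψ : 𝓓(dom T₀, ℝ)) :
    toDist T₀ X ψ = ∫ p : Y × ST, ψ p.2 * M p.1 p.2 ∂(ν.prod volume) := by
  rw [EMHD.toDist_apply (H.locallyIntegrableOn (dom T₀).isOpen),
    H.integral (dom T₀).isOpen (TestFunction.isCTest ψ)]

end

/-! ### Integrability of the kernels -/

theorem measurable_dir : Measurable dir := by
  unfold dir
  fun_prop

theorem measurable_dir_apply (i : Fin 3) : Measurable fun l => dir l i :=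
  (EuclideanSpace.proj (𝕜 := ℝ) i).continuous.measurable.comp measurable_dir

theorem integrable_kernel {w : E3 → ℝ} (hw : Measurable w) {C b : ℝ} (hC : 0 ≤ C)
    (h : ∀ l : E3, ‖l‖ ≤ b → |w l| ≤ C * (1 + ‖l‖⁻¹)) (h0 : ∀ l : E3, b < ‖l‖ → w l = 0) :
    Integrable w := by
  have h1 : IntegrableOn (fun l : E3 => C * (1 + ‖l‖⁻¹)) (Metric.ball 0 (b + 1)) volume := by
    rw [integrableOn_fun_norm_addHaar volume (f := fun r => C * (1 + r⁻¹))]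
    have h2 : IntegrableOn (fun y : ℝ => C * (y ^ 2 + y)) (Ioo 0 (b + 1)) :=
      (Continuous.integrableOn_Icc (by fun_prop)).mono_set Ioo_subset_Icc_self
    refine h2.congr_fun (fun y hy => ?_) measurableSet_Ioo
    have : y ≠ 0 := hy.1.ne'
    simp only [finrank_euclideanSpace, Fintype.card_fin, Nat.add_one_sub_one, smul_eq_mul]
    field_simp
  refine ((integrable_indicator_iff measurableSet_ball).2 h1).mono' hw.aestronglyMeasurable
    (.of_forall fun l => ?_)
  by_cases hl : ‖l‖ ≤ b
  · rw [indicator_of_mem (by simpa using hl.trans_lt (lt_add_one b))]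
    exact h l hl
  · rw [h0 l (not_le.1 hl), norm_zero]
    refine indicator_nonneg (fun x hx => ?_) _
    positivity

theorem abs_dir_le (l : E3) (i : Fin 3) : |dir l i| ≤ 1 := by
  refine (PiLp.norm_apply_le (dir l) i).trans ?_
  rw [dir, norm_smul, norm_inv, norm_norm]
  by_cases hl : ‖l‖ = 0
  · simp [hl]
  · rw [inv_mul_cancel₀ hl]

theorem abs_kd_le (i j : Fin 3) : |kd i j| ≤ 1 := by
  unfold kd
  split_ifs <;> simp

theorem abs_pm_le (α β : ℝ) (l : E3) (i j : Fin 3) : |pm α β (dir l) i j| ≤ |α| + |β| := by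
  unfold pm
  refine (abs_add_le _ _).trans (add_le_add ?_ ?_)
  · rw [abs_mul]
    exact mul_le_of_le_one_right (abs_nonneg _) (abs_kd_le i j)
  · rw [abs_mul, abs_mul]
    exact mul_le_of_le_one_right (abs_nonneg _)
      (mul_le_one₀ (abs_dir_le l i) (abs_nonneg _) (abs_dir_le l j))

theorem measurable_pm (α β : ℝ) (i j : Fin 3) : Measurable fun l => pm α β (dir l) i j := by
  unfold pm
  have := measurable_dir_apply i
  have := measurable_dir_apply j
  fun_prop

/-- Profiles of radial kernels with compact support. -/
structure Profile (F : ℝ → ℝ) (b : ℝ) : Prop where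
  smooth : C¹ F
  pos : 0 ≤ b
  zero : ∀ s, b < s → F s = 0

/-- The part of the derivatives of the kernel that is not linear in the profile. -/
def nF (α β : ℝ) (F : ℝ → ℝ) (l : E3) (k i j : Fin 3) : ℝ := dir l k * tF α β F l i j

section

variable {F : ℝ → ℝ} {b : ℝ} (α β : ℝ)

theorem Profile.exists_bound (h : Profile F b) : ∃ C, 0 ≤ C ∧ ∀ s, 0 ≤ s → |F s| ≤ C ∧
    |deriv F s| ≤ C := by
  have hF := h.smooth.continuous
  have hF' := h.smooth.continuous_deriv_one
  obtain ⟨C, hC⟩ := (isCompact_Icc (a := (0 : ℝ)) (b := b)).exists_bound_of_continuousOn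
    hF.continuousOn
  obtain ⟨C', hC'⟩ := (isCompact_Icc (a := (0 : ℝ)) (b := b)).exists_bound_of_continuousOn
    hF'.continuousOn
  have h0 : 0 ≤ C := (norm_nonneg _).trans (hC 0 ⟨le_rfl, h.pos⟩)
  have h0' : 0 ≤ C' := (norm_nonneg _).trans (hC' 0 ⟨le_rfl, h.pos⟩)
  refine ⟨max C C', le_max_of_le_left h0, fun s hs => ?_⟩
  by_cases hb : s ≤ b
  · exact ⟨(hC s ⟨hs, hb⟩).trans (le_max_left _ _), (hC' s ⟨hs, hb⟩).trans (le_max_right _ _)⟩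
  · rw [h.zero s (not_le.1 hb), deriv_eq_zero_of_gt h.zero (not_le.1 hb), abs_zero]
    exact ⟨le_max_of_le_left h0, le_max_of_le_left h0⟩

theorem measurable_tF (hF : Measurable F) (i j : Fin 3) : Measurable fun l => tF α β F l i j :=
  (hF.comp measurable_norm).mul (measurable_pm α β i j)

theorem tF_eq_zero (h : Profile F b) {l : E3} (hl : b < ‖l‖) : tF α β F l = 0 := by
  funext i j
  simp [tF, h.zero _ hl]

theorem nF_eq_zero (h : Profile F b) {l : E3} (hl : b < ‖l‖) : nF α β F l = 0 := by
  funext k i j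
  simp [nF, tF_eq_zero α β h hl]

theorem qF_eq_zero (h : Profile F b) {l : E3} (hl : b < ‖l‖) : qF α β F (deriv F) l = 0 := by
  funext k i j
  simp [qF, h.zero _ hl, deriv_eq_zero_of_gt h.zero hl]

theorem integrable_tF (h : Profile F b) : Integrable (tF α β F) := by
  obtain ⟨C, hC0, hC⟩ := h.exists_bound
  refine Integrable.of_eval fun i => Integrable.of_eval fun j => ?_
  refine integrable_kernel (measurable_tF α β h.smooth.continuous.measurable i j)
    (C := C * (|α| + |β|)) (b := b) (by positivity) (fun l _ => ?_) fun l hl => by rw [tF_eq_zero α β h hl]; rfl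
  rw [tF, abs_mul]
  calc _ ≤ C * (|α| + |β|) := mul_le_mul (hC _ (norm_nonneg _)).1 (abs_pm_le _ _ _ _ _)
        (abs_nonneg _) hC0
    _ ≤ _ := le_mul_of_one_le_right (by positivity) (by simp)

theorem integrable_nF (h : Profile F b) : Integrable fun l : E3 => ‖l‖⁻¹ • nF α β F l := by
  obtain ⟨C, hC0, hC⟩ := h.exists_bound
  have h1 := measurable_dir_apply
  refine Integrable.of_eval fun k => Integrable.of_eval fun i => Integrable.of_eval fun j => ?_
  refine integrable_kernel (measurable_norm.inv.mul ((h1 k).mul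
    (measurable_tF α β h.smooth.continuous.measurable i j)))
    (C := C * (|α| + |β|)) (b := b) (by positivity) (fun l _ => ?_) fun l hl => by
      rw [nF_eq_zero α β h hl, smul_zero]; rfl
  rw [Pi.smul_apply, Pi.smul_apply, Pi.smul_apply, smul_eq_mul, nF, abs_mul, abs_mul, tF, abs_mul,
    mul_comm, abs_of_nonneg (inv_nonneg.2 (norm_nonneg l))]
  have := mul_le_mul (hC _ (norm_nonneg l)).1 (abs_pm_le α β l i j) (abs_nonneg _) hC0
  calc _ ≤ C * (|α| + |β|) * ‖l‖⁻¹ := mul_le_mul_of_nonneg_right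
        ((mul_le_of_le_one_left (by positivity) (abs_dir_le l k)).trans this) (by positivity)
    _ ≤ _ := by
        gcongr
        simp

theorem integrable_qF (h : Profile F b) : Integrable (qF α β F (deriv F)) := by
  obtain ⟨C, hC0, hC⟩ := h.exists_bound
  have h1 := measurable_dir_apply
  have hF := h.smooth.continuous.measurable.comp (measurable_norm (α := E3))
  have hF' := h.smooth.continuous_deriv_one.measurable.comp (measurable_norm (α := E3))
  refine Integrable.of_eval fun k => Integrable.of_eval fun i => Integrable.of_eval fun j => ?_
  refine integrable_kernel ?_
    (C := C * (|α| + |β|) + C * (4 * |β|)) (b := b) (by positivity) (fun l _ => ?_) fun l hl => by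
      rw [qF_eq_zero α β h hl]; rfl
  · exact (hF'.mul ((h1 k).mul (measurable_pm α β i j))).add ((hF.div measurable_norm).mul
      (measurable_const.mul (((measurable_const.mul (h1 j)).add ((h1 i).mul measurable_const)).sub
        ((measurable_const.mul ((h1 i).mul (h1 j))).mul (h1 k)))))
  have hb1 : |deriv F ‖l‖ * (dir l k * pm α β (dir l) i j)| ≤ C * (|α| + |β|) := by
    rw [abs_mul, abs_mul]
    exact mul_le_mul (hC _ (norm_nonneg _)).2 ((mul_le_of_le_one_left (abs_nonneg _)
      (abs_dir_le l k)).trans (abs_pm_le _ _ _ _ _)) (by positivity) hC0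
  have hb2 : |kd k i * dir l j + dir l i * kd k j - 2 * (dir l i * dir l j) * dir l k| ≤ 4 := by
    have a1 : |kd k i * dir l j| ≤ 1 := by
      rw [abs_mul]; exact mul_le_one₀ (abs_kd_le _ _) (abs_nonneg _) (abs_dir_le _ _)
    have a2 : |dir l i * kd k j| ≤ 1 := by
      rw [abs_mul]; exact mul_le_one₀ (abs_dir_le _ _) (abs_nonneg _) (abs_kd_le _ _)
    have a3 : |(dir l i * dir l j) * dir l k| ≤ 1 := by
      rw [abs_mul, abs_mul]
      exact mul_le_one₀ (mul_le_one₀ (abs_dir_le _ _) (abs_nonneg _) (abs_dir_le _ _))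
        (abs_nonneg _) (abs_dir_le _ _)
    rw [abs_le] at *
    constructor <;> nlinarith
  have hb3 : |F ‖l‖ / ‖l‖ * (β * (kd k i * dir l j + dir l i * kd k j
      - 2 * (dir l i * dir l j) * dir l k))| ≤ C * (4 * |β|) * ‖l‖⁻¹ := by
    rw [abs_mul, abs_div, abs_norm, abs_mul, div_eq_mul_inv]
    have := (hC _ (norm_nonneg l)).1
    calc _ ≤ C * ‖l‖⁻¹ * (|β| * 4) := by gcongr
      _ = _ := by ring
  have h3 : 0 ≤ ‖l‖⁻¹ := by positivity
  calc _ ≤ C * (|α| + |β|) + C * (4 * |β|) * ‖l‖⁻¹ := (abs_add_le _ _).trans (add_le_add hb1 hb3)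
    _ ≤ _ := by
      have h4 : 0 ≤ C * (|α| + |β|) := by positivity
      have h5 : 0 ≤ C * (4 * |β|) := by positivity
      nlinarith [mul_nonneg h4 h3, mul_nonneg h5 h3]

theorem Profile.cut (h : Profile F b) {η : ℝ} (hη : 0 < η) :
    C¹ (fun s => F s * EMHD.cut (s / η)) ∧ (∀ s < η, F s * EMHD.cut (s / η) = 0) ∧
    (∀ s, b < s → F s * EMHD.cut (s / η) = 0) ∧ ∀ s, deriv (fun s => F s * EMHD.cut (s / η)) s
      = deriv F s * EMHD.cut (s / η) + F s * (deriv EMHD.cut (s / η) / η) := by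
  refine ⟨h.smooth.mul (contDiff_cut.comp (contDiff_id.div_const _)), fun s hs => ?_, fun s hs => ?_,
    fun s => ?_⟩
  · rw [cut_of_le ((div_le_one hη).2 hs.le), mul_zero]
  · rw [h.zero s hs, zero_mul]
  · have h1 : HasDerivAt (fun s => EMHD.cut (s / η)) (deriv EMHD.cut (s / η) * (1 / η)) s :=
      HasDerivAt.comp s (h₂ := EMHD.cut) (h := fun s => s / η)
        (contDiff_cut.differentiable one_ne_zero (s / η)).hasDerivAt
        ((hasDerivAt_id s).div_const η)
    rw [((h.smooth.differentiable one_ne_zero s).hasDerivAt.fun_mul h1).deriv]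
    ring

theorem tF_cut (c : ℝ → ℝ) (l : E3) : tF α β (fun s => F s * c s) l = c ‖l‖ • tF α β F l := by
  funext i j
  simp only [tF, Pi.smul_apply, smul_eq_mul]
  ring

theorem qF_cut (h : Profile F b) {η : ℝ} (hη : 0 < η) (l : E3) :
    qF α β (fun s => F s * EMHD.cut (s / η)) (deriv fun s => F s * EMHD.cut (s / η)) l
      = EMHD.cut (‖l‖ / η) • qF α β F (deriv F) l + (deriv EMHD.cut (‖l‖ / η) / η) • nF α β F l := by
  funext k i j
  simp only [qF, nF, tF, (h.cut hη).2.2.2, Pi.smul_apply, Pi.add_apply, smul_eq_mul]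
  ring

end

/-! ### Linearity of the forms in the kernel -/

/-- A form that is linear in each of its four arguments. -/
theorem ltri_of {P : Type*} [NormedAddCommGroup P] [NormedSpace ℝ P] {N : ℕ} {m : P → Form V3 N}
    (h : ∀ t t' u x w, m (t + t') u x w = m t u x w + m t' u x w)
    (h' : ∀ (c : ℝ) t u x w, m (c • t) u x w = c * m t u x w)
    (h₁ : ∀ t u u' x w, m t (u + u') x w = m t u x w + m t u' x w)
    (h₁' : ∀ (c : ℝ) t u x w, m t (c • u) x w = c * m t u x w)
    (h₂ : ∀ t u x x' w, m t u (x + x') w = m t u x w + m t u x' w)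
    (h₂' : ∀ (c : ℝ) t u x w, m t u (c • x) w = c * m t u x w)
    (h₃ : ∀ t u x w w', m t u x (w + w') = m t u x w + m t u x w')
    (h₃' : ∀ (c : ℝ) t u x w, m t u x (c • w) = c * m t u x w) : LTri m :=
  ⟨fun u x w => ⟨fun t t' => h t t' u x w, fun c t => h' c t u x w⟩, fun t =>
    isTri_of (h₁ t) (h₁' · t) (h₂ t) (h₂' · t) (h₃ t) (h₃' · t)⟩

theorem ltri_en : LTri enTri where
  lin u x w := by constructor <;> intros <;> simp [enTri, mv, dot3] <;> ring
  tri := isTri_en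

theorem ltri_flux (g : V3) : LTri fun t => fluxTri t g where
  lin u x w := by constructor <;> intros <;> simp [fluxTri, mv, dot3] <;> ring
  tri t := isTri_flux t g

theorem ltri_right (g : V3) : LTri fun t => rightTri t g where
  lin u x w := by constructor <;> intros <;> simp [rightTri, mv, dot3, cr] <;> ring
  tri t := isTri_right t g

theorem ltri_left (g : V3) : LTri fun q => leftTri q g where
  lin u x w := by
    constructor <;> intros <;> simp [leftTri, vq, dot3, cr, Fin.sum_univ_three] <;> ring
  tri t := isTri_left t g

theorem ltri_defect : LTri defectTri where
  lin u x w := by constructor <;> intros <;> simp [defectTri, tq, Fin.sum_univ_three] <;> ring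
  tri := isTri_defect

section

variable (t : Fin 3 → V3) (q : Fin 3 → Fin 3 → V3) (g : V3) (u x w : Fin 2 → V3)

theorem fluxTri_expand : fluxTri t g u x w = ∑ i, g i * fluxTri t (kd i) u x w := by
  simp [fluxTri, dot3, Fin.sum_univ_three, kd]
  ring

theorem rightTri_expand : rightTri t g u x w = ∑ i, g i * rightTri t (kd i) u x w := by
  simp [rightTri, dot3, Fin.sum_univ_three, kd]
  ring

theorem leftTri_expand : leftTri q g u x w = ∑ i, g i * leftTri q (kd i) u x w := by
  simp [leftTri, dot3, Fin.sum_univ_three, kd]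
  ring

end

/-- The displacements `0` and `l`. -/
def ps : Fin 2 → E3 → E3 := ![fun _ => 0, fun l => l]

theorem measurable_ps (a : Fin 2) : Measurable (ps a) := by
  fin_cases a
  · exact measurable_const
  · exact measurable_id

theorem norm_ps_le (a : Fin 2) (l : E3) : ‖ps a l‖ ≤ ‖l‖ := by
  fin_cases a <;> simp [ps]

theorem vals_ps (f : ST → E3) (l : E3) (z : ST) : vals f ps l z = two (cp f) l z := by
  funext a
  fin_cases a <;> simp [vals, ps, two, sh_zero]

theorem isCTest_gr {Ω : Set ST} {ψ : ST → ℝ} (hψ : IsTest Ω ψ) (i : Fin 3) :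
    IsCTest Ω fun z => gr ψ z i :=
  ⟨(continuous_apply i).comp (contDiff_gr hψ).continuous,
    (hψ.derivative (0, e i)).compact, (hψ.derivative (0, e i)).subset⟩

theorem isCTest_time {Ω : Set ST} {ψ : ST → ℝ} (hψ : IsTest Ω ψ) :
    IsCTest Ω fun z => fderiv ℝ ψ z (1, 0) :=
  ⟨(hψ.derivative (1, 0)).smooth.continuous, (hψ.derivative (1, 0)).compact,
    (hψ.derivative (1, 0)).subset⟩

theorem IsTest.isCTest {Ω : Set ST} {ψ : ST → ℝ} (hψ : IsTest Ω ψ) : IsCTest Ω ψ :=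
  ⟨hψ.smooth.continuous, hψ.compact, hψ.subset⟩

theorem Tame.locTame {f g h : ST → E3} (H : Tame f g h) (Ω : Set ST) : LocTame Ω f g h :=
  fun _ _ _ _ => ⟨f, g, h, H, fun _ _ _ _ => ⟨rfl, rfl, rfl⟩⟩

section

variable {P : Type*} [NormedAddCommGroup P] [NormedSpace ℝ P] [FiniteDimensional ℝ P]
  {m : P → Form V3 2}
  {Ω : Set ST} {b₁ b₂ b₃ : ST → E3} {T : E3 → P}

theorem LocTame.integrable_two (H : LocTame Ω b₁ b₂ b₃) (hm : LTri m) (hT : Integrable T)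
    {r : ℝ} (hr : ∀ l : E3, r < ‖l‖ → T l = 0) {ψ : ST → ℝ} (hψ : IsCTest Ω ψ) :
    Integrable (fun p : E3 × ST => ψ p.2 * m (T p.1) (two (cp b₁) p.1 p.2) (two (cp b₂) p.1 p.2)
      (two (cp b₃) p.1 p.2)) (volume.prod volume) := by
  simp_rw [← vals_ps]
  refine H.integrable hm hT measurable_ps (r := r) (fun l hl a => ?_) hψ
  by_contra! h
  exact hl (hr l (h.trans_le (norm_ps_le a l)))

end

/-- The density of the balance of energy. -/
def balTri (d τ p : ℝ) (g : V3) (t : Fin 3 → V3) (q : Fin 3 → Fin 3 → V3)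
    (u v : Fin 2 → V3) : ℝ :=
  τ * dot3 (u 0) (mv t (u 1))
    + d * (leftTri q g u u u + rightTri t g u u v + fluxTri t g u u v - p * defectTri q u u v)

theorem balTri_cut (d τ p : ℝ) (g : V3) (t : Fin 3 → V3)
    (q q' : Fin 3 → Fin 3 → V3) (u v : Fin 2 → V3) (c c' : ℝ) :
    balTri d τ p g (c • t) (c • q + c' • q') u v
      = c * balTri d τ p g t q u v + c' * balTri d τ p g 0 q' u v := by
  have hen : dot3 (u 0) (mv (c • t) (u 1)) = c * dot3 (u 0) (mv t (u 1)) := by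
    simp only [mv, dot3, Pi.smul_apply, smul_eq_mul]
    ring
  have hen0 : dot3 (u 0) (mv 0 (u 1)) = 0 := by simp [mv, dot3]
  simp only [balTri, hen, hen0, ((ltri_left g).lin u u u).map_add,
    ((ltri_left g).lin u u u).map_smul, ((ltri_right g).lin u u v).map_smul,
    ((ltri_flux g).lin u u v).map_smul, (ltri_defect.lin u u v).map_add,
    (ltri_defect.lin u u v).map_smul, (ltri_right g).zero_param, (ltri_flux g).zero_param,
    smul_eq_mul]
  ring

section

variable {Ω : Set ST} {d : ℝ} {f h : ST → E3} {ψ : ST → ℝ}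

theorem integrable_balTri (H : Cut Ω d f h) (hψ : IsTest Ω ψ) {t : E3 → Fin 3 → V3}
    {q : E3 → Fin 3 → Fin 3 → V3} (ht : Integrable t) (hq : Integrable q) {r : ℝ}
    (ht0 : ∀ l : E3, r < ‖l‖ → t l = 0) (hq0 : ∀ l : E3, r < ‖l‖ → q l = 0) :
    Integrable (fun x : E3 × ST => balTri d (fderiv ℝ ψ x.2 (1, 0)) (ψ x.2) (gr ψ x.2) (t x.1)
      (q x.1) (two (cp f) x.1 x.2) (two (cp h) x.1 x.2)) (volume.prod volume) := by
  have Hf : LocTame Ω f f f := (Tame.of_memLp H.tame.hf H.tame.hf H.tame.hf).locTame Ω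
  have Hu : LocTame Ω f (Ω.indicator fun _ => e 0) f :=
    (Tame.of_memLp H.tame.hf H.unit H.tame.hf).locTame Ω
  have Hh : LocTame Ω f f h := H.tame.locTame Ω
  unfold balTri
  refine Integrable.add ?_ (Integrable.const_mul (((Integrable.add ?_ ?_).add ?_).sub ?_) _)
  · refine (Hu.integrable_two ltri_en ht ht0 (isCTest_time hψ)).congr
      (.of_forall fun x => ?_)
    by_cases hz : x.2 ∈ tsupport ψ
    · have h1 : two (cp (Ω.indicator fun _ => e 0)) x.1 x.2 0 0 = 1 := by
        simp [two, cp, indicator_of_mem (hψ.subset hz), e]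
      simp only [enTri, h1, mul_one]
    · simp [fderiv_of_notMem_tsupport ℝ hz]
  · refine (integrable_finsetSum Finset.univ fun i _ => Hf.integrable_two (ltri_left (kd i)) hq hq0
      (isCTest_gr hψ i)).congr (.of_forall fun x => ?_)
    exact (leftTri_expand _ _ _ _ _).symm
  · refine (integrable_finsetSum Finset.univ fun i _ => Hh.integrable_two (ltri_right (kd i)) ht ht0
      (isCTest_gr hψ i)).congr (.of_forall fun x => ?_)
    exact (rightTri_expand _ _ _ _ _).symm
  · refine (integrable_finsetSum Finset.univ fun i _ => Hh.integrable_two (ltri_flux (kd i)) ht ht0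
      (isCTest_gr hψ i)).congr (.of_forall fun x => ?_)
    exact (fluxTri_expand _ _ _ _ _).symm
  · exact Hh.integrable_two ltri_defect hq hq0 hψ.isCTest

/-- The balance of energy for radial kernels. -/
theorem balance_of_profile (α β : ℝ) {F : ℝ → ℝ} {b : ℝ} (hF : Profile F b) (H : Cut Ω d f h)
    (hψ : IsTest Ω ψ)
    (hΩ : ∀ z ∈ tsupport ψ, ∀ l ∈ 𝔹 b, z + sh l ∈ Ω) :
    Zero volume fun l z => balTri d (fderiv ℝ ψ z (1, 0)) (ψ z) (gr ψ z) (tF α β F l)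
      (qF α β F (deriv F) l) (two (cp f) l z) (two (cp h) l z) := by
  refine zero_of_cut (N := fun l => ‖l‖) (I' := fun l z => balTri d (fderiv ℝ ψ z (1, 0)) (ψ z)
    (gr ψ z) 0 (nF α β F l) (two (cp f) l z) (two (cp h) l z)) ?_ ?_ ?_ fun η hη => ?_
  · filter_upwards [compl_mem_ae_iff.2 (measure_singleton (0 : E3))] with l hl
    exact norm_pos_iff.2 hl
  · exact integrable_balTri H hψ (integrable_tF α β hF) (integrable_qF α β hF)
      (fun l hl => tF_eq_zero α β hF hl) fun l hl => qF_eq_zero α β hF hl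
  · refine (integrable_balTri H hψ (t := fun _ => 0) (integrable_zero _ _ _)
      (integrable_nF α β hF) (r := b) (fun l hl => rfl)
      fun l hl => by rw [nF_eq_zero α β hF hl, smul_zero]).congr
      (.of_forall fun x => ?_)
    have := balTri_cut d (fderiv ℝ ψ x.2 (1, 0)) (ψ x.2) (gr ψ x.2) 0 0 (nF α β F x.1)
      (two (cp f) x.1 x.2) (two (cp h) x.1 x.2) 0 ‖x.1‖⁻¹
    simpa using this
  · obtain ⟨c1, c2, c3, -⟩ := hF.cut hη
    have h1 := limit_karmanHowarth (Ker.ofProfile α β b c1 hη c2 c3) H hψ hΩ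
    simp_rw [Ker.ofProfile_tm, Ker.ofProfile_qm] at h1
    refine h1.congr fun l z => ?_
    rw [← balTri_cut, ← qF_cut α β hF hη, ← tF_cut α β (fun s => EMHD.cut (s / η))]
    rfl

end

/-! ### Exchange of derivatives between the mollifier and the kernel -/

/-- The product of a gradient and a matrix. -/
def gk (G : V3) (t : Fin 3 → V3) (k i j : Fin 3) : ℝ := G k * t i j

@[fun_prop]
theorem continuous_gk {X : Type*} [TopologicalSpace X] {G : X → V3} {t : X → Fin 3 → V3}
    (hG : Continuous G) (ht : Continuous t) : Continuous fun p => gk (G p) (t p) := by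
  unfold gk
  fun_prop

/-- The displacements `0` and `y + l`. -/
def pa : Fin 2 → E3 × E3 → E3 := ![fun _ => 0, fun y => y.1 + y.2]

theorem continuous_pa (a : Fin 2) : Continuous (pa a) := by
  fin_cases a <;> simp only [pa] <;> dsimp <;> fun_prop

theorem vals_pa_zero (u : ST → E3) (y : E3 × E3) (z : ST) : vals u pa y z 0 = cp u z := by
  simp [vals, pa, sh_zero]

theorem vals_pa_one (u : ST → E3) (y : E3 × E3) (z : ST) :
    vals u pa y z 1 = cp u (z + sh (y.1 + y.2)) := by
  simp [vals, pa]

section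

variable {Ω : Set ST} {ψ : ST → ℝ} {ρ : E3 → ℝ}

theorem smooth_exchange (K : Ker) (hρ : C¹ ρ) (hρc : HasCompactSupport ρ)
    (hψ : IsTest Ω ψ) {u : ST → E3} (hu : C¹ u) (a : V3) :
    Zero volume fun (y : E3 × E3) z => ψ z * leftTri (gk (gs ρ y.1) (K.tm y.2) - ρ y.1 • K.qm y.2) a
      (vals u pa y z) (vals u pa y z) (vals u pa y z) := by
  have hψ1 := hψ.contDiff_one
  have hcp := contDiff_cp hu
  have ha : ∀ j, HasDerivAt (fun _ : ℝ => a j) ((0 : V3) j) 0 := fun _ => hasDerivAt_const _ _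
  refine zero_of_divergence (C := tsupport ρ ×ˢ 𝔹 K.r)
    (IsCompact.prod hρc (isCompact_closedBall _ _)) hψ.compact
    (fun k y z => ρ y.1 * ψ z * (-(1 / 2) * cp u (z + sh (y.1 + y.2)) k)
      * dot3 a (cr (mv (K.tm y.2) (cp u (z + sh (y.1 + y.2)))) (cp u z)))
    (fun _ _ _ => 0) (fun _ _ _ => 0) (a₁ := fun k => (e k, -e k)) (b₁ := fun _ => 0)
    (a₂ := 0) (b₂ := 0) (a₃ := 0) (b₃ := 0) (fun k => ⟨by fun_prop, by fun_prop, by fun_prop⟩)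
    ?_ fun ⟨y, l⟩ z _ _ => ?_
  · rintro ⟨y, l⟩ z (hy | hz)
    · have : gk (gs ρ y) (K.tm l) - ρ y • K.qm l = 0 := by
        funext k i j
        rcases not_and_or.1 hy with hy | hl
        · simp [gk, gs_eq_zero hy, image_eq_zero_of_notMem_tsupport hy]
        · simp [gk, K.tm_eq_zero hl, K.qm_eq_zero hl]
      simp only [this, (ltri_left a).zero_param, mul_zero]
      rcases not_and_or.1 hy with hy | hl
      · simp [image_eq_zero_of_notMem_tsupport hy]
      · simp [K.tm_eq_zero hl, dot3, cr, mv]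
    · simp [image_eq_zero_of_notMem_tsupport hz]
  · have hc : ∀ k i, HasDerivAt (fun t : ℝ => cp u (z + t • (0 : ST)
        + sh ((y + t • e k) + (l + t • -e k))) i) ((0 : V3) i) 0 := fun k i => by
      simpa [add_add_add_comm y] using hasDerivAt_const (0 : ℝ) (cp u (z + sh (y + l)) i)
    refine ⟨_, 0, 0, fun k => ((((hasDerivAt_line hρ y (e k)).fun_mul
        (hasDerivAt_line hψ1 z 0)).fun_mul ((hc k k).const_mul _)).fun_mul (hasDerivAt_dot3 ha
        (hasDerivAt_cr (hasDerivAt_mv (K.hasDerivAt_tm l _) (hc k)) (hasDerivAt_u hcp z _)))),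
      fun _ => hasDerivAt_const _ _, fun _ => hasDerivAt_const _ _, ?_⟩
    simp only [vals_pa_zero, vals_pa_one, leftTri, vq, gk, gs, dot3, cr, mv, K.fderiv_tm, map_neg,
      map_zero, Fin.sum_univ_three, Pi.sub_apply, Pi.smul_apply, Pi.zero_apply, smul_eq_mul,
      smul_zero, zero_smul, add_zero, Fin.isValue, Fin.reduceAdd, zero_add]
    ring

theorem limit_exchange (K : Ker) (hρ : C¹ ρ) (hρc : HasCompactSupport ρ)
    (hψ : IsTest Ω ψ) {f : ST → E3} (hf : MemLp f 3 volume) (a : V3) :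
    Zero volume fun (y : E3 × E3) z => ψ z * leftTri (gk (gs ρ y.1) (K.tm y.2) - ρ y.1 • K.qm y.2) a
      (vals f pa y z) (vals f pa y z) (vals f pa y z) := by
  have hfam : CFam (tsupport ρ ×ˢ 𝔹 K.r) (tsupport ψ)
      (fun a y => sh (pa a y)) fun y z U V W => ψ z * leftTri (gk (gs ρ y.1) (K.tm y.2)
        - ρ y.1 • K.qm y.2) a (fx U) (fx V) (fx W) := by
    refine ⟨fun y z => (isTri_left _ _).const_mul _, fun U V W => ?_, fun y z hyz U V W => ?_,
      fun a => continuous_sh.comp (continuous_pa a)⟩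
    · have h3 := continuous_gs hρ
      have h4 := hψ.smooth.continuous
      have h5 := hρ.continuous
      unfold leftTri
      fun_prop
    · rcases hyz with hy | hz
      · have : gk (gs ρ y.1) (K.tm y.2) - ρ y.1 • K.qm y.2 = 0 := by
          funext k i j
          rcases not_and_or.1 hy with hy | hl
          · simp [gk, gs_eq_zero hy, image_eq_zero_of_notMem_tsupport hy]
          · simp [gk, K.tm_eq_zero hl, K.qm_eq_zero hl]
        simp only [this, (ltri_left a).zero_param, mul_zero]
      · simp [image_eq_zero_of_notMem_tsupport hz]
  set φ : ℕ → ContDiffBump (0 : ST) := fun n => ⟨1 / ((n : ℝ) + 1) / 2, 1 / ((n : ℝ) + 1),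
    by positivity, half_lt_self (by positivity)⟩
  have T := Tame.of_memLp hf hf hf
  have key := zero_of_mollify (ν := volume) hfam (CFam.zero hfam.shift)
    (IsCompact.prod hρc (isCompact_closedBall _ _)) hψ.compact T T (φ := φ)
    tendsto_one_div_add_atTop_nhds_zero_nat fun n =>
      (smooth_exchange K hρ hρc hψ (contDiff_one_mollify (φ n) T.locallyIntegrable.1) a).congr
        fun y z => by simp only [ev, fx_vals, add_zero]
  exact key.congr fun y z => by simp only [ev, fx_vals, add_zero]

theorem integrable_mul_prod {P : Type*} [NormedAddCommGroup P] [NormedSpace ℝ P]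
    {w : E3 → ℝ} {t : E3 → P} (hw : Integrable w) (ht : Integrable t) :
    Integrable fun y : E3 × E3 => w y.1 • t y.2 :=
  hw.smul_prod ht

theorem integrable_gs (hρ : C¹ ρ) (hρc : HasCompactSupport ρ) (k : Fin 3) :
    Integrable fun y => gs ρ y k :=
  (continuous_pi_iff.1 (continuous_gs hρ) k).integrable_of_hasCompactSupport
    (HasCompactSupport.intro hρc fun y hy => by rw [gs_eq_zero hy]; rfl)

theorem integrable_gk (hρ : C¹ ρ) (hρc : HasCompactSupport ρ) {t : E3 → Fin 3 → V3}
    (ht : Integrable t) : Integrable fun y : E3 × E3 => gk (gs ρ y.1) (t y.2) :=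
  Integrable.of_eval fun k => integrable_mul_prod (integrable_gs hρ hρc k) ht

theorem exists_tsupport_subset (hρc : HasCompactSupport ρ) :
    ∃ r, 0 ≤ r ∧ tsupport ρ ⊆ 𝔹 r := by
  obtain ⟨r, hr⟩ := hρc.isBounded.subset_closedBall (0 : E3)
  exact ⟨max r 0, le_max_right _ _, hr.trans (Metric.closedBall_subset_closedBall (le_max_left _ _))⟩

theorem mem_support_pair {P : Type*} [NormedAddCommGroup P] {T : E3 × E3 → P} {r b : ℝ}
    (hρr : tsupport ρ ⊆ 𝔹 r)
    (h1 : ∀ y, y.1 ∉ tsupport ρ → T y = 0) (h2 : ∀ y : E3 × E3, b < ‖y.2‖ → T y = 0)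
    (y : E3 × E3) (hy : T y ≠ 0) : ‖y.1‖ ≤ r ∧ ‖y.2‖ ≤ b := by
  constructor
  · by_contra h
    exact hy (h1 y fun h' => h (by simpa using hρr h'))
  · by_contra! h
    exact hy (h2 y h)

theorem norm_pa_le (y : E3 × E3) (a : Fin 2) {r b : ℝ} (hy : ‖y.1‖ ≤ r ∧ ‖y.2‖ ≤ b) :
    ‖pa a y‖ ≤ r + b := by
  have h1 := norm_add_le y.1 y.2
  have h2 := norm_nonneg y.1
  have h3 := norm_nonneg y.2
  fin_cases a
  · simp [pa]; linarith
  · simp [pa]; linarith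

theorem LocTame.integrable_left {b₁ : ST → E3} (H : LocTame Ω b₁ b₁ b₁)
    {T : E3 × E3 → Fin 3 → Fin 3 → V3} (hT : Integrable T) {r b : ℝ}
    (hρr : tsupport ρ ⊆ 𝔹 r)
    (h1 : ∀ y, y.1 ∉ tsupport ρ → T y = 0) (h2 : ∀ y : E3 × E3, b < ‖y.2‖ → T y = 0)
    (hψ : IsCTest Ω ψ) (a : V3) :
    Integrable (fun p : (E3 × E3) × ST => ψ p.2 * leftTri (T p.1) a (vals b₁ pa p.1 p.2)
      (vals b₁ pa p.1 p.2) (vals b₁ pa p.1 p.2)) (volume.prod volume) :=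
  H.integrable (ltri_left a) hT (fun a => (continuous_pa a).measurable)
    (fun y hy a => norm_pa_le y a (mem_support_pair hρr h1 h2 y hy)) hψ

/-- A derivative of the mollifier may be replaced by a derivative of the kernel. -/
theorem LocTame.exchange {b₁ : ST → E3} (H : LocTame Ω b₁ b₁ b₁) (α β : ℝ) {F : ℝ → ℝ} {b : ℝ}
    (hF : Profile F b) (hρ : C¹ ρ) (hρc : HasCompactSupport ρ) (hψ : IsTest Ω ψ)
    (a : V3) :
    ∫ p : (E3 × E3) × ST, ψ p.2 * leftTri (gk (gs ρ p.1.1) (tF α β F p.1.2)) a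
      (vals b₁ pa p.1 p.2) (vals b₁ pa p.1 p.2) (vals b₁ pa p.1 p.2) ∂(volume.prod volume)
    = ∫ p : (E3 × E3) × ST, ψ p.2 * leftTri (ρ p.1.1 • qF α β F (deriv F) p.1.2) a
      (vals b₁ pa p.1 p.2) (vals b₁ pa p.1 p.2) (vals b₁ pa p.1 p.2) ∂(volume.prod volume) := by
  obtain ⟨r, hr0, hρr⟩ := exists_tsupport_subset hρc
  obtain ⟨f, g, h, ht, hf⟩ := H _ hψ.subset hψ.compact (r + b)
  have hff : LocTame Ω f f f := (Tame.of_memLp ht.hf ht.hf ht.hf).locTame Ω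
  have hρi : Integrable ρ := hρ.continuous.integrable_of_hasCompactSupport hρc
  have i1 := integrable_gk hρ hρc (integrable_tF α β hF)
  have i2 := integrable_mul_prod hρi (integrable_qF α β hF)
  have i3 := integrable_mul_prod hρi (integrable_nF α β hF)
  have z1 : (∀ y : E3 × E3, y.1 ∉ tsupport ρ → gk (gs ρ y.1) (tF α β F y.2) = 0)
      ∧ ∀ y : E3 × E3, b < ‖y.2‖ → gk (gs ρ y.1) (tF α β F y.2) = 0 := by
    constructor <;> intro y hy <;> funext k i j
    · simp [gk, gs_eq_zero hy]
    · simp [gk, tF_eq_zero α β hF hy]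
  have z2 : (∀ y : E3 × E3, y.1 ∉ tsupport ρ → ρ y.1 • qF α β F (deriv F) y.2 = 0)
      ∧ ∀ y : E3 × E3, b < ‖y.2‖ → ρ y.1 • qF α β F (deriv F) y.2 = 0 := by
    constructor <;> intro y hy
    · rw [image_eq_zero_of_notMem_tsupport hy, zero_smul]
    · rw [qF_eq_zero α β hF hy, smul_zero]
  have z3 : (∀ y : E3 × E3, y.1 ∉ tsupport ρ → ρ y.1 • ‖y.2‖⁻¹ • nF α β F y.2 = 0)
      ∧ ∀ y : E3 × E3, b < ‖y.2‖ → ρ y.1 • ‖y.2‖⁻¹ • nF α β F y.2 = 0 := by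
    constructor <;> intro y hy
    · rw [image_eq_zero_of_notMem_tsupport hy, zero_smul]
    · rw [nF_eq_zero α β hF hy, smul_zero, smul_zero]
  have j1 := hff.integrable_left i1 hρr z1.1 z1.2 hψ.isCTest a
  have j2 := hff.integrable_left i2 hρr z2.1 z2.2 hψ.isCTest a
  have j3 := hff.integrable_left i3 hρr z3.1 z3.2 hψ.isCTest a
  have hfb : ∀ z ∈ tsupport ψ, ∀ l : E3, ‖l‖ ≤ r + b → f (z + sh l) = b₁ (z + sh l)
      ∧ f (z + sh l) = b₁ (z + sh l) ∧ f (z + sh l) = b₁ (z + sh l) := fun z hz l hl =>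
    ⟨(hf z hz l hl).1, (hf z hz l hl).1, (hf z hz l hl).1⟩
  have e1 : ∀ {T : E3 × E3 → Fin 3 → Fin 3 → V3}, (∀ y, y.1 ∉ tsupport ρ → T y = 0) →
      (∀ y : E3 × E3, b < ‖y.2‖ → T y = 0) → ∀ p : (E3 × E3) × ST,
      ψ p.2 * leftTri (T p.1) a (vals b₁ pa p.1 p.2) (vals b₁ pa p.1 p.2) (vals b₁ pa p.1 p.2)
      = ψ p.2 * leftTri (T p.1) a (vals f pa p.1 p.2) (vals f pa p.1 p.2) (vals f pa p.1 p.2) :=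
    fun h1 h2 p => form_congr hfb (ltri_left a) subset_rfl
      (fun hy a => norm_pa_le p.1 a (mem_support_pair hρr h1 h2 p.1 hy)) p.2
  simp_rw [e1 z1.1 z1.2, e1 z2.1 z2.2]
  rw [← sub_eq_zero, ← integral_sub j1 j2]
  have key : Zero volume fun (y : E3 × E3) z => ψ z * leftTri (gk (gs ρ y.1) (tF α β F y.2)
      - ρ y.1 • qF α β F (deriv F) y.2) a (vals f pa y z) (vals f pa y z) (vals f pa y z) := by
    refine zero_of_cut (N := fun y => ‖y.2‖) (I' := fun y z => ψ z * leftTri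
      (-(ρ y.1 • nF α β F y.2)) a (vals f pa y z) (vals f pa y z) (vals f pa y z)) ?_ ?_ ?_
      fun η hη => ?_
    · have : ∀ᵐ l : E3, 0 < ‖l‖ := by
        filter_upwards [compl_mem_ae_iff.2 (measure_singleton (0 : E3))] with l hl
        exact norm_pos_iff.2 hl
      exact Measure.quasiMeasurePreserving_snd.ae this
    · refine (j1.sub j2).congr (.of_forall fun p => ?_)
      simp only [Pi.sub_apply, ((ltri_left a).lin _ _ _).map_sub]
      ring
    · refine j3.neg.congr (.of_forall fun p => ?_)
      simp only [Pi.neg_apply, ((ltri_left a).lin _ _ _).map_neg, ((ltri_left a).lin _ _ _).map_smul,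
        smul_eq_mul]
      ring
    · obtain ⟨c1, c2, c3, -⟩ := hF.cut hη
      have h1 := limit_exchange (Ker.ofProfile α β b c1 hη c2 c3) hρ hρc hψ ht.hf a
      simp_rw [Ker.ofProfile_tm, Ker.ofProfile_qm] at h1
      refine h1.congr fun y z => ?_
      rw [qF_cut α β hF hη, tF_cut α β (fun s => EMHD.cut (s / η))]
      have : gk (gs ρ y.1) (EMHD.cut (‖y.2‖ / η) • tF α β F y.2)
          - ρ y.1 • (EMHD.cut (‖y.2‖ / η) • qF α β F (deriv F) y.2
            + (deriv EMHD.cut (‖y.2‖ / η) / η) • nF α β F y.2)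
          = EMHD.cut (‖y.2‖ / η) • (gk (gs ρ y.1) (tF α β F y.2) - ρ y.1 • qF α β F (deriv F) y.2)
            + (deriv EMHD.cut (‖y.2‖ / η) / η) • -(ρ y.1 • nF α β F y.2) := by
        funext k i j
        simp only [gk, Pi.smul_apply, Pi.sub_apply, Pi.add_apply, Pi.neg_apply, smul_eq_mul]
        ring
      rw [this, ((ltri_left a).lin _ _ _).map_add, ((ltri_left a).lin _ _ _).map_smul,
        ((ltri_left a).lin _ _ _).map_smul, smul_eq_mul, smul_eq_mul]
      ring
  rw [← key.2]
  refine integral_congr_ae (.of_forall fun p => ?_)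
  simp only [((ltri_left a).lin _ _ _).map_sub]
  ring

end

/-! ### Local cut-offs of solutions -/

/-- The solution coincides locally with global fields to which the identities apply. -/
def LocalCut (Ω : Set ST) (d : ℝ) (b J : ST → E3) : Prop :=
  ∀ S ⊆ Ω, IsCompact S → ∀ r : ℝ, ∃ (Q : Set ST) (f h : ST → E3), Cut Q d f h ∧
    Tame (Q.indicator fun _ => e 0) (Q.indicator fun _ => e 0) h ∧
    Tame f (Q.indicator fun _ => e 0) h ∧
    ∀ z ∈ S, ∀ l : E3, ‖l‖ ≤ r → z + sh l ∈ Q ∧ f (z + sh l) = b (z + sh l) ∧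
      h (z + sh l) = J (z + sh l)

/-- A constant field. -/
def one : ST → E3 := fun _ => e 0

section

variable {Ω : Set ST} {d : ℝ} {b J : ST → E3}

theorem LocalCut.ffh (H : LocalCut Ω d b J) : LocTame Ω b b J := fun S hS hc r => by
  obtain ⟨Q, f, h, h1, -, -, h3⟩ := H S hS hc r
  exact ⟨f, f, h, h1.tame, fun z hz l hl => have h := (h3 z hz l hl).2; ⟨h.1, h⟩⟩

theorem LocalCut.fff (H : LocalCut Ω d b J) : LocTame Ω b b b := fun S hS hc r => by
  obtain ⟨Q, f, h, h1, -, -, h3⟩ := H S hS hc r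
  exact ⟨f, f, f, .of_memLp h1.tame.hf h1.tame.hf h1.tame.hf, fun z hz l hl =>
    have h := (h3 z hz l hl).2.1; ⟨h, h, h⟩⟩

theorem LocalCut.fuf (H : LocalCut Ω d b J) : LocTame Ω b one b := fun S hS hc r => by
  obtain ⟨Q, f, h, h1, -, -, h3⟩ := H S hS hc r
  exact ⟨f, _, f, .of_memLp h1.tame.hf h1.unit h1.tame.hf, fun z hz l hl =>
    have h := h3 z hz l hl; ⟨h.2.1, indicator_of_mem h.1 _, h.2.1⟩⟩

theorem LocalCut.fuh (H : LocalCut Ω d b J) : LocTame Ω b one J := fun S hS hc r => by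
  obtain ⟨Q, f, h, h1, -, h2, h3⟩ := H S hS hc r
  exact ⟨f, _, h, h2, fun z hz l hl =>
    have h := h3 z hz l hl; ⟨h.2.1, indicator_of_mem h.1 _, h.2.2⟩⟩

theorem LocalCut.uuf (H : LocalCut Ω d b J) : LocTame Ω one one b := fun S hS hc r => by
  obtain ⟨Q, f, h, h1, -, -, h3⟩ := H S hS hc r
  exact ⟨_, _, f, .of_memLp h1.unit h1.unit h1.tame.hf, fun z hz l hl =>
    have h := h3 z hz l hl; ⟨indicator_of_mem h.1 _, indicator_of_mem h.1 _, h.2.1⟩⟩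

theorem LocalCut.uuh (H : LocalCut Ω d b J) : LocTame Ω one one J := fun S hS hc r => by
  obtain ⟨Q, f, h, h1, h2, -, h3⟩ := H S hS hc r
  exact ⟨_, _, h, h2, fun z hz l hl =>
    have h := h3 z hz l hl; ⟨indicator_of_mem h.1 _, indicator_of_mem h.1 _, h.2.2⟩⟩

end

/-! ### The product of the divergence with a field, for radial kernels -/

section

variable (a g : V3) (s : Fin 3 → V3) (q : Fin 3 → Fin 3 → V3)

/-- The product of the divergence of a mollified tensor with a field. -/
def divTri (u x w : Fin 3 → V3) : ℝ :=
  ∑ k, u 1 k * dot3 a (cr (x 1) (mv (q k) (w 2)))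

/-- The product of the energy with a field and the gradient of the test function. -/
def sqTri (u x w : Fin 3 → V3) : ℝ :=
  1 / 2 * dot3 (u 1) (x 1) * dot3 a (cr g (mv s (w 2)))

/-- The product of the force with a field. -/
def crTri (u x w : Fin 3 → V3) : ℝ :=
  dot3 a (cr (cr (w 1) (u 1)) (mv s (x 2))) - 1 / 2 * dot3 (u 1) (x 1) * dot3 a (mv s (w 2))

theorem ltri_div : LTri (divTri a) := by
  apply ltri_of <;> intros <;> simp [divTri, mv, dot3, cr, Fin.sum_univ_three] <;> ring

theorem ltri_sq : LTri (sqTri a g) := by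
  apply ltri_of <;> intros <;> simp [sqTri, mv, dot3, cr] <;> ring

theorem ltri_cr : LTri (crTri a) := by
  apply ltri_of <;> intros <;> simp [crTri, mv, dot3, cr] <;> ring

theorem prodTri_add_curlTri (r p : ℝ) (G : V3) (u v : Fin 3 → V3) :
    prodTri s r p G g a u u u + curlTri s r p a u u v
      = p * divTri a (gk G s) u u u - ∑ i, g i * sqTri a (kd i) (r • s) u u u
        + p * crTri a (r • s) u u v := by
  simp only [prodTri, curlTri, divTri, sqTri, crTri, gk, mv, dot3, cr, Fin.sum_univ_three, kd,
    Pi.smul_apply, smul_eq_mul]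
  simp
  ring

end

/-- The displacements `0`, `y` and `l`. -/
def pb : Fin 3 → E3 × E3 → E3 := ![fun _ => 0, fun y => y.1, fun y => y.2]

/-- The displacements `0`, `y` and `0`. -/
def pc : Fin 3 → E3 → E3 := ![fun _ => 0, fun y => y, fun _ => 0]

theorem continuous_pb (a : Fin 3) : Continuous (pb a) := by
  fin_cases a
  exacts [continuous_const, continuous_fst, continuous_snd]

theorem continuous_pc (a : Fin 3) : Continuous (pc a) := by
  fin_cases a
  exacts [continuous_const, continuous_id, continuous_const]

theorem vals_pb (u : ST → E3) (y : E3 × E3) (z : ST) : vals u pb y z = three (cp u) y.1 y.2 z := by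
  funext a
  fin_cases a <;> simp [vals, pb, three, sh_zero]

theorem vals_pc (u : ST → E3) (y : E3) (z : ST) : vals u pc y z = three (cp u) y 0 z := by
  funext a
  fin_cases a <;> simp [vals, pc, three, sh_zero]

theorem norm_pb_le (y : E3 × E3) (a : Fin 3) {r b : ℝ} (hy : ‖y.1‖ ≤ r ∧ ‖y.2‖ ≤ b) :
    ‖pb a y‖ ≤ r + b := by
  have h2 := norm_nonneg y.1
  have h3 := norm_nonneg y.2
  fin_cases a
  all_goals simp [pb]; linarith

theorem norm_pc_le (y : E3) (a : Fin 3) : ‖pc a y‖ ≤ ‖y‖ := by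
  fin_cases a
  all_goals simp [pc]

section

variable {Ω : Set ST} {d : ℝ} {b J : ST → E3} {ψ : ST → ℝ} {ρ : E3 → ℝ}

/-- The weak form of the product identity for the fields `b` and `J`. -/
theorem LocalCut.product (H : LocalCut Ω d b J) (α β : ℝ) {F : ℝ → ℝ} {R : ℝ}
    (hF : Profile F R) (hρ : C¹ ρ) (hρc : HasCompactSupport ρ) (hψ : IsTest Ω ψ)
    (a : V3) :
    Zero volume fun (y : E3 × E3) z =>
      ψ z * divTri a (gk (gs ρ y.1) (tF α β F y.2)) (vals b pb y z) (vals b pb y z) (vals b pb y z)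
      - ∑ i, gr ψ z i * sqTri a (kd i) (ρ y.1 • tF α β F y.2) (vals b pb y z) (vals b pb y z)
        (vals b pb y z)
      + ψ z * crTri a (ρ y.1 • tF α β F y.2) (vals b pb y z) (vals b pb y z) (vals J pb y z) := by
  obtain ⟨r, hr0, hρr⟩ := exists_tsupport_subset hρc
  have hR := hF.pos
  obtain ⟨Q, f, h, hC, -, -, hf⟩ := H _ hψ.subset hψ.compact (r + R)
  have hψQ : IsTest Q ψ := ⟨hψ.smooth, hψ.compact, fun z hz => by
    simpa [sh_zero] using (hf z hz 0 (by simpa using by positivity)).1⟩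
  have hff : LocTame Q f f f := (Tame.of_memLp hC.tame.hf hC.tame.hf hC.tame.hf).locTame Q
  have hfh : LocTame Q f f h := hC.tame.locTame Q
  have hρi : Integrable ρ := hρ.continuous.integrable_of_hasCompactSupport hρc
  have z1 : (∀ y : E3 × E3, y.1 ∉ tsupport ρ → gk (gs ρ y.1) (tF α β F y.2) = 0)
      ∧ ∀ y : E3 × E3, R < ‖y.2‖ → gk (gs ρ y.1) (tF α β F y.2) = 0 := by
    constructor <;> intro y hy <;> funext k i j
    · simp [gk, gs_eq_zero hy]
    · simp [gk, tF_eq_zero α β hF hy]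
  have z2 : (∀ y : E3 × E3, y.1 ∉ tsupport ρ → ρ y.1 • tF α β F y.2 = 0)
      ∧ ∀ y : E3 × E3, R < ‖y.2‖ → ρ y.1 • tF α β F y.2 = 0 := by
    constructor <;> intro y hy
    · rw [image_eq_zero_of_notMem_tsupport hy, zero_smul]
    · rw [tF_eq_zero α β hF hy, smul_zero]
  have j1 := hff.integrable (ltri_div a) (integrable_gk hρ hρc (integrable_tF α β hF))
    (fun a => (continuous_pb a).measurable)
    (fun y hy a => norm_pb_le y a (mem_support_pair hρr z1.1 z1.2 y hy)) hψQ.isCTest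
  have j2 := fun i => hff.integrable (ltri_sq a (kd i)) (integrable_mul_prod hρi (integrable_tF α β hF))
    (fun a => (continuous_pb a).measurable)
    (fun y hy a => norm_pb_le y a (mem_support_pair hρr z2.1 z2.2 y hy)) (isCTest_gr hψQ i)
  have j3 := hfh.integrable (ltri_cr a) (integrable_mul_prod hρi (integrable_tF α β hF))
    (fun a => (continuous_pb a).measurable)
    (fun y hy a => norm_pb_le y a (mem_support_pair hρr z2.1 z2.2 y hy)) hψQ.isCTest
  have key : Zero volume fun (y : E3 × E3) z =>
      ψ z * divTri a (gk (gs ρ y.1) (tF α β F y.2)) (vals f pb y z) (vals f pb y z) (vals f pb y z)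
      - ∑ i, gr ψ z i * sqTri a (kd i) (ρ y.1 • tF α β F y.2) (vals f pb y z) (vals f pb y z)
        (vals f pb y z)
      + ψ z * crTri a (ρ y.1 • tF α β F y.2) (vals f pb y z) (vals f pb y z) (vals h pb y z) := by
    refine zero_of_cut (N := fun y => ‖y.2‖) (I' := fun y z => 0) ?_ ?_ ?_ fun η hη => ?_
    · have : ∀ᵐ l : E3, 0 < ‖l‖ := by
        filter_upwards [compl_mem_ae_iff.2 (measure_singleton (0 : E3))] with l hl
        exact norm_pos_iff.2 hl
      exact Measure.quasiMeasurePreserving_snd.ae this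
    · exact (j1.sub (integrable_finsetSum Finset.univ fun i _ => j2 i)).add j3
    · simp only [mul_zero]
      exact integrable_zero _ _ _
    · obtain ⟨c1, c2, c3, -⟩ := hF.cut hη
      have h1 := limit_product (Ker.ofProfile α β R c1 hη c2 c3) hρ hρc hC hψQ
        (hρr.trans (Metric.closedBall_subset_closedBall (by linarith : r ≤ r + R)))
        (by linarith : R ≤ r + R) (fun z hz l hl => (hf z hz l (by simpa using hl)).1) a
      simp_rw [Ker.ofProfile_tm, tF_cut α β (fun s => EMHD.cut (s / η))] at h1
      refine h1.congr fun y z => ?_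
      have e1 : gk (gs ρ y.1) (EMHD.cut (‖y.2‖ / η) • tF α β F y.2)
          = EMHD.cut (‖y.2‖ / η) • gk (gs ρ y.1) (tF α β F y.2) := by
        funext k i j
        simp only [gk, Pi.smul_apply, smul_eq_mul]
        ring
      rw [prodTri_add_curlTri, e1, smul_comm (ρ y.1), ((ltri_div a).lin _ _ _).map_smul,
        vals_pb, vals_pb]
      simp only [((ltri_cr a).lin (three (cp f) y.1 y.2 z) (three (cp f) y.1 y.2 z)
        (three (cp h) y.1 y.2 z)).map_smul, fun i => ((ltri_sq a (kd i)).lin (three (cp f) y.1 y.2 z) (three (cp f) y.1 y.2 z)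
        (three (cp f) y.1 y.2 z)).map_smul, Fin.sum_univ_three, smul_eq_mul]
      ring
  refine key.congr fun y z => ?_
  have e1 := fun (ψ' : ST → ℝ) (hs : tsupport ψ' ⊆ tsupport ψ)
    (m : (Fin 3 → V3) → Form V3 3)
    (hm : LTri m) => form_congr (b₁ := b) (b₂ := b) (b₃ := b) (g := f) (h := f)
      (fun z hz l hl => ⟨(hf z hz l hl).2.1, (hf z hz l hl).2.1, (hf z hz l hl).2.1⟩) hm hs
      (T := fun y : E3 × E3 => ρ y.1 • tF α β F y.2) (s := pb) (y := y)
      (fun hy a => norm_pb_le y a (mem_support_pair hρr z2.1 z2.2 y hy)) z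
  have e2 := form_congr (b₁ := b) (b₂ := b) (b₃ := b) (g := f) (h := f)
      (fun z hz l hl => ⟨(hf z hz l hl).2.1, (hf z hz l hl).2.1, (hf z hz l hl).2.1⟩)
      (ltri_div a) (ψ := ψ) subset_rfl
      (T := fun y : E3 × E3 => gk (gs ρ y.1) (tF α β F y.2)) (s := pb) (y := y)
      (fun hy a => norm_pb_le y a (mem_support_pair hρr z1.1 z1.2 y hy)) z
  have e3 := form_congr (b₁ := b) (b₂ := b) (b₃ := J) (g := f) (h := h)
      (fun z hz l hl => ⟨(hf z hz l hl).2.1, (hf z hz l hl).2.1, (hf z hz l hl).2.2⟩)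
      (ltri_cr a) (ψ := ψ) subset_rfl
      (T := fun y : E3 × E3 => ρ y.1 • tF α β F y.2) (s := pb) (y := y)
      (fun hy a => norm_pb_le y a (mem_support_pair hρr z2.1 z2.2 y hy)) z
  rw [e2, e3]
  congr 2
  exact Finset.sum_congr rfl fun i _ => e1 (fun z => gr ψ z i)
    (closure_minimal (fun z hz => by
      by_contra h'
      exact hz (by simp [gr_eq_zero h'])) (isClosed_tsupport ψ)) _ (ltri_sq a (kd i))

/-- The weak form of the product identity of `b` with itself. -/
theorem LocalCut.product_self (H : LocalCut Ω d b J) (hρ : C¹ ρ)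
    (hρc : HasCompactSupport ρ) (hψ : IsTest Ω ψ) (a : V3) :
    Zero volume fun (y : E3) z =>
      ψ z * divTri a (gk (gs ρ y) kd) (vals b pc y z) (vals b pc y z) (vals b pc y z)
      - ∑ i, gr ψ z i * sqTri a (kd i) (ρ y • kd) (vals b pc y z) (vals b pc y z) (vals b pc y z)
      + ψ z * crTri a (ρ y • kd) (vals b pc y z) (vals b pc y z) (vals J pc y z) := by
  obtain ⟨r, hr0, hρr⟩ := exists_tsupport_subset hρc
  obtain ⟨Q, f, h, hC, -, -, hf⟩ := H _ hψ.subset hψ.compact r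
  have hψQ : IsTest Q ψ := ⟨hψ.smooth, hψ.compact, fun z hz => by
    simpa [sh_zero] using (hf z hz 0 (by simpa using hr0)).1⟩
  have h1 := limit_product_self hρ hρc hC hψQ hρr
    (fun z hz l hl => (hf z hz l (by simpa using hl)).1) a
  refine h1.congr fun y z => ?_
  rw [prodTri_add_curlTri, ← vals_pc, ← vals_pc]
  by_cases hz : z ∈ tsupport ψ
  · by_cases hy : y ∈ tsupport ρ
    · have hle : ∀ a, ‖pc a y‖ ≤ r := fun a => (norm_pc_le y a).trans (by simpa using hρr hy)
      rw [vals_eq fun a => (hf z hz _ (hle a)).2.1.symm,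
        vals_eq fun a => (hf z hz _ (hle a)).2.2.symm]
    · have e1 : gk (gs ρ y) kd = 0 := by
        funext k i j
        simp [gk, gs_eq_zero hy]
      simp [e1, image_eq_zero_of_notMem_tsupport hy, (ltri_div a).zero_param,
        (ltri_cr a).zero_param, fun i => (ltri_sq a (kd i)).zero_param]
  · simp [image_eq_zero_of_notMem_tsupport hz, gr_eq_zero hz]

/-- Identities for the cut-off fields are identities for the fields. -/
theorem LocalCut.zero_of_cut (H : LocalCut Ω d b J) (hψ : IsTest Ω ψ) {R : ℝ} (hR : 0 ≤ R)
    {I : E3 → ST → (Fin 2 → V3) → (Fin 2 → V3) → ℝ}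
    (hz : ∀ l, ∀ z ∉ tsupport ψ, ∀ u v, I l z u v = 0)
    (hl : ∀ l : E3, R < ‖l‖ → ∀ z u v, I l z u v = 0)
    (h : ∀ Q f h, Cut Q d f h → IsTest Q ψ →
      (∀ z ∈ tsupport ψ, ∀ l ∈ 𝔹 R, z + sh l ∈ Q) →
      Zero volume fun l z => I l z (two (cp f) l z) (two (cp h) l z)) :
    Zero volume fun l z => I l z (two (cp b) l z) (two (cp J) l z) := by
  obtain ⟨Q, f, g, hC, -, -, hf⟩ := H _ hψ.subset hψ.compact R
  have hψQ : IsTest Q ψ := ⟨hψ.smooth, hψ.compact, fun z hz => by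
    simpa [sh_zero] using (hf z hz 0 (by simpa using hR)).1⟩
  refine (h Q f g hC hψQ fun z hz l hl => (hf z hz l (by simpa using hl)).1).congr fun l z => ?_
  by_cases hz' : z ∈ tsupport ψ
  · by_cases hl' : ‖l‖ ≤ R
    · have hle : ∀ a, ‖ps a l‖ ≤ R := fun a => (norm_ps_le a l).trans hl'
      rw [← vals_ps, ← vals_ps, vals_eq fun a => (hf z hz' _ (hle a)).2.1.symm,
        vals_eq fun a => (hf z hz' _ (hle a)).2.2.symm, vals_ps, vals_ps]
    · rw [hl l (not_le.1 hl'), hl l (not_le.1 hl')]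
  · rw [hz l z hz', hz l z hz']

/-- The balance of energy for radial kernels. -/
theorem LocalCut.balance (H : LocalCut Ω d b J) (α β : ℝ) {F : ℝ → ℝ} {R : ℝ} (hF : Profile F R)
    (hψ : IsTest Ω ψ) :
    Zero volume fun l z => balTri d (fderiv ℝ ψ z (1, 0)) (ψ z) (gr ψ z) (tF α β F l)
      (qF α β F (deriv F) l) (two (cp b) l z) (two (cp J) l z) := by
  refine H.zero_of_cut hψ hF.pos (I := fun l z => balTri d (fderiv ℝ ψ z (1, 0)) (ψ z) (gr ψ z)
    (tF α β F l) (qF α β F (deriv F) l)) (fun l z hz u v => ?_) (fun l hl z u v => ?_)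
    fun Q f h hC hψQ hQ => balance_of_profile α β hF hC hψQ hQ
  · have : gr ψ z = 0 := gr_eq_zero hz
    simp [balTri, fderiv_of_notMem_tsupport ℝ hz, image_eq_zero_of_notMem_tsupport hz, this,
      leftTri, rightTri, fluxTri, dot3]
  · have := balTri_cut d (fderiv ℝ ψ z (1, 0)) (ψ z) (gr ψ z) 0 0 0 u v 0 0
    simp only [smul_zero, add_zero, zero_mul] at this
    rw [tF_eq_zero α β hF hl, qF_eq_zero α β hF hl, this]

end

/-! ### Mollifiers as radial kernels -/

/-- The profile of a scaled mollifier. -/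
def prof (φ : E3 → ℝ) (ε : ℝ) (r : ℝ) : ℝ := scaled φ ε (r • e 0)

theorem norm_e (i : Fin 3) : ‖e i‖ = 1 := by simp [e]

theorem shift_eq (z : ST) (l : E3) : shift z l = z + sh l := by
  simp [shift, sh, Prod.ext_iff]

section

variable {φ : E3 → ℝ} {ε : ℝ}

theorem scaled_radial (hφ : IsMollifier φ) (ε : ℝ) {x y : E3} (h : ‖x‖ = ‖y‖) : scaled φ ε x = scaled φ ε y := by
  unfold scaled
  rw [hφ.radial (ε⁻¹ • x) (ε⁻¹ • y) (by rw [norm_smul, norm_smul, h])]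

theorem prof_norm (hφ : IsMollifier φ) (l : E3) : prof φ ε ‖l‖ = scaled φ ε l :=
  scaled_radial hφ ε (by rw [norm_smul, norm_e, norm_norm, mul_one])

theorem contDiff_scaled (hφ : IsMollifier φ) (ε : ℝ) : ContDiff ℝ (⊤ : ℕ∞) (scaled φ ε) :=
  contDiff_const.mul (hφ.smooth.comp (contDiff_id.const_smul _))

theorem hasCompactSupport_scaled (hφ : IsMollifier φ) (hε : 0 < ε) : HasCompactSupport (scaled φ ε) :=
  (hφ.compact.comp_smul (inv_ne_zero hε.ne')).mul_left

theorem scaled_nonneg (hφ : IsMollifier φ) (hε : 0 ≤ ε) (l : E3) : 0 ≤ scaled φ ε l :=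
  mul_nonneg (by positivity) (hφ.nonneg _)

theorem integral_scaled (hφ : IsMollifier φ) (hε : 0 < ε) : ∫ l, scaled φ ε l = 1 := by
  unfold scaled
  rw [integral_const_mul, Measure.integral_comp_inv_smul_of_nonneg volume φ hε.le, hφ.integral,
    finrank_euclideanSpace, Fintype.card_fin, smul_eq_mul, mul_one,
    inv_mul_cancel₀ (pow_ne_zero _ hε.ne')]

theorem exists_support_radius (hφ : IsMollifier φ) : ∃ R, 0 < R ∧ ∀ x : E3, R ≤ ‖x‖ → φ x = 0 := by
  obtain ⟨R, hR⟩ := hφ.compact.isBounded.subset_ball (0 : E3)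
  refine ⟨max R 1, by positivity, fun x hx => image_eq_zero_of_notMem_tsupport fun h => ?_⟩
  exact absurd (mem_ball_zero_iff.1 (hR h)) (not_lt.2 ((le_max_left _ _).trans hx))

theorem scaled_eq_zero {R : ℝ} (hR : ∀ x : E3, R ≤ ‖x‖ → φ x = 0) (hε : 0 < ε) {l : E3}
    (hl : ε * R ≤ ‖l‖) : scaled φ ε l = 0 := by
  rw [scaled, hR, mul_zero]
  rw [norm_smul, norm_inv, Real.norm_of_nonneg hε.le, inv_mul_eq_div, le_div_iff₀ hε, mul_comm]
  exact hl

theorem exists_profile (hφ : IsMollifier φ) (hε : 0 < ε) : ∃ R, Profile (prof φ ε) R := by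
  obtain ⟨R, hR0, hR⟩ := exists_support_radius hφ
  refine ⟨ε * R, ?_, by positivity, fun s hs => scaled_eq_zero hR hε ?_⟩
  · exact ((contDiff_scaled hφ ε).comp (contDiff_id.smul contDiff_const)).of_le
      (by exact_mod_cast le_top)
  · rw [norm_smul, norm_e, mul_one]
    exact hs.le.trans (le_abs_self s)

theorem gradient_scaled (hφ : IsMollifier φ) (hε : 0 < ε) {l : E3} (hl : l ≠ 0) :
    gradient (scaled φ ε) l = deriv (prof φ ε) ‖l‖ • dir l := by
  obtain ⟨R, hp⟩ := exists_profile hφ hε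
  have h1 : HasFDerivAt (fun l : E3 => prof φ ε ‖l‖)
      (deriv (prof φ ε) ‖l‖ • (‖l‖⁻¹ • innerSL ℝ l)) l :=
    (hp.smooth.differentiable one_ne_zero ‖l‖).hasDerivAt.comp_hasFDerivAt l (hasFDerivAt_norm_E3 hl)
  simp only [prof_norm hφ] at h1
  refine HasGradientAt.gradient (hasGradientAt_iff_hasFDerivAt.2 (h1.congr_fderiv ?_))
  ext v
  simp only [smul_apply, smul_eq_mul, innerSL_apply_apply,
    InnerProductSpace.toDual_apply_apply, dir, inner_smul_left]
  simp

end

theorem inner_eq_dot3 (v w : E3) : ⟪v, w⟫ = dot3 v w := by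
  simp only [PiLp.inner_apply, Fin.sum_univ_three, RCLike.inner_apply, conj_trivial, dot3]
  ring

theorem dot3_dir {l : E3} (hl : l ≠ 0) : dot3 (dir l) (dir l) = 1 := by
  rw [← inner_eq_dot3, real_inner_self_eq_norm_sq, dir, norm_smul, norm_inv, norm_norm,
    inv_mul_cancel₀ (norm_ne_zero_iff.2 hl), one_pow]

/-- The longitudinal or the transverse projection. -/
structure Part (P : E3 → E3 → E3) (α β : ℝ) : Prop where
  apply : ∀ n v i, P n v i = mv (pm α β n) v i
  coeff : α * α = α ∧ 2 * α * β + β * β = β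

theorem part_longi : Part longi 0 1 where
  apply n v i := by
    simp only [longi, PiLp.smul_apply, smul_eq_mul, inner_eq_dot3, mv, pm, dot3]
    ring
  coeff := by norm_num

theorem part_trans : Part trans 1 (-1) where
  apply n v i := by
    simp only [trans, longi, PiLp.smul_apply, PiLp.sub_apply, smul_eq_mul, inner_eq_dot3, mv, pm,
      dot3, kd]
    fin_cases i <;> simp <;> ring
  coeff := by norm_num

section

variable {P : E3 → E3 → E3} {α β : ℝ}

theorem Part.inner (hP : Part P α β) {n : E3} (hn : dot3 n n = 1) (v w : E3) :
    ⟪P n v, P n w⟫ = dot3 v (mv (pm α β n) w) := by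
  rw [inner_eq_dot3]
  obtain ⟨h1, h2⟩ := hP.coeff
  have e1 : ∀ x : E3, ∀ i : Fin 3, mv (pm α β n) x i = α * x i + β * dot3 n x * n i := by
    intro x i
    simp only [mv, pm, dot3, kd]
    fin_cases i <;> simp <;> ring
  have e2 : dot3 (P n v) (P n w) = α * α * dot3 v w
      + (2 * α * β + β * β * dot3 n n) * dot3 n v * dot3 n w := by
    simp only [dot3, hP.apply, e1]
    ring
  rw [e2, hn, mul_one, h1, h2]
  simp only [dot3, e1]
  ring

end

theorem ae_ne_zero : ∀ᵐ l : E3, l ≠ 0 :=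
  compl_mem_ae_iff.2 (measure_singleton (0 : E3))

section

variable {φ : E3 → ℝ} {ε : ℝ} {P : E3 → E3 → E3} {α β : ℝ}

theorem scaled_smul_part (hφ : IsMollifier φ) (hP : Part P α β) (l v : E3) (i : Fin 3) :
    (scaled φ ε l • P (dir l) v) i = mv (tF α β (prof φ ε) l) v i := by
  simp only [PiLp.smul_apply, smul_eq_mul, hP.apply, mv, tF, prof_norm hφ]
  ring

theorem scaled_inner_part (hφ : IsMollifier φ) (hP : Part P α β) {l : E3} (hl : l ≠ 0) (v w : E3) :
    scaled φ ε l * ⟪P (dir l) v, P (dir l) w⟫ = dot3 v (mv (tF α β (prof φ ε) l) w) := by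
  rw [hP.inner (dot3_dir hl)]
  simp only [dot3, mv, tF, prof_norm hφ]
  ring

theorem integral_apply_E3 {X : Type*} [MeasurableSpace X] {μ : Measure X} {f : X → E3}
    (h : ∀ i, Integrable (fun x => f x i) μ) (i : Fin 3) : (∫ x, f x ∂μ) i = ∫ x, f x i ∂μ :=
  eval_integral_piLp (fun i => h i) i

theorem mollX_apply (hφ : IsMollifier φ) (hP : Part P α β) {G : ST → E3} {z : ST}
    (h : ∀ i, Integrable fun l : E3 => mv (tF α β (prof φ ε) l) (cp G (z + sh l)) i) (i : Fin 3) :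
    mollX φ ε P G z i = ∫ l : E3, mv (tF α β (prof φ ε) l) (cp G (z + sh l)) i := by
  have h1 : ∀ (l : E3) i, (scaled φ ε l • P (dir l) (G (shift z l))) i
      = mv (tF α β (prof φ ε) l) (cp G (z + sh l)) i := fun l i => by
    rw [scaled_smul_part hφ hP, shift_eq]
    rfl
  rw [mollX, moll, integral_apply_E3 fun i => by simpa only [h1] using h i]
  simp only [h1]

theorem moll_inner (hφ : IsMollifier φ) (hP : Part P α β) {v w : ST → E3} (z : ST) :
    moll φ ε (fun n y => ⟪P n (v y), P n (w y)⟫) z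
      = ∫ l : E3, dot3 (cp v (z + sh l)) (mv (tF α β (prof φ ε) l) (cp w (z + sh l))) := by
  refine integral_congr_ae ?_
  filter_upwards [ae_ne_zero] with l hl
  rw [smul_eq_mul, scaled_inner_part hφ hP hl, shift_eq]
  rfl

theorem moll_inner_smul (hφ : IsMollifier φ) (hP : Part P α β) {v w G : ST → E3} {z : ST}
    (h : ∀ i, Integrable fun l : E3 => dot3 (cp v (z + sh l)) (mv (tF α β (prof φ ε) l)
      (cp w (z + sh l))) * cp G (z + sh l) i) (i : Fin 3) :
    moll φ ε (fun n y => ⟪P n (v y), P n (w y)⟫ • G y) z i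
      = ∫ l : E3, dot3 (cp v (z + sh l)) (mv (tF α β (prof φ ε) l) (cp w (z + sh l)))
        * cp G (z + sh l) i := by
  have h1 : ∀ i, (fun l => (scaled φ ε l • (⟪P (dir l) (v (shift z l)), P (dir l) (w (shift z l))⟫
      • G (shift z l))) i) =ᵐ[volume] fun l => dot3 (cp v (z + sh l)) (mv (tF α β (prof φ ε) l)
      (cp w (z + sh l))) * cp G (z + sh l) i := by
    intro i
    filter_upwards [ae_ne_zero] with l hl
    rw [smul_smul, PiLp.smul_apply, smul_eq_mul, scaled_inner_part hφ hP hl, shift_eq]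
    rfl
  rw [moll, integral_apply_E3 fun i => (h i).congr (h1 i).symm, integral_congr_ae (h1 i)]

end

/-! ### Integrals with their values -/

/-- `f` is integrable with integral `c`. -/
def HasInt {X : Type*} [MeasurableSpace X] (μ : Measure X) (f : X → ℝ) (c : ℝ) : Prop :=
  Integrable f μ ∧ ∫ x, f x ∂μ = c

namespace HasInt

variable {X : Type*} [MeasurableSpace X] {μ : Measure X} {f g : X → ℝ} {c c' : ℝ}

theorem of_integrable (h : Integrable f μ) : HasInt μ f (∫ x, f x ∂μ) := ⟨h, rfl⟩

theorem add (h : HasInt μ f c) (h' : HasInt μ g c') : HasInt μ (fun x => f x + g x) (c + c') :=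
  ⟨h.1.add h'.1, by rw [integral_add h.1 h'.1, h.2, h'.2]⟩

theorem sub (h : HasInt μ f c) (h' : HasInt μ g c') : HasInt μ (fun x => f x - g x) (c - c') :=
  ⟨h.1.sub h'.1, by rw [integral_sub h.1 h'.1, h.2, h'.2]⟩

theorem const_mul (h : HasInt μ f c) (k : ℝ) : HasInt μ (fun x => k * f x) (k * c) :=
  ⟨h.1.const_mul k, by rw [integral_const_mul, h.2]⟩

theorem sum {ι : Type*} {s : Finset ι} {F : ι → X → ℝ} {C : ι → ℝ} (h : ∀ i, HasInt μ (F i) (C i)) :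
    HasInt μ (fun x => ∑ i ∈ s, F i x) (∑ i ∈ s, C i) :=
  ⟨integrable_finsetSum _ fun i _ => (h i).1, by
    rw [integral_finsetSum _ fun i _ => (h i).1]
    exact Finset.sum_congr rfl fun i _ => (h i).2⟩

theorem congr (h : HasInt μ f c) (he : ∀ x, g x = f x) (hc : c' = c) : HasInt μ g c' := by
  rw [funext he, hc]
  exact h

end HasInt

/-! ### Sections of forms -/

section

variable {P : Type*} [NormedAddCommGroup P] [NormedSpace ℝ P] [FiniteDimensional ℝ P]
  {m : P → Form V3 2}
  {Ω : Set ST} {b₁ b₂ b₃ : ST → E3} {T : E3 → P}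

theorem LocTame.ae_section (H : LocTame Ω b₁ b₂ b₃) (hΩ : IsOpen Ω) (hm : LTri m)
    (hT : Integrable T) {r : ℝ} (hr : ∀ l : E3, r < ‖l‖ → T l = 0) :
    ∀ᵐ z ∂(volume.restrict Ω), Integrable fun l => m (T l) (two (cp b₁) l z) (two (cp b₂) l z)
      (two (cp b₃) l z) :=
  ae_integrable_of_test hΩ fun _ hψ => H.integrable_two hm hT hr hψ

theorem LocTame.rep (H : LocTame Ω b₁ b₂ b₃) (hm : LTri m)
    (hT : Integrable T) {r : ℝ} (hr : ∀ l : E3, r < ‖l‖ → T l = 0) {X : ST → ℝ}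
    (hX : ∀ᵐ z ∂(volume.restrict Ω), X z = ∫ l, m (T l) (two (cp b₁) l z) (two (cp b₂) l z)
      (two (cp b₃) l z)) :
    Rep Ω volume X fun l z => m (T l) (two (cp b₁) l z) (two (cp b₂) l z) (two (cp b₃) l z) :=
  ⟨hX, fun _ hψ => H.integrable_two hm hT hr hψ⟩

end

theorem LTri.const_mul {P : Type*} [NormedAddCommGroup P] [NormedSpace ℝ P] {N : ℕ}
    {m : P → Form V3 N}
    (h : LTri m) (c : ℝ) : LTri fun t u x w => c * m t u x w where
  lin u x w := ⟨fun t t' => by simp only [(h.lin u x w).map_add]; ring,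
    fun k t => by simp only [(h.lin u x w).map_smul, smul_eq_mul]; ring⟩
  tri t := (h.tri t).const_mul c

section

variable (i : Fin 3)

theorem ltri_lin : LTri fun (t : Fin 3 → V3) (u x w : Fin 2 → V3) =>
    u 0 0 * x 0 0 * mv t (w 1) i := by
  apply ltri_of <;> intros <;> simp [mv, dot3] <;> ring

theorem ltri_quad : LTri fun (t : Fin 3 → V3) (u x w : Fin 2 → V3) =>
    dot3 (w 1) (mv t (u 1)) * x 0 0 := by
  apply ltri_of <;> intros <;> simp [mv, dot3] <;> ring

theorem ltri_cubic : LTri fun (t : Fin 3 → V3) (u x w : Fin 2 → V3) =>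
    dot3 (u 1) (mv t (x 1)) * w 1 i := by
  apply ltri_of <;> intros <;> simp [mv, dot3] <;> ring

theorem ltri_cubic' : LTri fun (t : Fin 3 → V3) (u x w : Fin 2 → V3) =>
    dot3 (w 1) (mv t (u 1)) * x 1 i := by
  apply ltri_of <;> intros <;> simp [mv, dot3] <;> ring

/-- The form of a quadratic tensor. -/
theorem ltri_tensor (k : Fin 3) : LTri fun (t : Fin 3 → V3) (u x w : Fin 2 → V3) =>
    u 1 k * mv t (w 1) i * x 0 0 := by
  apply ltri_of <;> intros <;> simp [mv, dot3] <;> ring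

end

theorem ltri_tq : LTri fun (q : Fin 3 → Fin 3 → V3) (u x w : Fin 2 → V3) =>
    tq q (u 1 - u 0) (w 1 - w 0) (x 1 - x 0) := by
  apply ltri_of <;> intros <;> simp [tq, Fin.sum_univ_three] <;> ring

theorem two_one_zero (l : E3) (z : ST) : two (cp one) l z 0 0 = 1 := by
  simp [two, cp, one, e]

theorem two_zero (u : ST → V3) (l : E3) (z : ST) : two u l z 0 = u z := rfl

theorem two_one (u : ST → V3) (l : E3) (z : ST) : two u l z 1 = u (z + sh l) := rfl

/-! ### The energy and the flux as densities -/

section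

variable {T₀ d : ℝ} {b J : ST → E3} {φ : E3 → ℝ} {ε : ℝ} {P : E3 → E3 → E3} {α β : ℝ}

/-- The integrability of the sections that occur in the mollified quantities. -/
structure Sections (t : E3 → Fin 3 → V3) (b J : ST → E3) (z : ST) : Prop where
  linb : ∀ i, Integrable fun l => mv (t l) (cp b (z + sh l)) i
  linJ : ∀ i, Integrable fun l => mv (t l) (cp J (z + sh l)) i
  quadb : Integrable fun l => dot3 (cp b (z + sh l)) (mv (t l) (cp b (z + sh l)))
  quadJ : Integrable fun l => dot3 (cp J (z + sh l)) (mv (t l) (cp b (z + sh l)))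
  cubic : ∀ i, Integrable fun l => dot3 (cp b (z + sh l)) (mv (t l) (cp b (z + sh l)))
    * cp J (z + sh l) i
  cubic' : ∀ i, Integrable fun l => dot3 (cp J (z + sh l)) (mv (t l) (cp b (z + sh l)))
    * cp b (z + sh l) i

theorem LocalCut.ae_sections {Ω : Set ST} (H : LocalCut Ω d b J) (hΩ : IsOpen Ω)
    {t : E3 → Fin 3 → V3} (ht : Integrable t) {r : ℝ} (hr : ∀ l : E3, r < ‖l‖ → t l = 0) :
    ∀ᵐ z ∂(volume.restrict Ω), Sections t b J z := by
  filter_upwards [ae_all_iff.2 fun i => H.uuf.ae_section hΩ (ltri_lin i) ht hr,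
    ae_all_iff.2 fun i => H.uuh.ae_section hΩ (ltri_lin i) ht hr,
    H.fuf.ae_section hΩ ltri_quad ht hr, H.fuh.ae_section hΩ ltri_quad ht hr,
    ae_all_iff.2 fun i => H.ffh.ae_section hΩ (ltri_cubic i) ht hr,
    ae_all_iff.2 fun i => H.ffh.ae_section hΩ (ltri_cubic' i) ht hr] with z h1 h2 h3 h4 h5 h6
  simp only [two_one_zero, two_one, mul_one, one_mul] at h1 h2 h3 h4 h5 h6
  exact ⟨h1, h2, h3, h4, h5, h6⟩

theorem flux_apply (hφ : IsMollifier φ) (hP : Part P α β) {z : ST}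
    (h : Sections (tF α β (prof φ ε)) b J z) (i : Fin 3) :
    HasInt volume (fun l => d * fluxTri (tF α β (prof φ ε) l) (kd i) (two (cp b) l z)
      (two (cp b) l z) (two (cp J) l z)) (flux d b J φ ε P z i) := by
  have a1 := fun i => HasInt.of_integrable (h.linb i)
  have a2 := fun i => HasInt.of_integrable (h.linJ i)
  have a3 := HasInt.of_integrable h.quadb
  have a4 := HasInt.of_integrable h.quadJ
  have a5 := HasInt.of_integrable (h.cubic i)
  have a6 := HasInt.of_integrable (h.cubic' i)
  have key := ((((((((a2 0).const_mul (b z 0)).add ((a2 1).const_mul (b z 1))).add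
    ((a2 2).const_mul (b z 2))).const_mul (d / 2 * b z i)).add
    (((((a1 0).const_mul (J z 0)).add ((a1 1).const_mul (J z 1))).add
    ((a1 2).const_mul (J z 2))).const_mul (d / 2 * b z i))).sub
    (((((a1 0).const_mul (b z 0)).add ((a1 1).const_mul (b z 1))).add
    ((a1 2).const_mul (b z 2))).const_mul (d / 2 * J z i))).sub (a5.const_mul (d / 4))).add
    ((a3.const_mul (d / 4 * J z i)).add ((a6.const_mul (d / 2)).sub
    (a4.const_mul (d / 2 * b z i))))
  refine key.congr (fun l => ?_) ?_
  · simp only [two_zero, two_one, fluxTri]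
    have e1 : ∀ v : V3, dot3 (kd i) v = v i := by
      intro v
      fin_cases i <;> simp [dot3, kd]
    simp only [e1]
    simp only [dot3, cp]
    ring
  · simp only [flux, PiLp.add_apply, PiLp.sub_apply, PiLp.smul_apply, smul_eq_mul]
    rw [moll_inner_smul hφ hP h.cubic, moll_inner_smul hφ hP h.cubic', moll_inner hφ hP,
      moll_inner hφ hP]
    simp only [inner_eq_dot3, dot3, mollX_apply hφ hP h.linb, mollX_apply hφ hP h.linJ]
    ring

theorem energy_apply (hφ : IsMollifier φ) (hP : Part P α β) {z : ST}
    (h : Sections (tF α β (prof φ ε)) b J z) :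
    HasInt volume (fun l => enTri (tF α β (prof φ ε) l) (two (cp b) l z)
      (two (cp one) l z) (two (cp b) l z)) ⟪mollX φ ε P b z, b z⟫ := by
  have a1 := fun i => HasInt.of_integrable (h.linb i)
  have key := (((a1 0).const_mul (b z 0)).add ((a1 1).const_mul (b z 1))).add
    ((a1 2).const_mul (b z 2))
  refine key.congr (fun l => ?_) ?_
  · simp only [two_zero, two_one, enTri, two_one_zero, dot3, cp, mul_one]
  · simp only [inner_eq_dot3, dot3, mollX_apply hφ hP h.linb]
    ring

theorem locallyIntegrableOn_E3 {Ω : Set ST} (hΩ : IsOpen Ω) {f : ST → E3}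
    (h : ∀ i, LocallyIntegrableOn (fun z => f z i) Ω) : LocallyIntegrableOn f Ω := by
  rw [locallyIntegrableOn_iff hΩ.isLocallyClosed]
  intro K hK hKc
  exact Integrable.of_eval_piLp fun i =>
    (locallyIntegrableOn_iff hΩ.isLocallyClosed).1 (h i) K hK hKc

theorem LocalCut.rep_energy (H : LocalCut (dom T₀) d b J) (hφ : IsMollifier φ) (hε : 0 < ε)
    (hP : Part P α β) : Rep (dom T₀) volume (fun z => ⟪mollX φ ε P b z, b z⟫) fun l z =>
      enTri (tF α β (prof φ ε) l) (two (cp b) l z) (two (cp one) l z) (two (cp b) l z) := by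
  obtain ⟨R, hF⟩ := exists_profile hφ hε
  refine H.fuf.rep ltri_en (integrable_tF α β hF) (fun l hl => tF_eq_zero α β hF hl) ?_
  filter_upwards [H.ae_sections (dom T₀).isOpen (integrable_tF α β hF)
    fun l hl => tF_eq_zero α β hF hl] with z hz
  exact (energy_apply hφ hP hz).2.symm

theorem LocalCut.rep_flux (H : LocalCut (dom T₀) d b J) (hφ : IsMollifier φ) (hε : 0 < ε)
    (hP : Part P α β) (i : Fin 3) : Rep (dom T₀) volume (fun z => flux d b J φ ε P z i) fun l z =>
      d * fluxTri (tF α β (prof φ ε) l) (kd i) (two (cp b) l z) (two (cp b) l z)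
        (two (cp J) l z) := by
  obtain ⟨R, hF⟩ := exists_profile hφ hε
  refine H.ffh.rep ((ltri_flux (kd i)).const_mul d) (integrable_tF α β hF)
    (fun l hl => tF_eq_zero α β hF hl) ?_
  filter_upwards [H.ae_sections (dom T₀).isOpen (integrable_tF α β hF)
    fun l hl => tF_eq_zero α β hF hl] with z hz
  exact (flux_apply hφ hP hz i).2.symm

end

/-! ### The defect terms as densities -/

/-- The kernel `A k i j` multiplied by a bounded array. -/
theorem integrable_array {F : ℝ → ℝ} {R : ℝ} (hF : Profile F R)
    {A : E3 → Fin 3 → Fin 3 → V3} (hA : ∀ k i j, Measurable fun l => A l k i j) {C : ℝ}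
    (hC : ∀ l k i j, |A l k i j| ≤ C) :
    (Integrable fun l : E3 => deriv F ‖l‖ • A l) ∧ Integrable fun l : E3 => (F ‖l‖ / ‖l‖) • A l := by
  obtain ⟨B, hB0, hB⟩ := hF.exists_bound
  have hC0 : 0 ≤ C := (abs_nonneg _).trans (hC 0 0 0 0)
  have hF1 := hF.smooth.continuous.measurable.comp (measurable_norm (α := E3))
  have hF' := hF.smooth.continuous_deriv_one.measurable.comp (measurable_norm (α := E3))
  constructor <;> refine Integrable.of_eval fun k => Integrable.of_eval fun i =>
    Integrable.of_eval fun j => integrable_kernel (C := B * C) (b := R) ?_ (by positivity)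
      (fun l _ => ?_) fun l hl => ?_
  · exact hF'.mul (hA k i j)
  · simp only [Pi.smul_apply, smul_eq_mul, abs_mul]
    have h3 : 0 ≤ ‖l‖⁻¹ := by positivity
    calc _ ≤ B * C := mul_le_mul (hB _ (norm_nonneg _)).2 (hC _ _ _ _) (abs_nonneg _) hB0
      _ ≤ _ := le_mul_of_one_le_right (by positivity) (by linarith)
  · simp [deriv_eq_zero_of_gt hF.zero hl]
  · exact (hF1.div measurable_norm).mul (hA k i j)
  · simp only [Pi.smul_apply, smul_eq_mul, abs_mul, abs_div, abs_norm]
    have h3 : 0 ≤ ‖l‖⁻¹ := by positivity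
    calc _ ≤ B * ‖l‖⁻¹ * C := by
          rw [div_eq_mul_inv]
          exact mul_le_mul (mul_le_mul_of_nonneg_right (hB _ (norm_nonneg _)).1 h3) (hC _ _ _ _)
            (abs_nonneg _) (by positivity)
      _ ≤ _ := by nlinarith [mul_nonneg hB0 hC0]
  · simp [hF.zero _ hl]

theorem ltri_tq' : LTri fun (q : Fin 3 → Fin 3 → V3) (u x w : Fin 2 → V3) =>
    tq q (w 1 - w 0) (u 1 - u 0) (x 1 - x 0) := by
  apply ltri_of <;> intros <;> simp [tq, Fin.sum_univ_three] <;> ring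

/-- The arrays of the integrands of the defect terms. -/
def nnn (l : E3) (k i j : Fin 3) : ℝ := dir l k * (dir l i * dir l j)

/-- The arrays of the integrands of the defect terms. -/
def nk (l : E3) (k i j : Fin 3) : ℝ := dir l k * kd i j

/-- The arrays of the integrands of the defect terms. -/
def kn (l : E3) (k i j : Fin 3) : ℝ := dir l i * kd k j

section

variable {F : ℝ → ℝ} {R : ℝ}

theorem integrable_nnn (hF : Profile F R) : (Integrable fun l : E3 => deriv F ‖l‖ • nnn l) ∧
    Integrable fun l : E3 => (F ‖l‖ / ‖l‖) • nnn l := by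
  refine integrable_array hF (C := 1) (fun k i j => (measurable_dir_apply k).mul
    ((measurable_dir_apply i).mul (measurable_dir_apply j))) fun l k i j => ?_
  rw [nnn, abs_mul, abs_mul]
  exact mul_le_one₀ (abs_dir_le _ _) (by positivity)
    (mul_le_one₀ (abs_dir_le _ _) (by positivity) (abs_dir_le _ _))

theorem integrable_nk (hF : Profile F R) : (Integrable fun l : E3 => deriv F ‖l‖ • nk l) ∧
    Integrable fun l : E3 => (F ‖l‖ / ‖l‖) • nk l := by
  refine integrable_array hF (C := 1) (fun k i j => (measurable_dir_apply k).mul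
    measurable_const) fun l k i j => ?_
  rw [nk, abs_mul]
  exact mul_le_one₀ (abs_dir_le _ _) (by positivity) (abs_kd_le _ _)

theorem integrable_kn (hF : Profile F R) : (Integrable fun l : E3 => deriv F ‖l‖ • kn l) ∧
    Integrable fun l : E3 => (F ‖l‖ / ‖l‖) • kn l := by
  refine integrable_array hF (C := 1) (fun k i j => (measurable_dir_apply i).mul
    measurable_const) fun l k i j => ?_
  rw [kn, abs_mul]
  exact mul_le_one₀ (abs_dir_le _ _) (by positivity) (abs_kd_le _ _)

end

/-- The array of the first integral in the longitudinal defect. -/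
def arrL (F : ℝ → ℝ) (l : E3) : Fin 3 → Fin 3 → V3 :=
  deriv F ‖l‖ • nnn l + (2 : ℝ) • ((F ‖l‖ / ‖l‖) • kn l) - (2 : ℝ) • ((F ‖l‖ / ‖l‖) • nnn l)

/-- The array of the second integral in the longitudinal defect. -/
def arrL' (F : ℝ → ℝ) (l : E3) : Fin 3 → Fin 3 → V3 :=
  deriv F ‖l‖ • nnn l + (2 : ℝ) • ((F ‖l‖ / ‖l‖) • nk l) - (2 : ℝ) • ((F ‖l‖ / ‖l‖) • nnn l)

/-- The array of the first two integrals in the transverse defect. -/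
def arrT (F : ℝ → ℝ) (l : E3) : Fin 3 → Fin 3 → V3 :=
  deriv F ‖l‖ • nk l - deriv F ‖l‖ • nnn l - (2 : ℝ) • ((F ‖l‖ / ‖l‖) • nk l)
    + (2 : ℝ) • ((F ‖l‖ / ‖l‖) • nnn l)

/-- The array of the third integral in the transverse defect. -/
def arrT' (F : ℝ → ℝ) (l : E3) : Fin 3 → Fin 3 → V3 :=
  (2 : ℝ) • ((F ‖l‖ / ‖l‖) • nk l) - (2 : ℝ) • ((F ‖l‖ / ‖l‖) • kn l)

/-- The increment, in components. -/
def inc (u : ST → V3) (l : E3) (z : ST) : V3 := two u l z 1 - two u l z 0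

theorem incr_apply (G : ST → E3) (z : ST) (l : E3) (i : Fin 3) :
    incr G z l i = inc (cp G) l z i := by
  rw [incr, shift_eq]
  rfl

theorem ofLp_incr (G : ST → E3) (z : ST) (l : E3) : (incr G z l).ofLp = inc (cp G) l z :=
  funext fun i => incr_apply G z l i

section

variable {T₀ d : ℝ} {b J : ST → E3} {φ : E3 → ℝ} {ε : ℝ}

theorem tq_nnn (l : E3) (x y w : V3) :
    tq (nnn l) x y w = dot3 (dir l) x * dot3 (dir l) y * dot3 (dir l) w := by
  simp only [tq, nnn, dot3, Fin.sum_univ_three]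
  ring

theorem tq_nk (l : E3) (x y w : V3) : tq (nk l) x y w = dot3 (dir l) x * dot3 y w := by
  simp only [tq, nk, dot3, Fin.sum_univ_three, kd]
  simp
  ring

theorem tq_kn (l : E3) (x y w : V3) : tq (kn l) x y w = dot3 (dir l) y * dot3 x w := by
  simp only [tq, kn, dot3, Fin.sum_univ_three, kd]
  simp
  ring

theorem tq_add (q q' : Fin 3 → Fin 3 → V3) (x y w : V3) :
    tq (q + q') x y w = tq q x y w + tq q' x y w := by
  simp only [tq, Pi.add_apply, add_mul, Finset.sum_add_distrib]

theorem tq_smul (c : ℝ) (q : Fin 3 → Fin 3 → V3) (x y w : V3) :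
    tq (c • q) x y w = c * tq q x y w := by
  simp only [tq, Pi.smul_apply, smul_eq_mul, Finset.mul_sum, mul_assoc]

theorem tq_sub (q q' : Fin 3 → Fin 3 → V3) (x y w : V3) :
    tq (q - q') x y w = tq q x y w - tq q' x y w := by
  simp only [tq, Pi.sub_apply, sub_mul, Finset.sum_sub_distrib]

theorem longi_inner {n : E3} (hn : dot3 n n = 1) (v w : E3) :
    ⟪longi n v, longi n w⟫ = dot3 n v * dot3 n w := by
  rw [part_longi.inner hn]
  simp only [dot3, mv, pm]
  ring

theorem trans_inner {n : E3} (hn : dot3 n n = 1) (v w : E3) :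
    ⟪trans n v, trans n w⟫ = dot3 v w - dot3 n v * dot3 n w := by
  rw [part_trans.inner hn]
  simp only [dot3, mv, pm, kd]
  simp
  ring

theorem dot3_comm (v w : V3) : dot3 v w = dot3 w v := by
  simp only [dot3]
  ring

theorem defectTri_two (q : Fin 3 → Fin 3 → V3) (u v : ST → V3) (l : E3) (z : ST) :
    defectTri q (two u l z) (two u l z) (two v l z)
      = 1 / 2 * tq q (inc u l z) (inc v l z) (inc u l z)
        - 1 / 4 * tq q (inc v l z) (inc u l z) (inc u l z) := rfl

theorem qF_eq (α β : ℝ) (F : ℝ → ℝ) (l : E3) (x y w : V3) :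
    tq (qF α β F (deriv F) l) x y w
      = deriv F ‖l‖ * (α * (dot3 (dir l) x * dot3 y w)
          + β * (dot3 (dir l) x * dot3 (dir l) y * dot3 (dir l) w))
        + F ‖l‖ / ‖l‖ * (β * (dot3 x y * dot3 (dir l) w + dot3 (dir l) y * dot3 x w
          - 2 * (dot3 (dir l) x * dot3 (dir l) y * dot3 (dir l) w))) := by
  simp only [tq, qF, pm, dot3, Fin.sum_univ_three, kd]
  simp
  ring

/-- The integrability of the sections that occur in the defect terms. -/
structure DefectSections (F : ℝ → ℝ) (b J : ST → E3) (z : ST) : Prop where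
  L : Integrable fun l => tq (arrL F l) (inc (cp b) l z) (inc (cp J) l z) (inc (cp b) l z)
  L' : Integrable fun l => tq (arrL' F l) (inc (cp J) l z) (inc (cp b) l z) (inc (cp b) l z)
  T : Integrable fun l => tq (arrT F l) (inc (cp J) l z) (inc (cp b) l z) (inc (cp b) l z)
  T' : Integrable fun l => tq (arrT F l) (inc (cp b) l z) (inc (cp J) l z) (inc (cp b) l z)
  T'' : Integrable fun l => tq (arrT' F l) (inc (cp b) l z) (inc (cp J) l z) (inc (cp b) l z)

theorem LocalCut.ae_defectSections {Ω : Set ST} (H : LocalCut Ω d b J) (hΩ : IsOpen Ω) {F : ℝ → ℝ}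
    {R : ℝ} (hF : Profile F R) : ∀ᵐ z ∂(volume.restrict Ω), DefectSections F b J z := by
  obtain ⟨a1, a2⟩ := integrable_nnn hF
  obtain ⟨b1, b2⟩ := integrable_nk hF
  obtain ⟨c1, c2⟩ := integrable_kn hF
  have hL : Integrable (arrL F) := (a1.add (c2.smul (2 : ℝ))).sub (a2.smul (2 : ℝ))
  have hL' : Integrable (arrL' F) := (a1.add (b2.smul (2 : ℝ))).sub (a2.smul (2 : ℝ))
  have hT : Integrable (arrT F) := ((b1.sub a1).sub (b2.smul (2 : ℝ))).add (a2.smul (2 : ℝ))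
  have hT' : Integrable (arrT' F) := (b2.smul (2 : ℝ)).sub (c2.smul (2 : ℝ))
  have h0 : ∀ l : E3, R < ‖l‖ → F ‖l‖ = 0 ∧ deriv F ‖l‖ = 0 := fun l hl =>
    ⟨hF.zero _ hl, deriv_eq_zero_of_gt hF.zero hl⟩
  filter_upwards [
    H.ffh.ae_section hΩ ltri_tq hL (r := R) fun l hl => by simp [arrL, h0 l hl],
    H.ffh.ae_section hΩ ltri_tq' hL' (r := R) fun l hl => by simp [arrL', h0 l hl],
    H.ffh.ae_section hΩ ltri_tq' hT (r := R) fun l hl => by simp [arrT, h0 l hl],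
    H.ffh.ae_section hΩ ltri_tq hT (r := R) fun l hl => by simp [arrT, h0 l hl],
    H.ffh.ae_section hΩ ltri_tq hT' (r := R) fun l hl => by simp [arrT', h0 l hl]]
    with z h1 h2 h3 h4 h5
  exact ⟨h1, h2, h3, h4, h5⟩

theorem DEL_eq (hφ : IsMollifier φ) (hε : 0 < ε) {z : ST} (h : DefectSections (prof φ ε) b J z) :
    2 / 3 * DEL d b J φ ε z = ∫ l, d * defectTri (qF 0 1 (prof φ ε) (deriv (prof φ ε)) l)
      (two (cp b) l z) (two (cp b) l z) (two (cp J) l z) := by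
  have key := (((HasInt.of_integrable h.L).const_mul (1 / 2)).sub
    ((HasInt.of_integrable h.L').const_mul (1 / 4))).const_mul d
  refine Eq.trans (Eq.trans (congrArg (2 / 3 * ·) (congrArg₂ (3 * d / 4 * · - 3 * d / 8 * ·)
    ((integral_congr_ae ?_).trans (HasInt.of_integrable h.L).2)
    ((integral_congr_ae ?_).trans (HasInt.of_integrable h.L').2))) (Eq.trans ?_ key.2.symm))
    (integral_congr_ae (.of_forall fun l => ?_))
  rotate_left 2
  · ring
  · simp only [defectTri_two, arrL, arrL', tq_add, tq_sub, tq_smul, tq_nnn, tq_nk, tq_kn, qF_eq]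
    rw [dot3_comm (inc (cp J) l z) (inc (cp b) l z)]
    ring
  all_goals
    filter_upwards [ae_ne_zero] with l hl
    have hn := dot3_dir hl
    simp only [gradient_scaled hφ hε hl, ← real_inner_self_eq_norm_sq, longi_inner hn,
      trans_inner hn, ← prof_norm hφ, arrL, arrL', tq_add, tq_sub, tq_smul, tq_nnn, tq_kn, tq_nk,
      inner_add_right, inner_sub_right, inner_smul_right, real_inner_smul_left, inner_eq_dot3,
      ofLp_incr, dot3_comm (inc (cp J) l z) (inc (cp b) l z)]
    ring

theorem DET_eq (hφ : IsMollifier φ) (hε : 0 < ε) {z : ST} (h : DefectSections (prof φ ε) b J z) :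
    4 / 3 * DET d b J φ ε z = ∫ l, d * defectTri (qF 1 (-1) (prof φ ε) (deriv (prof φ ε)) l)
      (two (cp b) l z) (two (cp b) l z) (two (cp J) l z) := by
  have key := ((((HasInt.of_integrable h.T').const_mul (1 / 2)).add
    ((HasInt.of_integrable h.T'').const_mul (1 / 2))).sub
    ((HasInt.of_integrable h.T).const_mul (1 / 4))).const_mul d
  refine Eq.trans (Eq.trans (congrArg (4 / 3 * ·) (congrArg₂ (· + 3 * d / 8 * ·) (congrArg₂
    (-(3 * d / 16) * · + 3 * d / 8 * ·) ((integral_congr_ae ?_).trans (HasInt.of_integrable h.T).2)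
    ((integral_congr_ae ?_).trans (HasInt.of_integrable h.T').2))
    ((integral_congr_ae ?_).trans (HasInt.of_integrable h.T'').2))) (Eq.trans ?_ key.2.symm)) (integral_congr_ae (.of_forall fun l => ?_))
  rotate_left 3
  · ring
  · simp only [defectTri_two, arrT, arrT', tq_add, tq_sub, tq_smul, tq_nnn, tq_nk, tq_kn, qF_eq]
    rw [dot3_comm (inc (cp J) l z) (inc (cp b) l z)]
    ring
  all_goals
    filter_upwards [ae_ne_zero] with l hl
    have hn := dot3_dir hl
    simp only [gradient_scaled hφ hε hl, ← real_inner_self_eq_norm_sq, trans_inner hn,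
      ← prof_norm hφ, arrT, arrT', tq_add, tq_sub, tq_smul, tq_nnn, tq_nk, tq_kn, inner_sub_right,
      inner_smul_right, real_inner_smul_left, inner_eq_dot3, ofLp_incr,
      dot3_comm (inc (cp J) l z) (inc (cp b) l z)]
    ring

theorem LocalCut.rep_of_sections {Ω : Set ST} (hΩ : IsOpen Ω) (H : LocalCut Ω d b J) (α β : ℝ)
    {F : ℝ → ℝ} {R : ℝ} (hF : Profile F R) {D : ST → ℝ}
    (hD : ∀ z, DefectSections F b J z → D z = ∫ l, d * defectTri (qF α β F (deriv F) l)
      (two (cp b) l z) (two (cp b) l z) (two (cp J) l z)) :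
    Rep Ω volume D fun l z => d * defectTri (qF α β F (deriv F) l)
      (two (cp b) l z) (two (cp b) l z) (two (cp J) l z) :=
  H.ffh.rep (ltri_defect.const_mul d) (integrable_qF α β hF) (fun l hl => qF_eq_zero α β hF hl)
    ((H.ae_defectSections hΩ hF).mono hD)

end

/-! ### Distributional derivatives -/

section

variable {T₀ : ℝ}

theorem TestFunction.isTest {Ω : Opens ST} (ψ : 𝓓(Ω, ℝ)) : IsTest Ω ψ :=
  ⟨ψ.contDiff, ψ.hasCompactSupport, ψ.tsupport_subset⟩

/-- A smooth function with compact support as a test function. -/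
def IsTest.toTest {Ω : Opens ST} {ψ : ST → ℝ} (h : IsTest Ω ψ) : 𝓓(Ω, ℝ) :=
  ⟨ψ, h.smooth, h.compact, h.subset⟩

theorem lineDeriv_test {Ω : Opens ST} (ψ : 𝓓(Ω, ℝ)) (v : ST) :
    ((∂_{v} ψ : 𝓓(Ω, ℝ)) : ST → ℝ) = fun z => fderiv ℝ ψ z v := by
  funext z
  exact (TestFunction.lineDerivCLM_apply_of_le (𝕜 := ℝ) le_rfl).trans
    (ψ.contDiff.differentiable (by simp)).differentiableAt.lineDeriv_eq_fderiv

theorem dt_apply (u : 𝓓'(dom T₀, ℝ)) (ψ : 𝓓(dom T₀, ℝ)) :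
    dt u ψ = -u (∂_{((1, 0) : ST)} ψ) :=
  (Distribution.lineDerivOp_apply_apply u ψ _).trans (map_neg _ _)

theorem dx_apply (i : Fin 3) (u : 𝓓'(dom T₀, ℝ)) (ψ : 𝓓(dom T₀, ℝ)) :
    dx i u ψ = -u (∂_{((0, e i) : ST)} ψ) :=
  (Distribution.lineDerivOp_apply_apply u ψ _).trans (map_neg _ _)

theorem gr_eq_lineDeriv (ψ : 𝓓(dom T₀, ℝ)) (i : Fin 3) :
    ((∂_{((0, e i) : ST)} ψ : 𝓓(dom T₀, ℝ)) : ST → ℝ) = fun z => gr ψ z i :=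
  lineDeriv_test ψ _

theorem dx_comm (i j : Fin 3) (u : 𝓓'(dom T₀, ℝ)) : dx i (dx j u) = dx j (dx i u) := by
  ext ψ
  rw [dx_apply, dx_apply, dx_apply, dx_apply]
  congr 3
  ext z
  rw [lineDeriv_test, lineDeriv_test, lineDeriv_test, lineDeriv_test]
  have hψ : ContDiff ℝ 2 ψ := ψ.contDiff.of_le (by
    exact WithTop.coe_le_coe.2 (le_top : (2 : ℕ∞) ≤ ⊤))
  have h1 : ∀ v w : ST, fderiv ℝ (fun z => fderiv ℝ ψ z v) z w = fderiv ℝ (fderiv ℝ ψ) z w v := by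
    intro v w
    have h2 : DifferentiableAt ℝ (fderiv ℝ ψ) z :=
      ((hψ.fderiv_right (m := 1) le_rfl).differentiable one_ne_zero) z
    rw [fderiv_clm_apply h2 (differentiableAt_const v)]
    simp
  refine (h1 _ _).trans (Eq.trans ?_ (h1 _ _).symm)
  exact (hψ.contDiffAt.isSymmSndFDerivAt (by simp)).eq _ _

theorem div_apply (u : Fin 3 → 𝓓'(dom T₀, ℝ)) (ψ : 𝓓(dom T₀, ℝ)) :
    div u ψ = -∑ i, u i (∂_{((0, e i) : ST)} ψ) := by
  simp only [div, Fin.sum_univ_three, add_apply, dx_apply]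
  ring

end

/-! ### Sections of locally integrable fields -/

section

variable {T₀ : ℝ}

theorem ae_dom_iff {p : ST → Prop} : (∀ᵐ z ∂(volume.restrict (dom T₀ : Set ST)), p z) ↔
    ∀ᵐ z : ST, z.1 ∈ Ioo 0 T₀ → p z := by
  rw [ae_restrict_iff' (dom T₀).isOpen.measurableSet]
  simp [dom, Opens.coe_mk]

theorem ae_locallyIntegrable_section {f : ST → E3} (hf : LocallyIntegrableOn f (dom T₀)) :
    ∀ᵐ z ∂(volume.restrict (dom T₀ : Set ST)), LocallyIntegrable fun x : E3 => f (z.1, x) := by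
  set A : ℕ → Set ℝ := fun n => Icc (1 / ((n : ℝ) + 1)) (T₀ - 1 / ((n : ℝ) + 1))
  have h1 : ∀ n : ℕ, ∀ᵐ t : ℝ, t ∈ A n → IntegrableOn (fun x : E3 => f (t, x))
      (Metric.closedBall 0 n) := by
    intro n
    have hK : IsCompact (A n ×ˢ 𝔹 (n : ℝ)) :=
      isCompact_Icc.prod (isCompact_closedBall _ _)
    have hsub : A n ×ˢ 𝔹 (n : ℝ) ⊆ (dom T₀ : Set ST) := by
      rintro ⟨t, x⟩ ⟨ht, -⟩
      have : (0 : ℝ) < 1 / ((n : ℝ) + 1) := by positivity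
      exact ⟨⟨this.trans_le ht.1, ht.2.trans_lt (by linarith)⟩, trivial⟩
    have h2 := (locallyIntegrableOn_iff (dom T₀).isOpen.isLocallyClosed).1 hf _ hsub hK
    rw [IntegrableOn, Measure.volume_eq_prod, ← Measure.prod_restrict] at h2
    exact (ae_restrict_iff' measurableSet_Icc).1 h2.prod_right_ae
  rw [ae_dom_iff]
  have h3 : ∀ᵐ z : ST, ∀ n : ℕ, z.1 ∈ A n → IntegrableOn (fun x : E3 => f (z.1, x))
      (Metric.closedBall 0 n) :=
    Measure.quasiMeasurePreserving_fst.ae (ae_all_iff.2 h1)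
  filter_upwards [h3] with z hz hzT
  rw [locallyIntegrable_iff]
  intro K hK
  obtain ⟨r, hr⟩ := hK.isBounded.subset_closedBall (0 : E3)
  obtain ⟨n₁, hn₁⟩ := exists_nat_ge r
  obtain ⟨n₂, hn₂⟩ := exists_nat_one_div_lt hzT.1
  obtain ⟨n₃, hn₃⟩ := exists_nat_one_div_lt (sub_pos.2 hzT.2)
  have hmono : ∀ {m n : ℕ}, m ≤ n → 1 / ((n : ℝ) + 1) ≤ 1 / ((m : ℝ) + 1) := fun h =>
    Nat.one_div_le_one_div h
  set n := max n₁ (max n₂ n₃)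
  have e2 : n₂ ≤ n := (le_max_left _ _).trans (le_max_right _ _)
  have e3 : n₃ ≤ n := (le_max_right _ _).trans (le_max_right _ _)
  refine (hz n ⟨(hmono e2).trans hn₂.le, ?_⟩).mono_set (hr.trans
    (Metric.closedBall_subset_closedBall (hn₁.trans (by exact_mod_cast le_max_left _ _))))
  have := hmono e3
  linarith

theorem ae_shift {p : ST → Prop} (h : ∀ᵐ z ∂(volume.restrict (dom T₀ : Set ST)), p z) :
    ∀ᵐ z ∂(volume.restrict (dom T₀ : Set ST)), ∀ᵐ y : E3, p (z + sh y) := by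
  rw [ae_dom_iff] at h ⊢
  rw [Measure.volume_eq_prod] at h
  have h1 := Measure.ae_ae_of_ae_prod h
  have h2 : ∀ᵐ z : ST, ∀ᵐ x : E3, z.1 ∈ Ioo 0 T₀ → p (z.1, x) :=
    Measure.quasiMeasurePreserving_fst.ae h1
  filter_upwards [h2] with z hz hzT
  have h3 := (measurePreserving_add_left volume z.2).quasiMeasurePreserving.ae hz
  filter_upwards [h3] with y hy
  have : z + sh y = (z.1, z.2 + y) := by simp [sh, Prod.ext_iff]
  rw [this]
  exact hy hzT

end

/-! ### The divergence of mollified tensors -/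

section

variable {ρ : E3 → ℝ} {δ : ℝ}

theorem contDiff_one_scaled (hρ : IsMollifier ρ) (δ : ℝ) : C¹ (scaled ρ δ) :=
  (contDiff_scaled hρ δ).of_le (by exact_mod_cast le_top)

theorem gs_scaled_neg (hρ : IsMollifier ρ) (y : E3) (k : Fin 3) :
    fderiv ℝ (scaled ρ δ) (-y) (e k) = -gs (scaled ρ δ) y k := by
  have h1 : (fun y => scaled ρ δ (-y)) = scaled ρ δ :=
    funext fun y => scaled_radial hρ δ (norm_neg y)
  have h2 : HasFDerivAt (fun y => scaled ρ δ (-y)) ((fderiv ℝ (scaled ρ δ) (-y)).comp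
      (-ContinuousLinearMap.id ℝ E3)) y :=
    ((contDiff_one_scaled hρ δ).differentiable one_ne_zero (-y)).hasFDerivAt.comp y
      (hasFDerivAt_id y).neg
  rw [h1] at h2
  rw [gs, h2.fderiv]
  simp

theorem lineDeriv_moll (hρ : IsMollifier ρ) (hδ : 0 < δ) {g : ST → E3} {z : ST}
    (hg : LocallyIntegrable fun x : E3 => g (z.1, x)) (k : Fin 3) :
    lineDeriv ℝ (fun x : E3 => moll ρ δ (fun _ w => g w) (z.1, x)) z.2 (e k)
      = -∫ y : E3, gs (scaled ρ δ) y k • g (z + sh y) := by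
  set G : E3 → E3 := fun x => g (z.1, x)
  have h1 : (fun x : E3 => moll ρ δ (fun _ w => g w) (z.1, x))
      = convolution (scaled ρ δ) G (ContinuousLinearMap.lsmul ℝ ℝ) volume := by
    funext x
    rw [convolution, ← integral_neg_eq_self]
    refine integral_congr_ae (.of_forall fun l => ?_)
    simp only [ContinuousLinearMap.lsmul_apply, sub_neg_eq_add, shift, G]
    rw [scaled_radial hρ δ (norm_neg l)]
  have h2 := (hasCompactSupport_scaled hρ hδ).hasFDerivAt_convolution_left
    (ContinuousLinearMap.lsmul ℝ ℝ) (contDiff_one_scaled hρ δ) hg z.2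
  rw [h1, (h2.hasLineDerivAt (e k)).lineDeriv, convolution]
  have h3 := ((hasCompactSupport_scaled hρ hδ).fderiv (𝕜 := ℝ)).convolutionExists_left
    ((ContinuousLinearMap.lsmul ℝ ℝ : ℝ →L[ℝ] E3 →L[ℝ] E3).precompL E3)
    ((contDiff_one_scaled hρ δ).continuous_fderiv one_ne_zero) hg z.2
  rw [ContinuousLinearMap.integral_apply h3, ← integral_neg_eq_self, ← integral_neg]
  refine integral_congr_ae (.of_forall fun l => ?_)
  simp only [ContinuousLinearMap.precompL_apply, ContinuousLinearMap.lsmul_apply, sub_neg_eq_add]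
  rw [gs_scaled_neg hρ, neg_smul]
  rw [← shift_eq]
  rfl

theorem integrable_gs_smul (hρ : IsMollifier ρ) (hδ : 0 < δ) {g : ST → E3} {z : ST}
    (hg : LocallyIntegrable fun x : E3 => g (z.1, x)) (k : Fin 3) :
    Integrable fun y : E3 => gs (scaled ρ δ) y k • g (z + sh y) := by
  have h1 : LocallyIntegrable fun y : E3 => g (z + sh y) := by
    rw [locallyIntegrable_iff]
    intro K hK
    have h3 := (locallyIntegrable_iff.1 hg) _ (hK.image (continuous_const_add z.2))
    rw [← (measurePreserving_add_left volume z.2).integrableOn_comp_preimage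
      (Homeomorph.addLeft z.2).measurableEmbedding, preimage_image_eq _ (add_right_injective _)] at h3
    refine h3.congr_fun (fun y _ => ?_) hK.measurableSet
    simp only [← shift_eq, shift, Function.comp]
  have h2 := (contDiff_one_scaled hρ δ).continuous_fderiv one_ne_zero
  exact h1.integrable_smul_left_of_hasCompactSupport (h2.clm_apply continuous_const)
    (HasCompactSupport.intro (hasCompactSupport_scaled hρ hδ) fun y hy => by
      rw [gs_eq_zero hy]; rfl)

/-- The mollified divergence, in components. -/
theorem divMoll_apply (hρ : IsMollifier ρ) (hδ : 0 < δ) {A : ST → Fin 3 → E3} {z : ST}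
    (hA : ∀ k, LocallyIntegrable fun x : E3 => A (z.1, x) k) (j : Fin 3) :
    HasInt volume (fun y => -∑ k, gs (scaled ρ δ) y k * A (z + sh y) k j) (divMoll ρ δ A z j) := by
  have h1 := fun k => integrable_gs_smul hρ hδ (g := fun w => A w k) (hA k) k
  have h2 : ∀ k j, Integrable fun y : E3 => gs (scaled ρ δ) y k * A (z + sh y) k j := fun k j =>
    Integrable.eval_piLp (h1 k) j
  refine ⟨(integrable_finsetSum _ fun k _ => h2 k j).neg, ?_⟩
  rw [integral_neg, integral_finsetSum _ fun k _ => h2 k j, divMoll]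
  simp only [Fin.sum_univ_three, PiLp.add_apply]
  simp only [lineDeriv_moll hρ hδ (g := fun w => A w _) (hA _), PiLp.neg_apply]
  simp only [integral_apply_E3 fun j => Integrable.eval_piLp (h1 _) j]
  simp only [PiLp.smul_apply, smul_eq_mul]
  ring

end

/-! ### Approximate identities -/

theorem tendsto_scaled {ρ : E3 → ℝ} (hρ : IsMollifier ρ) {I : E3 → ℝ} (hI : ContinuousAt I 0)
    (hint : ∀ δ > 0, Integrable fun y => scaled ρ δ y * I y) :
    Tendsto (fun δ => ∫ y, scaled ρ δ y * I y) (𝓝[>] 0) (𝓝 (I 0)) := by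
  obtain ⟨R, hR0, hR⟩ := exists_support_radius hρ
  rw [Metric.tendsto_nhds]
  intro ε hε
  obtain ⟨η, hη, hηI⟩ := Metric.continuousAt_iff.1 hI (ε / 2) (by positivity)
  have h1 : ∀ᶠ δ in 𝓝[>] (0 : ℝ), δ < η / R :=
    nhdsWithin_le_nhds (Iio_mem_nhds (by positivity))
  filter_upwards [h1, self_mem_nhdsWithin] with δ hδ hδ0
  have hδ0 : 0 < δ := hδ0
  have i1 : Integrable (scaled ρ δ) := (contDiff_scaled hρ δ).continuous.integrable_of_hasCompactSupport
    (hasCompactSupport_scaled hρ hδ0)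
  have h2 : (∫ y, scaled ρ δ y * I y) - I 0 = ∫ y, scaled ρ δ y * (I y - I 0) := by
    simp only [mul_sub]
    rw [integral_sub (hint δ hδ0) (i1.mul_const _), integral_mul_const, integral_scaled hρ hδ0,
      one_mul]
  rw [Real.dist_eq, h2]
  refine lt_of_le_of_lt ?_ (half_lt_self hε)
  rw [← Real.norm_eq_abs]
  calc ‖∫ y, scaled ρ δ y * (I y - I 0)‖ ≤ ∫ y, scaled ρ δ y * (ε / 2) := by
        refine norm_integral_le_of_norm_le (i1.mul_const _) (.of_forall fun y => ?_)
        rw [norm_mul, Real.norm_of_nonneg (scaled_nonneg hρ hδ0.le y)]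
        by_cases hy : δ * R ≤ ‖y‖
        · rw [scaled_eq_zero hR hδ0 hy, zero_mul, zero_mul]
        · refine mul_le_mul_of_nonneg_left ?_ (scaled_nonneg hρ hδ0.le y)
          have h3 : dist y 0 < η := by
            rw [dist_zero_right]
            exact (not_le.1 hy).trans ((lt_div_iff₀ hR0).1 hδ)
          exact (hηI h3).le
    _ = ε / 2 := by rw [integral_mul_const, integral_scaled hρ hδ0, one_mul]

theorem integral_assoc {g : E3 → E3 → ST → ℝ}
    (h : Integrable (fun p : (E3 × E3) × ST => g p.1.1 p.1.2 p.2) (volume.prod volume)) :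
    (Integrable fun y => ∫ q : E3 × ST, g y q.1 q.2 ∂(volume.prod volume)) ∧
    ∫ p : (E3 × E3) × ST, g p.1.1 p.1.2 p.2 ∂(volume.prod volume)
      = ∫ y, ∫ q : E3 × ST, g y q.1 q.2 ∂(volume.prod volume) := by
  have h0 := measurePreserving_prodAssoc (volume : Measure E3) (volume : Measure E3)
    (volume : Measure ST)
  have h1 : Integrable (fun p : E3 × E3 × ST => g p.1 p.2.1 p.2.2)
      (volume.prod (volume.prod volume)) :=
    (h0.integrable_comp_emb MeasurableEquiv.prodAssoc.measurableEmbedding).1 h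
  refine ⟨h1.integral_prod_left, ?_⟩
  rw [← integral_prod _ h1, ← h0.integral_comp MeasurableEquiv.prodAssoc.measurableEmbedding]
  rfl

/-! ### Products of mollified divergences with fields -/

theorem HasInt.prod {X Y : Type*} [MeasurableSpace X] [MeasurableSpace Y] {μ : Measure X}
    {ν : Measure Y} [SFinite μ] [SFinite ν] {f : X → ℝ} {g : Y → ℝ} {c c' : ℝ} (h : HasInt μ f c)
    (h' : HasInt ν g c') : HasInt (μ.prod ν) (fun p => f p.1 * g p.2) (c * c') :=
  ⟨h.1.mul_prod h'.1, by rw [integral_prod_mul, h.2, h'.2]⟩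

theorem sh_add (x y : E3) : sh (x + y) = sh x + sh y := by simp [sh]

theorem cross_apply (v w : E3) (i : Fin 3) :
    cross v w i = v (i + 1) * w (i + 2) - v (i + 2) * w (i + 1) := by
  fin_cases i <;> simp [cross, crossProduct]

theorem dot3_kd (i : Fin 3) (v : V3) : dot3 (kd i) v = v i := by
  fin_cases i <;> simp [dot3, kd]

section

variable {T₀ d : ℝ} {b J : ST → E3} {φ ρ : E3 → ℝ} {ε δ : ℝ} {P : E3 → E3 → E3} {α β : ℝ}

theorem LocalCut.locallyIntegrableOn_tensor (H : LocalCut (dom T₀) d b J) (k : Fin 3) :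
    LocallyIntegrableOn (fun z => tensor b z k) (dom T₀) := by
  rw [locallyIntegrableOn_iff (dom T₀).isOpen.isLocallyClosed]
  intro K hKΩ hK
  obtain ⟨Q, f, h, hC, -, -, hf⟩ := H K hKΩ hK 0
  have hfin : IsFiniteMeasure ((volume : Measure ST).restrict K) :=
    ⟨by simpa using hK.measure_lt_top⟩
  have h1 : MemLp f 2 (volume.restrict K) :=
    (hC.tame.hf.restrict K).mono_exponent (by norm_num)
  have h2 : ∀ k, MemLp (fun z => f z k) 2 (volume.restrict K) := fun k => MemLp.eval_piLp h1 k
  have h3 : IntegrableOn (fun z => f z k • f z) K :=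
    Integrable.of_eval_piLp fun i => (h2 k).integrable_mul (h2 i)
  refine h3.congr_fun (fun z hz => ?_) hK.measurableSet
  have : f z = b z := by simpa [sh_zero] using (hf z hz 0 (by simp)).2.1
  simp only [tensor, this]

theorem tensorX_apply (hφ : IsMollifier φ) (hP : Part P α β) {z : ST} {k : Fin 3}
    (h : ∀ i, Integrable fun l : E3 => cp b (z + sh l) k * mv (tF α β (prof φ ε) l)
      (cp b (z + sh l)) i) (i : Fin 3) :
    tensorX φ ε P b z k i = ∫ l : E3, cp b (z + sh l) k * mv (tF α β (prof φ ε) l)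
      (cp b (z + sh l)) i := by
  have h1 : ∀ (l : E3) i, (scaled φ ε l • (b (shift z l) k • P (dir l) (b (shift z l)))) i
      = cp b (z + sh l) k * mv (tF α β (prof φ ε) l) (cp b (z + sh l)) i := fun l i => by
    rw [smul_comm, PiLp.smul_apply, scaled_smul_part hφ hP, shift_eq]
    rfl
  rw [tensorX, moll, integral_apply_E3 fun i => by simpa only [h1] using h i]
  simp only [h1]

theorem LocalCut.ae_tensor {Ω : Set ST} (H : LocalCut Ω d b J) (hΩ : IsOpen Ω)
    {t : E3 → Fin 3 → V3} (ht : Integrable t) {r : ℝ} (hr : ∀ l : E3, r < ‖l‖ → t l = 0) :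
    ∀ᵐ z ∂(volume.restrict Ω), ∀ k i, Integrable fun l : E3 => cp b (z + sh l) k * mv (t l)
      (cp b (z + sh l)) i := by
  filter_upwards [ae_all_iff.2 fun k => ae_all_iff.2 fun i =>
    H.fuf.ae_section hΩ (ltri_tensor i k) ht hr] with z hz k i
  simpa only [two_one_zero, two_one, mul_one] using hz k i

theorem LocalCut.ae_locallyIntegrable_tensorX (H : LocalCut (dom T₀) d b J) (hφ : IsMollifier φ)
    (hε : 0 < ε) (hP : Part P α β) : ∀ᵐ z ∂(volume.restrict (dom T₀ : Set ST)), ∀ k,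
      LocallyIntegrable fun x : E3 => tensorX φ ε P b (z.1, x) k := by
  obtain ⟨R, hF⟩ := exists_profile hφ hε
  refine ae_all_iff.2 fun k => ae_locallyIntegrable_section (f := fun z => tensorX φ ε P b z k)
    (locallyIntegrableOn_E3 (dom T₀).isOpen fun i => ?_)
  refine (H.fuf.rep (ltri_tensor i k) (integrable_tF α β hF) (fun l hl => tF_eq_zero α β hF hl)
    ?_).locallyIntegrableOn (dom T₀).isOpen
  filter_upwards [H.ae_tensor (dom T₀).isOpen (integrable_tF α β hF)
    fun l hl => tF_eq_zero α β hF hl] with z hz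
  simp only [two_one_zero, two_one, mul_one]
  exact tensorX_apply hφ hP (hz k) i

/-- The tensor with the direction-dependent mollification, as an integral over the sections. -/
theorem LocalCut.ae_conv_tensorX (H : LocalCut (dom T₀) d b J) (hφ : IsMollifier φ)
    (hε : 0 < ε) (hP : Part P α β) (hρ : IsMollifier ρ) (hδ : 0 < δ) :
    ∀ᵐ z ∂(volume.restrict (dom T₀ : Set ST)), ∀ k i, HasInt (volume.prod volume)
      (fun y : E3 × E3 => gs (scaled ρ δ) y.1 k * (cp b (z + sh (y.1 + y.2)) k
        * mv (tF α β (prof φ ε) y.2) (cp b (z + sh (y.1 + y.2))) i))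
      (∫ y, gs (scaled ρ δ) y k * tensorX φ ε P b (z + sh y) k i) := by
  obtain ⟨R, hF⟩ := exists_profile hφ hε
  have hρ1 := contDiff_one_scaled hρ δ
  have hρc := hasCompactSupport_scaled hρ hδ
  obtain ⟨r, hr0, hρr⟩ := exists_tsupport_subset hρc
  have h1 : ∀ k i, ∀ᵐ z ∂(volume.restrict (dom T₀ : Set ST)), Integrable
      (fun y : E3 × E3 => gs (scaled ρ δ) y.1 k * (cp b (z + sh (y.1 + y.2)) k
        * mv (tF α β (prof φ ε) y.2) (cp b (z + sh (y.1 + y.2))) i)) (volume.prod volume) := by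
    intro k i
    have z1 : (∀ y : E3 × E3, y.1 ∉ tsupport (scaled ρ δ) → gs (scaled ρ δ) y.1 k • tF α β (prof φ ε) y.2 = 0)
      ∧ ∀ y : E3 × E3, R < ‖y.2‖ → gs (scaled ρ δ) y.1 k • tF α β (prof φ ε) y.2 = 0 := by
      constructor <;> intro y hy
      · rw [gs_eq_zero hy, Pi.zero_apply, zero_smul]
      · rw [tF_eq_zero α β hF hy, smul_zero]
    refine (ae_integrable_of_test (dom T₀).isOpen (M := fun (y : E3 × E3) z =>
      (fun (t : Fin 3 → V3) (u x w : Fin 2 → V3) => u 1 k * mv t (w 1) i * x 0 0)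
        (gs (scaled ρ δ) y.1 k • tF α β (prof φ ε) y.2) (vals b pa y z) (vals one pa y z)
        (vals b pa y z)) fun ψ hψ => H.fuf.integrable (ltri_tensor i k)
        (integrable_mul_prod (integrable_gs hρ1 hρc k) (integrable_tF α β hF))
        (fun a => (continuous_pa a).measurable)
        (fun y hy a => norm_pa_le y a (mem_support_pair hρr z1.1 z1.2 y hy)) hψ).mono fun z hz => hz.congr (.of_forall fun y => ?_)
    simp only [vals_pa_one, vals_pa_zero, mv, Pi.smul_apply, smul_eq_mul]
    simp only [cp, one, e]
    simp
    ring
  have h2 := ae_shift ((H.ae_tensor (dom T₀).isOpen (integrable_tF α β hF)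
    fun l hl => tF_eq_zero α β hF hl))
  filter_upwards [ae_all_iff.2 fun k => ae_all_iff.2 fun i => h1 k i, h2] with z hz hz2 k i
  refine ⟨hz k i, ?_⟩
  rw [integral_prod _ (hz k i)]
  refine integral_congr_ae ?_
  filter_upwards [hz2] with y hy
  rw [integral_const_mul, tensorX_apply hφ hP (hy k)]
  simp only [sh_add, add_assoc]

/-- The product of the mollified divergence of `(b ⊗ b_X)^ε` with `b`. -/
theorem LocalCut.rep_left_moll (H : LocalCut (dom T₀) d b J) (hφ : IsMollifier φ)
    (hε : 0 < ε) (hP : Part P α β) (hρ : IsMollifier ρ) (hδ : 0 < δ) (i : Fin 3) :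
    Rep (dom T₀) (volume.prod volume)
      (fun z => cross (divMoll ρ δ (tensorX φ ε P b) z) (b z) i)
      fun y z => 2 * leftTri (gk (gs (scaled ρ δ) y.1) (tF α β (prof φ ε) y.2)) (kd i)
        (vals b pa y z) (vals b pa y z) (vals b pa y z) := by
  obtain ⟨R, hF⟩ := exists_profile hφ hε
  have hρ1 := contDiff_one_scaled hρ δ
  have hρc := hasCompactSupport_scaled hρ hδ
  obtain ⟨r, hr0, hρr⟩ := exists_tsupport_subset hρc
  constructor
  · filter_upwards [H.ae_conv_tensorX hφ hε hP hρ hδ, H.ae_locallyIntegrable_tensorX hφ hε hP]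
      with z hz hz2
    have h1 : ∀ j, HasInt (volume.prod volume) (fun y : E3 × E3 => -∑ k, gs (scaled ρ δ) y.1 k *
        (cp b (z + sh (y.1 + y.2)) k * mv (tF α β (prof φ ε) y.2) (cp b (z + sh (y.1 + y.2))) j))
        (divMoll ρ δ (tensorX φ ε P b) z j) := by
      intro j
      refine ((HasInt.sum fun k => hz k j).const_mul (-1)).congr (fun y => by ring) ?_
      rw [← (divMoll_apply hρ hδ hz2 j).2, integral_neg, integral_finsetSum]
      · ring
      · intro k _
        exact Integrable.eval_piLp (integrable_gs_smul hρ hδ (g := fun w => tensorX φ ε P b w k)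
          (hz2 k) k) j
    refine ((((h1 (i + 1)).const_mul (b z (i + 2))).sub ((h1 (i + 2)).const_mul
      (b z (i + 1)))).congr (fun y => ?_) (c' := cross (divMoll ρ δ (tensorX φ ε P b) z) (b z) i)
      ?_).2.symm
    · rw [leftTri, dot3_kd]
      simp only [cr, vq, gk, vals_pa_one, vals_pa_zero, mv, Fin.sum_univ_three]
      simp only [cp]
      ring
    · rw [cross_apply]
      ring
  · intro ψ hψ
    have := (H.fff.integrable_left (b := R) (integrable_gk hρ1 hρc (integrable_tF α β hF)) hρr
      (fun y hy => by funext k i j; simp [gk, gs_eq_zero hy])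
      (fun y hy => by funext k i j; simp [gk, tF_eq_zero α β hF hy]) hψ (kd i)).const_mul 2
    exact this.congr (.of_forall fun p => by ring)

end

/-! ### Limits of products -/

section

variable {Ω : Set ST} {b₁ b₂ b₃ : ST → E3} {ρ : E3 → ℝ}
  {P : Type*} [NormedAddCommGroup P] [NormedSpace ℝ P] [FiniteDimensional ℝ P] {N : ℕ}
  {m : P → Form V3 N}

theorem LocTame.integrable_scaled (H : LocTame Ω b₁ b₂ b₃) (hm : LTri m) {T : E3 → P}
    (hT : Integrable T) {R : ℝ} (hR : ∀ l : E3, R < ‖l‖ → T l = 0) {s : Fin N → E3 × E3 → E3}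
    (hs : ∀ a, Continuous (s a)) (hsb : ∀ a y, ‖s a y‖ ≤ ‖y.1‖ + ‖y.2‖) (hρ : IsMollifier ρ)
    {δ : ℝ} (hδ : 0 < δ) {ψ : ST → ℝ} (hψ : IsCTest Ω ψ) :
    Integrable (fun p : (E3 × E3) × ST => ψ p.2 * m (scaled ρ δ p.1.1 • T p.1.2)
      (vals b₁ s p.1 p.2) (vals b₂ s p.1 p.2) (vals b₃ s p.1 p.2)) (volume.prod volume) := by
  have hρc := hasCompactSupport_scaled hρ hδ
  obtain ⟨r, hr0, hρr⟩ := exists_tsupport_subset hρc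
  have hρi : Integrable (scaled ρ δ) :=
    (contDiff_scaled hρ δ).continuous.integrable_of_hasCompactSupport hρc
  refine H.integrable hm (integrable_mul_prod hρi hT) (fun a => (hs a).measurable) (r := r + R)
    (fun y hy a => ?_) hψ
  obtain ⟨h1, h2⟩ := mem_support_pair (b := R) hρr (T := fun y : E3 × E3 => scaled ρ δ y.1 • T y.2)
    (fun y hy => by rw [image_eq_zero_of_notMem_tsupport hy, zero_smul])
    (fun y hy => by rw [hR _ hy, smul_zero]) y hy
  exact (hsb a y).trans (add_le_add h1 h2)

/-- The mollification of one of the displacements tends to the identity. -/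
theorem LocTame.tendsto_scaled (H : LocTame Ω b₁ b₂ b₃) (hm : LTri m) {T : E3 → P}
    (hT : Integrable T) {R : ℝ} (hR : ∀ l : E3, R < ‖l‖ → T l = 0) {s : Fin N → E3 × E3 → E3}
    (hs : ∀ a, Continuous (s a)) (hsb : ∀ a y, ‖s a y‖ ≤ ‖y.1‖ + ‖y.2‖) (hρ : IsMollifier ρ)
    {ψ : ST → ℝ} (hψ : IsCTest Ω ψ) :
    Tendsto (fun δ => ∫ p : (E3 × E3) × ST, ψ p.2 * m (scaled ρ δ p.1.1 • T p.1.2)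
      (vals b₁ s p.1 p.2) (vals b₂ s p.1 p.2) (vals b₃ s p.1 p.2) ∂(volume.prod volume)) (𝓝[>] 0)
      (𝓝 (∫ q : E3 × ST, ψ q.2 * m (T q.1) (vals b₁ s (0, q.1) q.2) (vals b₂ s (0, q.1) q.2)
        (vals b₃ s (0, q.1) q.2) ∂(volume.prod volume))) := by
  set I : E3 → ℝ := fun y => ∫ q : E3 × ST, ψ q.2 * m (T q.1) (vals b₁ s (y, q.1) q.2)
    (vals b₂ s (y, q.1) q.2) (vals b₃ s (y, q.1) q.2) ∂(volume.prod volume) with hI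
  have hcont : ContinuousAt I 0 := by
    refine H.continuousAt (Y := E3) (Θ := E3) hm hT (s := fun a θ l => s a (θ, l)) (r := 1 + R)
      (fun a θ => ((hs a).comp (by fun_prop : Continuous fun l : E3 => (θ, l))).measurable)
      (fun a l => (hs a).comp (by fun_prop)) ?_ hψ
    filter_upwards [Metric.ball_mem_nhds (0 : E3) one_pos] with θ hθ l hl a
    refine (hsb a _).trans (add_le_add (mem_ball_zero_iff.1 hθ).le ?_)
    by_contra! h
    exact hl (hR l h)
  have key : ∀ δ > 0, Integrable (fun y => scaled ρ δ y * I y) ∧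
      ∫ p : (E3 × E3) × ST, ψ p.2 * m (scaled ρ δ p.1.1 • T p.1.2)
      (vals b₁ s p.1 p.2) (vals b₂ s p.1 p.2) (vals b₃ s p.1 p.2) ∂(volume.prod volume)
      = ∫ y, scaled ρ δ y * I y := by
    intro δ hδ
    have h1 := integral_assoc (g := fun y l z => ψ z * m (scaled ρ δ y • T l)
      (vals b₁ s (y, l) z) (vals b₂ s (y, l) z) (vals b₃ s (y, l) z))
      (H.integrable_scaled hm hT hR hs hsb hρ hδ hψ)
    have h2 : ∀ y, ∫ q : E3 × ST, ψ q.2 * m (scaled ρ δ y • T q.1) (vals b₁ s (y, q.1) q.2)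
        (vals b₂ s (y, q.1) q.2) (vals b₃ s (y, q.1) q.2) ∂(volume.prod volume)
        = scaled ρ δ y * I y := by
      intro y
      rw [hI, ← integral_const_mul]
      refine integral_congr_ae (.of_forall fun q => ?_)
      simp only [(hm.lin _ _ _).map_smul, smul_eq_mul]
      ring
    simp only [h2] at h1
    exact h1
  refine (EMHD.tendsto_scaled hρ hcont fun δ hδ => (key δ hδ).1).congr' ?_
  filter_upwards [self_mem_nhdsWithin] with δ hδ
  exact (key δ hδ).2.symm

theorem integral_unit_prod {g : Unit × ST → ℝ} :
    ∫ p, g p ∂((Measure.dirac ()).prod volume) = ∫ z, g ((), z) := by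
  rw [Measure.dirac_prod, (measurableEmbedding_prodMk_left ()).integral_map]

theorem integrable_unit_prod {g : Unit × ST → ℝ}
    (h : Integrable g ((Measure.dirac ()).prod volume)) : Integrable fun z => g ((), z) := by
  rwa [Measure.dirac_prod, (measurableEmbedding_prodMk_left ()).integrable_map_iff] at h

theorem LocTame.integrable_scaled_self (H : LocTame Ω b₁ b₂ b₃) (hm : LTri m) {t : P}
    {s : Fin N → E3 → E3} (hs : ∀ a, Continuous (s a)) (hsb : ∀ a y, ‖s a y‖ ≤ ‖y‖)
    (hρ : IsMollifier ρ) {δ : ℝ} (hδ : 0 < δ) {ψ : ST → ℝ} (hψ : IsCTest Ω ψ) :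
    Integrable (fun p : E3 × ST => ψ p.2 * m (scaled ρ δ p.1 • t)
      (vals b₁ s p.1 p.2) (vals b₂ s p.1 p.2) (vals b₃ s p.1 p.2)) (volume.prod volume) := by
  have hρc := hasCompactSupport_scaled hρ hδ
  obtain ⟨r, hr0, hρr⟩ := exists_tsupport_subset hρc
  have hρi : Integrable (scaled ρ δ) :=
    (contDiff_scaled hρ δ).continuous.integrable_of_hasCompactSupport hρc
  refine H.integrable hm (hρi.smul_const t) (fun a => (hs a).measurable) (r := r)
    (fun y hy a => (hsb a y).trans ?_) hψ
  by_contra h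
  exact hy (by rw [image_eq_zero_of_notMem_tsupport (f := scaled ρ δ) fun h' => h (by simpa using hρr h'), zero_smul])

theorem LocTame.tendsto_scaled_self (H : LocTame Ω b₁ b₂ b₃) (hm : LTri m) {t : P}
    {s : Fin N → E3 → E3} (hs : ∀ a, Continuous (s a)) (hsb : ∀ a y, ‖s a y‖ ≤ ‖y‖)
    (hρ : IsMollifier ρ) {ψ : ST → ℝ} (hψ : IsCTest Ω ψ) :
    Tendsto (fun δ => ∫ p : E3 × ST, ψ p.2 * m (scaled ρ δ p.1 • t)
      (vals b₁ s p.1 p.2) (vals b₂ s p.1 p.2) (vals b₃ s p.1 p.2) ∂(volume.prod volume)) (𝓝[>] 0)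
      (𝓝 (∫ z, ψ z * m t (vals b₁ s 0 z) (vals b₂ s 0 z) (vals b₃ s 0 z))) := by
  set I : E3 → ℝ := fun y => ∫ z, ψ z * m t (vals b₁ s y z) (vals b₂ s y z) (vals b₃ s y z) with hI
  have hcont : ContinuousAt I 0 := by
    have := H.continuousAt (Y := Unit) (ν := Measure.dirac ()) (Θ := E3) (θ₀ := 0) hm
      (T := fun _ => t) (integrable_const t) (s := fun a θ _ => s a θ) (r := 1)
      (fun a θ => measurable_const) (fun a _ => hs a) (by
        filter_upwards [Metric.ball_mem_nhds (0 : E3) one_pos] with θ hθ l hl a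
        exact (hsb a _).trans (mem_ball_zero_iff.1 hθ).le) hψ
    simp only [integral_unit_prod] at this
    exact this
  have key : ∀ δ > 0, Integrable (fun y => scaled ρ δ y * I y) ∧
      ∫ p : E3 × ST, ψ p.2 * m (scaled ρ δ p.1 • t)
      (vals b₁ s p.1 p.2) (vals b₂ s p.1 p.2) (vals b₃ s p.1 p.2) ∂(volume.prod volume)
      = ∫ y, scaled ρ δ y * I y := by
    intro δ hδ
    have h1 := H.integrable_scaled_self hm (t := t) hs hsb hρ hδ hψ
    have h2 : ∀ y, ∫ z, ψ z * m (scaled ρ δ y • t) (vals b₁ s y z)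
        (vals b₂ s y z) (vals b₃ s y z) = scaled ρ δ y * I y := by
      intro y
      rw [hI, ← integral_const_mul]
      refine integral_congr_ae (.of_forall fun q => ?_)
      simp only [(hm.lin _ _ _).map_smul, smul_eq_mul]
      ring
    have h3 := h1.integral_prod_left
    rw [integral_prod _ h1]
    simp only [h2] at h3 ⊢
    exact ⟨h3, trivial⟩
  refine (EMHD.tendsto_scaled hρ hcont fun δ hδ => (key δ hδ).1).congr' ?_
  filter_upwards [self_mem_nhdsWithin] with δ hδ
  exact (key δ hδ).2.symm

end

section

variable {T₀ d : ℝ} {b J : ST → E3} {φ ρ : E3 → ℝ} {ε δ : ℝ} {P : E3 → E3 → E3} {α β : ℝ}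

theorem norm_pa_le_add (a : Fin 2) (y : E3 × E3) : ‖pa a y‖ ≤ ‖y.1‖ + ‖y.2‖ :=
  norm_pa_le y a ⟨le_rfl, le_rfl⟩

theorem norm_pb_le_add (a : Fin 3) (y : E3 × E3) : ‖pb a y‖ ≤ ‖y.1‖ + ‖y.2‖ :=
  norm_pb_le y a ⟨le_rfl, le_rfl⟩

theorem vals_pa_zero_left (u : ST → E3) (l : E3) (z : ST) :
    vals u pa (0, l) z = two (cp u) l z := by
  funext a
  fin_cases a <;> simp [vals, pa, two, sh_zero]

/-- The product of `[div (b ⊗ b_X)]^ε` with `b`. -/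
def leftProd (α β : ℝ) (F : ℝ → ℝ) (b : ST → E3) (i : Fin 3) (z : ST) : ℝ :=
  ∫ l, 2 * leftTri (qF α β F (deriv F) l) (kd i) (two (cp b) l z) (two (cp b) l z) (two (cp b) l z)

theorem LocalCut.rep_left (H : LocalCut (dom T₀) d b J) (α β : ℝ) {F : ℝ → ℝ} {R : ℝ}
    (hF : Profile F R) (i : Fin 3) : Rep (dom T₀) volume (leftProd α β F b i)
      fun l z => 2 * leftTri (qF α β F (deriv F) l) (kd i) (two (cp b) l z) (two (cp b) l z)
        (two (cp b) l z) :=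
  H.fff.rep ((ltri_left (kd i)).const_mul 2) (integrable_qF α β hF)
    (fun l hl => qF_eq_zero α β hF hl) (.of_forall fun _ => rfl)

theorem LocalCut.isDivCross_left (H : LocalCut (dom T₀) d b J) (hφ : IsMollifier φ)
    (hε : 0 < ε) (hP : Part P α β) : IsDivCross T₀ (tensorX φ ε P b) b
      fun i => toDist T₀ (leftProd α β (prof φ ε) b i) := by
  obtain ⟨R, hF⟩ := exists_profile hφ hε
  refine fun ρ hρ i => ⟨fun δ hδ => (H.rep_left_moll hφ hε hP hρ hδ i).locallyIntegrableOn
    (dom T₀).isOpen, fun ψ => ?_⟩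
  rw [(H.rep_left α β hF i).toDist_apply]
  have key := H.fff.tendsto_scaled ((ltri_left (kd i)).const_mul 2) (integrable_qF α β hF)
    (fun l hl => qF_eq_zero α β hF hl) continuous_pa norm_pa_le_add hρ (TestFunction.isCTest ψ)
  simp only [vals_pa_zero_left] at key
  refine key.congr' ?_
  filter_upwards [self_mem_nhdsWithin] with δ hδ
  rw [(H.rep_left_moll hφ hε hP hρ hδ i).toDist_apply]
  have h1 := H.fff.exchange α β hF (contDiff_one_scaled hρ δ) (hasCompactSupport_scaled hρ hδ)
    (TestFunction.isTest ψ) (kd i)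
  simp only [mul_left_comm _ (2 : ℝ), integral_const_mul]
  exact congrArg (2 * ·) h1.symm

end

/-! ### Distributions with a rotational part -/

section

variable {T₀ d : ℝ} {b J : ST → E3} {φ ρ : E3 → ℝ} {ε δ : ℝ} {P : E3 → E3 → E3} {α β : ℝ}

/-- The vector of distributions `v + curl G`. -/
def rotDist (T₀ : ℝ) (v G : Fin 3 → ST → ℝ) (i : Fin 3) : 𝓓'(dom T₀, ℝ) :=
  toDist T₀ (v i) + (dx (i + 1) (toDist T₀ (G (i + 2))) - dx (i + 2) (toDist T₀ (G (i + 1))))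

theorem dx_add (i : Fin 3) (u w : 𝓓'(dom T₀, ℝ)) : dx i (u + w) = dx i u + dx i w :=
  map_add (Distribution.lineDerivCLM _) u w

theorem dx_sub (i : Fin 3) (u w : 𝓓'(dom T₀, ℝ)) : dx i (u - w) = dx i u - dx i w :=
  map_sub (Distribution.lineDerivCLM _) u w

theorem div_rotDist (v G : Fin 3 → ST → ℝ) :
    div (rotDist T₀ v G) = div fun i => toDist T₀ (v i) := by
  simp only [div, rotDist, Fin.sum_univ_three, dx_add, dx_sub, Fin.isValue, Fin.reduceAdd, zero_add]
  rw [dx_comm 1 0, dx_comm 2 0, dx_comm 2 1]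
  abel

theorem rotDist_apply (v G : Fin 3 → ST → ℝ) (i : Fin 3) (ψ : 𝓓(dom T₀, ℝ)) :
    rotDist T₀ v G i ψ = toDist T₀ (v i) ψ
      - toDist T₀ (G (i + 2)) (∂_{((0, e (i + 1)) : ST)} ψ)
      + toDist T₀ (G (i + 1)) (∂_{((0, e (i + 2)) : ST)} ψ) := by
  simp only [rotDist, add_apply, sub_apply, dx_apply]
  ring

/-! ### The product with the mollified field -/

theorem ltri_pot (i : Fin 3) : LTri fun (t : Fin 3 → V3) (u x w : Fin 2 → V3) =>
    1 / 2 * dot3 (u 0) (x 0) * mv t (w 1) i := by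
  apply ltri_of <;> intros <;> simp [mv, dot3] <;> ring

/-- The regular part of the product of `div (b ⊗ b)` with `b_X^ε`. -/
def rightProd (α β : ℝ) (F : ℝ → ℝ) (b J : ST → E3) (i : Fin 3) (z : ST) : ℝ :=
  ∫ l, 2 * rightTri (tF α β F l) (kd i) (two (cp b) l z) (two (cp b) l z) (two (cp J) l z)

/-- The potential of the rotational part of the product of `div (b ⊗ b)` with `b_X^ε`. -/
def potProd (α β : ℝ) (F : ℝ → ℝ) (b : ST → E3) (i : Fin 3) (z : ST) : ℝ :=
  ∫ l, 1 / 2 * dot3 (two (cp b) l z 0) (two (cp b) l z 0) * mv (tF α β F l) (two (cp b) l z 1) i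

theorem LocalCut.rep_right (H : LocalCut (dom T₀) d b J) (α β : ℝ) {F : ℝ → ℝ} {R : ℝ}
    (hF : Profile F R) (i : Fin 3) : Rep (dom T₀) volume (rightProd α β F b J i)
      fun l z => 2 * rightTri (tF α β F l) (kd i) (two (cp b) l z) (two (cp b) l z)
        (two (cp J) l z) :=
  H.ffh.rep ((ltri_right (kd i)).const_mul 2) (integrable_tF α β hF)
    (fun l hl => tF_eq_zero α β hF hl) (.of_forall fun _ => rfl)

theorem LocalCut.rep_pot (H : LocalCut (dom T₀) d b J) (α β : ℝ) {F : ℝ → ℝ} {R : ℝ}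
    (hF : Profile F R) (i : Fin 3) : Rep (dom T₀) volume (potProd α β F b i)
      fun l z => 1 / 2 * dot3 (two (cp b) l z 0) (two (cp b) l z 0)
        * mv (tF α β F l) (two (cp b) l z 1) i :=
  H.fff.rep (ltri_pot i) (integrable_tF α β hF)
    (fun l hl => tF_eq_zero α β hF hl) (.of_forall fun _ => rfl)

theorem integrable_div (H : LocalCut (dom T₀) d b J) {F : ℝ → ℝ} {R : ℝ} (hF : Profile F R)
    (hρ : IsMollifier ρ) (hδ : 0 < δ) (a : V3) {ψ : ST → ℝ} (hψ : IsCTest (dom T₀) ψ) :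
    Integrable (fun p : (E3 × E3) × ST => ψ p.2 * divTri a
      (gk (gs (scaled ρ δ) p.1.1) (tF α β F p.1.2)) (vals b pb p.1 p.2) (vals b pb p.1 p.2)
      (vals b pb p.1 p.2)) (volume.prod volume) := by
  have hρ1 := contDiff_one_scaled hρ δ
  have hρc := hasCompactSupport_scaled hρ hδ
  obtain ⟨r, hr0, hρr⟩ := exists_tsupport_subset hρc
  have z1 : (∀ y : E3 × E3, y.1 ∉ tsupport (scaled ρ δ) →
      gk (gs (scaled ρ δ) y.1) (tF α β F y.2) = 0)
      ∧ ∀ y : E3 × E3, R < ‖y.2‖ → gk (gs (scaled ρ δ) y.1) (tF α β F y.2) = 0 := by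
    constructor <;> intro y hy <;> funext k i j
    · simp [gk, gs_eq_zero hy]
    · simp [gk, tF_eq_zero α β hF hy]
  exact H.fff.integrable (ltri_div a) (integrable_gk hρ1 hρc (integrable_tF α β hF))
    (fun a => (continuous_pb a).measurable)
    (fun y hy a => norm_pb_le y a (mem_support_pair hρr z1.1 z1.2 y hy))
    hψ

theorem LocalCut.rep_right_moll (H : LocalCut (dom T₀) d b J) (hφ : IsMollifier φ)
    (hε : 0 < ε) (hP : Part P α β) (hρ : IsMollifier ρ) (hδ : 0 < δ) (i : Fin 3) :
    Rep (dom T₀) volume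
      (fun z => cross (divMoll ρ δ (tensor b) z) (mollX φ ε P b z) i)
      fun (y : E3 × E3) z => -divTri (kd i) (gk (gs (scaled ρ δ) y.1) (tF α β (prof φ ε) y.2))
        (vals b pb y z) (vals b pb y z) (vals b pb y z) := by
  obtain ⟨R, hF⟩ := exists_profile hφ hε
  constructor
  · filter_upwards [ae_all_iff.2 fun k => ae_locallyIntegrable_section
      (H.locallyIntegrableOn_tensor k), H.ae_sections (dom T₀).isOpen (integrable_tF α β hF)
      fun l hl => tF_eq_zero α β hF hl] with z hz hz2
    have h1 := fun j => divMoll_apply hρ hδ hz j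
    have h2 : ∀ j, HasInt volume (fun l => mv (tF α β (prof φ ε) l) (cp b (z + sh l)) j)
        (mollX φ ε P b z j) := fun j => ⟨hz2.linb j, (mollX_apply hφ hP hz2.linb j).symm⟩
    refine ((((h1 (i + 1)).prod (h2 (i + 2))).sub ((h1 (i + 2)).prod (h2 (i + 1)))).congr
      (fun y => ?_) (c' := cross (divMoll ρ δ (tensor b) z) (mollX φ ε P b z) i) ?_).2.symm
    · simp only [divTri, dot3_kd, vals_pb, three]
      simp only [cr, gk, mv, tensor, Fin.sum_univ_three, PiLp.smul_apply, smul_eq_mul, cp]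
      simp
      ring
    · rw [cross_apply]
  · intro ψ hψ
    exact (integrable_div (α := α) (β := β) H hF hρ hδ (kd i) hψ).neg.congr (.of_forall fun p => by
      simp only [Pi.neg_apply, mul_neg])

theorem LocalCut.isDivCross_right (H : LocalCut (dom T₀) d b J) (hφ : IsMollifier φ)
    (hε : 0 < ε) (hP : Part P α β) : IsDivCross T₀ (tensor b) (mollX φ ε P b)
      (rotDist T₀ (rightProd α β (prof φ ε) b J) (potProd α β (prof φ ε) b)) := by
  obtain ⟨R, hF⟩ := exists_profile hφ hε
  refine fun ρ hρ i => ⟨fun δ hδ => (H.rep_right_moll hφ hε hP hρ hδ i).locallyIntegrableOn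
    (dom T₀).isOpen, fun ψ => ?_⟩
  have hψ := TestFunction.isTest ψ
  have i1 := integrable_tF α β hF
  have z1 : ∀ l : E3, R < ‖l‖ → tF α β (prof φ ε) l = 0 := fun l hl => tF_eq_zero α β hF hl
  have t1 := H.ffh.tendsto_scaled (ltri_cr (kd i)) i1 z1 continuous_pb norm_pb_le_add hρ
    hψ.isCTest
  have t2 := fun k => H.fff.tendsto_scaled (ltri_sq (kd i) (kd k)) i1 z1 continuous_pb
    norm_pb_le_add hρ (isCTest_gr hψ k)
  have key := t1.sub (tendsto_finsetSum Finset.univ fun k _ => t2 k)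
  have hlim : (∫ q : E3 × ST, ψ q.2 * crTri (kd i) (tF α β (prof φ ε) q.1) (vals b pb (0, q.1) q.2)
        (vals b pb (0, q.1) q.2) (vals J pb (0, q.1) q.2) ∂(volume.prod volume))
      - ∑ k, ∫ q : E3 × ST, gr ψ q.2 k * sqTri (kd i) (kd k) (tF α β (prof φ ε) q.1)
        (vals b pb (0, q.1) q.2) (vals b pb (0, q.1) q.2) (vals b pb (0, q.1) q.2)
        ∂(volume.prod volume)
      = rotDist T₀ (rightProd α β (prof φ ε) b J) (potProd α β (prof φ ε) b) i ψ := by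
    rw [rotDist_apply, (H.rep_right α β hF i).toDist_apply, (H.rep_pot α β hF _).toDist_apply,
      (H.rep_pot α β hF _).toDist_apply, gr_eq_lineDeriv, gr_eq_lineDeriv]
    have e1 : ∀ q : E3 × ST, crTri (kd i) (tF α β (prof φ ε) q.1) (vals b pb (0, q.1) q.2)
        (vals b pb (0, q.1) q.2) (vals J pb (0, q.1) q.2) = 2 * rightTri (tF α β (prof φ ε) q.1)
        (kd i) (two (cp b) q.1 q.2) (two (cp b) q.1 q.2) (two (cp J) q.1 q.2) := by
      intro q
      simp [crTri, rightTri, vals_pb, three, two, sh_zero]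
      ring
    have e2 : ∀ (k : Fin 3) (q : E3 × ST), sqTri (kd i) (kd k) (tF α β (prof φ ε) q.1)
        (vals b pb (0, q.1) q.2) (vals b pb (0, q.1) q.2) (vals b pb (0, q.1) q.2)
        = kd k (i + 1) * (1 / 2 * dot3 (two (cp b) q.1 q.2 0) (two (cp b) q.1 q.2 0)
          * mv (tF α β (prof φ ε) q.1) (two (cp b) q.1 q.2 1) (i + 2))
        - kd k (i + 2) * (1 / 2 * dot3 (two (cp b) q.1 q.2 0) (two (cp b) q.1 q.2 0)
          * mv (tF α β (prof φ ε) q.1) (two (cp b) q.1 q.2 1) (i + 1)) := by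
      intro k q
      simp [sqTri, dot3_kd, cr, vals_pb, three, two, sh_zero]
      ring
    have e3 : ∀ k, ∫ q : E3 × ST, gr ψ q.2 k * sqTri (kd i) (kd k) (tF α β (prof φ ε) q.1)
        (vals b pb (0, q.1) q.2) (vals b pb (0, q.1) q.2) (vals b pb (0, q.1) q.2)
        ∂(volume.prod volume)
        = kd k (i + 1) * (∫ q : E3 × ST, gr ψ q.2 k * (1 / 2 * dot3 (two (cp b) q.1 q.2 0)
          (two (cp b) q.1 q.2 0) * mv (tF α β (prof φ ε) q.1) (two (cp b) q.1 q.2 1) (i + 2))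
          ∂(volume.prod volume))
        - kd k (i + 2) * (∫ q : E3 × ST, gr ψ q.2 k * (1 / 2 * dot3 (two (cp b) q.1 q.2 0)
          (two (cp b) q.1 q.2 0) * mv (tF α β (prof φ ε) q.1) (two (cp b) q.1 q.2 1) (i + 1))
          ∂(volume.prod volume)) := by
      intro k
      rw [← integral_const_mul, ← integral_const_mul, ← integral_sub
        (((H.rep_pot α β hF _).int _ (isCTest_gr hψ k)).const_mul _)
        (((H.rep_pot α β hF _).int _ (isCTest_gr hψ k)).const_mul _)]
      refine integral_congr_ae (.of_forall fun q => ?_)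
      simp only [e2]
      ring
    simp only [e1, e3]
    fin_cases i <;> simp [Fin.sum_univ_three, kd] <;> ring
  rw [hlim] at key
  refine key.congr' ?_
  filter_upwards [self_mem_nhdsWithin] with δ hδ
  have hδ : 0 < δ := hδ
  rw [(H.rep_right_moll hφ hε hP hρ hδ i).toDist_apply]
  have h1 := H.product α β hF (contDiff_one_scaled hρ δ) (hasCompactSupport_scaled hρ hδ) hψ (kd i)
  have j1 := integrable_div (α := α) (β := β) H hF hρ hδ (kd i) hψ.isCTest
  have j2 := H.ffh.integrable_scaled (ltri_cr (kd i)) i1 z1 continuous_pb norm_pb_le_add hρ hδ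
    hψ.isCTest
  have j3 := fun k => H.fff.integrable_scaled (ltri_sq (kd i) (kd k)) i1 z1 continuous_pb
    norm_pb_le_add hρ hδ (isCTest_gr hψ k)
  have h2 := (((HasInt.of_integrable j1).sub (HasInt.sum (s := Finset.univ) fun k =>
    HasInt.of_integrable (j3 k))).add (HasInt.of_integrable j2)).2.symm.trans h1.2
  simp only [mul_neg, integral_neg]
  linarith

end

/-! ### The local Kármán–Howarth equations -/

section

variable {T₀ d : ℝ} {b J : ST → E3} {φ ρ : E3 → ℝ} {ε δ : ℝ} {P : E3 → E3 → E3} {α β : ℝ}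

theorem toDistV_apply (F : ST → E3) (i : Fin 3) : toDistV T₀ F i = toDist T₀ fun z => F z i := rfl

theorem LocalCut.toDist_defect (H : LocalCut (dom T₀) d b J) (hφ : IsMollifier φ) (hε : 0 < ε)
    {c : ℝ} (hc : c ≠ 0) {D : ST → ℝ}
    (hD : ∀ z, DefectSections (prof φ ε) b J z → c * D z = ∫ l, d * defectTri
      (qF α β (prof φ ε) (deriv (prof φ ε)) l) (two (cp b) l z) (two (cp b) l z)
      (two (cp J) l z)) : LocallyIntegrableOn D (dom T₀) ∧ ∀ ψ : 𝓓(dom T₀, ℝ),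
      c * toDist T₀ D ψ = ∫ p : E3 × ST, ψ p.2 * (d * defectTri (qF α β (prof φ ε)
        (deriv (prof φ ε)) p.1) (two (cp b) p.1 p.2) (two (cp b) p.1 p.2) (two (cp J) p.1 p.2))
        ∂(volume.prod volume) := by
  obtain ⟨R, hF⟩ := exists_profile hφ hε
  have hDr := H.rep_of_sections (dom T₀).isOpen α β hF hD
  have hDl : LocallyIntegrableOn D (dom T₀) := by
    refine locallyIntegrableOn_of_test (dom T₀).isOpen fun ψ hψ =>
      ((hDr.integrable (dom T₀).isOpen hψ).const_mul c⁻¹).congr (.of_forall fun z => ?_)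
    field_simp
  refine ⟨hDl, fun ψ => ?_⟩
  rw [← hDr.toDist_apply, toDist_apply hDl, toDist_apply (hDr.locallyIntegrableOn
    (dom T₀).isOpen), ← integral_const_mul]
  simp only [mul_left_comm]

theorem LocalCut.karmanHowarth (H : LocalCut (dom T₀) d b J) (hφ : IsMollifier φ) (hε : 0 < ε)
    (hP : Part P α β) {c : ℝ} (hc : c ≠ 0) {D : ST → ℝ}
    (hD : ∀ z, DefectSections (prof φ ε) b J z → c * D z = ∫ l, d * defectTri
      (qF α β (prof φ ε) (deriv (prof φ ε)) l) (two (cp b) l z) (two (cp b) l z)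
      (two (cp J) l z)) : KarmanHowarth T₀ d b J φ ε P c D := by
  obtain ⟨R, hF⟩ := exists_profile hφ hε
  have hE := H.rep_energy hφ hε hP
  have hFl := H.rep_flux hφ hε hP
  have hD' := H.toDist_defect hφ hε hc hD
  refine ⟨hE.locallyIntegrableOn (dom T₀).isOpen, locallyIntegrableOn_E3 (dom T₀).isOpen fun i =>
    (hFl i).locallyIntegrableOn (dom T₀).isOpen, hD'.1, _, _, H.isDivCross_left hφ hε hP,
    H.isDivCross_right hφ hε hP, ?_⟩
  rw [div_rotDist]
  ext ψ
  have hψ := TestFunction.isTest ψ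
  have a1 := HasInt.of_integrable (hE.int _ (isCTest_time hψ))
  have a2 := fun i => HasInt.of_integrable ((H.rep_left α β hF i).int _ (isCTest_gr hψ i))
  have a3 := fun i => HasInt.of_integrable ((H.rep_right α β hF i).int _ (isCTest_gr hψ i))
  have a4 := fun i => HasInt.of_integrable ((hFl i).int _ (isCTest_gr hψ i))
  have a5 := HasInt.of_integrable ((H.rep_of_sections (dom T₀).isOpen α β hF hD).int _ hψ.isCTest)
  have key := ((((a1.add ((HasInt.sum (s := Finset.univ) a2).const_mul (d / 2))).add
    ((HasInt.sum (s := Finset.univ) a3).const_mul (d / 2))).add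
    (HasInt.sum (s := Finset.univ) a4)).sub a5).congr (g := fun p : E3 × ST =>
      balTri d (fderiv ℝ ψ p.2 (1, 0)) (ψ p.2) (gr ψ p.2) (tF α β (prof φ ε) p.1)
      (qF α β (prof φ ε) (deriv (prof φ ε)) p.1) (two (cp b) p.1 p.2) (two (cp J) p.1 p.2))
    (fun p => by
      simp only [balTri, enTri, two_one_zero, mul_one]
      rw [leftTri_expand, rightTri_expand, fluxTri_expand]
      simp only [Fin.sum_univ_three]
      ring) rfl
  have hz := key.2.symm.trans (H.balance α β hF hψ).2
  simp only [add_apply, neg_apply, smul_apply, smul_eq_mul, div_apply, dt_apply, toDistV_apply, hD'.2]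
  rw [hE.toDist_apply, lineDeriv_test]
  simp only [(hFl _).toDist_apply, (H.rep_left α β hF _).toDist_apply,
    (H.rep_right α β hF _).toDist_apply, gr_eq_lineDeriv]
  linarith

/-! ### The product of the divergence with the field itself -/

theorem LocTame.locallyIntegrableOn_self {Ω : Set ST} (hΩ : IsOpen Ω) {b₁ b₂ b₃ : ST → E3}
    (H : LocTame Ω b₁ b₂ b₃)
    {P : Type*} [NormedAddCommGroup P] [NormedSpace ℝ P] [FiniteDimensional ℝ P] {N : ℕ}
    {m : P → Form V3 N}
    (hm : LTri m) (t : P) : LocallyIntegrableOn (fun z => m t (fun _ => cp b₁ z)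
      (fun _ => cp b₂ z) fun _ => cp b₃ z) Ω := by
  refine locallyIntegrableOn_of_test hΩ fun ψ hψ => ?_
  have h1 := integrable_unit_prod (H.integrable hm (Y := Unit) (ν := Measure.dirac ())
    (T := fun _ => t) (integrable_const t) (s := fun _ _ => 0) (fun _ => measurable_const) (r := 0)
    (fun _ _ _ => by simp) hψ)
  refine h1.congr (.of_forall fun z => ?_)
  have : ∀ u : ST → E3, vals u (fun (_ : Fin N) (_ : Unit) => (0 : E3)) () z = fun _ => cp u z :=
    fun u => funext fun a => by simp [vals, sh_zero]
  simp only [this]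

/-- The regular part of the product of `div (b ⊗ b)` with `b`. -/
def selfProd (b J : ST → E3) (i : Fin 3) (z : ST) : ℝ :=
  crTri (kd i) kd (fun _ => cp b z) (fun _ => cp b z) fun _ => cp J z

/-- The potential of the rotational part of the product of `div (b ⊗ b)` with `b`. -/
def selfPot (b : ST → E3) (i : Fin 3) (z : ST) : ℝ := 1 / 2 * dot3 (cp b z) (cp b z) * cp b z i

theorem mv_kd (v : V3) : mv kd v = v := by
  funext i
  fin_cases i <;> simp [mv, kd]

theorem LocalCut.locallyIntegrableOn_selfProd (H : LocalCut (dom T₀) d b J) (i : Fin 3) :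
    LocallyIntegrableOn (selfProd b J i) (dom T₀) :=
  H.ffh.locallyIntegrableOn_self (dom T₀).isOpen (ltri_cr (kd i)) kd

theorem LocalCut.locallyIntegrableOn_selfPot (H : LocalCut (dom T₀) d b J) (i : Fin 3) :
    LocallyIntegrableOn (selfPot b i) (dom T₀) := by
  have := H.fff.locallyIntegrableOn_self (dom T₀).isOpen (ltri_pot i) kd
  simp only [mv_kd] at this
  exact this

theorem integrable_div_self (H : LocalCut (dom T₀) d b J) (hρ : IsMollifier ρ) (hδ : 0 < δ)
    (a : V3) {ψ : ST → ℝ} (hψ : IsCTest (dom T₀) ψ) :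
    Integrable (fun p : E3 × ST => ψ p.2 * divTri a (gk (gs (scaled ρ δ) p.1) kd) (vals b pc p.1 p.2)
      (vals b pc p.1 p.2) (vals b pc p.1 p.2)) (volume.prod volume) := by
  have hρ1 := contDiff_one_scaled hρ δ
  have hρc := hasCompactSupport_scaled hρ hδ
  obtain ⟨r, hr0, hρr⟩ := exists_tsupport_subset hρc
  refine H.fff.integrable (ltri_div a) (Integrable.of_eval fun k => Integrable.of_eval fun i =>
    Integrable.of_eval fun j => (integrable_gs hρ1 hρc k).mul_const (kd i j))
    (fun a => (continuous_pc a).measurable) (r := r)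
    (fun y hy a => (norm_pc_le y a).trans ?_) hψ
  by_contra h
  refine hy ?_
  funext k i j
  simp [gk, gs_eq_zero fun h' => h (by simpa using hρr h')]

theorem LocalCut.rep_self_moll (H : LocalCut (dom T₀) d b J) (hρ : IsMollifier ρ) (hδ : 0 < δ)
    (i : Fin 3) : Rep (dom T₀) volume (fun z => cross (divMoll ρ δ (tensor b) z) (b z) i)
      fun (y : E3) z => -divTri (kd i) (gk (gs (scaled ρ δ) y) kd)
        (vals b pc y z) (vals b pc y z) (vals b pc y z) := by
  constructor
  · filter_upwards [ae_all_iff.2 fun k => ae_locallyIntegrable_section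
      (H.locallyIntegrableOn_tensor k)] with z hz
    have h1 := fun j => divMoll_apply hρ hδ hz j
    refine ((((h1 (i + 1)).const_mul (b z (i + 2))).sub ((h1 (i + 2)).const_mul
      (b z (i + 1)))).congr (fun y => ?_) (c' := cross (divMoll ρ δ (tensor b) z) (b z) i)
      ?_).2.symm
    · have e1 : ∀ k, mv (gk (gs (scaled ρ δ) y) kd k) (vals b pc y z 2)
          = fun j => gs (scaled ρ δ) y k * b z j := by
        intro k
        funext j
        fin_cases j <;> simp [mv, gk, kd, vals_pc, three, sh_zero, cp]
      simp only [divTri, dot3_kd, cr, e1]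
      simp only [vals_pc, three]
      simp only [cr, tensor, Fin.sum_univ_three, PiLp.smul_apply, smul_eq_mul, cp]
      simp
      ring
    · rw [cross_apply]
      ring
  · intro ψ hψ
    exact (integrable_div_self H hρ hδ (kd i) hψ).neg.congr (.of_forall fun p => by
      simp only [Pi.neg_apply, mul_neg])

theorem LocalCut.isDivCross_self (H : LocalCut (dom T₀) d b J) :
    IsDivCross T₀ (tensor b) b (rotDist T₀ (selfProd b J) (selfPot b)) := by
  refine fun ρ hρ i => ⟨fun δ hδ => (H.rep_self_moll hρ hδ i).locallyIntegrableOn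
    (dom T₀).isOpen, fun ψ => ?_⟩
  have hψ := TestFunction.isTest ψ
  have t1 := H.ffh.tendsto_scaled_self (ltri_cr (kd i)) (t := kd) continuous_pc
    (fun a y => norm_pc_le y a) hρ hψ.isCTest
  have t2 := fun k => H.fff.tendsto_scaled_self (ltri_sq (kd i) (kd k)) (t := kd) continuous_pc
    (fun a y => norm_pc_le y a) hρ (isCTest_gr hψ k)
  have key := t1.sub (tendsto_finsetSum Finset.univ fun k _ => t2 k)
  have e0 : ∀ (u : ST → E3) z, vals u pc 0 z = fun _ => cp u z := by
    intro u z
    funext a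
    fin_cases a <;> simp [vals, pc, sh_zero]
  have hlim : (∫ z, ψ z * crTri (kd i) kd (vals b pc 0 z) (vals b pc 0 z) (vals J pc 0 z))
      - ∑ k, ∫ z, gr ψ z k * sqTri (kd i) (kd k) kd (vals b pc 0 z) (vals b pc 0 z) (vals b pc 0 z)
      = rotDist T₀ (selfProd b J) (selfPot b) i ψ := by
    rw [rotDist_apply, toDist_apply (H.locallyIntegrableOn_selfProd i),
      toDist_apply (H.locallyIntegrableOn_selfPot _),
      toDist_apply (H.locallyIntegrableOn_selfPot _), gr_eq_lineDeriv, gr_eq_lineDeriv]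
    have e3 : ∀ k, ∫ z, gr ψ z k * sqTri (kd i) (kd k) kd (vals b pc 0 z) (vals b pc 0 z)
        (vals b pc 0 z)
        = kd k (i + 1) * (∫ z, gr ψ z k * selfPot b (i + 2) z)
        - kd k (i + 2) * (∫ z, gr ψ z k * selfPot b (i + 1) z) := by
      intro k
      have hi : ∀ j, Integrable fun z => gr ψ z k * selfPot b j z := fun j => by
        have h1 := integrable_unit_prod (H.fff.integrable (ltri_pot j) (Y := Unit)
          (ν := Measure.dirac ()) (T := fun _ => kd) (integrable_const _) (s := fun _ _ => 0)
          (fun _ => measurable_const) (r := 0) (fun _ _ _ => by simp) (isCTest_gr hψ k))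
        refine h1.congr (.of_forall fun z => ?_)
        simp [vals, selfPot, mv_kd, sh_zero]
      rw [← integral_const_mul, ← integral_const_mul, ← integral_sub
        ((hi _).const_mul _) ((hi _).const_mul _)]
      refine integral_congr_ae (.of_forall fun z => ?_)
      simp only [e0, sqTri, dot3_kd, mv_kd, selfPot]
      simp only [cr]
      ring
    simp only [e3]
    simp only [e0]
    have : ∀ z, crTri (kd i) kd (fun _ => cp b z) (fun _ => cp b z) (fun _ => cp J z)
      = selfProd b J i z := fun z => rfl
    simp only [this]
    fin_cases i <;> simp [Fin.sum_univ_three, kd] <;> ring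
  rw [hlim] at key
  refine key.congr' ?_
  filter_upwards [self_mem_nhdsWithin] with δ hδ
  have hδ : 0 < δ := hδ
  rw [(H.rep_self_moll hρ hδ i).toDist_apply]
  have h1 := H.product_self (contDiff_one_scaled hρ δ) (hasCompactSupport_scaled hρ hδ) hψ (kd i)
  have j1 := integrable_div_self H hρ hδ (kd i) hψ.isCTest
  have j2 := H.ffh.integrable_scaled_self (ltri_cr (kd i)) (t := kd) continuous_pc
    (fun a y => norm_pc_le y a) hρ hδ hψ.isCTest
  have j3 := fun k => H.fff.integrable_scaled_self (ltri_sq (kd i) (kd k)) (t := kd) continuous_pc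
    (fun a y => norm_pc_le y a) hρ hδ (isCTest_gr hψ k)
  have h2 := (((HasInt.of_integrable j1).sub (HasInt.sum (s := Finset.univ) fun k =>
    HasInt.of_integrable (j3 k))).add (HasInt.of_integrable j2)).2.symm.trans h1.2
  simp only [mul_neg, integral_neg]
  linarith

end

/-! ### Mixed Lebesgue norms -/

/-- The norm of `L^p(ℝ; L^q(ℝ³))`. -/
def mixNorm (p q : ℝ≥0∞) (f : ST → E3) : ℝ≥0∞ :=
  eLpNorm (fun t : ℝ => eLpNorm (fun x : E3 => f (t, x)) q volume) p volume

theorem ae_aesm_slice {f : ST → E3} (hf : AEStronglyMeasurable f volume) :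
    ∀ᵐ t : ℝ, AEStronglyMeasurable (fun x : E3 => f (t, x)) volume :=
  AEStronglyMeasurable.prodMk_left (ν := volume) (μ := volume) hf

theorem aemeasurable_eLpNorm_slice {f : ST → E3} (hf : AEStronglyMeasurable f volume) (q : ℝ≥0∞) :
    AEMeasurable (fun t : ℝ => eLpNorm (fun x : E3 => f (t, x)) q volume) volume := by
  obtain ⟨g, hg, hfg⟩ := hf
  have h1 : ∀ᵐ t : ℝ, (fun x : E3 => f (t, x)) =ᵐ[volume] fun x => g (t, x) :=
    Measure.ae_ae_of_ae_prod hfg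
  refine ⟨fun t => eLpNorm (fun x : E3 => g (t, x)) q volume, ?_,
    h1.mono fun t ht => eLpNorm_congr_ae ht⟩
  have hm : Measurable fun z : ℝ × E3 => ‖g z‖ₑ := hg.measurable.enorm
  rcases eq_or_ne q 0 with rfl | h0
  · simp
  rcases eq_or_ne q ∞ with rfl | h2
  · refine measurable_of_Iic fun a => ?_
    have : (fun t => eLpNorm (fun x : E3 => g (t, x)) ∞ volume) ⁻¹' Iic a
        = (fun t => volume (Prod.mk t ⁻¹' {z : ℝ × E3 | a < ‖g z‖ₑ})) ⁻¹' {0} := by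
      ext t
      simp only [eLpNorm_exponent_top, mem_preimage, mem_Iic, mem_singleton_iff,
        eLpNormEssSup_eq_essSup_enorm]
      have : volume (Prod.mk t ⁻¹' {z : ℝ × E3 | a < ‖g z‖ₑ}) = 0 ↔ ∀ᵐ x, ‖g (t, x)‖ₑ ≤ a := by
        simp only [ae_iff, not_le]
        rfl
      rw [this]
      exact ⟨fun h => (ae_le_essSup).mono fun x hx => hx.trans h, fun h => essSup_le_of_ae_le a h⟩
    rw [this]
    exact (measurable_measure_prodMk_left (measurableSet_lt measurable_const hm))
      (measurableSet_singleton 0)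
  · simp only [eLpNorm_eq_lintegral_rpow_enorm_toReal h0 h2]
    exact (hm.pow_const _).lintegral_prod_right'.pow_const _

theorem mixNorm_ae_lt_top {p q : ℝ≥0∞} (hp : p ≠ 0) {f : ST → E3}
    (hf : AEStronglyMeasurable f volume) (h : mixNorm p q f < ∞) :
    ∀ᵐ t : ℝ, eLpNorm (fun x : E3 => f (t, x)) q volume < ∞ := by
  rcases eq_or_ne p ∞ with rfl | h2
  · rw [mixNorm, eLpNorm_exponent_top] at h
    filter_upwards [enorm_ae_le_eLpNormEssSup
      (fun t : ℝ => eLpNorm (fun x : E3 => f (t, x)) q volume) volume] with t ht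
    exact ht.trans_lt h
  · have h3 := lintegral_rpow_enorm_lt_top_of_eLpNorm_lt_top hp h2 h
    filter_upwards [ae_lt_top' ((aemeasurable_eLpNorm_slice hf q).pow_const _) h3.ne] with t ht
    by_contra h4
    rw [not_lt_top_iff] at h4
    rw [h4, ENNReal.top_rpow_of_pos (ENNReal.toReal_pos hp h2)] at ht
    exact lt_irrefl _ ht

theorem mixNorm_translate {p q : ℝ≥0∞} {f : ST → E3} (hf : AEStronglyMeasurable f volume)
    (s : ST) : mixNorm p q (fun z => f (z + s)) = mixNorm p q f := by
  have h1 : mixNorm p q (fun z => f (z + s)) = eLpNorm ((fun t : ℝ =>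
      eLpNorm (fun x : E3 => f (t, x)) q volume) ∘ fun t => t + s.1) p volume := by
    refine eLpNorm_congr_ae ?_
    filter_upwards [(measurePreserving_add_right volume s.1).quasiMeasurePreserving.ae
      (ae_aesm_slice hf)] with t ht
    exact eLpNorm_comp_measurePreserving ht (measurePreserving_add_right volume s.2)
  rw [h1, eLpNorm_comp_measurePreserving (aemeasurable_eLpNorm_slice hf q).aestronglyMeasurable
    (measurePreserving_add_right volume s.1), mixNorm]

section

variable {p s m q s' n : ℝ≥0∞} {f g w : ST → E3}

theorem lintegral_mixNorm_le (_ : ENNReal.HolderTriple p p s) (_ : ENNReal.HolderTriple s m 1)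
    (_ : ENNReal.HolderTriple q q s') (_ : ENNReal.HolderTriple s' n 1) (hp : p ≠ 0) (hm : m ≠ 0)
    (hf : AEStronglyMeasurable f volume)
    (hg : AEStronglyMeasurable g volume) (hw : AEStronglyMeasurable w volume)
    (hf' : mixNorm p q f < ∞) (hg' : mixNorm p q g < ∞) (hw' : mixNorm m n w < ∞) :
    ∫⁻ z, ‖f z‖ₑ * ‖g z‖ₑ * ‖w z‖ₑ ≤ mixNorm p q f * mixNorm p q g * mixNorm m n w := by
  have e1 : ∀ {a b : ℝ≥0∞} {u : ST → E3}, (∀ᵐ t : ℝ, eLpNorm (fun x => u (t, x)) b volume < ∞) →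
      mixNorm a b u = eLpNorm (fun t => (eLpNorm (fun x => u (t, x)) b volume).toReal) a volume := by
    intro a b u hu
    refine eLpNorm_congr_enorm_ae ?_
    filter_upwards [hu] with t ht
    rw [Real.enorm_toReal ht.ne, enorm_eq_self]
  have f1 := mixNorm_ae_lt_top hp hf hf'
  have g1 := mixNorm_ae_lt_top hp hg hg'
  have w1 := mixNorm_ae_lt_top hm hw hw'
  rw [e1 f1, e1 g1, e1 w1]
  have h2 := lintegral_enorm_mul3_le (p := p) (q := p) (r := m) (s := s) (μ := (volume : Measure ℝ))
    (aemeasurable_eLpNorm_slice hf q).ennreal_toReal.aestronglyMeasurable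
    (aemeasurable_eLpNorm_slice hg q).ennreal_toReal.aestronglyMeasurable
    (aemeasurable_eLpNorm_slice hw n).ennreal_toReal.aestronglyMeasurable
  refine le_trans ?_ h2
  refine (lintegral_prod _ ((hf.enorm.mul hg.enorm).mul hw.enorm)).trans_le ?_
  refine lintegral_mono_ae ?_
  filter_upwards [f1, g1, w1, ae_aesm_slice hf, ae_aesm_slice hg, ae_aesm_slice hw]
    with t a1 a2 a3 b1 b2 b3
  rw [Real.enorm_toReal a1.ne, Real.enorm_toReal a2.ne, Real.enorm_toReal a3.ne]
  exact lintegral_enorm_mul3_le (s := s') b1 b2 b3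

theorem lintegral_mixNorm_translate_le (h1 : ENNReal.HolderTriple p p s)
    (h2 : ENNReal.HolderTriple s m 1) (h3 : ENNReal.HolderTriple q q s')
    (h4 : ENNReal.HolderTriple s' n 1) (hp : p ≠ 0) (hm : m ≠ 0) (hf : AEStronglyMeasurable f volume)
    (hg : AEStronglyMeasurable g volume) (hw : AEStronglyMeasurable w volume)
    (hf' : mixNorm p q f < ∞) (hg' : mixNorm p q g < ∞) (hw' : mixNorm m n w < ∞) (y₁ y₂ : ST) :
    ∫⁻ z, ‖f (z + y₁)‖ₑ * ‖g (z + y₂)‖ₑ * ‖w z‖ₑ ≤ mixNorm p q f * mixNorm p q g * mixNorm m n w := by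
  have e1 := mixNorm_translate (p := p) (q := q) hf y₁
  have e2 := mixNorm_translate (p := p) (q := q) hg y₂
  refine (lintegral_mixNorm_le h1 h2 h3 h4 hp hm (aesm_translate hf y₁) (aesm_translate hg y₂) hw
    (e1.trans_lt hf') (e2.trans_lt hg') hw').trans_eq ?_
  rw [e1, e2]

end

theorem memLp_of_mixNorm {f : ST → E3} (hf : AEStronglyMeasurable f volume)
    (h : mixNorm 3 3 f < ∞) : MemLp f 3 volume := by
  refine ⟨hf, ?_⟩
  have h1 := lintegral_rpow_enorm_lt_top_of_eLpNorm_lt_top (by norm_num) (by norm_num) h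
  refine (eLpNorm_lt_top_iff_lintegral_rpow_enorm_lt_top (by norm_num) (by norm_num)).2 ?_
  have h2 : ∫⁻ z, ‖f z‖ₑ ^ (3 : ℝ≥0∞).toReal = ∫⁻ t : ℝ, ∫⁻ x : E3, ‖f (t, x)‖ₑ ^ (3 : ℝ≥0∞).toReal :=
    lintegral_prod _ (hf.enorm.pow_const _)
  rw [h2]
  refine lt_of_eq_of_lt (lintegral_congr fun t => ?_) h1
  rw [enorm_eq_self, eLpNorm_eq_lintegral_rpow_enorm_toReal (by norm_num) (by norm_num),
    ← ENNReal.rpow_mul, one_div, inv_mul_cancel₀ (by norm_num), ENNReal.rpow_one]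

/-- Approximation by truncations. -/
theorem exists_truncation {m n : ℝ≥0∞} (hm : m ≠ 0) (hm' : m ≠ ∞) (hn : n ≠ 0) (hn' : n ≠ ∞)
    {h : ST → E3} (hh : AEStronglyMeasurable h volume) (hmix : mixNorm m n h < ∞)
    {ε : ℝ≥0∞} (hε : 0 < ε) : ∃ N : ℝ, ∃ k : ST → E3, AEStronglyMeasurable k volume ∧
      (∀ z, ‖k z‖ ≤ N) ∧ (∀ z, h z = 0 → k z = 0) ∧ mixNorm m n (fun z => h z - k z) < ε := by
  classical
  set k : ℕ → ST → E3 := fun N z => if ‖h z‖ ≤ N then h z else 0 with hk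
  have hkm : ∀ N, AEStronglyMeasurable (k N) volume := fun N => by
    obtain ⟨g, hg, hfg⟩ := hh
    refine ⟨fun z => if ‖g z‖ ≤ N then g z else 0,
      StronglyMeasurable.ite (hg.norm.measurable measurableSet_Iic) hg stronglyMeasurable_const,
      hfg.mono fun z hz => by simp only [hk, hz]⟩
  have hle : ∀ N z, ‖h z - k N z‖ₑ ≤ ‖h z‖ₑ := fun N z => by
    simp only [hk]
    split_ifs <;> simp
  have h0 : ∀ z, ∀ᶠ N in atTop, ‖h z - k N z‖ₑ = 0 := fun z => by
    obtain ⟨n₀, hn₀⟩ := exists_nat_ge ‖h z‖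
    filter_upwards [eventually_ge_atTop n₀] with N hN
    simp [hk, hn₀.trans (Nat.cast_le.2 hN)]
  have hn1 := ENNReal.toReal_pos hn hn'
  have hm1 := ENNReal.toReal_pos hm hm'
  have hd : ∀ N, AEStronglyMeasurable (fun z => h z - k N z) volume := fun N => hh.sub (hkm N)
  have hx : ∀ᵐ t : ℝ, Tendsto (fun N => eLpNorm (fun x : E3 => h (t, x) - k N (t, x)) n volume)
      atTop (𝓝 0) := by
    filter_upwards [mixNorm_ae_lt_top hm hh hmix, ae_aesm_slice hh,
      ae_all_iff.2 fun N => ae_aesm_slice (hd N)] with t h1 h2 h3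
    simp only [eLpNorm_eq_lintegral_rpow_enorm_toReal hn hn']
    have h4 := tendsto_lintegral_of_dominated_convergence' (μ := (volume : Measure E3))
      (F := fun N x => ‖h (t, x) - k N (t, x)‖ₑ ^ n.toReal) (f := fun _ => 0)
      (fun x => ‖h (t, x)‖ₑ ^ n.toReal) (fun N => (h3 N).enorm.pow_const _)
      (fun N => Eventually.of_forall fun x => ENNReal.rpow_le_rpow (hle N _) ENNReal.toReal_nonneg)
      (lintegral_rpow_enorm_lt_top_of_eLpNorm_lt_top hn hn' h1).ne
      (.of_forall fun x => by
        refine tendsto_const_nhds.congr' ?_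
        filter_upwards [h0 (t, x)] with N hN
        rw [hN, ENNReal.zero_rpow_of_pos hn1])
    have := h4.ennrpow_const (1 / n.toReal)
    simpa [ENNReal.zero_rpow_of_pos, hn1] using this
  have hfin : Tendsto (fun N => mixNorm m n fun z => h z - k N z) atTop (𝓝 0) := by
    simp only [mixNorm, eLpNorm_eq_lintegral_rpow_enorm_toReal hm hm', enorm_eq_self]
    have h4 := tendsto_lintegral_of_dominated_convergence' (μ := (volume : Measure ℝ))
      (F := fun N t => eLpNorm (fun x : E3 => h (t, x) - k N (t, x)) n volume ^ m.toReal)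
      (f := fun _ => 0)
      (fun t => eLpNorm (fun x : E3 => h (t, x)) n volume ^ m.toReal)
      (fun N => (aemeasurable_eLpNorm_slice (hd N) n).pow_const _)
      (fun N => Eventually.of_forall fun t => ENNReal.rpow_le_rpow
        (eLpNorm_mono_enorm fun x => hle N (t, x)) ENNReal.toReal_nonneg)
      (lintegral_rpow_enorm_lt_top_of_eLpNorm_lt_top hm hm' hmix).ne
      (by
        filter_upwards [hx] with t ht
        simpa [ENNReal.zero_rpow_of_pos, hm1] using ht.ennrpow_const m.toReal)
    have := h4.ennrpow_const (1 / m.toReal)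
    simpa [ENNReal.zero_rpow_of_pos, hm1] using this
  obtain ⟨N, hN⟩ := (hfin.eventually (gt_mem_nhds hε)).exists
  refine ⟨N, k N, hkm N, fun z => ?_, fun z hz => ?_, hN⟩
  · simp only [hk]
    split_ifs with h1
    · exact h1
    · simp
  · simp [hk, hz]

theorem exists_exponents {p m : ℝ≥0∞} (hp : 3 ≤ p) (h : 2 / p + 1 / m ≤ 1) :
    ∃ p₁ s m₁, p₁ ≤ p ∧ m₁ ≤ m ∧ p₁ ≠ 0 ∧ m₁ ≠ 0 ∧ m₁ ≠ ∞ ∧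
      ENNReal.HolderTriple p₁ p₁ s ∧ ENNReal.HolderTriple s m₁ 1 := by
  have hm1 : 1 ≤ m := by
    have : 1 / m ≤ 1 := le_add_self.trans h
    rwa [one_div, ENNReal.inv_le_one] at this
  have hm3 : 1 ≤ min m 3 := le_min hm1 (by norm_num)
  have hi : (min m 3)⁻¹ ≤ 1 := ENNReal.inv_le_one.2 hm3
  have hp1 : ((1 - (min m 3)⁻¹) / 2)⁻¹ ≤ p := by
    rw [ENNReal.inv_le_iff_inv_le, ENNReal.le_div_iff_mul_le (by simp) (by simp)]
    refine ENNReal.le_sub_of_add_le_right (by simp [(hi.trans_lt ENNReal.one_lt_top).ne]) ?_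
    rcases le_total m 3 with h3 | h3
    · rw [min_eq_left h3]
      rwa [one_div, ENNReal.div_eq_inv_mul] at h
    · rw [min_eq_right h3]
      have : p⁻¹ ≤ 3⁻¹ := ENNReal.inv_le_inv.2 hp
      calc p⁻¹ * 2 + 3⁻¹ ≤ 3⁻¹ * 2 + 3⁻¹ := by gcongr
        _ = 3⁻¹ * 3 := by rw [← mul_add_one]; norm_num
        _ ≤ 1 := by rw [ENNReal.inv_mul_cancel] <;> norm_num
  refine ⟨((1 - (min m 3)⁻¹) / 2)⁻¹, (1 - (min m 3)⁻¹)⁻¹, min m 3, hp1, min_le_left _ _, ?_,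
    (one_pos.trans_le hm3).ne', ((min_le_right _ _).trans_lt (by norm_num)).ne,
    ⟨by rw [inv_inv, inv_inv, ENNReal.add_halves]⟩, ⟨by
      rw [inv_inv, inv_one, tsub_add_cancel_of_le hi]⟩⟩
  rw [ENNReal.inv_ne_zero]
  exact (ENNReal.div_lt_top (tsub_le_self.trans_lt ENNReal.one_lt_top).ne (by simp)).ne

/-! ### Periodic fields on bounded sets -/

/-- Lattice vectors. -/
def lat (L : ℝ) (k : Fin 3 → ℤ) : E3 := ∑ i, k i • (L • e i)

theorem lat_apply (L : ℝ) (k : Fin 3 → ℤ) (i : Fin 3) : lat L k i = k i * L := by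
  fin_cases i <;> simp [lat, Fin.sum_univ_three, e]

theorem exists_lat_cover {L : ℝ} (hL : 0 < L) (R : ℝ) : ∃ S : Finset (Fin 3 → ℤ), ∀ x : E3,
    ‖x‖ < R → ∃ k ∈ S, x + lat L k ∈ cell L := by
  refine ⟨Fintype.piFinset fun _ => Finset.Icc (-(⌈R / L⌉ + 1)) (⌈R / L⌉ + 1), fun x hx =>
    ⟨fun i => -⌊x i / L⌋, Fintype.mem_piFinset.2 fun i => ?_, fun i => ?_⟩⟩
  · have h1 : |x i| < R := (PiLp.norm_apply_le x i).trans_lt hx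
    have h2 : |x i / L| < R / L := by
      rw [abs_div, abs_of_pos hL]
      gcongr
    have h3 := abs_lt.1 h2
    have h4 := Int.le_ceil (R / L)
    have h5 := Int.floor_le (x i / L)
    have h6 := Int.lt_floor_add_one (x i / L)
    rw [Finset.mem_Icc]
    constructor
    · have : (⌊x i / L⌋ : ℝ) ≤ ((⌈R / L⌉ + 1 : ℤ) : ℝ) := by push_cast; linarith
      have := Int.cast_le.1 this
      omega
    · have : (-((⌈R / L⌉ + 1 : ℤ) : ℝ)) < ⌊x i / L⌋ + 1 := by push_cast; linarith
      have : -(⌈R / L⌉ + 1) < ⌊x i / L⌋ + 1 := by exact_mod_cast this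
      omega
  · have h5 := Int.floor_le (x i / L)
    have h6 := Int.lt_floor_add_one (x i / L)
    rw [le_div_iff₀ hL] at h5
    rw [div_lt_iff₀ hL] at h6
    rw [PiLp.add_apply, lat_apply]
    push_cast
    constructor <;> nlinarith

theorem measurableSet_cell (L : ℝ) : MeasurableSet (cell L) := by
  have : cell L = ⋂ i, (fun x : E3 => x i) ⁻¹' Ico 0 L := by
    ext x
    simp [cell]
  rw [this]
  exact MeasurableSet.iInter fun i => (by fun_prop : Measurable fun x : E3 => x i) measurableSet_Ico

theorem eLpNorm_ball_le {L : ℝ} (hL : 0 < L) (R : ℝ) : ∃ C : ℕ, ∀ (q : ℝ≥0∞), 1 ≤ q →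
    ∀ g : E3 → E3, AEStronglyMeasurable g volume → (∀ x i, g (x + L • e i) = g x) →
    eLpNorm g q (volume.restrict (Metric.ball 0 R)) ≤ C * eLpNorm g q (volume.restrict (cell L)) := by
  obtain ⟨S, hS⟩ := exists_lat_cover hL R
  refine ⟨S.card, fun q hq g hg hper => ?_⟩
  have hlat : ∀ k x, g (x + lat L k) = g x := fun k => by
    have h1 : ∀ i, Function.Periodic g (k i • (L • e i)) := fun i =>
      Function.Periodic.zsmul (fun x => hper x i) (k i)
    rw [lat, Fin.sum_univ_three]
    exact ((h1 0).add_period (h1 1)).add_period (h1 2)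
  rw [← eLpNorm_indicator_eq_eLpNorm_restrict measurableSet_ball,
    ← eLpNorm_indicator_eq_eLpNorm_restrict (measurableSet_cell L)]
  have hc := (hg.indicator (measurableSet_cell L)).norm
  have hmp : ∀ k, MeasurePreserving (fun x : E3 => x + lat L k) volume volume := fun k =>
    measurePreserving_add_right volume _
  calc eLpNorm ((Metric.ball 0 R).indicator g) q volume
      ≤ eLpNorm (∑ k ∈ S, fun x => ‖(cell L).indicator g (x + lat L k)‖) q volume := by
        refine eLpNorm_mono_real fun x => ?_
        rw [Finset.sum_apply]
        by_cases hx : x ∈ Metric.ball (0 : E3) R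
        · obtain ⟨k, hk, hxk⟩ := hS x (by simpa using hx)
          refine le_trans ?_ (Finset.single_le_sum (fun k _ => norm_nonneg _) hk)
          rw [indicator_of_mem hx, indicator_of_mem hxk, hlat]
        · rw [indicator_of_notMem hx, norm_zero]
          positivity
    _ ≤ ∑ k ∈ S, eLpNorm (fun x => ‖(cell L).indicator g (x + lat L k)‖) q volume :=
        eLpNorm_sum_le (fun k _ => hc.comp_measurePreserving (hmp k)) hq
    _ = _ := by
        refine (Finset.sum_congr rfl fun k _ => (eLpNorm_comp_measurePreserving hc (hmp k)).trans
          (eLpNorm_norm _)).trans ?_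
        rw [Finset.sum_const, nsmul_eq_mul]

/-- The set of the local cut-off. -/
def cyl (s t R : ℝ) : Set ST := Ioo s t ×ˢ Metric.ball 0 R

theorem measurableSet_cyl (s t R : ℝ) : MeasurableSet (cyl s t R) :=
  measurableSet_Ioo.prod measurableSet_ball

theorem MemLpLq.aesm {L s t R : ℝ} {p q : ℝ≥0∞} {f : ST → E3} (h : MemLpLq L s t p q f) :
    AEStronglyMeasurable ((cyl s t R).indicator f) volume :=
  (aestronglyMeasurable_indicator_iff (measurableSet_cyl s t R)).2
    (h.1.mono_measure (Measure.restrict_mono (prod_mono_right (subset_univ _)) le_rfl))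

theorem rpow_measure_univ_ne_top {X : Type*} [MeasurableSpace X] {μ : Measure X} (hμ : μ univ < ∞)
    {p' p : ℝ≥0∞} (h0 : p' ≠ 0) (hp : p' ≤ p) : μ univ ^ (1 / p'.toReal - 1 / p.toReal) ≠ ∞ := by
  refine (ENNReal.rpow_lt_top_of_nonneg ?_ hμ.ne).ne
  rcases eq_or_ne p ∞ with rfl | h1
  · simp
  · rw [sub_nonneg]
    exact one_div_le_one_div_of_le (ENNReal.toReal_pos h0 (hp.trans_lt h1.lt_top).ne)
      (ENNReal.toReal_mono h1 hp)

theorem MemLpLq.mixNorm_lt_top {L s t R : ℝ} (hL : 0 < L) {p q p' q' : ℝ≥0∞} {f : ST → E3}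
    (h : MemLpLq L s t p q f) (hf : SpacePeriodic L f) (hp : p' ≤ p) (hq : q' ≤ q) (hq1 : 1 ≤ q)
    (hp0 : p' ≠ 0) (hq0 : q' ≠ 0) : mixNorm p' q' ((cyl s t R).indicator f) < ∞ := by
  obtain ⟨C, hC⟩ := eLpNorm_ball_le hL R
  set I : Measure ℝ := volume.restrict (Ioo s t)
  obtain ⟨A, hA⟩ : ∃ A : NNReal, (A : ℝ≥0∞) = volume.restrict (Metric.ball (0 : E3) R) univ
      ^ (1 / q'.toReal - 1 / q.toReal) := ⟨_, ENNReal.coe_toNNReal (rpow_measure_univ_ne_top (by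
        rw [Measure.restrict_apply_univ]; exact measure_ball_lt_top) hq0 hq)⟩
  have hsl : ∀ᵐ τ ∂I, AEStronglyMeasurable (fun x : E3 => f (τ, x)) volume := by
    have h1 := h.1
    rw [Measure.volume_eq_prod, ← Measure.prod_restrict, Measure.restrict_univ] at h1
    exact h1.prodMk_left
  have h1 : ∀ᵐ τ ∂I, eLpNorm (fun x : E3 => (cyl s t R).indicator f (τ, x)) q' volume
      ≤ ((A * C : NNReal) : ℝ≥0∞) * eLpNorm (fun x : E3 => f (τ, x)) q (volume.restrict (cell L)) := by
    filter_upwards [hsl, ae_restrict_mem measurableSet_Ioo] with τ hτ hτI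
    have e1 : (fun x : E3 => (cyl s t R).indicator f (τ, x))
        = (Metric.ball 0 R).indicator fun x => f (τ, x) := by
      funext x
      by_cases hx : x ∈ Metric.ball (0 : E3) R
      · rw [indicator_of_mem hx, indicator_of_mem (show (τ, x) ∈ cyl s t R from ⟨hτI, hx⟩)]
      · rw [indicator_of_notMem hx, indicator_of_notMem fun h' : (τ, x) ∈ cyl s t R => hx h'.2]
    rw [e1, eLpNorm_indicator_eq_eLpNorm_restrict measurableSet_ball]
    refine (eLpNorm_le_eLpNorm_mul_rpow_measure_univ hq hτ.restrict).trans ?_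
    rw [← hA, mul_comm, ENNReal.coe_mul, mul_assoc]
    gcongr
    exact hC q hq1 _ hτ fun x i => hf τ x i
  have h2 : mixNorm p' q' ((cyl s t R).indicator f)
      = eLpNorm (fun τ : ℝ => eLpNorm (fun x : E3 => (cyl s t R).indicator f (τ, x)) q' volume)
        p' I := by
    rw [mixNorm, ← eLpNorm_indicator_eq_eLpNorm_restrict measurableSet_Ioo]
    congr 1
    funext τ
    by_cases hτ : τ ∈ Ioo s t
    · rw [indicator_of_mem hτ]
    · rw [indicator_of_notMem hτ]
      have : (fun x : E3 => (cyl s t R).indicator f (τ, x)) = 0 :=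
        funext fun x => indicator_of_notMem (fun h' : (τ, x) ∈ cyl s t R => hτ h'.1) _
      rw [this, eLpNorm_zero]
  have hm := (aemeasurable_eLpNorm_slice (h.aesm (R := R)) q').aestronglyMeasurable.restrict
    (s := Ioo s t)
  rw [h2]
  refine (eLpNorm_le_eLpNorm_mul_rpow_measure_univ hp hm).trans_lt (ENNReal.mul_lt_top ?_ ?_)
  · refine (eLpNorm_le_nnreal_smul_eLpNorm_of_ae_le_mul' (c := A * C)
      (g := fun τ : ℝ => eLpNorm (fun x : E3 => f (τ, x)) q (volume.restrict (cell L)))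
      (h1.mono fun τ h => by rwa [enorm_eq_self, enorm_eq_self]) p).trans_lt ?_
    rw [ENNReal.smul_def, smul_eq_mul]
    exact ENNReal.mul_lt_top ENNReal.coe_lt_top h.2
  · exact (rpow_measure_univ_ne_top (by simp [I]) hp0 hp).lt_top

/-! ### Cut-offs of solutions -/

theorem cross_indicator (Q : Set ST) (b J : ST → E3) : (fun z => cross (Q.indicator J z)
    (Q.indicator b z)) = Q.indicator fun z => cross (J z) (b z) := by
  funext z
  by_cases hz : z ∈ Q
  · simp [hz]
  · simp [hz, cross]

theorem locallyIntegrableOn_apply {Ω : Set ST} {F : ST → E3} (h : LocallyIntegrableOn F Ω)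
    (i : Fin 3) : LocallyIntegrableOn (fun z => F z i) Ω := fun z hz => by
  obtain ⟨s, h1, h2⟩ := h z hz
  exact ⟨s, h1, Integrable.eval_piLp h2 i⟩

theorem IsSolution.weakEq {T d : ℝ} {b J : ST → E3} (H : IsSolution T d b J) {Q : Set ST}
    (hQ : Q ⊆ dom T) : WeakEq Q d (Q.indicator b) (Q.indicator J)
      fun z => cross (Q.indicator J z) (Q.indicator b z) := by
  rw [cross_indicator]
  have key : ∀ {F : ST → E3} {u : ST → ℝ} (i : Fin 3), tsupport u ⊆ Q →
      ∫ z, u z * F z i = ∫ z, u z * (Q.indicator F z) i := by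
    intro F u i hu
    congr 1
    funext z
    by_cases hz : z ∈ Q
    · rw [indicator_of_mem hz]
    · rw [image_eq_zero_of_notMem_tsupport fun h => hz (hu h), zero_mul, zero_mul]
  have k1 : ∀ {F : ST → E3} (_ : LocallyIntegrableOn F (dom T)) {η : ST → ℝ} (hη : IsTest Q η)
      (v : ST) (i : Fin 3), toDistV T F i (∂_{v} (⟨hη.smooth, hη.compact, hη.subset.trans hQ⟩ :
      IsTest (dom T) η).toTest) = ∫ z, fderiv ℝ η z v * (Q.indicator F z) i := by
    intro F hF η hη v i
    rw [toDistV, toDist_apply (locallyIntegrableOn_apply hF i), lineDeriv_test]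
    exact key i ((tsupport_fderiv_apply_subset ℝ v).trans hη.subset)
  refine ⟨fun η hη => ?_, fun η hη i => ?_, fun η hη i => ?_⟩
  · have := DFunLike.congr_fun H.div_b (⟨hη.smooth, hη.compact, hη.subset.trans hQ⟩ :
      IsTest (dom T) η).toTest
    rw [div_apply] at this
    simp only [k1 H.locallyIntegrable_b hη] at this
    exact neg_eq_zero.1 this
  · have := DFunLike.congr_fun (congrFun H.curl_b i) (⟨hη.smooth, hη.compact, hη.subset.trans hQ⟩ :
      IsTest (dom T) η).toTest
    have e1 : toDistV T J i (⟨hη.smooth, hη.compact, hη.subset.trans hQ⟩ :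
        IsTest (dom T) η).toTest = ∫ z, η z * (Q.indicator J z) i := by
      rw [toDistV, toDist_apply (locallyIntegrableOn_apply H.locallyIntegrable_J i)]
      exact key i hη.subset
    rw [← e1, this]
    fin_cases i <;>
    · simp [curl, dx_apply, k1 H.locallyIntegrable_b hη]
      try ring
  · have := DFunLike.congr_fun (H.equation i) (⟨hη.smooth, hη.compact, hη.subset.trans hQ⟩ :
      IsTest (dom T) η).toTest
    rw [add_apply, dt_apply, k1 H.locallyIntegrable_b hη] at this
    fin_cases i <;>
    · simp [curl, dx_apply, k1 H.locallyIntegrable_cross hη] at this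
      simp
      linarith

theorem norm_cross_le (u v : E3) : ‖cross u v‖ ≤ ‖u‖ * ‖v‖ := by
  refine abs_le_of_sq_le_sq' ?_ (by positivity) |>.2
  rw [mul_pow, ← norm_sq_E3, ← norm_sq_E3, ← norm_sq_E3]
  simp only [cross, crossProduct, LinearMap.mk₂_apply]
  simp only [Matrix.cons_val]
  nlinarith [sq_nonneg (u 0 * v 0 + u 1 * v 1 + u 2 * v 2)]

theorem cross_sub_left (u u' v : E3) : cross u v - cross u' v = cross (u - u') v := by
  simp [cross]

section

variable {p s m q s' n : ℝ≥0∞} {f g h : ST → E3} {Q : Set ST}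

theorem tame_of_mixNorm (h1 : ENNReal.HolderTriple p p s) (h2 : ENNReal.HolderTriple s m 1)
    (h3 : ENNReal.HolderTriple q q s') (h4 : ENNReal.HolderTriple s' n 1) (hp : p ≠ 0) (hm : m ≠ 0)
    (hm' : m ≠ ∞) (hn : n ≠ 0) (hn' : n ≠ ∞) (hf : MemLp f 3 volume) (hg : MemLp g 3 volume)
    (hh : LocallyIntegrable h volume) (hf' : mixNorm p q f < ∞) (hg' : mixNorm p q g < ∞)
    (hh' : mixNorm m n h < ∞) (hQ : volume Q < ∞) (hQm : MeasurableSet Q)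
    (h0 : ∀ z ∉ Q, h z = 0) : Tame f g h ∧ (∀ u, MemLp u 3 volume → (∀ z, ‖u z‖ ≤ 1) →
      LocallyIntegrable (fun z => cross (h z) (f z)) volume →
      Tame f u fun z => cross (h z) (f z)) := by
  have hha := hh.aestronglyMeasurable
  have key : ∀ {g' : ST → E3}, MemLp g' 3 volume → mixNorm p q g' < ∞ → ∀ ε : ℝ≥0∞, 0 < ε →
      ∃ N : ℝ, ∃ k : ST → E3, MemLp k 3 volume ∧ (∀ z, ‖k z‖ ≤ N) ∧ ∀ y₁ y₂ : ST,
        ∫⁻ z, ‖f (z + y₁)‖ₑ * ‖g' (z + y₂)‖ₑ * ‖h z - k z‖ₑ ≤ ε := by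
    intro g' hg hg' ε hε
    obtain ⟨C, hC, hC'⟩ : ∃ C : ℝ≥0∞, C ≠ ∞ ∧ mixNorm p q f * mixNorm p q g' ≤ C :=
      ⟨_, (ENNReal.mul_lt_top hf' hg').ne, le_rfl⟩
    have hC1 : C + 1 ≠ ∞ := ENNReal.add_ne_top.2 ⟨hC, ENNReal.one_ne_top⟩
    obtain ⟨N, k, k1, k2, k3, k4⟩ := exists_truncation hm hm' hn hn' hha hh'
      (ENNReal.div_pos hε.ne' hC1)
    refine ⟨N, k, ?_, k2, fun y₁ y₂ => ?_⟩
    · have : Q.indicator k = k := indicator_eq_self.2 fun z hz => by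
        by_contra hzQ
        exact hz (k3 z (h0 z hzQ))
      rw [← this, memLp_indicator_iff_restrict hQm]
      have : IsFiniteMeasure ((volume : Measure ST).restrict Q) := ⟨by simpa using hQ⟩
      exact MemLp.of_bound k1.restrict N (Eventually.of_forall k2)
    · refine (lintegral_mixNorm_translate_le h1 h2 h3 h4 hp hm hf.1 hg.1 (hha.sub k1) hf' hg'
        (k4.trans_le le_top) y₁ y₂).trans ?_
      exact (mul_le_mul' (hC'.trans le_self_add) k4.le).trans ENNReal.mul_div_le
  refine ⟨⟨hf, hg, hh, fun ε hε => ?_⟩, fun u hu hu1 hc => ⟨hf, hu, hc, fun ε hε => ?_⟩⟩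
  · obtain ⟨N, k, k1, -, k3⟩ := key hg hg' ε hε
    exact ⟨k, k1, k3⟩
  · obtain ⟨N, k, k1, k2, k3⟩ := key hf hf' ε hε
    have hcr : AEStronglyMeasurable (fun z => cross (k z) (f z)) volume := by
      have hc : Continuous fun w : E3 × E3 => cross w.1 w.2 := by
        refine (PiLp.continuous_toLp 2 _).comp (continuous_pi fun i => ?_)
        fin_cases i <;> simp [crossProduct] <;> fun_prop
      exact hc.comp_aestronglyMeasurable (k1.1.prodMk hf.1)
    refine ⟨fun z => cross (k z) (f z), MemLp.of_le_mul (c := N) hf hcr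
      (.of_forall fun z => (norm_cross_le _ _).trans
        (mul_le_mul_of_nonneg_right (k2 z) (norm_nonneg _))), fun y₁ y₂ => ?_⟩
    refine le_trans (lintegral_mono fun z => ?_) (k3 y₁ 0)
    rw [cross_sub_left, add_zero, mul_assoc, mul_assoc]
    refine mul_le_mul' le_rfl ?_
    rw [← one_mul (‖f z‖ₑ * _)]
    refine mul_le_mul' ?_ ?_
    · rw [← ofReal_norm, ENNReal.ofReal_le_one]
      exact hu1 _
    · rw [← ofReal_norm, ← ofReal_norm, ← ofReal_norm, ← ENNReal.ofReal_mul (norm_nonneg _), mul_comm]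
      exact ENNReal.ofReal_le_ofReal (norm_cross_le _ _)

end

theorem memLpLq_const (L s t : ℝ) (v : E3) : MemLpLq L s t ∞ ∞ fun _ => v := by
  refine ⟨aestronglyMeasurable_const, ?_⟩
  rw [eLpNorm_exponent_top]
  refine (essSup_le_of_ae_le _ (.of_forall fun _ => le_rfl)).trans_lt ?_
  rw [enorm_eq_self]
  exact (memLp_top_const v).2

theorem exists_cyl {T r : ℝ} {S : Set ST} (hS : S ⊆ dom T) (hc : IsCompact S) : ∃ s t R : ℝ,
    0 < s ∧ t < T ∧ ∀ z ∈ S, ∀ l : E3, ‖l‖ ≤ r → z + sh l ∈ cyl s t R := by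
  rcases S.eq_empty_or_nonempty with rfl | hne
  · exact ⟨1, T - 1, 0, one_pos, by linarith, by simp⟩
  obtain ⟨z₀, h₀, hmin⟩ := hc.exists_isMinOn hne continuous_fst.continuousOn
  obtain ⟨z₁, h₁, hmax⟩ := hc.exists_isMaxOn hne continuous_fst.continuousOn
  obtain ⟨R, hR⟩ := hc.isBounded.exists_norm_le
  have e0 := (hS h₀).1
  have e1 := (hS h₁).1
  refine ⟨z₀.1 / 2, (z₁.1 + T) / 2, R + r + 1, by linarith [e0.1], by linarith [e1.2],
    fun z hz l hl => ⟨⟨?_, ?_⟩, ?_⟩⟩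
  · have : z₀.1 ≤ z.1 := hmin hz
    have := e0.1
    simp only [sh, Prod.fst_add, add_zero]
    linarith
  · have : z.1 ≤ z₁.1 := hmax hz
    have := e1.2
    simp only [sh, Prod.fst_add, add_zero]
    linarith
  · have h1 := norm_add_le z.2 l
    have h2 := (norm_snd_le z).trans (hR z hz)
    simp only [sh, Prod.snd_add, Metric.mem_ball, dist_zero_right]
    linarith

theorem IsSolution.localCut {L T d : ℝ} (hL : 0 < L) {b J : ST → E3} (hb : SpacePeriodic L b)
    (hJ : SpacePeriodic L J) (hsol : IsSolution T d b J) {p q m n : ℝ≥0∞} (hp : 3 ≤ p) (hq : 3 ≤ q)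
    (hpm : 2 / p + 1 / m ≤ 1) (hqn : 2 / q + 1 / n ≤ 1)
    (H : ∀ s t : ℝ, 0 < s → t < T → MemLpLq L s t p q b ∧ MemLpLq L s t m n J) :
    LocalCut (dom T) d b J := by
  intro S hS hc r
  obtain ⟨s, t, R, hs, ht, hQ⟩ := exists_cyl (r := r) hS hc
  set Q := cyl s t R with hQd
  have hQm : MeasurableSet Q := measurableSet_cyl s t R
  have hKc : IsCompact (Icc s t ×ˢ 𝔹 R) :=
    isCompact_Icc.prod (isCompact_closedBall _ _)
  have hQK : Q ⊆ Icc s t ×ˢ 𝔹 R :=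
    prod_mono Ioo_subset_Icc_self Metric.ball_subset_closedBall
  have hKd : Icc s t ×ˢ 𝔹 R ⊆ (dom T : Set ST) := fun z hz =>
    ⟨⟨hs.trans_le hz.1.1, hz.1.2.trans_lt ht⟩, trivial⟩
  have hloc : ∀ {F : ST → E3}, LocallyIntegrableOn F (dom T) →
      LocallyIntegrable (Q.indicator F) volume := fun hF =>
    ((integrable_indicator_iff hQm).2 (((locallyIntegrableOn_iff
      (dom T).isOpen.isLocallyClosed).1 hF _ hKd hKc).mono_set hQK)).locallyIntegrable
  obtain ⟨hbm, hJm⟩ := H s t hs ht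
  obtain ⟨p₁, s₁, m₁, a1, a2, a3, a4, a5, a6, a7⟩ := exists_exponents hp hpm
  obtain ⟨q₁, s₂, n₁, b1, b2, b3, b4, b5, b6, b7⟩ := exists_exponents hq hqn
  have hq1 : 1 ≤ q := le_trans (by norm_num) hq
  have hn1 : 1 ≤ n := by
    have : 1 / n ≤ 1 := le_add_self.trans hqn
    rwa [one_div, ENNReal.inv_le_one] at this
  have hu : MemLpLq L s t ∞ ∞ fun _ => e 0 := memLpLq_const L s t _
  have hup : SpacePeriodic L fun _ => e 0 := fun _ _ _ => rfl
  have fm := hbm.mixNorm_lt_top (R := R) hL hb a1 b1 hq1 a3 b3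
  have um := hu.mixNorm_lt_top (R := R) hL hup (p' := p₁) (q' := q₁) le_top le_top le_top a3 b3
  have hm := hJm.mixNorm_lt_top (R := R) hL hJ a2 b2 hn1 a4 b4
  have f3 := memLp_of_mixNorm hbm.aesm
    (hbm.mixNorm_lt_top (R := R) hL hb hp hq hq1 (by norm_num) (by norm_num))
  have u3 := memLp_of_mixNorm hu.aesm
    (hu.mixNorm_lt_top (R := R) hL hup (p' := 3) (q' := 3) le_top le_top le_top (by norm_num)
      (by norm_num))
  have tame := fun {f g : ST → E3} hf hg hf' hg' => tame_of_mixNorm (f := f) (g := g) a6 a7 b6 b7 a3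
    a4 a5 b4 b5 hf hg (hloc hsol.locallyIntegrable_J) hf' hg' hm
    ((measure_mono hQK).trans_lt hKc.measure_lt_top) hQm
    fun z hz => indicator_of_notMem hz _
  refine ⟨Q, Q.indicator b, Q.indicator J, ⟨isOpen_Ioo.prod Metric.isOpen_ball,
    (tame f3 f3 fm fm).1, u3, (tame f3 f3 fm fm).2 _ u3 (fun z => ?_) ?_,
    hsol.weakEq (hQK.trans hKd)⟩, (tame u3 u3 um um).1, (tame f3 u3 fm um).1, fun z hz l hl =>
    ⟨hQ z hz l hl, indicator_of_mem (hQ z hz l hl) _, indicator_of_mem (hQ z hz l hl) _⟩⟩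
  · refine (norm_indicator_le_norm_self _ _).trans ?_
    simp [e]
  · rw [cross_indicator]
    exact hloc hsol.locallyIntegrable_cross

/-! ### Polar coordinates -/

/-- The surface measure of the unit sphere. -/
abbrev surf : Measure 𝕊 := (volume : Measure E3).toSphere

theorem integral_polar {g : E3 → ℝ} (hg : Integrable g) :
    HasInt (volume.restrict (Ioi 0)) (fun r => r ^ 2 * ∫ n, g (r • (n : E3)) ∂surf) (∫ l, g l) := by
  have h0 := (volume : Measure E3).measurePreserving_homeomorphUnitSphereProd
  have hemb := (homeomorphUnitSphereProd E3).measurableEmbedding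
  have hs : MeasurableSet ({0}ᶜ : Set E3) := (measurableSet_singleton 0).compl
  set G : 𝕊 × Ioi (0 : ℝ) → ℝ := fun p => g ((p.2 : ℝ) • (p.1 : E3))
  have h1 : ∀ x : ({0}ᶜ : Set E3), G (homeomorphUnitSphereProd E3 x) = g x := fun x => by
    have := congrArg Subtype.val ((homeomorphUnitSphereProd E3).symm_apply_apply x)
    rw [homeomorphUnitSphereProd_symm_apply_coe] at this
    exact congrArg g this
  have i1 : Integrable G (surf.prod (Measure.volumeIoiPow (Module.finrank ℝ E3 - 1))) := by
    rw [← h0.integrable_comp_emb hemb, show G ∘ _ = g ∘ Subtype.val from funext h1]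
    exact (integrableOn_iff_comap_subtypeVal hs).1 hg.integrableOn
  have e1 : ∫ l, g l = ∫ p, G p ∂(surf.prod (Measure.volumeIoiPow (Module.finrank ℝ E3 - 1))) := by
    rw [← h0.integral_comp hemb]
    simp_rw [h1]
    rw [integral_subtype_comap hs fun x => g x, restrict_compl_singleton]
  have hd : Module.finrank ℝ E3 - 1 = 2 := by simp
  rw [hd] at i1 e1
  have hm : Measurable fun r : Ioi (0 : ℝ) => ((r : ℝ) ^ 2).toNNReal :=
    (measurable_subtype_coe.pow_const _).real_toNNReal
  have h2 : ∀ r ∈ Ioi (0 : ℝ), (r ^ 2).toNNReal • (∫ n, g (r • (n : E3)) ∂surf)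
      = r ^ 2 * ∫ n, g (r • (n : E3)) ∂surf := fun r _ => by
    rw [NNReal.smul_def, Real.coe_toNNReal _ (by positivity), smul_eq_mul]
  have i2 := (integrable_withDensity_iff_integrable_smul hm).1 i1.integral_prod_right
  refine ⟨(((integrableOn_iff_comap_subtypeVal measurableSet_Ioi (f := fun r : ℝ =>
    (r ^ 2).toNNReal • (∫ n, g (r • (n : E3)) ∂surf))).2 i2).congr_fun h2 measurableSet_Ioi), ?_⟩
  rw [e1, integral_prod_symm _ i1, Measure.volumeIoiPow]
  refine Eq.symm ((integral_withDensity_eq_integral_smul hm _).trans ((integral_subtype_comap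
    measurableSet_Ioi fun r : ℝ => (r ^ 2).toNNReal • (∫ n, g (r • (n : E3)) ∂surf)).trans
    (setIntegral_congr_fun measurableSet_Ioi h2)))

theorem dir_smul_sphere {r : ℝ} (hr : 0 < r) (n : 𝕊) :
    dir (r • (n : E3)) = n := by
  rw [dir, norm_smul, norm_eq_of_mem_sphere, mul_one, Real.norm_of_nonneg hr.le, smul_smul,
    inv_mul_cancel₀ hr.ne', one_smul]

section

variable {P : Type*} [NormedAddCommGroup P] [NormedSpace ℝ P] [FiniteDimensional ℝ P]
  {m : P → Form V3 2}
  {Ω : Set ST} {b₁ b₂ b₃ : ST → E3} {A : E3 → P} {ψ : ST → ℝ}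

/-- The average of a form over the displacements of length `r`. -/
def sph (m : P → Form V3 2)
    (A : E3 → P) (b₁ b₂ b₃ : ST → E3) (ψ : ST → ℝ) (r : ℝ) : ℝ :=
  ∫ p : 𝕊 × ST, ψ p.2 * m (A p.1) (two (cp b₁) (r • (p.1 : E3)) p.2)
    (two (cp b₂) (r • (p.1 : E3)) p.2) (two (cp b₃) (r • (p.1 : E3)) p.2) ∂(surf.prod volume)

theorem norm_ps_sphere_le (r : ℝ) (a : Fin 2) (n : 𝕊) :
    ‖ps a (r • (n : E3))‖ ≤ |r| :=
  (norm_ps_le a _).trans (by rw [norm_smul, norm_eq_of_mem_sphere, mul_one, Real.norm_eq_abs])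

theorem continuous_ps (a : Fin 2) : Continuous (ps a) := by
  fin_cases a
  · exact continuous_const
  · exact continuous_id

theorem LocTame.integrable_sph (H : LocTame Ω b₁ b₂ b₃) (hm : LTri m)
    (hA : Integrable (fun n : 𝕊 => A n) surf) (hψ : IsCTest Ω ψ) (r : ℝ) :
    Integrable (fun p : 𝕊 × ST => ψ p.2 * m (A p.1)
      (two (cp b₁) (r • (p.1 : E3)) p.2) (two (cp b₂) (r • (p.1 : E3)) p.2)
      (two (cp b₃) (r • (p.1 : E3)) p.2)) (surf.prod volume) := by
  simp_rw [← vals_ps]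
  exact H.integrable hm hA (s := fun a n => ps a (r • (n : E3)))
    (fun a => ((continuous_ps a).comp (by fun_prop)).measurable) (r := |r|)
    (fun n _ a => norm_ps_sphere_le r a n) hψ

theorem LocTame.continuous_sph (H : LocTame Ω b₁ b₂ b₃) (hm : LTri m)
    (hA : Integrable (fun n : 𝕊 => A n) surf) (hψ : IsCTest Ω ψ) :
    Continuous (sph m A b₁ b₂ b₃ ψ) := by
  refine continuous_iff_continuousAt.2 fun r₀ => ?_
  unfold sph
  simp_rw [← vals_ps]
  refine H.continuousAt hm hA (s := fun a r (n : 𝕊) => ps a (r • (n : E3)))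
    (fun a r => ((continuous_ps a).comp (by fun_prop)).measurable)
    (fun a n => (continuous_ps a).comp (by fun_prop)) (r := |r₀| + 1) ?_ hψ
  filter_upwards [(continuous_abs.tendsto r₀).eventually_lt_const (lt_add_one _)] with r hr n _ a
  exact (norm_ps_sphere_le r a n).trans hr.le

theorem LocTame.polar (H : LocTame Ω b₁ b₂ b₃) (hm : LTri m)
    (hA : Integrable (fun n : 𝕊 => A n) surf) (hψ : IsCTest Ω ψ) {c : ℝ → ℝ}
    (hc : Integrable fun l : E3 => c ‖l‖ • A (dir l)) {R : ℝ} (hR : ∀ r, R < r → c r = 0) :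
    ∃ I, HasInt (volume.prod volume) (fun p : E3 × ST => ψ p.2 * m (c ‖p.1‖ • A (dir p.1))
        (two (cp b₁) p.1 p.2) (two (cp b₂) p.1 p.2) (two (cp b₃) p.1 p.2)) I ∧
      HasInt (volume.restrict (Ioi 0)) (fun r => r ^ 2 * (c r * sph m A b₁ b₂ b₃ ψ r)) I := by
  have h1 := H.integrable_two hm hc (r := R) (fun l hl => by rw [hR _ hl, zero_smul]) hψ
  have h2 := integral_polar h1.integral_prod_left
  have h3 : ∀ r ∈ Ioi (0 : ℝ), (r ^ 2 * ∫ n : 𝕊, (∫ z, ψ z *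
      m (c ‖r • (n : E3)‖ • A (dir (r • (n : E3)))) (two (cp b₁) (r • (n : E3)) z)
      (two (cp b₂) (r • (n : E3)) z) (two (cp b₃) (r • (n : E3)) z)) ∂surf)
      = r ^ 2 * (c r * sph m A b₁ b₂ b₃ ψ r) := fun r hr => by
    rw [sph, integral_prod _ (H.integrable_sph hm hA hψ r), ← integral_const_mul (c r)]
    congr 2
    funext n
    rw [dir_smul_sphere hr, norm_smul, norm_eq_of_mem_sphere, mul_one,
      Real.norm_of_nonneg (le_of_lt hr), ← integral_const_mul]
    congr 1
    funext z
    rw [(hm.lin _ _ _).map_smul, smul_eq_mul]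
    ring
  refine ⟨_, HasInt.of_integrable h1, IntegrableOn.congr_fun h2.1 h3 measurableSet_Ioi, ?_⟩
  rw [integral_prod _ h1, ← h2.2]
  exact (setIntegral_congr_fun measurableSet_Ioi h3).symm

/-- The value without displacement depends only on the mean of the parameter. -/
theorem LocTame.sph_zero (H : LocTame Ω b₁ b₂ b₃) (hm : LTri m)
    (hA : Integrable (fun n : 𝕊 => A n) surf) (hψ : IsCTest Ω ψ) :
    sph m A b₁ b₂ b₃ ψ 0 = ∫ z, ψ z * m (∫ n : 𝕊, A n ∂surf)
      (two (cp b₁) 0 z) (two (cp b₂) 0 z) (two (cp b₃) 0 z) := by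
  rw [sph, integral_prod_symm _ (H.integrable_sph hm hA hψ 0)]
  congr 1
  funext z
  simp only [zero_smul]
  rw [integral_const_mul]
  exact congrArg (ψ z * ·) ((LinearMap.toContinuousLinearMap (IsLinearMap.mk' _ (hm.lin
    (two (cp b₁) 0 z) (two (cp b₂) 0 z) (two (cp b₃) 0 z)))).integral_comp_comm hA)

end

/-! ### Means over the sphere -/

theorem surf_real_univ : surf.real univ = 4 * Real.pi := by
  rw [Measure.toSphere_real_apply_univ, measureReal_def, EuclideanSpace.volume_ball_fin_three]
  simp [ENNReal.toReal_ofReal (show (0 : ℝ) ≤ Real.pi * 4 / 3 by positivity)]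
  ring

theorem continuous_coord (i : Fin 3) : Continuous fun n : 𝕊 => (n : E3) i :=
  (EuclideanSpace.proj (𝕜 := ℝ) i).continuous.comp continuous_subtype_val

theorem Continuous.integrable_surf {V : Type*} [NormedAddCommGroup V] [NormedSpace ℝ V]
    [FiniteDimensional ℝ V] {f : 𝕊 → V} (hf : Continuous f) :
    Integrable f surf :=
  have := isCompact_iff_compactSpace.1 (isCompact_sphere (0 : E3) 1)
  hf.integrable_of_hasCompactSupport (HasCompactSupport.of_compactSpace f)

theorem integral_surf_coord (i j : Fin 3) :
    ∫ n : 𝕊, (n : E3) i * (n : E3) j ∂surf = 4 * Real.pi / 3 * kd i j := by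
  set c : ℝ → ℝ := (Iio 1).indicator fun _ => 1 with hc
  set I : Fin 3 → V3 := fun i j => ∫ n : 𝕊, (n : E3) i * (n : E3) j ∂surf
  have h1 : ∀ i j, ∫ l, c ‖l‖ * (dir l i * dir l j) = 1 / 3 * I i j := by
    intro i j
    have hi : Integrable fun l : E3 => c ‖l‖ * (dir l i * dir l j) := by
      refine integrable_kernel (C := 1) (b := 1) (((measurable_const.indicator
        measurableSet_Iio).comp measurable_norm).mul ((measurable_dir_apply i).mul
        (measurable_dir_apply j))) zero_le_one (fun l _ => ?_) fun l hl => ?_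
      · have h2 : 0 ≤ ‖l‖⁻¹ := by positivity
        have h3 : |c ‖l‖| ≤ 1 := by
          rw [hc, indicator_apply]
          split_ifs <;> simp
        rw [abs_mul, abs_mul, one_mul]
        exact (mul_le_one₀ h3 (by positivity) (mul_le_one₀ (abs_dir_le _ _) (abs_nonneg _)
          (abs_dir_le _ _))).trans (by linarith)
      · rw [hc, indicator_of_notMem (by simpa using hl.le), zero_mul]
    rw [← (integral_polar hi).2]
    have h4 : ∀ r ∈ Ioi (0 : ℝ), r ^ 2 * ∫ n : 𝕊, c ‖r • (n : E3)‖ *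
        (dir (r • (n : E3)) i * dir (r • (n : E3)) j) ∂surf
        = (Iio 1).indicator (fun r => r ^ 2 * I i j) r := by
      intro r hr
      simp only [dir_smul_sphere hr, norm_smul, norm_eq_of_mem_sphere, mul_one,
        Real.norm_of_nonneg (le_of_lt hr)]
      rw [integral_const_mul, hc, indicator_apply, indicator_apply]
      split_ifs <;> simp [I]
    rw [setIntegral_congr_fun measurableSet_Ioi h4, setIntegral_indicator measurableSet_Iio,
      Ioi_inter_Iio, ← integral_Ioc_eq_integral_Ioo, ← intervalIntegral.integral_of_le zero_le_one,
      intervalIntegral.integral_mul_const, integral_pow]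
    norm_num
  have h2 : ∀ (f : E3 ≃ₗᵢ[ℝ] E3) i j, ∫ l, c ‖l‖ * (f (dir l) i * f (dir l) j) = 1 / 3 * I i j := by
    intro f i j
    rw [← h1, ← f.measurePreserving.integral_comp f.toHomeomorph.measurableEmbedding
      fun l => c ‖l‖ * (dir l i * dir l j)]
    simp only [f.norm_map, dir, map_smul]
  have h3 : ∀ i j, I j j = I i i := fun i j => by
    have := h2 (LinearIsometryEquiv.piLpCongrLeft 2 ℝ ℝ (Equiv.swap i j)) i i
    simp only [LinearIsometryEquiv.piLpCongrLeft_apply, Equiv.piCongrLeft'_apply,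
      Equiv.symm_swap, Equiv.swap_apply_left, h1] at this
    linarith
  have h4 : ∀ i j, i ≠ j → I i j = 0 := fun i j hij => by
    have := h2 (LinearIsometryEquiv.piLpCongrRight 2 fun k => if k = i then
      LinearIsometryEquiv.neg ℝ else LinearIsometryEquiv.refl ℝ ℝ) i j
    simp only [LinearIsometryEquiv.piLpCongrRight_apply, if_true, if_neg hij.symm,
      LinearIsometryEquiv.coe_neg, LinearIsometryEquiv.coe_refl, id, neg_mul, mul_neg,
      integral_neg, h1] at this
    linarith
  have h5 : I 0 0 + I 1 1 + I 2 2 = 4 * Real.pi := by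
    have hi : ∀ i, Integrable (fun n : 𝕊 => (n : E3) i * (n : E3) i) surf :=
      fun i => Continuous.integrable_surf ((continuous_coord i).mul (continuous_coord i))
    refine (((HasInt.of_integrable (hi 0)).add (.of_integrable (hi 1))).add
      (.of_integrable (hi 2))).2.symm.trans ?_
    rw [← surf_real_univ, ← mul_one (surf.real univ), ← smul_eq_mul, ← integral_const]
    refine integral_congr_ae (.of_forall fun n => ?_)
    have := EuclideanSpace.real_norm_sq_eq (n : E3)
    rw [norm_eq_of_mem_sphere, Fin.sum_univ_three] at this
    simp only
    linarith
  change I i j = _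
  by_cases hij : i = j
  · subst hij
    rw [kd, if_pos rfl]
    linarith [h3 i 0, h3 i 1, h3 i 2]
  · rw [h4 i j hij, kd, if_neg hij, mul_zero]

theorem integral_surf_pm (α β : ℝ) :
    ∫ n : 𝕊, pm α β (n : E3) ∂surf = (4 * Real.pi * (α + β / 3)) • kd := by
  have hi : ∀ i j, Integrable (fun n : 𝕊 => (n : E3) i * (n : E3) j) surf :=
    fun i j => Continuous.integrable_surf ((continuous_coord i).mul (continuous_coord j))
  have h1 : ∀ i j, Integrable (fun n : 𝕊 => pm α β (n : E3) i j) surf :=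
    fun i j => (integrable_const _).add ((hi i j).const_mul β)
  funext i j
  rw [eval_integral fun i => Integrable.of_eval fun j => h1 i j, eval_integral fun j => h1 i j]
  simp only [pm]
  rw [integral_add (integrable_const _) ((hi i j).const_mul β), integral_const_mul,
    integral_const_mul, integral_surf_coord, integral_const, surf_real_univ]
  simp only [Pi.smul_apply, smul_eq_mul]
  ring

/-! ### The lemma of du Bois-Reymond -/

theorem hasDerivAt_primitive {B : ℝ → ℝ} (hB : ContinuousOn B (Ioi 0)) {c s : ℝ} (hc : 0 < c)
    (hs : 0 < s) : HasDerivAt (fun s => ∫ x in c..s, B x) (B s) s := by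
  refine intervalIntegral.integral_hasDerivAt_right (ContinuousOn.intervalIntegrable
    (hB.mono fun x hx => (lt_min hc hs).trans_le hx.1)) ?_ (hB.continuousAt (Ioi_mem_nhds hs))
  exact hB.stronglyMeasurableAtFilter isOpen_Ioi s hs

theorem hasDerivAt_of_integral_eq_zero {A B : ℝ → ℝ} (hA : ContinuousOn A (Ioi 0))
    (hB : ContinuousOn B (Ioi 0))
    (h : ∀ (F : ℝ → ℝ) (a b : ℝ), C¹ F → 0 < a → a ≤ b → (∀ s < a, F s = 0) →
      (∀ s, b < s → F s = 0) → ∫ s in a..b, (deriv F s * A s + F s * B s) = 0) {s : ℝ} (hs : 0 < s) :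
    HasDerivAt A (B s) s := by
  set C : ℝ → ℝ := fun s => A s - ∫ x in (1 : ℝ)..s, B x with hC
  have hCc : ContinuousOn C (Ioi 0) := hA.sub fun s hs =>
    (hasDerivAt_primitive hB one_pos hs).continuousAt.continuousWithinAt
  have sub : ∀ {a b : ℝ}, 0 < a → a ≤ b → uIcc a b ⊆ Ioi 0 := fun ha hab x hx => by
    rw [uIcc_of_le hab] at hx
    exact ha.trans_le hx.1
  have h1 : ∀ (F : ℝ → ℝ) (a b : ℝ), C¹ F → 0 < a → a ≤ b → (∀ s ≤ a, F s = 0) →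
      (∀ s, b ≤ s → F s = 0) → ∫ s in a..b, deriv F s * C s = 0 := by
    intro F a b hF ha hab h0 h1
    have hsub := sub ha hab
    have hF' := hF.continuous_deriv_one
    have hP : ContinuousOn (fun s => ∫ x in (1 : ℝ)..s, B x) (uIcc a b) := fun s hs =>
      (hasDerivAt_primitive hB one_pos (hsub hs)).continuousAt.continuousWithinAt
    have e1 := intervalIntegral.integral_deriv_mul_eq_sub (u := F) (u' := deriv F) (v' := B)
      (v := fun s => ∫ x in (1 : ℝ)..s, B x) (a := a) (b := b)
      (fun s _ => (hF.differentiable one_ne_zero s).hasDerivAt)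
      (fun s hs => hasDerivAt_primitive hB one_pos (hsub hs)) (hF'.intervalIntegrable _ _)
      (hB.mono hsub).intervalIntegrable
    rw [h0 a le_rfl, h1 b le_rfl, zero_mul, zero_mul, sub_zero] at e1
    have e2 := h F a b hF ha hab (fun s hs => h0 s hs.le) fun s hs => h1 s hs.le
    rw [← sub_eq_zero.2 (e2.trans e1.symm), ← intervalIntegral.integral_sub]
    · congr 1
      funext s
      simp only [hC]
      ring
    · exact ((hF'.continuousOn.mul (hA.mono hsub)).add
        (hF.continuous.continuousOn.mul (hB.mono hsub))).intervalIntegrable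
    · exact ((hF'.continuousOn.mul hP).add
        (hF.continuous.continuousOn.mul (hB.mono hsub))).intervalIntegrable
  let φ : ContDiffBump (2 : ℝ) := ⟨1 / 2, 1, by norm_num, by norm_num⟩
  set g₀ : ℝ → ℝ := φ.normed volume
  have g0c : Continuous g₀ := φ.continuous_normed
  have g0s : ∀ x, x ∉ Ioc 1 3 → g₀ x = 0 := fun x hx => by
    by_contra h
    have : x ∈ Metric.ball (2 : ℝ) 1 := φ.support_normed_eq (μ := volume) ▸ Function.mem_support.2 h
    rw [Real.ball_eq_Ioo] at this
    exact hx ⟨by linarith [this.1], by linarith [this.2]⟩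
  set k : ℝ := ∫ x, g₀ x * C x
  have h2 : ∀ g : ℝ → ℝ, ContDiff ℝ (⊤ : ℕ∞) g → HasCompactSupport g → tsupport g ⊆ Ioi 0 →
      ∫ x, g x • (C x - k) = 0 := by
    intro g hg hgc hgs
    obtain ⟨a, b, ha, hab, ha1, hb3, hgab⟩ : ∃ a b, 0 < a ∧ a ≤ b ∧ a ≤ 1 ∧ 3 ≤ b ∧
        ∀ x, x ∉ Ioc a b → g x = 0 := by
      obtain ⟨M, hM⟩ := hgc.bddAbove
      obtain ⟨δ, hδ, hδs⟩ : ∃ δ > 0, ∀ x ∈ tsupport g, δ ≤ x := by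
        rcases (tsupport g).eq_empty_or_nonempty with he | hne
        · exact ⟨1, one_pos, by simp [he]⟩
        · obtain ⟨x, hx, hmin⟩ := hgc.exists_isMinOn hne continuousOn_id
          exact ⟨x, hgs hx, fun y hy => hmin hy⟩
      refine ⟨min (δ / 2) 1, max M 3, by positivity, (min_le_right _ _).trans
        (by norm_num [le_max_iff] : (1 : ℝ) ≤ max M 3), min_le_right _ _, le_max_right _ _,
        fun x hx => image_eq_zero_of_notMem_tsupport fun h => hx ⟨?_, ?_⟩⟩
      · exact (min_le_left _ _).trans_lt (by linarith [hδs x h])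
      · exact (hM h).trans (le_max_left _ _)
    have hg0 : ∀ x, x ∉ Ioc a b → g₀ x = 0 := fun x hx =>
      g0s x fun h => hx ⟨ha1.trans_lt h.1, h.2.trans hb3⟩
    have full : ∀ u v : ℝ → ℝ, Continuous u → (∀ x, x ∉ Ioc a b → u x = 0) → ContinuousOn v (Ioi 0) →
        HasInt volume (fun x => u x * v x) (∫ x in a..b, u x * v x) := fun u v hu hu0 hv => by
      have h3 : Function.support (fun x => u x * v x) ⊆ Ioc a b := fun x hx => by
        by_contra h
        exact hx (by simp only [hu0 x h, zero_mul])
      refine ⟨(integrableOn_iff_integrable_of_support_subset h3).1 ?_,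
        (intervalIntegral.integral_eq_integral_of_support_subset h3).symm⟩
      exact (intervalIntegrable_iff_integrableOn_Ioc_of_le hab).1
        (hu.continuousOn.mul (hv.mono (sub ha hab))).intervalIntegrable
    set G : ℝ → ℝ := fun x => g x - (∫ x, g x) * g₀ x with hG
    have hGc : Continuous G := hg.continuous.sub (continuous_const.mul g0c)
    have hGz : ∀ x, x ∉ Ioc a b → G x = 0 := fun x hx => by simp [hG, hgab x hx, hg0 x hx]
    have hd : ∀ x, HasDerivAt (fun x => ∫ y in a..x, G y) (G x) x := fun x =>
      intervalIntegral.integral_hasDerivAt_right (hGc.intervalIntegrable _ _)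
        hGc.stronglyMeasurable.stronglyMeasurableAtFilter hGc.continuousAt
    have i1 := fun u hu hu0 => (full u 1 hu hu0 continuousOn_const).congr (g := u)
      (fun x => (mul_one _).symm) rfl
    have hGi : ∫ y in a..b, G y = 0 := by
      have e1 := (i1 G hGc hGz).2
      simp only [Pi.one_apply, mul_one] at e1
      rw [← e1, integral_sub (i1 g hg.continuous hgab).1 ((i1 g₀ g0c hg0).1.const_mul _),
        integral_const_mul, φ.integral_normed, mul_one, sub_self]
    have key := h1 (fun x => ∫ y in a..x, G y) a b (contDiff_one_iff_deriv.2
      ⟨fun x => (hd x).differentiableAt, by rwa [funext fun x => (hd x).deriv]⟩) ha hab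
      (fun x hx => by
        rw [intervalIntegral.integral_of_ge hx, setIntegral_eq_zero_of_forall_eq_zero fun y hy =>
          hGz y fun h => absurd h.1 (not_lt.2 hy.2), neg_zero])
      (fun x hx => by
        rw [← intervalIntegral.integral_add_adjacent_intervals (hGc.intervalIntegrable a b)
          (hGc.intervalIntegrable b x), hGi, intervalIntegral.integral_of_le hx,
          setIntegral_eq_zero_of_forall_eq_zero fun y hy =>
          hGz y fun h => absurd hy.1 (not_lt.2 h.2), zero_add])
    simp only [funext fun x => (hd x).deriv] at key
    have e1 := full G C hGc hGz hCc
    have e2 := full g₀ C g0c hg0 hCc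
    refine (((e1.add (e2.const_mul (∫ x, g x))).sub ((HasInt.of_integrable
      (i1 g hg.continuous hgab).1).const_mul k)).congr (fun x => ?_) rfl).2.trans ?_
    · simp only [hG, smul_eq_mul]
      ring
    · rw [key, ← e2.2]
      ring
  have h3 := IsOpen.ae_eq_zero_of_integral_contDiff_smul_eq_zero (μ := volume) isOpen_Ioi
    ((hCc.sub continuousOn_const).locallyIntegrableOn measurableSet_Ioi) h2
  have h4 : EqOn (fun x => C x - k) (fun _ => 0) (Ioi 0) := Measure.eqOn_open_of_ae_eq
    (μ := volume) ((ae_restrict_iff' measurableSet_Ioi).2 h3) isOpen_Ioi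
    (hCc.sub continuousOn_const) continuousOn_const
  refine ((hasDerivAt_primitive hB one_pos hs).const_add k).congr_of_eventuallyEq ?_
  filter_upwards [Ioi_mem_nhds hs] with x hx
  have := h4 hx
  simp only [hC] at this
  linarith

/-! ### The balance of energy over spheres -/

/-- The part of the derivatives of the kernel with the derivative of the profile. -/
def qa (α β : ℝ) (n : E3) (k i j : Fin 3) : ℝ := n k * pm α β n i j

/-- The part of the derivatives of the kernel without the derivative of the profile. -/
def qb (β : ℝ) (n : E3) (k i j : Fin 3) : ℝ :=
  β * (kd k i * n j + n i * kd k j - 2 * (n i * n j) * n k)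

/-- The flux of energy, without the part with the potential of the kernel. -/
def energyTri (i : Fin 3) (t : Fin 3 → V3) (u x w : Fin 2 → V3) : ℝ :=
  forceTri t 0 (kd i) u x w + (rightTri t (kd i) u x w + fluxTri t (kd i) u x w)

theorem ltri_energy (i : Fin 3) : LTri (energyTri i) := by
  apply ltri_of <;> intros <;>
    simp [energyTri, forceTri, rightTri, fluxTri, mv, dot3, cr] <;> ring

theorem ltri_pressure (i : Fin 3) : LTri fun k => forceTri 0 k (kd i) := by
  apply ltri_of <;> intros <;> simp [forceTri, mv, dot3, cr] <;> ring

theorem forceTri_split (t : Fin 3 → V3) (k : ℝ) (g : V3) (u x w : Fin 2 → V3) :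
    forceTri t k g u x w + rightTri t g u x w + fluxTri t g u x w
      = ∑ i, g i * energyTri i t u x w + ∑ i, g i * forceTri 0 k (kd i) u x w := by
  rw [rightTri_expand t g, fluxTri_expand t g]
  simp only [energyTri, mul_add, Finset.sum_add_distrib]
  simp only [forceTri, dot3, mv, cr, Fin.sum_univ_three, kd, Pi.zero_apply]
  simp
  ring

section

variable {Ω : Set ST} (d : ℝ) (b J : ST → E3) (ψ : ST → ℝ) (α β : ℝ)

/-- The transfer of energy over displacements of a given length. -/
def transferS (r : ℝ) : ℝ :=
  sph enTri (pm α β) b one b (fun z => fderiv ℝ ψ z (1, 0)) r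
    + d * ∑ i, sph (energyTri i) (pm α β) b b J (fun z => gr ψ z i) r

/-- The part of the transfer of energy with the potential of the kernel. -/
def pressureS (r : ℝ) : ℝ :=
  d * ∑ i, sph (fun k => forceTri 0 k (kd i)) (fun _ => 1) b b J (fun z => gr ψ z i) r

/-- The defect over displacements of a given length. -/
def defectS (A : E3 → Fin 3 → Fin 3 → V3) (r : ℝ) : ℝ := d * sph defectTri A b b J ψ r

/-- The integral of the pressure part over the ball. -/
def pressureI (r : ℝ) : ℝ := ∫ s in (0 : ℝ)..r, s ^ 2 * pressureS d b J ψ s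

variable {d b J ψ α β}

theorem integrable_pm_surf :
    Integrable (fun n : 𝕊 => pm α β n) surf := by
  refine Continuous.integrable_surf (continuous_pi fun i => continuous_pi fun j => ?_)
  have := continuous_coord i
  have := continuous_coord j
  unfold pm
  fun_prop

theorem integrable_qa_surf :
    Integrable (fun n : 𝕊 => qa α β n) surf := by
  refine Continuous.integrable_surf (continuous_pi fun k => continuous_pi fun i =>
    continuous_pi fun j => ?_)
  have := continuous_coord i
  have := continuous_coord j
  have := continuous_coord k
  unfold qa pm
  fun_prop

theorem integrable_qb_surf :
    Integrable (fun n : 𝕊 => qb β n) surf := by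
  refine Continuous.integrable_surf (continuous_pi fun k => continuous_pi fun i =>
    continuous_pi fun j => ?_)
  have := continuous_coord i
  have := continuous_coord j
  have := continuous_coord k
  unfold qb
  fun_prop

theorem integrable_qa {F : ℝ → ℝ} {R : ℝ} (hF : Profile F R) :
    Integrable fun l : E3 => deriv F ‖l‖ • qa α β (dir l) := by
  refine (integrable_array hF (A := fun l => qa α β (dir l)) (C := |α| + |β|)
    (fun k i j => (measurable_dir_apply k).mul (measurable_pm α β i j)) fun l k i j => ?_).1
  rw [qa, abs_mul]
  exact (mul_le_of_le_one_left (abs_nonneg _) (abs_dir_le l k)).trans (abs_pm_le α β l i j)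

theorem integrable_qb {F : ℝ → ℝ} {R : ℝ} (hF : Profile F R) :
    Integrable fun l : E3 => (F ‖l‖ / ‖l‖) • qb β (dir l) := by
  refine (integrable_array hF (A := fun l => qb β (dir l)) (C := |β| * 4)
    (fun k i j => ?_) fun l k i j => ?_).2
  · have := measurable_dir_apply i
    have := measurable_dir_apply j
    have := measurable_dir_apply k
    unfold qb
    fun_prop
  · have h1 := abs_dir_le l
    have h2 := mul_le_one₀ (abs_kd_le k i) (abs_nonneg _) (h1 j)
    have h3 := mul_le_one₀ (h1 i) (abs_nonneg _) (abs_kd_le k j)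
    have h4 := mul_le_one₀ (mul_le_one₀ (h1 i) (abs_nonneg _) (h1 j)) (by positivity) (h1 k)
    simp only [← abs_mul, abs_le] at h2 h3 h4
    rw [qb, abs_mul]
    exact mul_le_mul_of_nonneg_left (abs_le.2 ⟨by linarith, by linarith⟩) (abs_nonneg _)

theorem qF_split (F : ℝ → ℝ) (l : E3) : qF α β F (deriv F) l
    = deriv F ‖l‖ • qa α β (dir l) + (F ‖l‖ / ‖l‖) • qb β (dir l) := rfl

theorem LocalCut.continuous_transferS (H : LocalCut Ω d b J) (hψ : IsTest Ω ψ) :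
     Continuous (transferS d b J ψ α β) :=
  (H.fuf.continuous_sph ltri_en integrable_pm_surf (isCTest_time hψ)).add
    (continuous_const.mul (continuous_finsetSum _ fun i _ =>
      H.ffh.continuous_sph (ltri_energy i) integrable_pm_surf (isCTest_gr hψ i)))

theorem LocalCut.continuous_pressureS (H : LocalCut Ω d b J) (hψ : IsTest Ω ψ) :
     Continuous (pressureS d b J ψ) :=
  continuous_const.mul (continuous_finsetSum _ fun i _ =>
    H.ffh.continuous_sph (ltri_pressure i) (integrable_const _) (isCTest_gr hψ i))

theorem LocalCut.continuous_defectS (H : LocalCut Ω d b J) (hψ : IsTest Ω ψ)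
    {A : E3 → Fin 3 → Fin 3 → V3}
    (hA : Integrable (fun n : 𝕊 => A n) surf) :
    Continuous (defectS d b J ψ A) :=
  continuous_const.mul (H.ffh.continuous_sph ltri_defect hA hψ.isCTest)

theorem LocalCut.hasDerivAt_pressureI (H : LocalCut Ω d b J) (hψ : IsTest Ω ψ) (s : ℝ) :
    HasDerivAt (pressureI d b J ψ) (s ^ 2 * pressureS d b J ψ s) s :=
  have hc := (continuous_id.pow 2).mul (H.continuous_pressureS hψ)
  intervalIntegral.integral_hasDerivAt_right (hc.intervalIntegrable _ _)
    hc.stronglyMeasurable.stronglyMeasurableAtFilter hc.continuousAt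

/-- The defect in polar coordinates. -/
theorem LocalCut.polar_defect (H : LocalCut Ω d b J) (hψ : IsTest Ω ψ)
    {F : ℝ → ℝ} {R : ℝ} (hF : Profile F R) :
    ∃ I, HasInt (volume.prod volume) (fun p : E3 × ST => d * (ψ p.2 * defectTri
        (qF α β F (deriv F) p.1) (two (cp b) p.1 p.2) (two (cp b) p.1 p.2) (two (cp J) p.1 p.2))) I ∧
      HasInt (volume.restrict (Ioi 0)) (fun r => r ^ 2 * (deriv F r * defectS d b J ψ (qa α β) r
        + F r / r * defectS d b J ψ (qb β) r)) I := by
  obtain ⟨I₁, p1, r1⟩ := H.ffh.polar ltri_defect (A := qa α β) integrable_qa_surf hψ.isCTest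
    (integrable_qa hF) fun r hr => deriv_eq_zero_of_gt hF.zero hr
  obtain ⟨I₂, p2, r2⟩ := H.ffh.polar ltri_defect (A := qb β) integrable_qb_surf hψ.isCTest
    (c := fun r => F r / r) (integrable_qb hF) fun r hr => by rw [hF.zero r hr, zero_div]
  refine ⟨d * (I₁ + I₂), ((p1.add p2).const_mul d).congr (fun p => ?_) rfl,
    ((r1.add r2).const_mul d).congr (fun r => ?_) rfl⟩
  · rw [qF_split, (ltri_defect.lin _ _ _).map_add, mul_add]
  · simp only [defectS]
    ring

/-- The balance of energy for kernels with profile supported in `(0, ∞)`. -/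
theorem LocalCut.polar_energy (H : LocalCut Ω d b J) (hψ : IsTest Ω ψ)
    {F : ℝ → ℝ} {a R : ℝ} (hF : C¹ F) (ha : 0 < a) (haR : a ≤ R)
    (h0 : ∀ s < a, F s = 0) (h1 : ∀ s, R < s → F s = 0) :
    ∃ I, HasInt (volume.restrict (Ioi 0)) (fun s => s ^ 2 * (F s * transferS d b J ψ α β s)
      - s ^ 2 * (deriv F s * defectS d b J ψ (qa α β) s + F s / s * defectS d b J ψ (qb β) s)) I ∧
      HasInt (volume.restrict (Ioi 0)) (fun s => s ^ 2 * (κF α β R F s * pressureS d b J ψ s))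
        (-I) := by
  have hP : Profile F R := ⟨hF, ha.le.trans haR, h1⟩
  have hκ : Integrable fun l : E3 => κF α β R F ‖l‖ • (1 : ℝ) := by
    simp only [smul_eq_mul, mul_one]
    refine ((contDiff_κF hF ha h0).continuous.comp continuous_norm).integrable_of_hasCompactSupport
      (HasCompactSupport.intro (isCompact_closedBall 0 R) fun l hl => κF_eq_zero h1 ?_)
    simpa using hl
  obtain ⟨I₁, p1, r1⟩ := H.fuf.polar ltri_en (A := pm α β) integrable_pm_surf (isCTest_time hψ)
    (c := F) (integrable_tF α β hP) h1
  have h2 := fun i => H.ffh.polar (ltri_energy i) (A := pm α β) integrable_pm_surf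
    (isCTest_gr hψ i) (c := F) (integrable_tF α β hP) h1
  choose I₂ p2 r2 using h2
  have h3 := fun i => H.ffh.polar (ltri_pressure i) (A := fun _ => 1) (integrable_const _)
    (isCTest_gr hψ i) hκ fun s hs => κF_eq_zero h1 hs
  choose I₃ p3 r3 using h3
  obtain ⟨I₄, p4, r4⟩ := H.polar_defect (α := α) (β := β) hψ hP
  have key : Zero volume fun l z => fderiv ℝ ψ z (1, 0) * dot3 (two (cp b) l z 0)
      (mv (tF α β F l) (two (cp b) l z 1)) + d * (forceTri (tF α β F l) (κF α β R F ‖l‖) (gr ψ z)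
      (two (cp b) l z) (two (cp b) l z) (two (cp J) l z) + rightTri (tF α β F l) (gr ψ z)
      (two (cp b) l z) (two (cp b) l z) (two (cp J) l z) + fluxTri (tF α β F l) (gr ψ z)
      (two (cp b) l z) (two (cp b) l z) (two (cp J) l z) - ψ z * defectTri (qF α β F (deriv F) l)
      (two (cp b) l z) (two (cp b) l z) (two (cp J) l z)) := by
    refine H.zero_of_cut hψ hP.pos (I := fun l z u v => fderiv ℝ ψ z (1, 0) * dot3 (u 0)
      (mv (tF α β F l) (u 1)) + d * (forceTri (tF α β F l) (κF α β R F ‖l‖) (gr ψ z) u u v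
      + rightTri (tF α β F l) (gr ψ z) u u v + fluxTri (tF α β F l) (gr ψ z) u u v
      - ψ z * defectTri (qF α β F (deriv F) l) u u v)) (fun l z hz u v => ?_)
      (fun l hl z u v => ?_) fun Q f h hC hψQ hQ => ?_
    · have : gr ψ z = 0 := gr_eq_zero hz
      simp [fderiv_of_notMem_tsupport ℝ hz, image_eq_zero_of_notMem_tsupport hz, this, forceTri,
        rightTri, fluxTri, dot3]
    · rw [tF_eq_zero α β hP hl, qF_eq_zero α β hP hl, κF_eq_zero h1 hl, ltri_defect.zero_param,
        (ltri_right _).zero_param, (ltri_flux _).zero_param]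
      simp [forceTri, mv, dot3, cr]
    · have := limit_energy (Ker.ofProfile α β R hF ha h0 h1) hC hψQ hQ
      simp_rw [Ker.ofProfile_tm, Ker.ofProfile_qm] at this
      exact this
  have hz := ((((p1.add ((HasInt.sum (s := Finset.univ) p2).const_mul d)).add
    ((HasInt.sum (s := Finset.univ) p3).const_mul d)).sub p4).congr (fun p => ?_) rfl).2.symm.trans
    key.2
  · refine ⟨_, ((r1.add ((HasInt.sum (s := Finset.univ) r2).const_mul d)).sub r4).congr
      (fun s => ?_) rfl, ((HasInt.sum (s := Finset.univ) r3).const_mul d).congr (fun s => ?_) ?_⟩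
    · simp only [transferS, Fin.sum_univ_three]
      ring
    · simp only [pressureS, Fin.sum_univ_three]
      ring
    · linarith
  · have e : tF α β F p.1 = F ‖p.1‖ • pm α β (dir p.1) := rfl
    simp only [forceTri_split, enTri, two_one_zero, mul_one, smul_eq_mul, e]
    ring

end

/-! ### The equation for the defect over spheres -/

theorem integral_Ioi_eq {u : ℝ → ℝ} {a b : ℝ} (ha : 0 ≤ a) (hab : a ≤ b)
    (h0 : ∀ s, 0 < s → s < a → u s = 0)
    (h1 : ∀ s, b < s → u s = 0) : ∫ s in Ioi 0, u s = ∫ s in a..b, u s := by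
  rw [intervalIntegral.integral_of_le hab]
  refine setIntegral_eq_of_subset_of_ae_sdiff_eq_zero measurableSet_Ioi.nullMeasurableSet
    (fun s hs => ha.trans_lt hs.1) ?_
  filter_upwards [compl_mem_ae_iff.2 (measure_singleton a)] with s hs hs'
  rcases lt_or_gt_of_ne hs with h | h
  · exact h0 s hs'.1 h
  · exact h1 s (not_le.1 fun h' => hs'.2 ⟨h, h'⟩)

section

variable {Ω : Set ST} {d : ℝ} {b J : ST → E3} {ψ : ST → ℝ} {α β : ℝ}

/-- The transfer of energy as a density with respect to the profile. -/
def meanS (d : ℝ) (b J : ST → E3) (ψ : ST → ℝ) (α β s : ℝ) : ℝ :=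
  transferS d b J ψ α β s + (α + β) * pressureS d b J ψ s - 2 * β * (pressureI d b J ψ s / s ^ 3)

theorem LocalCut.hasDerivAt_defectS (H : LocalCut Ω d b J) (hψ : IsTest Ω ψ) {s : ℝ} (hs : 0 < s) :
    HasDerivAt (fun s => s ^ 2 * defectS d b J ψ (qa α β) s)
      (s * defectS d b J ψ (qb β) s - s ^ 2 * meanS d b J ψ α β s) s := by
  have cT := H.continuous_transferS hψ (α := α) (β := β)
  have cI : Continuous (pressureI d b J ψ) :=
    continuous_iff_continuousAt.2 fun s => (H.hasDerivAt_pressureI hψ s).continuousAt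
  have ca := H.continuous_defectS hψ (A := qa α β) integrable_qa_surf
  have cb := H.continuous_defectS hψ (A := qb β) integrable_qb_surf
  have key := hasDerivAt_of_integral_eq_zero (A := fun s => s ^ 2 * defectS d b J ψ (qa α β) s
    + (α + β) * pressureI d b J ψ s) (B := fun s => s * defectS d b J ψ (qb β) s
    + 2 * β * (pressureI d b J ψ s / s) - s ^ 2 * transferS d b J ψ α β s) (by fun_prop)
    ((((continuous_id.mul cb).continuousOn.add (continuousOn_const.mul (cI.continuousOn.div
      continuousOn_id fun s hs => ne_of_gt hs)))).sub
      ((continuous_id.pow 2).mul cT).continuousOn) (fun F a R hF ha haR h0 h1 => ?_) hs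
  · refine (key.sub ((H.hasDerivAt_pressureI hψ s).const_mul (α + β))).congr_deriv ?_
      |>.congr_of_eventuallyEq (.of_forall fun x => ?_)
    · rw [meanS]
      field_simp
      ring
    · simp only [Pi.sub_apply]
      ring
  · obtain ⟨I, r1, r2⟩ := H.polar_energy hψ (α := α) (β := β) hF ha haR h0 h1
    have hκ := contDiff_κF (α := α) (β := β) (b := R) hF ha h0
    have hR0 := ha.le.trans haR
    have hdκ : ∀ s, R + 1 < s → deriv (κF α β R F) s = 0 := fun s hs =>
      deriv_eq_zero_of_gt (fun s hs => κF_eq_zero h1 hs) (by linarith)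
    have hdF : ∀ s < a, deriv F s = 0 := fun s hs => by
      have : F =ᶠ[𝓝 s] fun _ => 0 := by filter_upwards [Iio_mem_nhds hs] with x hx using h0 x hx
      rw [this.deriv_eq, deriv_const]
    have cP := (continuous_id.pow 2).mul (H.continuous_pressureS hψ)
    have i3 : IntegrableOn (fun s => deriv (κF α β R F) s * pressureI d b J ψ s) (Ioi 0) :=
      IntegrableOn.of_forall_sdiff_eq_zero (((hκ.continuous_deriv_one.mul
        cI).integrableOn_Icc (a := 0) (b := R + 1))) measurableSet_Ioi fun s hs => by
          rw [hdκ s (not_le.1 fun h => hs.2 ⟨le_of_lt hs.1, h⟩), zero_mul]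
    have e2 := intervalIntegral.integral_deriv_mul_eq_sub (a := 0) (b := R + 1)
      (fun s _ => (hκ.differentiable one_ne_zero s).hasDerivAt)
      (fun s _ => H.hasDerivAt_pressureI hψ s)
      (hκ.continuous_deriv_one.intervalIntegrable _ _) (cP.intervalIntegrable _ _)
    rw [κF_eq_zero h1 (lt_add_one R), show pressureI d b J ψ 0 = 0 from
      intervalIntegral.integral_same, mul_zero, zero_mul, sub_zero,
      ← integral_Ioi_eq le_rfl (by linarith) (fun s hs hs' => absurd hs (not_lt.2 hs'.le))
      fun s hs => by rw [hdκ s hs, κF_eq_zero h1 (by linarith)]; ring] at e2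
    have r3 := HasInt.of_integrable i3
    have e3 := ((r3.add r2).congr (fun s => by ring) rfl).2.symm.trans e2
    have hv : ∀ s, F s = 0 → deriv F s = 0 → deriv F s * (s ^ 2 * defectS d b J ψ (qa α β) s
        + (α + β) * pressureI d b J ψ s) + F s * (s * defectS d b J ψ (qb β) s
        + 2 * β * (pressureI d b J ψ s / s) - s ^ 2 * transferS d b J ψ α β s) = 0 := by
      intro s h h'
      rw [h, h', zero_mul, zero_mul, zero_add]
    rw [← integral_Ioi_eq ha.le haR (fun s _ hs => hv s (h0 s hs) (hdF s hs))
      fun s hs => hv s (h1 s hs) (deriv_eq_zero_of_gt h1 hs)]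
    refine ((r3.sub r1).congr (fun s => ?_) rfl).2.trans (by linarith)
    rw [(hasDerivAt_κF hF ha h0 s).deriv]
    by_cases hs : s = 0
    · simp [hs, h0 0 ha, hdF 0 ha]
    · field_simp
      ring

end

/-! ### The limit of the transfer of energy -/

section

variable {Ω : Set ST} {d : ℝ} {b J : ST → E3} {ψ : ST → ℝ} {α β : ℝ}

/-- The balance of energy tested with `ψ`. -/
def energyRate (d : ℝ) (b J : ST → E3) (ψ : ST → ℝ) : ℝ :=
  (∫ z, fderiv ℝ ψ z (1, 0) * enTri kd (two (cp b) 0 z) (two (cp one) 0 z) (two (cp b) 0 z))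
    + d * ((∑ i, ∫ z, gr ψ z i * energyTri i kd (two (cp b) 0 z) (two (cp b) 0 z) (two (cp J) 0 z))
    + ∑ i, ∫ z, gr ψ z i * forceTri 0 1 (kd i) (two (cp b) 0 z) (two (cp b) 0 z) (two (cp J) 0 z))

theorem LocTame.sph_zero_of_eq {P : Type*} [NormedAddCommGroup P] [NormedSpace ℝ P]
    [FiniteDimensional ℝ P]
    {m : P → Form V3 2}
    {b₁ b₂ b₃ : ST → E3} {A : E3 → P} {c : ℝ} {t : P} (H : LocTame Ω b₁ b₂ b₃) (hm : LTri m)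
    (hA : Integrable (fun n : 𝕊 => A n) surf) (hψ : IsCTest Ω ψ)
    (ht : ∫ n : 𝕊, A n ∂surf = c • t) :
    sph m A b₁ b₂ b₃ ψ 0
      = c * ∫ z, ψ z * m t (two (cp b₁) 0 z) (two (cp b₂) 0 z) (two (cp b₃) 0 z) := by
  rw [H.sph_zero hm hA hψ, ht, ← integral_const_mul]
  congr 1
  funext z
  rw [(hm.lin _ _ _).map_smul, smul_eq_mul]
  ring

theorem LocalCut.tendsto_meanS (H : LocalCut Ω d b J) (hψ : IsTest Ω ψ) :
    Tendsto (meanS d b J ψ α β) (𝓝[>] 0)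
      (𝓝 (4 * Real.pi * (α + β / 3) * energyRate d b J ψ)) := by
  have h1 : transferS d b J ψ α β 0 + (α + β) * pressureS d b J ψ 0
      - 2 * β * (pressureS d b J ψ 0 / 3) = 4 * Real.pi * (α + β / 3) * energyRate d b J ψ := by
    have e1 := H.fuf.sph_zero_of_eq ltri_en integrable_pm_surf (isCTest_time hψ)
      (integral_surf_pm α β)
    have e2 := fun i => H.ffh.sph_zero_of_eq (ltri_energy i) integrable_pm_surf (isCTest_gr hψ i)
      (integral_surf_pm α β)
    have e3 := fun i => H.ffh.sph_zero_of_eq (c := 4 * Real.pi) (t := 1) (ltri_pressure i)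
      (A := fun _ => 1) (integrable_const _) (isCTest_gr hψ i)
      (by rw [integral_const, surf_real_univ])
    rw [transferS, pressureS, e1, Finset.sum_congr rfl fun i _ => e2 i,
      Finset.sum_congr rfl fun i _ => e3 i, ← Finset.mul_sum, ← Finset.mul_sum, energyRate]
    ring
  have h2 : Tendsto (fun s => pressureI d b J ψ s / s ^ 3) (𝓝[>] 0)
      (𝓝 (pressureS d b J ψ 0 / 3)) := by
    have h3 := (H.hasDerivAt_pressureI hψ 0).continuousAt.tendsto
    rw [pressureI, intervalIntegral.integral_same] at h3
    refine HasDerivAt.lhopital_zero_nhdsGT (f' := fun s => s ^ 2 * pressureS d b J ψ s)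
      (g' := fun s => 3 * s ^ 2) (Eventually.of_forall (H.hasDerivAt_pressureI hψ))
      (.of_forall fun s => by simpa using hasDerivAt_pow 3 s) ?_
      (h3.mono_left nhdsWithin_le_nhds) ?_ ?_
    · filter_upwards [self_mem_nhdsWithin] with s hs
      have : s ≠ 0 := ne_of_gt hs
      positivity
    · exact ((continuous_pow 3).tendsto' 0 0 (by simp)).mono_left nhdsWithin_le_nhds
    · refine ((((H.continuous_pressureS hψ).div_const 3).tendsto 0).mono_left
        nhdsWithin_le_nhds).congr' ?_
      filter_upwards [self_mem_nhdsWithin] with s hs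
      have : s ≠ 0 := ne_of_gt hs
      field_simp
  rw [← h1]
  exact ((((H.continuous_transferS hψ).tendsto 0).mono_left nhdsWithin_le_nhds).add
    ((((H.continuous_pressureS hψ).tendsto 0).mono_left nhdsWithin_le_nhds).const_mul _)).sub
    (h2.const_mul _)

variable {φ : E3 → ℝ} {ε : ℝ}

/-- The mean transfer of energy as a continuous function of the displacement. -/
def meanF (d : ℝ) (b J : ST → E3) (ψ : ST → ℝ) (α β : ℝ) : E3 → ℝ :=
  Function.update (fun l => meanS d b J ψ α β ‖l‖) 0
    (4 * Real.pi * (α + β / 3) * energyRate d b J ψ)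

theorem LocalCut.continuous_meanF (H : LocalCut Ω d b J) (hψ : IsTest Ω ψ) :
    Continuous (meanF d b J ψ α β) := by
  refine continuous_iff_continuousAt.2 fun l => ?_
  by_cases hl : l = 0
  · subst hl
    exact continuousAt_update_same.2 ((H.tendsto_meanS hψ).comp (tendsto_norm_nhdsNE_zero))
  · refine (continuousAt_update_of_ne hl).2 (ContinuousAt.comp (f := fun l : E3 => ‖l‖)
      (g := meanS d b J ψ α β) ?_ continuous_norm.continuousAt)
    exact ((H.continuous_transferS hψ).continuousAt.add (continuousAt_const.mul
      (H.continuous_pressureS hψ).continuousAt)).sub (continuousAt_const.mul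
      ((H.hasDerivAt_pressureI hψ _).continuousAt.div (continuous_pow 3).continuousAt
      (pow_ne_zero 3 (norm_ne_zero_iff.2 hl))))

/-- The defect for a mollifier is a mean of the transfer of energy. -/
theorem LocalCut.integral_defect (H : LocalCut Ω d b J) (hψ : IsTest Ω ψ) (hφ : IsMollifier φ)
    (hε : 0 < ε) : Integrable (fun l => scaled φ ε l * meanF d b J ψ α β l) ∧
    4 * Real.pi * ∫ p : E3 × ST, ψ p.2 * (d * defectTri (qF α β (prof φ ε) (deriv (prof φ ε)) p.1)
      (two (cp b) p.1 p.2) (two (cp b) p.1 p.2) (two (cp J) p.1 p.2)) ∂(volume.prod volume)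
      = ∫ l, scaled φ ε l * meanF d b J ψ α β l := by
  obtain ⟨R, hF⟩ := exists_profile hφ hε
  have h1 : Integrable (fun l => scaled φ ε l * meanF d b J ψ α β l) :=
    ((contDiff_scaled hφ ε).continuous.mul
      (H.continuous_meanF hψ)).integrable_of_hasCompactSupport
      (hasCompactSupport_scaled hφ hε).mul_right
  obtain ⟨I, p1, r1⟩ := H.polar_defect (α := α) (β := β) hψ hF
  have h2 := integral_polar h1
  have h3 : ∀ s ∈ Ioi (0 : ℝ), s ^ 2 * ∫ n : 𝕊, scaled φ ε (s • (n : E3))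
      * meanF d b J ψ α β (s • (n : E3)) ∂surf
      = 4 * Real.pi * (prof φ ε s * (s ^ 2 * meanS d b J ψ α β s)) := by
    intro s hs
    have e1 : ∀ n : 𝕊, scaled φ ε (s • (n : E3))
        * meanF d b J ψ α β (s • (n : E3)) = prof φ ε s * meanS d b J ψ α β s := fun n => by
      have hn : ‖s • (n : E3)‖ = s := by
        rw [norm_smul, norm_eq_of_mem_sphere, mul_one, Real.norm_of_nonneg (le_of_lt hs)]
      have hn0 : s • (n : E3) ≠ 0 := norm_ne_zero_iff.1 (hn.trans_ne (ne_of_gt hs))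
      rw [← prof_norm hφ, meanF, Function.update_of_ne hn0, hn]
    simp only [e1]
    rw [integral_const, surf_real_univ, smul_eq_mul]
    ring
  have i3 := IntegrableOn.congr_fun h2.1 h3 measurableSet_Ioi
  have e2 := (setIntegral_congr_fun measurableSet_Ioi h3).symm.trans h2.2
  rw [integral_const_mul] at e2
  have i4 : IntegrableOn (fun s => prof φ ε s * (s ^ 2 * meanS d b J ψ α β s)) (Ioi 0) := by
    refine IntegrableOn.congr_fun (i3.const_mul (4 * Real.pi)⁻¹) (fun s _ => ?_) measurableSet_Ioi
    field_simp
  have key := (r1.sub (HasInt.of_integrable i4)).congr (g := fun s => deriv (prof φ ε) s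
    * (s ^ 2 * defectS d b J ψ (qa α β) s) + prof φ ε s * (s * defectS d b J ψ (qb β) s
    - s ^ 2 * meanS d b J ψ α β s)) (fun s => by
      by_cases hs : s = 0
      · simp [hs]
      · field_simp
        ring) rfl
  have cF := hF.smooth.continuous.mul ((continuous_pow 2).mul
    (H.continuous_defectS hψ (A := qa α β) integrable_qa_surf))
  have h5 := integral_Ioi_of_hasDerivAt_of_tendsto (m := 0) (a := 0) cF.continuousWithinAt
    (fun s hs => ((hF.smooth.differentiable one_ne_zero s).hasDerivAt.mul
      (H.hasDerivAt_defectS hψ (α := α) (β := β) hs))) key.1 (tendsto_const_nhds.congr' (by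
        filter_upwards [eventually_gt_atTop R] with s hs
        simp [hF.zero s hs]))
  have h6 := key.2.symm.trans h5
  refine ⟨h1, ?_⟩
  rw [← e2, (p1.congr (fun p => by ring) rfl).2]
  simp at h6
  rw [sub_eq_zero.1 h6]

theorem LocalCut.tendsto_defect (H : LocalCut Ω d b J) (hψ : IsTest Ω ψ) (hφ : IsMollifier φ)
    (α β : ℝ) : Tendsto (fun ε => ∫ p : E3 × ST, ψ p.2 * (d * defectTri
      (qF α β (prof φ ε) (deriv (prof φ ε)) p.1) (two (cp b) p.1 p.2) (two (cp b) p.1 p.2)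
      (two (cp J) p.1 p.2)) ∂(volume.prod volume)) (𝓝[>] 0)
      (𝓝 ((α + β / 3) * energyRate d b J ψ)) := by
  have h1 := (tendsto_scaled hφ (H.continuous_meanF hψ (α := α) (β := β)).continuousAt
    fun ε hε => (H.integral_defect hψ hφ hε).1).const_mul (4 * Real.pi)⁻¹
  have h0 : meanF d b J ψ α β 0 = 4 * Real.pi * (α + β / 3) * energyRate d b J ψ :=
    Function.update_self ..
  rw [h0, mul_assoc (4 * Real.pi), inv_mul_cancel_left₀ (by positivity)] at h1
  refine h1.congr' ?_
  filter_upwards [self_mem_nhdsWithin] with ε hε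
  rw [← (H.integral_defect hψ hφ hε).2, inv_mul_cancel_left₀ (by positivity)]

end

/-! ### The structure functions as densities -/

theorem toDist_add_mul {T₀ : ℝ} {f g : ST → ℝ} (hf : LocallyIntegrableOn f (dom T₀))
    (hg : LocallyIntegrableOn g (dom T₀)) (c : ℝ) :
    LocallyIntegrableOn (fun z => f z + c * g z) (dom T₀) ∧
      toDist T₀ (fun z => f z + c * g z) = toDist T₀ f + c • toDist T₀ g := by
  have hi : LocallyIntegrableOn (fun z => f z + c * g z) (dom T₀) := hf.add (hg.smul c)
  refine ⟨hi, ?_⟩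
  ext ψ
  simp only [add_apply, smul_apply, smul_eq_mul]
  rw [toDist_apply hi, toDist_apply hf, toDist_apply hg]
  exact (((HasInt.of_integrable (ψ.integrable_bilin (ContinuousLinearMap.mul ℝ ℝ) hf)).add
    ((HasInt.of_integrable (ψ.integrable_bilin (ContinuousLinearMap.mul ℝ ℝ) hg)).const_mul
    c)).congr (fun z => by simp; ring) rfl).2

/-- The array of the structure function of the energy. -/
def qe (n : E3) : Fin 3 → Fin 3 → V3 := qb 1 n - (2 : ℝ) • qa 1 (-1) n

theorem tq_qa (α β : ℝ) (n : E3) (x y w : V3) :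
    tq (qa α β n) x y w = dot3 n x * dot3 y (mv (pm α β n) w) := by
  simp only [tq, qa, dot3, mv, Fin.sum_univ_three]
  ring

theorem tq_qe (n : E3) (x y w : V3) : tq (qe n) x y w
    = dot3 n w * dot3 x y + dot3 n y * dot3 x w - 2 * (dot3 n x * dot3 y w) := by
  simp only [qe, tq_sub, tq_smul, tq_qa]
  simp only [tq, qb, dot3, mv, pm, kd, Fin.sum_univ_three]
  simp
  ring

theorem integrable_qe_surf : Integrable (fun n : 𝕊 => qe n) surf :=
  integrable_qb_surf.sub (integrable_qa_surf.smul (2 : ℝ))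

section

variable {T₀ d : ℝ} {b J : ST → E3} {ψ : ST → ℝ} {α β : ℝ}
  {A : E3 → Fin 3 → Fin 3 → V3}

theorem LocalCut.defectS_qe {Ω : Set ST} (H : LocalCut Ω d b J) (hψ : IsTest Ω ψ) (r : ℝ) :
    defectS d b J ψ qe r = defectS d b J ψ (qb 1) r - 2 * defectS d b J ψ (qa 1 (-1)) r := by
  have h := (((HasInt.of_integrable (H.ffh.integrable_sph ltri_defect (A := qb 1)
    integrable_qb_surf hψ.isCTest r)).sub ((HasInt.of_integrable (H.ffh.integrable_sph ltri_defect
    (A := qa 1 (-1)) integrable_qa_surf hψ.isCTest r)).const_mul 2)).const_mul d).congr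
    (g := fun p : 𝕊 × ST => d * (ψ p.2 * defectTri (qe p.1)
      (two (cp b) (r • (p.1 : E3)) p.2) (two (cp b) (r • (p.1 : E3)) p.2)
      (two (cp J) (r • (p.1 : E3)) p.2))) (fun p => by
      rw [qe, (ltri_defect.lin _ _ _).map_sub, (ltri_defect.lin _ _ _).map_smul, smul_eq_mul]
      ring) rfl
  have h2 := h.2
  rw [integral_const_mul] at h2
  refine h2.trans ?_
  simp only [defectS, sph]
  ring

theorem LocalCut.toDist_sph (H : LocalCut (dom T₀) d b J)
    (hA : Integrable (fun n : 𝕊 => A n) surf) {X : ST → ℝ} {c r : ℝ}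
    (hX : ∀ z, X z = c * (d * ∫ n : 𝕊, defectTri (A n)
      (two (cp b) (r • (n : E3)) z) (two (cp b) (r • (n : E3)) z)
      (two (cp J) (r • (n : E3)) z) ∂surf)) :
    LocallyIntegrableOn X (dom T₀) ∧
      ∀ ψ : 𝓓(dom T₀, ℝ), toDist T₀ X ψ = c * defectS d b J ψ A r := by
  have hr : Rep (dom T₀) surf X fun n z => c * (d * defectTri (A n) (two (cp b) (r • (n : E3)) z)
      (two (cp b) (r • (n : E3)) z) (two (cp J) (r • (n : E3)) z)) :=
    ⟨Eventually.of_forall fun z => by rw [hX, integral_const_mul, integral_const_mul], fun ψ hψ =>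
      (H.ffh.integrable_sph ((ltri_defect.const_mul d).const_mul c) hA hψ r)⟩
  refine ⟨hr.locallyIntegrableOn (dom T₀).isOpen, fun ψ => ?_⟩
  rw [hr.toDist_apply, defectS, sph, ← integral_const_mul, ← integral_const_mul]
  congr 1
  funext p
  ring

theorem sphereAvg_eq {G : E3 → E3} {M : E3 → ℝ} {d c r : ℝ} (hr : 0 < r)
    (h : ∀ n : E3, dot3 n n = 1 → dir (r • n) = n → ⟪n, G (r • n)⟫ = c * M n) :
    d * sphereAvg r G = (r⁻¹ * (4 * Real.pi)⁻¹ * c) * (d * ∫ n : 𝕊,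
      M n ∂surf) := by
  have h1 : ∀ n : 𝕊, ⟪(n : E3), G (r • (n : E3))⟫ = c * M n := fun n =>
    h n (by rw [← inner_eq_dot3, real_inner_self_eq_norm_sq, norm_eq_of_mem_sphere, one_pow])
      (dir_smul_sphere hr n)
  rw [sphereAvg]
  simp only [h1]
  rw [integral_const_mul]
  ring

theorem LocalCut.toDist_SbarX (H : LocalCut (dom T₀) d b J) {P : E3 → E3 → E3} (hP : Part P α β)
    {r : ℝ} (hr : 0 < r) : LocallyIntegrableOn (SbarX d b J P r) (dom T₀) ∧
      ∀ ψ : 𝓓(dom T₀, ℝ), toDist T₀ (SbarX d b J P r) ψ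
        = r⁻¹ * (4 * Real.pi)⁻¹ * 2 * defectS d b J ψ (qa α β) r := by
  refine H.toDist_sph integrable_qa_surf fun z => sphereAvg_eq
    (M := fun n => defectTri (qa α β n) (two (cp b) (r • n) z) (two (cp b) (r • n) z)
      (two (cp J) (r • n) z)) hr fun n hn hd => ?_
  rw [hd, ← real_inner_self_eq_norm_sq, hP.inner hn, hP.inner hn]
  simp only [defectTri_two, tq_qa, inner_sub_right, inner_smul_right, inner_eq_dot3, ofLp_incr]
  ring

theorem LocalCut.toDist_SbarE (H : LocalCut (dom T₀) d b J) {r : ℝ} (hr : 0 < r) :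
    LocallyIntegrableOn (SbarE d b J r) (dom T₀) ∧ ∀ ψ : 𝓓(dom T₀, ℝ),
      toDist T₀ (SbarE d b J r) ψ = r⁻¹ * (4 * Real.pi)⁻¹ * 1 * defectS d b J ψ qe r := by
  refine H.toDist_sph integrable_qe_surf fun z => sphereAvg_eq
    (M := fun n => defectTri (qe n) (two (cp b) (r • n) z) (two (cp b) (r • n) z)
      (two (cp J) (r • n) z)) hr fun n hn hd => ?_
  rw [← real_inner_self_eq_norm_sq]
  simp only [defectTri_two, tq_qe, inner_sub_right, inner_smul_right, inner_eq_dot3, ofLp_incr]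
  simp only [dot3]
  ring

end

/-! ### The limits of the structure functions -/

section

variable {Ω : Set ST} {d : ℝ} {b J : ST → E3} {ψ : ST → ℝ}

theorem tendsto_div_pow {f f' : ℝ → ℝ} {c L : ℝ} (k : ℕ) (hc : c ≠ 0)
    (hf : Continuous f) (hd : ∀ s, 0 < s → HasDerivAt (fun s => s ^ (k + 1) * f s) (f' s) s)
    (hL : Tendsto (fun s => f' s / (c * s ^ (k + 1))) (𝓝[>] 0) (𝓝 L)) :
    Tendsto (fun s => (c / (k + 2))⁻¹ * (f s / s)) (𝓝[>] 0) (𝓝 L) := by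
  have h := HasDerivAt.lhopital_zero_nhdsGT (f := fun s => s ^ (k + 1) * f s)
    (g := fun s => c / (k + 2) * s ^ (k + 2)) (g' := fun s => c * s ^ (k + 1)) (l := 𝓝 L)
    (a := 0) (by filter_upwards [self_mem_nhdsWithin] with s hs using hd s hs)
    (.of_forall fun s => ((hasDerivAt_pow (k + 2) s).const_mul (c / (k + 2))).congr_deriv
      (by push_cast; field_simp))
    (by filter_upwards [self_mem_nhdsWithin] with s hs; have : s ≠ 0 := ne_of_gt hs; positivity)
    ((((continuous_pow (k + 1)).mul hf).tendsto' 0 0 (by simp)).mono_left nhdsWithin_le_nhds)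
    (((continuous_const.mul (continuous_pow (k + 2))).tendsto' 0 0
      (by simp)).mono_left nhdsWithin_le_nhds) hL
  refine h.congr' ?_
  filter_upwards [self_mem_nhdsWithin] with s hs
  have : s ≠ 0 := ne_of_gt hs
  field_simp
  ring

theorem LocalCut.defectS_qb (H : LocalCut Ω d b J) (hψ : IsTest Ω ψ) (β r : ℝ) :
    defectS d b J ψ (qb β) r = β * (defectS d b J ψ qe r + 2 * defectS d b J ψ (qa 1 (-1)) r) := by
  rw [H.defectS_qe hψ, sub_add_cancel, defectS, defectS, sph, sph, mul_left_comm,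
    ← integral_const_mul β]
  congr 2
  funext p
  rw [show qb β (p.1 : E3) = β • qb 1 (p.1 : E3) by funext k i j; simp [qb],
    (ltri_defect.lin _ _ _).map_smul, smul_eq_mul, mul_left_comm]

theorem LocalCut.tendsto_trans (H : LocalCut Ω d b J) (hψ : IsTest Ω ψ) {W : ℝ}
    (hW : Tendsto (fun r => r⁻¹ * (4 * Real.pi)⁻¹ * 1 * defectS d b J ψ qe r) (𝓝[>] 0) (𝓝 W)) :
    Tendsto (fun r => r⁻¹ * (4 * Real.pi)⁻¹ * 2 * defectS d b J ψ (qa 1 (-1)) r) (𝓝[>] 0)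
      (𝓝 (-(2 / 5) * W - 4 / 15 * energyRate d b J ψ)) := by
  have h1 := tendsto_div_pow (f := defectS d b J ψ (qa 1 (-1))) (c := 10 * Real.pi)
    (L := -(2 / 5) * W - 4 / 15 * energyRate d b J ψ) 3 (by positivity)
    (H.continuous_defectS hψ integrable_qa_surf) (fun s hs => ((hasDerivAt_pow 2 s).mul
      (H.hasDerivAt_defectS hψ hs)).congr_of_eventuallyEq (.of_forall fun x => by
        simp only [Pi.mul_apply]; ring)) ?_
  · refine h1.congr fun s => ?_
    push_cast
    field_simp
    ring
  · have h2 := (hW.const_mul (-(2 / 5))).sub ((H.tendsto_meanS hψ (α := 1) (β := -1)).const_mul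
      (10 * Real.pi)⁻¹)
    rw [show -(2 / 5) * W - 4 / 15 * energyRate d b J ψ = -(2 / 5) * W - (10 * Real.pi)⁻¹
      * (4 * Real.pi * (1 + -1 / 3) * energyRate d b J ψ) by field_simp; ring]
    refine h2.congr' ?_
    filter_upwards [self_mem_nhdsWithin] with s hs
    have : s ≠ 0 := ne_of_gt hs
    rw [H.defectS_qb hψ]
    field_simp
    ring

theorem LocalCut.tendsto_longi (H : LocalCut Ω d b J) (hψ : IsTest Ω ψ) {W : ℝ}
    (hW : Tendsto (fun r => r⁻¹ * (4 * Real.pi)⁻¹ * 1 * defectS d b J ψ qe r) (𝓝[>] 0) (𝓝 W)) :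
    Tendsto (fun r => r⁻¹ * (4 * Real.pi)⁻¹ * 2 * defectS d b J ψ (qa 0 1) r) (𝓝[>] 0)
      (𝓝 (2 / 5 * W - 2 / 5 * energyRate d b J ψ)) := by
  have h1 := tendsto_div_pow (f := defectS d b J ψ (qa 0 1)) (c := 6 * Real.pi)
    (L := 2 / 5 * W - 2 / 5 * energyRate d b J ψ) 1 (by positivity)
    (H.continuous_defectS hψ integrable_qa_surf) (fun s hs => H.hasDerivAt_defectS hψ hs) ?_
  · refine h1.congr fun s => ?_
    push_cast
    field_simp
    ring
  · have h2 := ((hW.const_mul (2 / 3)).add ((H.tendsto_trans hψ hW).const_mul (2 / 3))).sub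
      ((H.tendsto_meanS hψ (α := 0) (β := 1)).const_mul (6 * Real.pi)⁻¹)
    rw [show 2 / 5 * W - 2 / 5 * energyRate d b J ψ = 2 / 3 * W + 2 / 3 * (-(2 / 5) * W - 4 / 15
      * energyRate d b J ψ) - (6 * Real.pi)⁻¹ * (4 * Real.pi * (0 + 1 / 3) * energyRate d b J ψ) by
        field_simp; ring]
    refine h2.congr' ?_
    filter_upwards [self_mem_nhdsWithin] with s hs
    have : s ≠ 0 := ne_of_gt hs
    rw [H.defectS_qb hψ]
    field_simp
    ring

end

theorem LocalCut.convergesTo_structure {T₀ d : ℝ} {b J : ST → E3} (H : LocalCut (dom T₀) d b J)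
    {P : E3 → E3 → E3} {α β : ℝ} (hP : Part P α β) {D W : 𝓓'(dom T₀, ℝ)} {c k : ℝ}
    (hW : ConvergesTo T₀ (SbarE d b J) W)
    (hX : ∀ ψ : 𝓓(dom T₀, ℝ), Tendsto (fun r => r⁻¹ * (4 * Real.pi)⁻¹ * 1 * defectS d b J ψ qe r)
      (𝓝[>] 0) (𝓝 (W ψ)) → Tendsto (fun r => r⁻¹ * (4 * Real.pi)⁻¹ * 2
      * defectS d b J ψ (qa α β) r) (𝓝[>] 0) (𝓝 (k * D ψ - c * W ψ))) :
    ConvergesTo T₀ (fun r z => SbarX d b J P r z + c * SbarE d b J r z) (k • D) := by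
  refine ⟨fun r hr => (toDist_add_mul (H.toDist_SbarX hP hr).1 (H.toDist_SbarE hr).1 c).1,
    fun ψ => ?_⟩
  have h1 := (hX ψ ((hW.2 ψ).congr' (by
    filter_upwards [self_mem_nhdsWithin] with r hr using (H.toDist_SbarE hr).2 ψ))).add
    ((hW.2 ψ).const_mul c)
  rw [sub_add_cancel] at h1
  refine h1.congr' ?_
  filter_upwards [self_mem_nhdsWithin] with r hr
  rw [(toDist_add_mul (H.toDist_SbarX hP hr).1 (H.toDist_SbarE hr).1 c).2]
  simp [(H.toDist_SbarX hP hr).2]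

/-! ### The local energy equation -/

section

variable {T₀ d : ℝ} {b J : ST → E3}

/-- The distribution in the local energy equation. -/
def energyDist (T₀ d : ℝ) (b J : ST → E3) : 𝓓'(dom T₀, ℝ) :=
  -(dt (toDist T₀ fun z => ‖b z‖ ^ 2 / 2) + (d / 2) • div (rotDist T₀ (selfProd b J) (selfPot b))
    - (d / 4) • div (toDistV T₀ fun z => ‖b z‖ ^ 2 • J z)
    + (d / 2) • div (toDistV T₀ fun z => ⟪J z, b z⟫ • b z))

theorem two_self (u : ST → V3) (z : ST) : two u 0 z = fun _ => u z := by
  funext a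
  fin_cases a <;> simp [two, sh_zero]

theorem norm_sq_eq_dot3 (v : E3) : ‖v‖ ^ 2 = dot3 v v := by
  rw [← real_inner_self_eq_norm_sq, inner_eq_dot3]

theorem LocalCut.locallyIntegrableOn_energy (H : LocalCut (dom T₀) d b J) :
    LocallyIntegrableOn (fun z => ‖b z‖ ^ 2 / 2) (dom T₀) := by
  refine ((H.fuf.locallyIntegrableOn_self (dom T₀).isOpen ltri_en kd).smul (1 / 2 : ℝ)).congr
    (.of_forall fun z => ?_)
  simp [enTri, mv_kd, cp, one, e, norm_sq_eq_dot3]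
  ring

theorem LocalCut.locallyIntegrableOn_energy_current (H : LocalCut (dom T₀) d b J) :
    LocallyIntegrableOn (fun z => ‖b z‖ ^ 2 • J z) (dom T₀) := by
  refine locallyIntegrableOn_E3 (dom T₀).isOpen fun i => (H.ffh.locallyIntegrableOn_self
    (dom T₀).isOpen (ltri_pressure i) (-4 : ℝ)).congr (.of_forall fun z => ?_)
  simp [forceTri, norm_sq_eq_dot3, dot3_kd, mv, cr, cp]
  simp [dot3]
  ring

theorem LocalCut.locallyIntegrableOn_current_dot (H : LocalCut (dom T₀) d b J) :
    LocallyIntegrableOn (fun z => ⟪J z, b z⟫ • b z) (dom T₀) := by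
  refine locallyIntegrableOn_E3 (dom T₀).isOpen fun i => (H.ffh.locallyIntegrableOn_self
    (dom T₀).isOpen (ltri_cubic' i) kd).congr (.of_forall fun z => ?_)
  simp [mv_kd, cp, inner_eq_dot3]

theorem LocalCut.localEnergy (H : LocalCut (dom T₀) d b J) :
    LocalEnergy T₀ d b J (energyDist T₀ d b J) :=
  ⟨H.locallyIntegrableOn_energy, H.locallyIntegrableOn_energy_current,
    H.locallyIntegrableOn_current_dot, _, H.isDivCross_self, (neg_neg _).symm⟩

theorem LocalCut.energyDist_apply (H : LocalCut (dom T₀) d b J) (ψ : 𝓓(dom T₀, ℝ)) :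
    energyDist T₀ d b J ψ = 1 / 2 * energyRate d b J ψ := by
  have l2 := locallyIntegrableOn_apply H.locallyIntegrableOn_energy_current
  have l3 := locallyIntegrableOn_apply H.locallyIntegrableOn_current_dot
  have a : ∀ (i : Fin 3) {f : ST → ℝ}, LocallyIntegrableOn f (dom T₀) →
      HasInt volume (fun z => gr ψ z i * f z) (toDist T₀ f (∂_{((0, e i) : ST)} ψ)) :=
    fun i f hf => by
      rw [toDist_apply hf, gr_eq_lineDeriv]
      refine HasInt.of_integrable ?_
      have := (∂_{((0, e i) : ST)} ψ : 𝓓(dom T₀, ℝ)).integrable_bilin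
        (ContinuousLinearMap.mul ℝ ℝ) hf
      rwa [gr_eq_lineDeriv] at this
  have h1 : ∫ z, fderiv ℝ ψ z (1, 0) * enTri kd (two (cp b) 0 z) (two (cp one) 0 z)
      (two (cp b) 0 z) = 2 * toDist T₀ (fun z => ‖b z‖ ^ 2 / 2) (∂_{((1, 0) : ST)} ψ) := by
    rw [toDist_apply H.locallyIntegrableOn_energy, lineDeriv_test, ← integral_const_mul]
    congr 1
    funext z
    simp only [enTri, two_one_zero, two_self, mv_kd, norm_sq_eq_dot3, cp]
    ring
  have h2 := fun i => (((a i (H.locallyIntegrableOn_selfProd i)).add (a i (l3 i))).sub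
    ((a i (l2 i)).const_mul (1 / 4))).congr (g := fun z => gr ψ z i * energyTri i kd
    (two (cp b) 0 z) (two (cp b) 0 z) (two (cp J) 0 z)) (fun z => by
      simp only [energyTri, forceTri, rightTri, fluxTri, two_self, mv_kd, dot3_kd, selfProd, crTri,
        PiLp.smul_apply, smul_eq_mul, norm_sq_eq_dot3, inner_eq_dot3, cp]
      rw [dot3_comm (b z) (J z)]
      ring) rfl
  have h3 := fun i => ((a i (l2 i)).const_mul (-(1 / 4))).congr (g := fun z => gr ψ z i
    * forceTri 0 1 (kd i) (two (cp b) 0 z) (two (cp b) 0 z) (two (cp J) 0 z)) (fun z => by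
      simp [forceTri, two_self, dot3_kd, norm_sq_eq_dot3, cp, mv, cr]
      ring) rfl
  rw [energyRate, h1, Finset.sum_congr rfl fun i _ => (h2 i).2,
    Finset.sum_congr rfl fun i _ => (h3 i).2, energyDist, div_rotDist]
  simp only [add_apply, sub_apply, neg_apply, smul_apply, smul_eq_mul, dt_apply, div_apply,
    toDistV_apply, Fin.sum_univ_three]
  ring

theorem LocalCut.convergesTo_defect (H : LocalCut (dom T₀) d b J) {φ : E3 → ℝ}
    (hφ : IsMollifier φ) {D : ℝ → ST → ℝ} {c α β : ℝ} (hc : 0 < c) (hαβ : α + β / 3 = c / 2)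
    (hD : ∀ ε, 0 < ε → ∀ z, DefectSections (prof φ ε) b J z → c * D ε z = ∫ l, d * defectTri
      (qF α β (prof φ ε) (deriv (prof φ ε)) l) (two (cp b) l z) (two (cp b) l z)
      (two (cp J) l z)) : ConvergesTo T₀ D (energyDist T₀ d b J) := by
  refine ⟨fun ε hε => (H.toDist_defect hφ hε hc.ne' (hD ε hε)).1, fun ψ => ?_⟩
  have h1 := (H.tendsto_defect (TestFunction.isTest ψ) hφ α β).const_mul c⁻¹
  rw [hαβ, show c⁻¹ * (c / 2 * energyRate d b J ψ) = energyDist T₀ d b J ψ by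
    rw [H.energyDist_apply]; field_simp] at h1
  refine h1.congr' ?_
  filter_upwards [self_mem_nhdsWithin] with ε hε
  rw [← (H.toDist_defect hφ hε hc.ne' (hD ε hε)).2, inv_mul_cancel_left₀ hc.ne']

end

theorem MemLpLq.mono {L s t s' t' : ℝ} {p q : ℝ≥0∞} {f : ST → E3} (h : MemLpLq L s t p q f)
    (hs : s ≤ s') (ht : t' ≤ t) : MemLpLq L s' t' p q f :=
  have hI : Ioo s' t' ⊆ Ioo s t := Ioo_subset_Ioo hs ht
  ⟨h.1.mono_measure (Measure.restrict_mono (prod_mono hI subset_rfl) le_rfl),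
    (eLpNorm_mono_measure _ (Measure.restrict_mono hI le_rfl)).trans_lt h.2⟩

end EMHD

end

open EMHD in
theorem theorem1p1 (L T d : ℝ) (hL : 0 < L) (hT : 0 < T) (b J : ST → E3)
    (hb : SpacePeriodic L b) (hJ : SpacePeriodic L J) (hsol : IsSolution T d b J) :
    (∀ p q m n : ℝ≥0∞, 3 ≤ p → 3 ≤ q → 2 / p + 1 / m ≤ 1 → 2 / q + 1 / n ≤ 1 →
      (∀ s t : ℝ, 0 < s → t < T → MemLpLq L s t p q b ∧ MemLpLq L s t m n J) →
      ∀ φ, IsMollifier φ → ∀ ε : ℝ, 0 < ε →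
        KarmanHowarth T d b J φ ε longi (2 / 3) (DEL d b J φ ε) ∧
        KarmanHowarth T d b J φ ε trans (4 / 3) (DET d b J φ ε)) ∧
    (∀ p q m n : ℝ≥0∞, 3 ≤ p → p < ∞ → 3 ≤ q → q < ∞ → 1 < m → m < ∞ → 1 < n → n < ∞ →
      2 / p + 1 / m = 1 → 2 / q + 1 / n = 1 →
      MemLpLq L 0 T p q b → MemLpLq L 0 T m n J →
      ∃ D : 𝓓'(dom T, ℝ),
        (∀ φ, IsMollifier φ →
          ConvergesTo T (DEL d b J φ) D ∧ ConvergesTo T (DET d b J φ) D) ∧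
        LocalEnergy T d b J D ∧
        ((∃ W : 𝓓'(dom T, ℝ), ConvergesTo T (SbarE d b J) W) →
          ConvergesTo T (SEL d b J) (-(4 / 5 : ℝ) • D) ∧
          ConvergesTo T (SET d b J) (-(8 / 15 : ℝ) • D))) := by
  refine ⟨fun p q m n hp hq hpm hqn H φ hφ ε hε => ?_,
    fun p q m n hp _ hq _ _ _ _ _ hpm hqn hb' hJ' => ?_⟩
  · have hc := IsSolution.localCut hL hb hJ hsol hp hq hpm hqn H
    exact ⟨hc.karmanHowarth hφ hε part_longi (by norm_num) fun z h => DEL_eq hφ hε h,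
      hc.karmanHowarth hφ hε part_trans (by norm_num) fun z h => DET_eq hφ hε h⟩
  · have hc := IsSolution.localCut hL hb hJ hsol hp hq hpm.le hqn.le fun s t hs ht =>
      ⟨hb'.mono hs.le ht.le, hJ'.mono hs.le ht.le⟩
    refine ⟨energyDist T d b J, fun φ hφ => ⟨hc.convergesTo_defect hφ (c := 2 / 3) (by norm_num)
      (by norm_num) fun ε hε z h => DEL_eq hφ hε h, hc.convergesTo_defect hφ (c := 4 / 3)
      (by norm_num) (by norm_num) fun ε hε z h => DET_eq hφ hε h⟩, hc.localEnergy, ?_⟩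
    rintro ⟨W, hW⟩
    constructor
    · have := hc.convergesTo_structure (c := -(2 / 5)) (k := -(4 / 5)) (D := energyDist T d b J)
        part_longi hW fun ψ h => by
          have := hc.tendsto_longi (TestFunction.isTest ψ) h
          rwa [show (2 : ℝ) / 5 * W ψ - 2 / 5 * energyRate d b J ψ = -(4 / 5) * energyDist T d b J ψ
            - -(2 / 5) * W ψ by rw [hc.energyDist_apply]; ring] at this
      convert this using 3
      rw [SEL]
      ring
    · exact hc.convergesTo_structure (c := 2 / 5) (k := -(8 / 15)) part_trans hW fun ψ h => by
        have := hc.tendsto_trans (TestFunction.isTest ψ) h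
        rwa [show -((2 : ℝ) / 5) * W ψ - 4 / 15 * energyRate d b J ψ = -(8 / 15)
          * energyDist T d b J ψ - 2 / 5 * W ψ by rw [hc.energyDist_apply]; ring] at this
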